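/- Let $\Gamma\rightrightarrows M$ be a proper topological groupoid (Hausdorff, locally compact, second countable; source $s$, target $t$; $\Gamma_x=s^{-1}(x)$, $\Gamma^x=t^{-1}(x)$) with a left Haar system $(\lambda^x)_{x\in M}$, let $\lambda_x$ be the image of $\lambda^x$ under inversion, and let $E=(E_g)_{g\in\Gamma}$ be an upper semicontinuous Fell bundle over $\Gamma$ (full: $E_gE_h$ spans a dense subspace of $E_{gh}$). Put $A=C_0(M;E)$, a $C^*$-algebra with fibres $A_x=E_x$. Let $L^2(\Gamma;E)$ be the Hilbert $A$-module obtained by completing $C_c(\Gamma;E)$ for $\langle\xi,\eta\rangle(x)=\int_{\Gamma_x}\xi(g)^*\eta(g)\,d\lambda_x(g)$, with fibres $L^2(\Gamma_x;E)$, the completions of $C_c(\Gamma_x;E)$; an adjointable operator $T\in\mathcal L(L^2(\Gamma;E))$ induces operators $T_x\in\mathcal L(L^2(\Gamma_x;E))$. Let $\mathcal K(L^2(\Gamma;E))$ be the closed linear span of the rank-one operators $\zeta\mapsto\xi\langle\eta,\zeta\rangle$. For $\gamma\in\Gamma$ with $s(\gamma)=x$ and $t(\gamma)=y$, let $\alpha_\gamma:\mathcal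 L(L^2(\Gamma_x;E))\to\mathcal L(L^2(\Gamma_y;E))$ be determined by $\alpha_\gamma(T)(\xi e)=(T\xi)e$ for $\xi\in L^2(\Gamma_x;E)$ and $e\in E_{\gamma^{-1}}$, where $\xi e$ is the continuous extension of $(\xi e)(g)=\xi(g\gamma)e$, $g\in\Gamma_y$. An operator $T\in\mathcal L(L^2(\Gamma;E))$ is $\Gamma$-invariant if $\alpha_\gamma(T_{s(\gamma)})=T_{t(\gamma)}$ for all $\gamma\in\Gamma$. Let $C^*_r(\Gamma;E)\subset\mathcal L(L^2(\Gamma;E))$ be the norm closure of the set of the convolution operators $\eta\mapsto f*\eta$, $f\in C_c(\Gamma;E)$, where $(f*\eta)(g)=\int_{\Gamma^{t(g)}}f(h)\eta(h^{-1}g)\,d\lambda^{t(g)}(h)$. Let $\mathcal K_\Gamma(L^2(\Gamma;E))$ be the set of all $\Gamma$-invariant $T\in\mathcal L(L^2(\Gamma;E))$ such that $\varphi T\in\mathcal K(L^2(\Gamma;E))$ for every $\varphi\in C_0(M)$ and $\|T_x\|\to0$ when $x\to\infty$ in $M/\Gamma$. A cutoff function is a continuous function $c:M\to[0,\infty)$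 such that $\int_{\Gamma^x}c(s(\gamma))\,d\lambda^x(\gamma)=1$ for all $x\in M$ and such that, for every compact $K\subset M$, the support of the restriction of $c\circ s$ to $t^{-1}(K)$ is compact. Given a cutoff function $c$, the average $T^\Gamma\in\mathcal L(L^2(\Gamma;E))$ of $T\in\mathcal L(L^2(\Gamma;E))$ is defined by the strongly convergent integrals $(T^\Gamma)_x=\int_{\Gamma^x}c(s(\gamma))\,\alpha_\gamma(T_{s(\gamma)})\,d\lambda^x(\gamma)$, $x\in M$. Then $C^*_r(\Gamma;E)=\mathcal K_\Gamma(L^2(\Gamma;E))$, and, for every cutoff function $c$, $$C^*_r(\Gamma;E)=\{T^\Gamma\mid T\in\mathcal K(L^2(\Gamma;E))\}=\mathcal K_\Gamma(L^2(\Gamma;E)).$$ -/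

import Mathlib

open MeasureTheory Filter Topology
open scoped ENNReal ZeroAtInfty

set_option linter.unusedSectionVars false

namespace FellGroupoid

noncomputable section

/-! ### Topological groupoids, Haar systems, cutoff functions -/

/-- A topological groupoid with space of arrows `G` and space of objects `M`.
The product `mul g h` (also written `gh`) is defined when `src g = tgt h`. -/
structure TopGroupoid (G M : Type*) [TopologicalSpace G] [TopologicalSpace M] where
  src : G → M
  tgt : G → M
  unit : M → G
  inv : G → G
  mul : ∀ g h : G, src g = tgt h → G
  src_unit : ∀ x, src (unit x) = x
  tgt_unit : ∀ x, tgt (unit x) = x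
  src_inv : ∀ g, src (inv g) = tgt g
  tgt_inv : ∀ g, tgt (inv g) = src g
  src_mul : ∀ g h c, src (mul g h c) = src h
  tgt_mul : ∀ g h c, tgt (mul g h c) = tgt g
  mul_assoc : ∀ g h k (c : src g = tgt h) (d : src h = tgt k),
    mul (mul g h c) k ((src_mul g h c).trans d) = mul g (mul h k d) (c.trans (tgt_mul h k d).symm)
  unit_mul : ∀ g, mul (unit (tgt g)) g (src_unit _) = g
  mul_unit : ∀ g, mul g (unit (src g)) (tgt_unit _).symm = g
  inv_mul : ∀ g, mul (inv g) g (src_inv g) = unit (src g)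
  mul_inv : ∀ g, mul g (inv g) (tgt_inv g).symm = unit (tgt g)
  continuous_src : Continuous src
  continuous_tgt : Continuous tgt
  continuous_unit : Continuous unit
  continuous_inv : Continuous inv
  continuous_mul : Continuous fun p : {p : G × G // src p.1 = tgt p.2} => mul p.1.1 p.1.2 p.2

section Groupoid

variable {G M : Type*} [TopologicalSpace G] [TopologicalSpace M]

namespace TopGroupoid

variable (Γ : TopGroupoid G M)

/-- `g` and `h` are composable and `gh = k`. -/
def IsMul (g h k : G) : Prop := ∃ c : Γ.src g = Γ.tgt h, Γ.mul g h c = k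

/-- The fibre `Γ_x` of arrows with source `x`. -/
abbrev SFib (x : M) : Type _ := {g : G // Γ.src g = x}

/-- The fibre `Γ^x` of arrows with target `x`. -/
abbrev TFib (x : M) : Type _ := {g : G // Γ.tgt g = x}

theorem inv_inv (g : G) : Γ.inv (Γ.inv g) = g := by
  have h := Γ.mul_assoc (Γ.inv (Γ.inv g)) (Γ.inv g) g (Γ.src_inv _) (Γ.src_inv _)
  have e1 : ∀ a (ha : a = Γ.unit (Γ.src (Γ.inv g))) (c : Γ.src a = Γ.tgt g),
      Γ.mul a g c = g := by
    intro a ha c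
    subst ha
    have := Γ.unit_mul g
    have e : ∀ y (_ : y = Γ.tgt g) (c : Γ.src (Γ.unit y) = Γ.tgt g),
        Γ.mul (Γ.unit y) g c = g := by
      rintro y rfl c; exact this
    exact e _ (Γ.src_inv g) c
  have e2 : ∀ a (ha : a = Γ.unit (Γ.src g)) (c : Γ.src (Γ.inv (Γ.inv g)) = Γ.tgt a),
      Γ.mul (Γ.inv (Γ.inv g)) a c = Γ.inv (Γ.inv g) := by
    intro a ha c
    subst ha
    have := Γ.mul_unit (Γ.inv (Γ.inv g))
    have e : ∀ y (_ : y = Γ.src (Γ.inv (Γ.inv g)))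
        (c : Γ.src (Γ.inv (Γ.inv g)) = Γ.tgt (Γ.unit y)),
        Γ.mul (Γ.inv (Γ.inv g)) (Γ.unit y) c = Γ.inv (Γ.inv g) := by
      rintro y rfl c; exact this
    exact e _ (by rw [Γ.src_inv, Γ.tgt_inv]) c
  rw [e1 _ (Γ.inv_mul _), e2 _ (Γ.inv_mul _)] at h
  exact h.symm

/-- Inversion as a homeomorphism `Γ^x ≃ Γ_x`. -/
def invFib (x : M) : Γ.TFib x ≃ₜ Γ.SFib x where
  toFun g := ⟨Γ.inv g.1, (Γ.src_inv _).trans g.2⟩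
  invFun g := ⟨Γ.inv g.1, (Γ.tgt_inv _).trans g.2⟩
  left_inv _ := Subtype.ext (Γ.inv_inv _)
  right_inv _ := Subtype.ext (Γ.inv_inv _)
  continuous_toFun := (Γ.continuous_inv.comp continuous_subtype_val).subtype_mk _
  continuous_invFun := (Γ.continuous_inv.comp continuous_subtype_val).subtype_mk _

/-- Left translation `h ↦ γh`, from `Γ^{s(γ)}` to `Γ^{t(γ)}`. -/
def leftMul (γ : G) (h : Γ.TFib (Γ.src γ)) : Γ.TFib (Γ.tgt γ) :=
  ⟨Γ.mul γ h.1 h.2.symm, Γ.tgt_mul _ _ _⟩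

/-- The groupoid is proper: the map `(s, t)` to `M × M` is proper. -/
def IsProper : Prop := IsProperMap fun g => (Γ.src g, Γ.tgt g)

/-- Two objects are equivalent when an arrow connects them. -/
def orbitSetoid : Setoid M where
  r x y := ∃ g, Γ.src g = x ∧ Γ.tgt g = y
  iseqv :=
    { refl := fun x => ⟨Γ.unit x, Γ.src_unit x, Γ.tgt_unit x⟩
      symm := by
        rintro x y ⟨g, hs, ht⟩
        exact ⟨Γ.inv g, (Γ.src_inv g).trans ht, (Γ.tgt_inv g).trans hs⟩
      trans := by
        rintro x y z ⟨g, hs, ht⟩ ⟨h, hs', ht'⟩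
        exact ⟨Γ.mul h g (hs'.trans ht.symm), (Γ.src_mul _ _ _).trans hs,
          (Γ.tgt_mul _ _ _).trans ht'⟩ }

/-- The orbit space `M/Γ`, with the quotient topology. -/
abbrev OrbitSpace : Type _ := Quotient Γ.orbitSetoid

/-- The filter on `M` of the neighbourhoods of infinity in `M/Γ`. -/
def atInftyOrbit : Filter M := comap (Quotient.mk Γ.orbitSetoid) (cocompact Γ.OrbitSpace)

theorem isMul_inv_self {x : M} (g : Γ.SFib x) : Γ.IsMul (Γ.inv g.1) g.1 (Γ.unit x) :=
  ⟨Γ.src_inv _, (Γ.inv_mul _).trans (by rw [g.2])⟩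

theorem isMul_unit (x : M) : Γ.IsMul (Γ.unit x) (Γ.unit x) (Γ.unit x) := by
  have key : ∀ (y : M) (hy : y = Γ.src (Γ.unit x)) (c : Γ.src (Γ.unit x) = Γ.tgt (Γ.unit y)),
      Γ.mul (Γ.unit x) (Γ.unit y) c = Γ.unit x := by
    rintro y rfl c
    exact Γ.mul_unit _
  exact ⟨(Γ.src_unit x).trans (Γ.tgt_unit x).symm, key x (Γ.src_unit x).symm _⟩

theorem inv_unit (x : M) : Γ.inv (Γ.unit x) = Γ.unit x := by
  have h1 := Γ.inv_mul (Γ.unit x)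
  have key : ∀ (y : M) (hy : y = Γ.src (Γ.inv (Γ.unit x)))
      (c : Γ.src (Γ.inv (Γ.unit x)) = Γ.tgt (Γ.unit y)),
      Γ.mul (Γ.inv (Γ.unit x)) (Γ.unit y) c = Γ.inv (Γ.unit x) := by
    rintro y rfl c
    exact Γ.mul_unit _
  rw [key x (by rw [Γ.src_inv, Γ.tgt_unit])] at h1
  rw [h1, Γ.src_unit]

/-- `h · (h⁻¹ g) = g`. -/
theorem isMul_mul_inv_mul (h g : G) (e : Γ.tgt h = Γ.tgt g) :
    Γ.IsMul h (Γ.mul (Γ.inv h) g ((Γ.src_inv h).trans e)) g := by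
  refine ⟨by rw [Γ.tgt_mul, Γ.tgt_inv], ?_⟩
  rw [← Γ.mul_assoc h (Γ.inv h) g (Γ.tgt_inv h).symm]
  have key : ∀ (a : G) (ha : a = Γ.unit (Γ.tgt g)) (c : Γ.src a = Γ.tgt g),
      Γ.mul a g c = g := by
    rintro a rfl c
    exact Γ.unit_mul g
  exact key _ ((Γ.mul_inv h).trans (by rw [e])) _

/-- `(g k⁻¹) · k = g`. -/
theorem isMul_mul_inv (g k : G) (e : Γ.src g = Γ.src k) :
    Γ.IsMul (Γ.mul g (Γ.inv k) (e.trans (Γ.tgt_inv k).symm)) k g := by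
  refine ⟨by rw [Γ.src_mul, Γ.src_inv], ?_⟩
  rw [Γ.mul_assoc g (Γ.inv k) k (e.trans (Γ.tgt_inv k).symm) (Γ.src_inv k)]
  have key : ∀ (a : G) (ha : a = Γ.unit (Γ.src g)) (c : Γ.src g = Γ.tgt a),
      Γ.mul g a c = g := by
    rintro a rfl c
    exact Γ.mul_unit g
  exact key _ ((Γ.inv_mul k).trans (by rw [e])) _

/-- The map `g ↦ g k⁻¹`, from `Γ_{s(k)}` to `Γ_{t(k)}`. -/
def rightDiv {x y : M} (k : G) (ht : Γ.tgt k = x) (hs : Γ.src k = y) (g : Γ.SFib y) : Γ.SFib x :=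
  ⟨Γ.mul g.1 (Γ.inv k) ((g.2.trans hs.symm).trans (Γ.tgt_inv k).symm),
    by rw [Γ.src_mul, Γ.src_inv, ht]⟩

theorem isMul_rightDiv {x y : M} (k : G) (ht : Γ.tgt k = x) (hs : Γ.src k = y) (g : Γ.SFib y) :
    Γ.IsMul (Γ.rightDiv k ht hs g).1 k g.1 :=
  Γ.isMul_mul_inv g.1 k (g.2.trans hs.symm)

theorem continuous_rightDiv {x y : M} (k : G) (ht : Γ.tgt k = x) (hs : Γ.src k = y) :
    Continuous (Γ.rightDiv k ht hs) := by
  refine Continuous.subtype_mk ?_ _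
  exact Γ.continuous_mul.comp
    ((continuous_subtype_val.prodMk continuous_const).subtype_mk
      fun g => (g.2.trans hs.symm).trans (Γ.tgt_inv k).symm)

end TopGroupoid

variable [MeasurableSpace G]

/-- A (left) Haar system `(λ^x)_{x ∈ M}`: Radon measures `λ^x` on `Γ^x` with full support,
depending continuously on `x`, and invariant under left translations. (The arrow spaces of interest
are locally compact, Hausdorff and second countable, so that a Borel measure is Radon as soon as it
is finite on compact sets.) -/
structure HaarSystem (Γ : TopGroupoid G M) where
  meas : ∀ x : M, Measure (Γ.TFib x)
  finite_on_compacts : ∀ x, IsFiniteMeasureOnCompacts (meas x)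
  full_support : ∀ x, (meas x).IsOpenPosMeasure
  continuous_integral : ∀ f : G → ℝ, Continuous f → HasCompactSupport f →
    Continuous fun x => ∫ g : Γ.TFib x, f g.1 ∂(meas x)
  left_invariant : ∀ γ : G, (meas (Γ.src γ)).map (Γ.leftMul γ) = meas (Γ.tgt γ)

namespace HaarSystem

variable {Γ : TopGroupoid G M} (lam : HaarSystem Γ)

/-- The measure `λ_x` on `Γ_x`: the image of `λ^x` under inversion. -/
def smeas (x : M) : Measure (Γ.SFib x) := (lam.meas x).map (Γ.invFib x)

/-- Cutoff functions. -/
structure IsCutoff (c : M → ℝ) : Prop where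
  continuous : Continuous c
  nonneg : ∀ x, 0 ≤ c x
  integral_eq_one : ∀ x, ∫ γ : Γ.TFib x, c (Γ.src γ.1) ∂(lam.meas x) = 1
  compact_support : ∀ K : Set M, IsCompact K →
    IsCompact (closure {γ : G | Γ.tgt γ ∈ K ∧ c (Γ.src γ) ≠ 0})

end HaarSystem

end Groupoid

/-! ### Upper semicontinuous fields of Banach spaces -/

/-- The total space of a field. -/
structure Tot {X : Type*} (E : X → Type*) where
  base : X
  vec : E base

/-- The fibred product over `X` of the total space with itself. -/
structure TotPair {X : Type*} (E : X → Type*) where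
  base : X
  fst : E base
  snd : E base

instance {X : Type*} (E : X → Type*) [TopologicalSpace (Tot E)] : TopologicalSpace (TotPair E) :=
  TopologicalSpace.induced (fun p => ((⟨p.base, p.fst⟩ : Tot E), (⟨p.base, p.snd⟩ : Tot E)))
    inferInstance

/-- The given topology on the total space makes `E` an upper semicontinuous field of
Banach spaces over `X` (completeness of the fibres is required separately). -/
structure IsUSCField {X : Type*} [TopologicalSpace X] (E : X → Type*)
    [∀ x, NormedAddCommGroup (E x)] [∀ x, NormedSpace ℂ (E x)] [TopologicalSpace (Tot E)] :
    Prop where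
  inducing_mk : ∀ x, IsInducing fun e : E x => (⟨x, e⟩ : Tot E)
  continuous_base : Continuous fun e : Tot E => e.base
  isOpenMap_base : IsOpenMap fun e : Tot E => e.base
  continuous_add : Continuous fun p : TotPair E => (⟨p.base, p.fst + p.snd⟩ : Tot E)
  continuous_smul : Continuous fun p : ℂ × Tot E => (⟨p.2.base, p.1 • p.2.vec⟩ : Tot E)
  usc_norm : UpperSemicontinuous fun e : Tot E => ‖e.vec‖
  tendsto_zero : ∀ x : X, comap (fun e : Tot E => ‖e.vec‖) (𝓝 0) ⊓
    comap (fun e : Tot E => e.base) (𝓝 x) ≤ 𝓝 (⟨x, 0⟩ : Tot E)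
  exists_section : ∀ (x : X) (e : E x), ∃ ξ : ∀ x, E x,
    Continuous (fun x => (⟨x, ξ x⟩ : Tot E)) ∧ ξ x = e

section Sections

variable {X Y : Type*} [TopologicalSpace X] [TopologicalSpace Y] {E : X → Type*}
  [∀ x, NormedAddCommGroup (E x)] [∀ x, NormedSpace ℂ (E x)] [TopologicalSpace (Tot E)]

/-- `C_c(Y; f^*E)`: the compactly supported continuous sections of the pull-back of the field `E`
under a continuous map `f : Y → X`. -/
def CcSection (hE : IsUSCField E) (f : C(Y, X)) : Submodule ℂ (∀ y, E (f y)) where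
  carrier := {ξ | Continuous (fun y => (⟨f y, ξ y⟩ : Tot E)) ∧
    ∃ K : Set Y, IsCompact K ∧ ∀ y ∉ K, ξ y = 0}
  add_mem' := by
    rintro ξ η ⟨hξ, K, hK, h0⟩ ⟨hη, L, hL, h1⟩
    refine ⟨?_, K ∪ L, hK.union hL, fun y hy => ?_⟩
    · have : Continuous fun y => (⟨f y, ξ y, η y⟩ : TotPair E) :=
        continuous_induced_rng.2 (hξ.prodMk hη)
      exact hE.continuous_add.comp this
    · rw [Set.mem_union, not_or] at hy
      simp [h0 y hy.1, h1 y hy.2]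
  zero_mem' := by
    refine ⟨continuous_iff_continuousAt.2 fun y => ?_, ∅, isCompact_empty, fun _ _ => rfl⟩
    refine Tendsto.mono_right ?_ (hE.tendsto_zero (f y))
    rw [tendsto_inf, tendsto_comap_iff, tendsto_comap_iff]
    refine ⟨?_, f.continuous.continuousAt⟩
    have : ((fun e : Tot E => ‖e.vec‖) ∘ fun y => (⟨f y, (0 : ∀ y, E (f y)) y⟩ : Tot E)) =
        fun _ => 0 := by
      funext y; simp
    rw [this]
    exact tendsto_const_nhds
  smul_mem' := by
    rintro c ξ ⟨hξ, K, hK, h0⟩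
    refine ⟨hE.continuous_smul.comp (continuous_const.prodMk hξ), K, hK, fun y hy => ?_⟩
    simp [h0 y hy]

end Sections

/-! ### Fell bundles -/

section Fell

variable {G M : Type*} [TopologicalSpace G] [TopologicalSpace M]

/-- An upper semicontinuous Fell bundle over the groupoid `Γ`. The product of `a ∈ E_g` and
`b ∈ E_h` is `mul p a b ∈ E_k`, for any witness `p` of `gh = k`; the adjoint of `a ∈ E_g` is
`star p a ∈ E_k`, for any witness `p` of `g⁻¹ = k`. An element of the
C*-algebra `E_{unit x}` is positive iff it is of the form `b* b`. -/
structure FellBundle (Γ : TopGroupoid G M) (E : G → Type*)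
    [∀ g, NormedAddCommGroup (E g)] [∀ g, NormedSpace ℂ (E g)] [TopologicalSpace (Tot E)] where
  isField : IsUSCField E
  complete : ∀ g, CompleteSpace (E g)
  mul : ∀ {g h k : G}, Γ.IsMul g h k → E g → E h → E k
  star : ∀ {g k : G}, Γ.inv g = k → E g → E k
  mul_add : ∀ {g h k} (p : Γ.IsMul g h k) (a : E g) (b b' : E h),
    mul p a (b + b') = mul p a b + mul p a b'
  add_mul : ∀ {g h k} (p : Γ.IsMul g h k) (a a' : E g) (b : E h),
    mul p (a + a') b = mul p a b + mul p a' b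
  mul_smul : ∀ {g h k} (p : Γ.IsMul g h k) (z : ℂ) (a : E g) (b : E h),
    mul p a (z • b) = z • mul p a b
  smul_mul : ∀ {g h k} (p : Γ.IsMul g h k) (z : ℂ) (a : E g) (b : E h),
    mul p (z • a) b = z • mul p a b
  mul_assoc : ∀ {g h k gh hk ghk} (p : Γ.IsMul g h gh) (p' : Γ.IsMul gh k ghk)
    (q : Γ.IsMul h k hk) (q' : Γ.IsMul g hk ghk) (a : E g) (b : E h) (c : E k),
    mul p' (mul p a b) c = mul q' a (mul q b c)
  star_add : ∀ {g k} (p : Γ.inv g = k) (a b : E g), star p (a + b) = star p a + star p b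
  star_smul : ∀ {g k} (p : Γ.inv g = k) (z : ℂ) (a : E g),
    star p (z • a) = (starRingEnd ℂ z) • star p a
  star_star : ∀ {g k} (p : Γ.inv g = k) (q : Γ.inv k = g) (a : E g), star q (star p a) = a
  norm_mul_le : ∀ {g h k} (p : Γ.IsMul g h k) (a : E g) (b : E h), ‖mul p a b‖ ≤ ‖a‖ * ‖b‖
  star_mul : ∀ {g h k g' h' k'} (p : Γ.IsMul g h k) (hg : Γ.inv g = g') (hh : Γ.inv h = h')
    (hk : Γ.inv k = k') (q : Γ.IsMul h' g' k') (a : E g) (b : E h),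
    star hk (mul p a b) = mul q (star hh b) (star hg a)
  norm_star_mul_self : ∀ {g g' k} (hg : Γ.inv g = g') (p : Γ.IsMul g' g k) (a : E g),
    ‖mul p (star hg a) a‖ = ‖a‖ ^ 2
  star_mul_self_pos : ∀ {g} (x : M) (p : Γ.IsMul (Γ.inv g) g (Γ.unit x)) (a : E g),
    ∃ b : E (Γ.unit x), mul p (star rfl a) a = mul (Γ.isMul_unit x) (star (Γ.inv_unit x) b) b
  continuous_mul : Continuous
    fun p : {p : Tot E × Tot E // Γ.src p.1.base = Γ.tgt p.2.base} =>
      (⟨Γ.mul p.1.1.base p.1.2.base p.2, mul ⟨p.2, rfl⟩ p.1.1.vec p.1.2.vec⟩ : Tot E)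
  continuous_star : Continuous fun e : Tot E => (⟨Γ.inv e.base, star rfl e.vec⟩ : Tot E)
  dense_mul : ∀ {g h k} (p : Γ.IsMul g h k),
    Dense (Submodule.span ℂ {e : E k | ∃ (a : E g) (b : E h), e = mul p a b} : Set (E k))

namespace FellBundle

variable {Γ : TopGroupoid G M} {E : G → Type*}
  [∀ g, NormedAddCommGroup (E g)] [∀ g, NormedSpace ℂ (E g)] [TopologicalSpace (Tot E)]
  (F : FellBundle Γ E)

/-- Continuity of products of continuous sections over a space `Y`. -/
theorem continuous_mul_comp {Y : Type*} [TopologicalSpace Y] {g h k : Y → G}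
    (p : ∀ y, Γ.IsMul (g y) (h y) (k y)) {a : ∀ y, E (g y)} {b : ∀ y, E (h y)}
    (ha : Continuous fun y => (⟨g y, a y⟩ : Tot E)) (hb : Continuous fun y => (⟨h y, b y⟩ : Tot E)) :
    Continuous fun y => (⟨k y, F.mul (p y) (a y) (b y)⟩ : Tot E) := by
  have key : ∀ {g h k : G} (p : Γ.IsMul g h k) (a : E g) (b : E h),
      (⟨k, F.mul p a b⟩ : Tot E) = ⟨Γ.mul g h p.1, F.mul ⟨p.1, rfl⟩ a b⟩ := by
    rintro g h k ⟨c, rfl⟩ a b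
    rfl
  have h1 := F.continuous_mul.comp ((ha.prodMk hb).subtype_mk fun y => (p y).1)
  refine h1.congr fun y => ?_
  exact (key (p y) (a y) (b y)).symm

/-- The C*-algebra `A_x = E_{unit x}`. -/
def UnitFib (_ : FellBundle Γ E) (x : M) : Type _ := E (Γ.unit x)

instance (x : M) : NonUnitalCStarAlgebra (F.UnitFib x) where
  __ := (inferInstance : NormedAddCommGroup (E (Γ.unit x)))
  __ := (inferInstance : NormedSpace ℂ (E (Γ.unit x)))
  mul a b := F.mul (Γ.isMul_unit x) a b
  star a := F.star (Γ.inv_unit x) a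
  left_distrib a b c := F.mul_add _ a b c
  right_distrib a b c := F.add_mul _ a b c
  zero_mul a := by
    have := F.smul_mul (Γ.isMul_unit x) 0 0 a
    rwa [zero_smul, zero_smul] at this
  mul_zero a := by
    have := F.mul_smul (Γ.isMul_unit x) 0 a 0
    rwa [zero_smul, zero_smul] at this
  mul_assoc a b c := F.mul_assoc _ _ _ _ a b c
  norm_mul_le a b := F.norm_mul_le _ a b
  star_involutive a := F.star_star _ _ a
  star_mul a b := F.star_mul _ _ _ _ _ a b
  star_add a b := F.star_add _ a b
  complete := (F.complete (Γ.unit x)).complete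
  norm_mul_self_le a := by
    have := F.norm_star_mul_self (Γ.inv_unit x) (Γ.isMul_unit x) a
    exact ((sq _).symm.trans this.symm).le
  smul_assoc z a b := F.smul_mul _ z a b
  smul_comm z a b := (F.mul_smul _ z a b).symm
  star_smul z a := F.star_smul _ z a

/-- The compactly supported continuous sections `C_c(Γ; E)`. -/
abbrev Cc : Submodule ℂ (∀ g : G, E g) := CcSection F.isField (ContinuousMap.id G)

/-- The inclusion of `Γ_x` in `Γ`. -/
def incl (_ : FellBundle Γ E) (x : M) : C(Γ.SFib x, G) := ⟨Subtype.val, continuous_subtype_val⟩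

/-- The compactly supported continuous sections `C_c(Γ_x; E)`. As a type of its own, because it will
be given the (semi)norm of `L²(Γ_x; E)`. -/
def CcFib (x : M) : Type _ := CcSection F.isField (F.incl x)

instance (x : M) : AddCommGroup (F.CcFib x) :=
  inferInstanceAs (AddCommGroup (CcSection F.isField (F.incl x)))

instance (x : M) : Module ℂ (F.CcFib x) :=
  inferInstanceAs (Module ℂ (CcSection F.isField (F.incl x)))

/-- Evaluation of a section at an arrow. -/
def CcFib.eval {F : FellBundle Γ E} {x : M} (ξ : F.CcFib x) (g : Γ.SFib x) : E g.1 := ξ.1 g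

/-- Restriction of sections, from `C_c(Γ; E)` to `C_c(Γ_x; E)`. -/
def restrict [T2Space M] (x : M) (ξ : F.Cc) : F.CcFib x :=
  ⟨fun g => ξ.1 g.1, by
    obtain ⟨hξ, K, hK, h0⟩ := ξ.2
    refine ⟨hξ.comp continuous_subtype_val, Subtype.val ⁻¹' K, ?_, fun g hg => h0 g.1 hg⟩
    exact (isClosed_singleton.preimage Γ.continuous_src).isClosedEmbedding_subtypeVal
      |>.isCompact_preimage hK⟩

/-- Right multiplication by `e ∈ E_k`: the section `(ξe)(g) = ξ(g k⁻¹) e`, from `C_c(Γ_{t(k)}; E)`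
to `C_c(Γ_{s(k)}; E)`. -/
def rmulPre {x y : M} (k : G) (ht : Γ.tgt k = x) (hs : Γ.src k = y) (e : E k) (ξ : F.CcFib x) :
    F.CcFib y :=
  ⟨fun g => F.mul (Γ.isMul_rightDiv k ht hs g) (ξ.eval (Γ.rightDiv k ht hs g)) e, by
    obtain ⟨hξ, K, hK, h0⟩ := ξ.2
    refine ⟨F.continuous_mul_comp (fun g => Γ.isMul_rightDiv k ht hs g)
      (hξ.comp (Γ.continuous_rightDiv k ht hs)) continuous_const, ?_⟩
    have hc : Continuous fun g : Γ.SFib x => (⟨Γ.mul g.1 k (g.2.trans ht.symm),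
        (Γ.src_mul _ _ _).trans hs⟩ : Γ.SFib y) :=
      Continuous.subtype_mk (Γ.continuous_mul.comp
        ((continuous_subtype_val.prodMk continuous_const).subtype_mk
          fun g => g.2.trans ht.symm)) _
    refine ⟨_, hK.image hc, fun g hg => ?_⟩
    have hz : ξ.eval (Γ.rightDiv k ht hs g) = 0 := by
      refine h0 _ fun hmem => hg ⟨_, hmem, Subtype.ext ?_⟩
      exact (Γ.isMul_rightDiv k ht hs g).2
    have hm := F.smul_mul (Γ.isMul_rightDiv k ht hs g) 0 0 e
    rw [zero_smul, zero_smul] at hm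
    simp only [hz]
    exact hm⟩

end FellBundle

/-! ### The Hilbert modules `L²(Γ_x; E)` and `L²(Γ; E)` -/

/-- The triangle inequality for a C*-algebra valued semi-inner product. -/
theorem sqrt_norm_ip_add_le {V A : Type*} [AddCommGroup V] [Module ℂ V] [NonUnitalCStarAlgebra A]
    [PartialOrder A] [StarOrderedRing A] (ip : V → V → A)
    (hadd : ∀ x y z, ip x (y + z) = ip x y + ip x z)
    (hadd' : ∀ x y z, ip (x + y) z = ip x z + ip y z)
    (hsmul : ∀ (r : ℝ) x y, ip x ((r : ℂ) • y) = r • ip x y)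
    (hsmul' : ∀ (r : ℝ) x y, ip ((r : ℂ) • x) y = r • ip x y)
    (hpos : ∀ x, 0 ≤ ip x x) (x y : V) :
    √‖ip (x + y) (x + y)‖ ≤ √‖ip x x‖ + √‖ip y y‖ := by
  set a := √‖ip x x‖ with ha
  set b := √‖ip y y‖ with hb
  have ha2 : ‖ip x x‖ = a ^ 2 := (Real.sq_sqrt (norm_nonneg _)).symm
  have hb2 : ‖ip y y‖ = b ^ 2 := (Real.sq_sqrt (norm_nonneg _)).symm
  have ha0 : 0 ≤ a := Real.sqrt_nonneg _
  have hb0 : 0 ≤ b := Real.sqrt_nonneg _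
  refine le_of_forall_pos_le_add fun ε hε => ?_
  refine Real.sqrt_le_iff.2 ⟨by positivity, ?_⟩
  set p := a + ε / 2 with hp
  set q := b + ε / 2 with hq
  have hp0 : 0 < p := by positivity
  have hq0 : 0 < q := by positivity
  have hle : ip (x + y) (x + y) ≤ (1 + q / p) • ip x x + (1 + p / q) • ip y y := by
    have h := hpos (((q : ℝ) : ℂ) • x + (((-p : ℝ)) : ℂ) • y)
    simp only [hadd, hadd', hsmul, hsmul'] at h
    have h2 : (0 : A) ≤ (1 / (p * q)) • (q • q • ip x x + (-p) • q • ip y x +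
        (q • (-p) • ip x y + (-p) • (-p) • ip y y)) := by
      refine smul_nonneg (by positivity) ?_
      convert! h using 1
      module
    have h3 : (1 / (p * q)) • (q • q • ip x x + (-p) • q • ip y x +
        (q • (-p) • ip x y + (-p) • (-p) • ip y y)) =
        (q / p) • ip x x + (p / q) • ip y y - ip x y - ip y x := by
      simp only [smul_add, smul_smul]
      have e1 : 1 / (p * q) * (q * q) = q / p := by field_simp
      have e2 : 1 / (p * q) * (-p * q) = -1 := by field_simp
      have e3 : 1 / (p * q) * (q * -p) = -1 := by field_simp
      have e4 : 1 / (p * q) * (-p * -p) = p / q := by field_simp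
      rw [e1, e2, e3, e4]
      module
    rw [h3] at h2
    rw [← sub_nonneg]
    convert! h2 using 1
    simp only [hadd, hadd']
    module
  calc ‖ip (x + y) (x + y)‖ ≤ ‖(1 + q / p) • ip x x + (1 + p / q) • ip y y‖ :=
        CStarAlgebra.norm_le_norm_of_nonneg_of_le (hpos _) hle
    _ ≤ (1 + q / p) * a ^ 2 + (1 + p / q) * b ^ 2 := by
        refine (norm_add_le _ _).trans (le_of_eq ?_)
        rw [norm_smul, norm_smul, ha2, hb2, Real.norm_of_nonneg (by positivity),
          Real.norm_of_nonneg (by positivity)]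
    _ ≤ (1 + q / p) * p ^ 2 + (1 + p / q) * q ^ 2 := by
        have : a ≤ p := by linarith
        have : b ≤ q := by linarith
        gcongr
    _ = (a + b + ε) ^ 2 := by
        have : a + b + ε = p + q := by rw [hp, hq]; ring
        rw [this]
        field_simp
        ring

variable [MeasurableSpace G]

namespace FellBundle

variable {Γ : TopGroupoid G M} {E : G → Type*}
  [∀ g, NormedAddCommGroup (E g)] [∀ g, NormedSpace ℂ (E g)] [TopologicalSpace (Tot E)]
  (F : FellBundle Γ E) (lam : HaarSystem Γ)

/-- The `A_x`-valued inner product `⟨ξ, η⟩ = ∫_{Γ_x} ξ(g)* η(g) dλ_x(g)` on `C_c(Γ_x; E)`. -/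
def ipPre (x : M) (ξ η : F.CcFib x) : E (Γ.unit x) :=
  ∫ g : Γ.SFib x, F.mul (Γ.isMul_inv_self g) (F.star rfl (ξ.eval g)) (η.eval g) ∂(lam.smeas x)

theorem continuous_ip_integrand (x : M) (ξ η : F.CcFib x) : Continuous fun g : Γ.SFib x =>
    F.mul (Γ.isMul_inv_self g) (F.star rfl (ξ.eval g)) (η.eval g) := by
  rw [(F.isField.inducing_mk (Γ.unit x)).continuous_iff]
  exact F.continuous_mul_comp (fun g => Γ.isMul_inv_self g) (F.continuous_star.comp ξ.2.1) η.2.1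

theorem hasCompactSupport_ip_integrand [T2Space G] (x : M) (ξ η : F.CcFib x) :
    HasCompactSupport fun g : Γ.SFib x =>
      F.mul (Γ.isMul_inv_self g) (F.star rfl (ξ.eval g)) (η.eval g) := by
  obtain ⟨-, K, hK, h0⟩ := η.2
  refine HasCompactSupport.intro hK fun g hg => ?_
  have hz : η.eval g = 0 := h0 g hg
  have := F.mul_smul (Γ.isMul_inv_self g) 0 (F.star rfl (ξ.eval g)) 0
  rw [zero_smul, zero_smul] at this
  rw [hz, this]

theorem integrable_ip_integrand [T2Space G] [BorelSpace G] (x : M) (ξ η : F.CcFib x) :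
    Integrable (fun g : Γ.SFib x =>
      F.mul (Γ.isMul_inv_self g) (F.star rfl (ξ.eval g)) (η.eval g)) (lam.smeas x) := by
  have := lam.finite_on_compacts x
  have : IsFiniteMeasureOnCompacts (lam.smeas x) :=
    MeasureTheory.Measure.IsFiniteMeasureOnCompacts.map (lam.meas x) (Γ.invFib x)
  exact (F.continuous_ip_integrand x ξ η).integrable_of_hasCompactSupport
    (F.hasCompactSupport_ip_integrand x ξ η)

variable [T2Space G] [BorelSpace G]

theorem ipPre_add (x : M) (ξ η ζ : F.CcFib x) :
    F.ipPre lam x ξ (η + ζ) = F.ipPre lam x ξ η + F.ipPre lam x ξ ζ := by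
  unfold ipPre
  rw [← integral_add (F.integrable_ip_integrand lam x ξ η) (F.integrable_ip_integrand lam x ξ ζ)]
  exact integral_congr_ae (ae_of_all _ fun g => F.mul_add _ _ _ _)

theorem ipPre_add' (x : M) (ξ η ζ : F.CcFib x) :
    F.ipPre lam x (ξ + η) ζ = F.ipPre lam x ξ ζ + F.ipPre lam x η ζ := by
  unfold ipPre
  rw [← integral_add (F.integrable_ip_integrand lam x ξ ζ) (F.integrable_ip_integrand lam x η ζ)]
  refine integral_congr_ae (ae_of_all _ fun g => ?_)
  exact (congrArg (fun a => F.mul (Γ.isMul_inv_self g) a (ζ.eval g))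
    (F.star_add rfl (ξ.eval g) (η.eval g))).trans (F.add_mul _ _ _ _)

theorem ipPre_smul (x : M) (z : ℂ) (ξ η : F.CcFib x) :
    F.ipPre lam x ξ (z • η) = z • F.ipPre lam x ξ η := by
  unfold ipPre
  rw [← integral_smul]
  exact integral_congr_ae (ae_of_all _ fun g => F.mul_smul _ _ _ _)

theorem ipPre_smul' (x : M) (z : ℂ) (ξ η : F.CcFib x) :
    F.ipPre lam x (z • ξ) η = (starRingEnd ℂ z) • F.ipPre lam x ξ η := by
  unfold ipPre
  rw [← integral_smul]
  refine integral_congr_ae (ae_of_all _ fun g => ?_)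
  exact (congrArg (fun a => F.mul (Γ.isMul_inv_self g) a (η.eval g))
    (F.star_smul rfl z (ξ.eval g))).trans (F.smul_mul _ _ _ _)

/-- The pre-Hilbert `A_x`-module `C_c(Γ_x; E)`, with the seminorm `‖⟨ξ, ξ⟩‖^{1/2}`. -/
def PreL2 (_ : HaarSystem Γ) (x : M) : Type _ := F.CcFib x

instance (x : M) : AddCommGroup (F.PreL2 lam x) := inferInstanceAs (AddCommGroup (F.CcFib x))

instance (x : M) : Module ℂ (F.PreL2 lam x) := inferInstanceAs (Module ℂ (F.CcFib x))

instance (x : M) : Norm (F.PreL2 lam x) := ⟨fun ξ => √‖F.ipPre lam x ξ ξ‖⟩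

theorem seminormedSpaceCore (x : M) : SeminormedSpace.Core ℂ (F.PreL2 lam x) := by
  refine ⟨fun ξ => Real.sqrt_nonneg _, fun z ξ => ?_, fun ξ η => ?_⟩
  · let ξ' : F.CcFib x := ξ
    change √‖F.ipPre lam x (z • ξ') (z • ξ')‖ = ‖z‖ * √‖F.ipPre lam x ξ' ξ'‖
    rw [ipPre_smul, ipPre_smul', norm_smul, norm_smul, RCLike.norm_conj, ← _root_.mul_assoc,
      Real.sqrt_mul (by positivity), Real.sqrt_mul_self (norm_nonneg z)]
  · let := CStarAlgebra.spectralOrder (F.UnitFib x)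
    have := CStarAlgebra.spectralOrderedRing (F.UnitFib x)
    have hpos : ∀ ξ : F.CcFib x, (0 : F.UnitFib x) ≤ F.ipPre lam x ξ ξ := by
      intro ξ
      refine integral_nonneg (E := F.UnitFib x) fun g => ?_
      obtain ⟨b, hb⟩ := F.star_mul_self_pos x (Γ.isMul_inv_self g) (ξ.eval g)
      let b' : F.UnitFib x := b
      have : 0 ≤ Star.star b' * b' := star_mul_self_nonneg b'
      exact this.trans_eq hb.symm
    refine sqrt_norm_ip_add_le (A := F.UnitFib x) (F.ipPre lam x) (F.ipPre_add lam x)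
      (F.ipPre_add' lam x) (fun r ξ η => ?_) (fun r ξ η => ?_) hpos ξ η
    · exact F.ipPre_smul lam x r ξ η
    · have := F.ipPre_smul' lam x r ξ η
      rw [Complex.conj_ofReal] at this
      exact this

instance (x : M) : SeminormedAddCommGroup (F.PreL2 lam x) :=
  SeminormedAddCommGroup.ofCore (F.seminormedSpaceCore lam x)

instance (x : M) : NormedSpace ℂ (F.PreL2 lam x) where
  norm_smul_le z ξ := ((F.seminormedSpaceCore lam x).norm_smul z ξ).le

/-- The Hilbert `A_x`-module `L²(Γ_x; E)`: the completion of `C_c(Γ_x; E)`. -/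
abbrev L2Fib (x : M) : Type _ := UniformSpace.Completion (F.PreL2 lam x)

/-- The canonical map from `C_c(Γ_x; E)` to `L²(Γ_x; E)`. -/
def toL2Fib (x : M) (ξ : F.CcFib x) : F.L2Fib lam x :=
  ((show F.PreL2 lam x from ξ : F.PreL2 lam x) : UniformSpace.Completion (F.PreL2 lam x))

/-- The `A_x`-valued inner product on `L²(Γ_x; E)`, the continuous extension of the one on
`C_c(Γ_x; E)`. -/
def ip (x : M) (ξ η : F.L2Fib lam x) : E (Γ.unit x) :=
  (UniformSpace.Completion.isDenseInducing_coe.prodMap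
    UniformSpace.Completion.isDenseInducing_coe).extend
    (fun p : F.PreL2 lam x × F.PreL2 lam x => F.ipPre lam x p.1 p.2) (ξ, η)

/-- Right multiplication by `e ∈ E_k`, from `L²(Γ_{t(k)}; E)` to `L²(Γ_{s(k)}; E)`: the continuous
extension of `(ξe)(g) = ξ(g k⁻¹) e`. -/
def rmul {x y : M} (k : G) (ht : Γ.tgt k = x) (hs : Γ.src k = y) (e : E k) :
    F.L2Fib lam x → F.L2Fib lam y :=
  UniformSpace.Completion.map
    (fun ξ : F.PreL2 lam x => (show F.PreL2 lam y from F.rmulPre k ht hs e ξ))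

variable [LocallyCompactSpace G] [T2Space M]

/-- A compactly supported continuous section has uniformly bounded norms in the `L²(Γ_x; E)`. -/
theorem bddAbove_norm_restrict (ξ : F.Cc) :
    BddAbove (Set.range fun x : M => ‖F.toL2Fib lam x (F.restrict x ξ)‖) := by
  obtain ⟨hξ, K, hK, h0⟩ := ξ.2
  obtain ⟨C, hC⟩ := (((F.isField.usc_norm.comp hξ).upperSemicontinuousOn K).bddAbove_of_isCompact hK)
  have hC' : ∀ g, ‖ξ.1 g‖ ≤ max C 0 := by
    intro g
    by_cases hg : g ∈ K
    · exact (hC ⟨g, hg, rfl⟩).trans (le_max_left _ _)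
    · have : ξ.1 g = 0 := h0 g hg
      rw [this, norm_zero]
      exact le_max_right _ _
  have hstar : ∀ {g k : G} (p : Γ.inv g = k) (a : E g), ‖F.star p a‖ ≤ ‖a‖ := by
    intro g k p a
    have q : Γ.inv k = g := by rw [← p, Γ.inv_inv]
    have hp : Γ.IsMul (Γ.inv k) k (Γ.unit (Γ.src k)) := Γ.isMul_inv_self ⟨k, rfl⟩
    rw [q] at hp
    have h1 := F.norm_star_mul_self q hp (F.star p a)
    have h2 := F.norm_mul_le hp (F.star q (F.star p a)) (F.star p a)
    rw [h1, F.star_star p q, sq] at h2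
    by_contra hlt
    push Not at hlt
    have : ‖a‖ * ‖F.star p a‖ < ‖F.star p a‖ * ‖F.star p a‖ :=
      mul_lt_mul_of_pos_right hlt ((norm_nonneg a).trans_lt hlt)
    linarith
  obtain ⟨f, hf1, -, hfc, hf01⟩ := exists_continuous_one_zero_of_isCompact
    (hK.image Γ.continuous_inv) isClosed_empty (Set.disjoint_empty _)
  have hcont := lam.continuous_integral f f.continuous hfc
  obtain ⟨D, hD⟩ := (hfc.isCompact.image Γ.continuous_tgt).bddAbove_image hcont.continuousOn
  have hD' : ∀ x, ∫ g : Γ.TFib x, f g.1 ∂(lam.meas x) ≤ max D 0 := by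
    intro x
    by_cases hx : x ∈ Γ.tgt '' tsupport f
    · exact (hD ⟨x, hx, rfl⟩).trans (le_max_left _ _)
    · refine le_trans (le_of_eq ?_) (le_max_right _ _)
      refine integral_eq_zero_of_ae (ae_of_all _ fun g => ?_)
      exact image_eq_zero_of_notMem_tsupport fun hg => hx ⟨g.1, hg, g.2⟩
  refine ⟨√(max C 0 ^ 2 * max D 0), ?_⟩
  rintro _ ⟨x, rfl⟩
  have hnorm : ‖F.toL2Fib lam x (F.restrict x ξ)‖ =
      √‖F.ipPre lam x (F.restrict x ξ) (F.restrict x ξ)‖ :=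
    UniformSpace.Completion.norm_coe (E := F.PreL2 lam x) _
  simp only [hnorm]
  refine Real.sqrt_le_sqrt ?_
  have := lam.finite_on_compacts x
  have hint : Integrable (fun g : Γ.TFib x => f g.1) (lam.meas x) := by
    refine (f.continuous.comp continuous_subtype_val).integrable_of_hasCompactSupport ?_
    exact hfc.comp_isClosedEmbedding
      (isClosed_singleton.preimage Γ.continuous_tgt).isClosedEmbedding_subtypeVal
  have hemb := (Γ.invFib x).measurableEmbedding
  unfold ipPre HaarSystem.smeas
  rw [hemb.integral_map]
  calc _ ≤ ∫ g : Γ.TFib x, max C 0 ^ 2 * f g.1 ∂(lam.meas x) := by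
        refine norm_integral_le_of_norm_le (hint.const_mul _) (ae_of_all _ fun g => ?_)
        by_cases hg : Γ.inv g.1 ∈ K
        · have h1 : f g.1 = 1 := hf1 ⟨_, hg, Γ.inv_inv _⟩
          rw [h1, mul_one, sq]
          refine (F.norm_mul_le _ _ _).trans ?_
          exact mul_le_mul ((hstar _ _).trans (hC' _)) (hC' _) (norm_nonneg _) (le_max_right _ _)
        · have hz : (F.restrict x ξ).eval (Γ.invFib x g) = 0 := h0 _ hg
          have hm := F.norm_mul_le (Γ.isMul_inv_self (Γ.invFib x g))
            (F.star rfl ((F.restrict x ξ).eval (Γ.invFib x g)))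
            ((F.restrict x ξ).eval (Γ.invFib x g))
          refine hm.trans ?_
          rw [hz, norm_zero, mul_zero]
          exact mul_nonneg (sq_nonneg _) (hf01 _).1
    _ = max C 0 ^ 2 * ∫ g : Γ.TFib x, f g.1 ∂(lam.meas x) := integral_const_mul _ _
    _ ≤ max C 0 ^ 2 * max D 0 := mul_le_mul_of_nonneg_left (hD' x) (sq_nonneg _)

/-- The map sending `ξ ∈ C_c(Γ; E)` to the bounded family of the classes of `ξ|_{Γ_x}` in
`L²(Γ_x; E)`. -/
def toFamily : F.Cc →ₗ[ℂ] lp (fun x : M => F.L2Fib lam x) ∞ where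
  toFun ξ := ⟨fun x => F.toL2Fib lam x (F.restrict x ξ),
    memℓp_infty (F.bddAbove_norm_restrict lam ξ)⟩
  map_add' ξ η := by
    ext x
    exact UniformSpace.Completion.coe_add (α := F.PreL2 lam x) (F.restrict x ξ) (F.restrict x η)
  map_smul' z ξ := by
    ext x
    exact UniformSpace.Completion.coe_smul (X := F.PreL2 lam x) z (F.restrict x ξ)

/-- The Hilbert module `L²(Γ; E)` over `A = C_0(M; E)`: the completion of `C_c(Γ; E)` for the norm
`sup_x ‖⟨ξ, ξ⟩(x)‖^{1/2}`, realized as a closed space of bounded families `(ξ_x)_{x ∈ M}`,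
where `ξ_x ∈ L²(Γ_x; E)`. The `A`-valued inner product of `ξ` and `η` is `x ↦ ⟨ξ_x, η_x⟩`. -/
def L2 : Submodule ℂ (lp (fun x : M => F.L2Fib lam x) ∞) :=
  (LinearMap.range (F.toFamily lam)).topologicalClosure

/-- The canonical map from `C_c(Γ; E)` to `L²(Γ; E)`. -/
def toL2 (ξ : F.Cc) : F.L2 lam :=
  ⟨F.toFamily lam ξ, Submodule.le_topologicalClosure _ ⟨ξ, rfl⟩⟩

/-- The component `ξ_x ∈ L²(Γ_x; E)` of `ξ ∈ L²(Γ; E)`. -/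
def fiberAt (ξ : F.L2 lam) (x : M) : F.L2Fib lam x := ξ.1 x

/-! ### Operators -/

/-- `T` is an adjointable operator on `L²(Γ; E)`, that is `T ∈ 𝓛(L²(Γ; E))`. -/
def IsAdjointable (T : F.L2 lam →L[ℂ] F.L2 lam) : Prop :=
  ∃ S : F.L2 lam → F.L2 lam, ∀ (ξ η : F.L2 lam) (x : M),
    F.ip lam x (F.fiberAt lam (T ξ) x) (F.fiberAt lam η x) = F.ip lam x (F.fiberAt lam ξ x) (F.fiberAt lam (S η) x)

/-- `T` is the rank-one operator `ζ ↦ ξ⟨η, ζ⟩`. -/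
def IsRankOne (ξ η : F.L2 lam) (T : F.L2 lam →L[ℂ] F.L2 lam) : Prop :=
  ∀ (ζ : F.L2 lam) (x : M), F.fiberAt lam (T ζ) x =
    F.rmul lam (Γ.unit x) (Γ.tgt_unit x) (Γ.src_unit x)
      (F.ip lam x (F.fiberAt lam η x) (F.fiberAt lam ζ x)) (F.fiberAt lam ξ x)

/-- The compact operators `𝓚(L²(Γ; E))`: the closed linear span of the rank-one operators. -/
def compactOps : Submodule ℂ (F.L2 lam →L[ℂ] F.L2 lam) :=
  (Submodule.span ℂ {T | ∃ ξ η, F.IsRankOne lam ξ η T}).topologicalClosure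

/-- The convolution `(f * η)(g) = ∫_{Γ^{t(g)}} f(h) η(h⁻¹g) dλ^{t(g)}(h)`. -/
def conv (f η : F.Cc) (g : G) : E g :=
  ∫ h : Γ.TFib (Γ.tgt g),
    F.mul (Γ.isMul_mul_inv_mul h.1 g h.2) (f.1 h.1)
      (η.1 (Γ.mul (Γ.inv h.1) g ((Γ.src_inv h.1).trans h.2))) ∂(lam.meas (Γ.tgt g))

/-- `S` is the operator `π_l(f) : η ↦ f * η` of the left regular representation. -/
def IsLeftConv (f : F.Cc) (S : F.L2 lam →L[ℂ] F.L2 lam) : Prop :=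
  ∀ η : F.Cc, ∃ ζ : F.Cc, (∀ g, ζ.1 g = F.conv lam f η g) ∧ S (F.toL2 lam η) = F.toL2 lam ζ

/-- The reduced C*-algebra `C*_r(Γ; E)`: the norm closure of `π_l(C_c(Γ; E))`. -/
def reducedCStar : Set (F.L2 lam →L[ℂ] F.L2 lam) :=
  closure {S | ∃ f : F.Cc, F.IsLeftConv lam f S}

open Classical in
/-- The operator `T_x` on `L²(Γ_x; E)` induced by an adjointable operator `T` on `L²(Γ; E)`: the
unique operator such that `T_x ξ_x = (Tξ)_x` for all `ξ` (and `0` if there is none). -/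
def fiberOp (T : F.L2 lam →L[ℂ] F.L2 lam) (x : M) : F.L2Fib lam x →L[ℂ] F.L2Fib lam x :=
  if h : ∃ S : F.L2Fib lam x →L[ℂ] F.L2Fib lam x,
      ∀ ξ : F.L2 lam, S (F.fiberAt lam ξ x) = F.fiberAt lam (T ξ) x
  then h.choose else 0

open Classical in
/-- For `γ` from `x` to `y`, the operator `α_γ(T)` on `L²(Γ_y; E)`, where `T` is an
adjointable operator on `L²(Γ_x; E)`: under `L²(Γ_x; E) ⊗ E_{γ⁻¹} ≅ L²(Γ_y; E)`, `ξ ⊗ e ↦ ξe`, it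
is `T ⊗ 1`, that is, the unique operator such that `α_γ(T)(ξe) = (Tξ)e` for all `ξ` and
`e ∈ E_{γ⁻¹}` (and `0` if there is none). -/
def transport {x y : M} (γ : G) (hs : Γ.src γ = x) (ht : Γ.tgt γ = y)
    (T : F.L2Fib lam x →L[ℂ] F.L2Fib lam x) : F.L2Fib lam y →L[ℂ] F.L2Fib lam y :=
  if h : ∃ S : F.L2Fib lam y →L[ℂ] F.L2Fib lam y,
      ∀ (ξ : F.L2Fib lam x) (e : E (Γ.inv γ)),
        S (F.rmul lam (Γ.inv γ) ((Γ.tgt_inv γ).trans hs) ((Γ.src_inv γ).trans ht) e ξ) =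
          F.rmul lam (Γ.inv γ) ((Γ.tgt_inv γ).trans hs) ((Γ.src_inv γ).trans ht) e (T ξ)
  then h.choose else 0

/-- `S` is the average `T^Γ` of `T` with respect to the cutoff function `c`: the adjointable operator
with `(T^Γ)_x = ∫_{Γ^x} c(s(γ)) α_γ(T_{s(γ)}) dλ^x(γ)`, a strongly convergent integral. -/
def IsAverage (c : M → ℝ) (T S : F.L2 lam →L[ℂ] F.L2 lam) : Prop :=
  F.IsAdjointable lam S ∧ ∀ (x : M) (ξ : F.L2Fib lam x),
    Integrable (fun γ : Γ.TFib x =>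
      c (Γ.src γ.1) • F.transport lam γ.1 rfl γ.2 (F.fiberOp lam T (Γ.src γ.1)) ξ) (lam.meas x) ∧
    F.fiberOp lam S x ξ = ∫ γ : Γ.TFib x,
      c (Γ.src γ.1) • F.transport lam γ.1 rfl γ.2 (F.fiberOp lam T (Γ.src γ.1)) ξ ∂(lam.meas x)

/-- The set `{T^Γ | T ∈ 𝓚(L²(Γ; E))}` of the averages of compact operators. -/
def averages (c : M → ℝ) : Set (F.L2 lam →L[ℂ] F.L2 lam) :=
  {S | ∃ T ∈ F.compactOps lam, F.IsAverage lam c T S}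

/-- `T` is `Γ`-invariant: `α_γ(T_{s(γ)}) = T_{t(γ)}` for all `γ`. -/
def IsInvariant (T : F.L2 lam →L[ℂ] F.L2 lam) : Prop :=
  ∀ γ : G, F.transport lam γ rfl rfl (F.fiberOp lam T (Γ.src γ)) = F.fiberOp lam T (Γ.tgt γ)

/-- `φT` is compact for all `φ ∈ C_0(M)`. -/
def IsLocallyCompact (T : F.L2 lam →L[ℂ] F.L2 lam) : Prop :=
  ∀ φ : C₀(M, ℂ), ∃ S ∈ F.compactOps lam, ∀ (ξ : F.L2 lam) (x : M),
    F.fiberAt lam (S ξ) x = φ x • F.fiberAt lam (T ξ) x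

/-- `𝓚_Γ(L²(Γ; E))`: the adjointable, `Γ`-invariant, locally compact operators `T` such that
`‖T_x‖ → 0` when `x → ∞` in `M/Γ`. -/
def invariantCompactOps : Set (F.L2 lam →L[ℂ] F.L2 lam) :=
  {T | F.IsAdjointable lam T ∧ F.IsLocallyCompact lam T ∧ F.IsInvariant lam T ∧
    Tendsto (fun x => ‖F.fiberOp lam T x‖) Γ.atInftyOrbit (𝓝 0)}

end FellBundle

end Fell

end

end FellGroupoid

/-! Everything is expressed through integral kernels. A continuous kernel K(g,k) ∈ E_{gk⁻¹}, defined
for arrows with the same source, acts by (Kη)(g) = ∫ K(g,k)η(k) dλ_{s(g)}(k). Two kinds of kernels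
matter.

Compactly supported kernels give compact operators. Fullness of the bundle lets them be approximated
uniformly, with supports in a fixed compact set, by finite sums of kernels ξ(g)η(k)*
(`IsCompactKern.exists_rankSpan_approx`), and the Schur test (`norm_kerOp_le`) turns this into norm
approximation. Conversely, compact operators are norm limits of operators with such finite rank
kernels (`exists_isKernOp_of_mem_compactOps`).

The kernels f(gk⁻¹), with f ∈ C_c(Γ;E), give the convolution operators. They do not change under
right translation, whence invariance; over a compact set of objects their support is compact because
Γ is proper, whence local compactness; and they vanish outside a compact set of orbits. As 𝓚_Γ is
norm closed, C*_r ⊆ 𝓚_Γ.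

Transport by γ replaces K(g,k) by K(gn⁻¹,kn⁻¹) with n = γ⁻¹ (`IsKernOp.transport_apply`). Integrated
against a weight c, this becomes, by invariance of the Haar system, a function of gk⁻¹ alone. Hence
the average of an operator with compactly supported kernel is a convolution operator
(`IsKernOp.average`). Transport is bounded uniformly in γ, so averages of compact operators lie in
C*_r (`exists_isLeftConv_of_average`).

For 𝓚_Γ ⊆ C*_r, let c be a compactly supported weight whose average is 1 on the orbits where ‖T_x‖
is not small. By invariance, the weighted average of T is T multiplied by the average of c, which is
close to T. It only involves T over the support of c, where T agrees with a compact operator, so the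
previous paragraph applies.

To write S ∈ C*_r exactly as an average for a given cutoff function c, it suffices to find a compact
T with T_x = S_x wherever c(x) ≠ 0. Such a T is a norm convergent series of operators w_n S with w_n
∈ C_c(M); on {c ≠ 0} the partial sums of the w_n agree with invariant weights equal to 1 where ‖S_x‖
is not small (`exists_weights`).

Two analytic tools serve throughout. Fibre integrals of continuous sections of an upper
semicontinuous field are continuous (`continuousAt_integral`). Operators admitting an adjoint for an
algebra-valued semi-inner product are bounded through the growth of the iterates of T'T
(`norm_le_of_adjoint`); the resulting constants 4 and 8 are not optimal, but only their finiteness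
matters. -/

namespace FellGroupoid

noncomputable section

/-! ### Uniform approximation of sections -/

/-- Local approximability by a module of sections, stable under multiplication by compactly
supported functions, implies uniform approximability. -/
theorem exists_approx {Z B : Type*} [TopologicalSpace B] [T2Space B] [LocallyCompactSpace B]
    {V : Z → Type*} [∀ z, NormedAddCommGroup (V z)] [∀ z, NormedSpace ℂ (V z)] (r : Z → B)
    (S : Submodule ℂ (∀ z, V z))
    (hS : ∀ φ : C(B, ℝ), HasCompactSupport φ → ∀ s ∈ S, (fun z => ((φ (r z) : ℝ) : ℂ) • s z) ∈ S)
    (f : ∀ z, V z) {L : Set B} (hL : IsCompact L) (hf : ∀ z, r z ∉ L → f z = 0) {ε : ℝ}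
    (hε : 0 ≤ ε) (hloc : ∀ b ∈ L, ∃ s ∈ S, ∃ U ∈ 𝓝 b, ∀ z, r z ∈ U → ‖s z - f z‖ ≤ ε) :
    ∃ s ∈ S, ∀ z, ‖s z - f z‖ ≤ ε := by
  choose s hs U hU hsU using hloc
  obtain ⟨t, ht⟩ := hL.elim_nhds_subcover' (fun x hx => interior (U x hx))
    fun x hx => interior_mem_nhds.2 (hU x hx)
  obtain ⟨φ, hφ, hφc⟩ := PartitionOfUnity.exists_isSubordinate_of_locallyFinite_t2space hL
    (fun i : t => interior (U i.1.1 i.1.2)) (fun _ => isOpen_interior) (locallyFinite_of_finite _)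
    (ht.trans fun b hb => by
      obtain ⟨i, hi, hbi⟩ := Set.mem_iUnion₂.1 hb
      exact Set.mem_iUnion.2 ⟨⟨i, hi⟩, hbi⟩)
  refine ⟨∑ i : t, fun z => ((φ i (r z) : ℝ) : ℂ) • s i.1.1 i.1.2 z,
    S.sum_mem fun i _ => hS (φ i) (hφc i) _ (hs _ _), fun z => ?_⟩
  have hsum : ∑ i : t, φ i (r z) ≤ 1 := by
    rw [← finsum_eq_sum_of_fintype]; exact φ.sum_le_one _
  -- The partition sums to 1 only on L; elsewhere the identity holds because f vanishes there.
  have hfz : f z = ∑ i : t, ((φ i (r z) : ℝ) : ℂ) • f z := by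
    rw [← Finset.sum_smul]
    by_cases hz : r z ∈ L
    · have := φ.sum_eq_one hz
      rw [finsum_eq_sum_of_fintype] at this
      rw [← Complex.ofReal_sum, this, Complex.ofReal_one, one_smul]
    · rw [hf z hz, smul_zero]
  rw [hfz, Finset.sum_apply, ← Finset.sum_sub_distrib]
  calc _ ≤ ∑ i : t, φ i (r z) * ε := by
        refine norm_sum_le_of_le _ fun i _ => ?_
        rw [← smul_sub, norm_smul, Complex.norm_real, Real.norm_of_nonneg (φ.nonneg i _)]
        by_cases hi : r z ∈ tsupport (φ i)
        · exact mul_le_mul_of_nonneg_left (hsU _ _ z (interior_subset (hφ i hi))) (φ.nonneg i _)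
        · rw [image_eq_zero_of_notMem_tsupport hi, zero_mul, zero_mul]
    _ ≤ ε := by
        rw [← Finset.sum_mul]
        exact mul_le_of_le_one_left hε hsum

/-! ### Norm estimates for algebra-valued semi-inner products -/

/-- If `P` is symmetric for a semi-inner product with values in a normed group, then its norm is
controlled by the growth of its iterates. -/
theorem norm_le_of_symmetric {V A : Type*} [NormedAddCommGroup A] (N : V → ℝ) (B : V → V → A)
    (hN : ∀ u, 0 ≤ N u) (hNB : ∀ u, ‖B u u‖ = N u ^ 2) (hB : ∀ u v, ‖B u v‖ ≤ 4 * N u * N v)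
    (P : V → V) (hP : ∀ u v, B (P u) v = B u (P v)) {u : V} {C m : ℝ} (hm : 0 ≤ m)
    (hC : ∀ n : ℕ, N (P^[n] u) ≤ C * m ^ n) : N (P u) ≤ 4 * m * N u := by
  have hP' : ∀ (n : ℕ) (u v), B (P^[n] u) v = B u (P^[n] v) := by
    intro n
    induction n with
    | zero => intro u v; rfl
    | succ n ih => intro u v; rw [Function.iterate_succ_apply, ih, hP, ← Function.iterate_succ_apply' P]
  have h2 : ∀ n : ℕ, N (P^[n] u) ^ 2 ≤ 4 * N u * N (P^[2 * n] u) := by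
    intro n
    rw [← hNB, hP', ← Function.iterate_add_apply, ← two_mul]
    exact hB _ _
  -- With a(n) = N(Pⁿu)/(4N(u)), the inequality `h2` reads a(n)² ≤ a(2n); iterated doubling gives
  -- a(1)^(2ⁿ) ≤ a(2ⁿ). Denominators are cleared so that N(u) = 0 is allowed.
  have h3 : ∀ n : ℕ, N (P u) ^ 2 ^ n * (4 * N u) ≤ (4 * N u) ^ 2 ^ n * N (P^[2 ^ n] u) := by
    intro n
    induction n with
    | zero => simp [mul_comm]
    | succ n ih =>
      have h4 := h2 (2 ^ n)
      by_cases h0 : N u = 0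
      · simp [h0]
      have hpos : 0 < 4 * N u := by have := (hN u).lt_of_ne' h0; positivity
      refine le_of_mul_le_mul_right ?_ hpos
      calc N (P u) ^ 2 ^ (n + 1) * (4 * N u) * (4 * N u)
          = (N (P u) ^ 2 ^ n * (4 * N u)) ^ 2 := by ring
        _ ≤ ((4 * N u) ^ 2 ^ n * N (P^[2 ^ n] u)) ^ 2 := by
            have := hN (P u)
            gcongr
        _ = (4 * N u) ^ 2 ^ (n + 1) * N (P^[2 ^ n] u) ^ 2 := by ring
        _ ≤ (4 * N u) ^ 2 ^ (n + 1) * (4 * N u * N (P^[2 * 2 ^ n] u)) := by gcongr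
        _ = _ := by rw [← pow_succ' 2 n]; ring
  by_cases h0 : N u = 0
  · have := h2 1
    rw [h0] at this
    have h5 : N (P u) ^ 2 ≤ 0 := by simpa using this
    have h6 : N (P u) = 0 := by
      have := sq_nonneg (N (P u))
      exact pow_eq_zero_iff two_ne_zero |>.1 (le_antisymm h5 this)
    rw [h6, h0, mul_zero]
  have hpos : 0 < 4 * N u := by have := (hN u).lt_of_ne' h0; positivity
  -- This replaces the extraction of 2ⁿ-th roots: if 4mN(u) < N(Pu), the powers (4mN(u)/N(Pu))^(2ⁿ)
  -- tend to 0 and force 4N(u) ≤ 0.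
  by_contra! hlt
  have ha : 0 < N (P u) := lt_of_le_of_lt (by have := hN u; positivity) hlt
  have h4 : ∀ n : ℕ, N (P u) ^ 2 ^ n * (4 * N u) ≤ C * (4 * m * N u) ^ 2 ^ n := by
    intro n
    calc _ ≤ (4 * N u) ^ 2 ^ n * N (P^[2 ^ n] u) := h3 n
      _ ≤ (4 * N u) ^ 2 ^ n * (C * m ^ 2 ^ n) := by
        gcongr; exact hC _
      _ = _ := by
        rw [show 4 * m * N u = (4 * N u) * m by ring, mul_pow]; ring
  set b := 4 * m * N u with hb
  have hb0 : 0 ≤ b := by have := hN u; positivity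
  have hlim : Tendsto (fun n : ℕ => C * (b / N (P u)) ^ 2 ^ n) atTop (𝓝 (C * 0)) :=
    ((tendsto_pow_atTop_nhds_zero_of_lt_one (by positivity) ((div_lt_one ha).2 hlt)).comp
      (tendsto_pow_atTop_atTop_of_one_lt (by norm_num))).const_mul _
  rw [mul_zero] at hlim
  have := ge_of_tendsto' hlim (b := 4 * N u) fun n => by
    rw [div_pow, ← mul_div_assoc, le_div_iff₀ (by positivity), mul_comm]
    exact h4 n
  linarith

/-- Operators admitting an adjoint are bounded as soon as the iterates of `T'T` grow at most
exponentially. -/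
theorem norm_le_of_adjoint {V A : Type*} [NormedAddCommGroup A] (N : V → ℝ) (B : V → V → A)
    (hN : ∀ u, 0 ≤ N u) (hNB : ∀ u, ‖B u u‖ = N u ^ 2) (hB : ∀ u v, ‖B u v‖ ≤ 4 * N u * N v)
    (T T' : V → V) (hT : ∀ u v, B (T u) v = B u (T' v)) (hT' : ∀ u v, B (T' u) v = B u (T v))
    {u : V} {C m : ℝ} (hm : 0 ≤ m)
    (hC : ∀ n : ℕ, N ((fun v => T' (T v))^[n] u) ≤ C * (m ^ 2) ^ n) : N (T u) ≤ 4 * m * N u := by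
  have h := norm_le_of_symmetric N B hN hNB hB (fun v => T' (T v))
    (fun u v => by rw [hT', hT]) (sq_nonneg m) hC
  have h2 : N (T u) ^ 2 ≤ (4 * m * N u) ^ 2 := by
    calc N (T u) ^ 2 = ‖B u (T' (T u))‖ := by rw [← hNB, hT]
      _ ≤ 4 * N u * N (T' (T u)) := hB _ _
      _ ≤ 4 * N u * (4 * m ^ 2 * N u) := by
        have := hN u
        gcongr
      _ = _ := by ring
  exact (pow_le_pow_iff_left₀ (hN _) (by have := hN u; positivity) two_ne_zero).1 h2

/-- Polarization: a bound for a sesquilinear map on the diagonal gives a bound everywhere. -/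
theorem norm_sesq_le {V A : Type*} [SeminormedAddCommGroup V] [NormedSpace ℂ V]
    [NormedAddCommGroup A] [NormedSpace ℂ A] (B : V → V → A)
    (hadd : ∀ x y z, B x (y + z) = B x y + B x z) (hadd' : ∀ x y z, B (x + y) z = B x z + B y z)
    (hsmul : ∀ (c : ℂ) x y, B x (c • y) = c • B x y)
    (hsmul' : ∀ (c : ℂ) x y, B (c • x) y = (starRingEnd ℂ c) • B x y)
    (hB : ∀ x, ‖B x x‖ = ‖x‖ ^ 2) (x y : V) : ‖B x y‖ ≤ 4 * ‖x‖ * ‖y‖ := by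
  have key : ∀ x y, ‖B x y‖ ≤ (‖x‖ + ‖y‖) ^ 2 := by
    intro x y
    have h1 : ∀ c : ℂ, ‖c‖ = 1 → ‖B (x + c • y) (x + c • y)‖ ≤ (‖x‖ + ‖y‖) ^ 2 := by
      intro c hc
      rw [hB]
      gcongr
      refine (norm_add_le _ _).trans ?_
      rw [norm_smul, hc, one_mul]
    have h2 : B x y = (1 / 4 : ℂ) • (B (x + (1 : ℂ) • y) (x + (1 : ℂ) • y) -
        B (x + (-1 : ℂ) • y) (x + (-1 : ℂ) • y) -
        Complex.I • B (x + Complex.I • y) (x + Complex.I • y) +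
        Complex.I • B (x + (-Complex.I) • y) (x + (-Complex.I) • y)) := by
      simp only [hadd, hadd', hsmul, hsmul', map_one, map_neg, Complex.conj_I, smul_add, smul_smul]
      simp only [Complex.I_mul_I, mul_neg, neg_mul, neg_neg, mul_one]
      module
    rw [h2, norm_smul]
    have hI : ‖(-Complex.I : ℂ)‖ = 1 := by simp
    calc _ ≤ ‖(1 / 4 : ℂ)‖ * ((‖x‖ + ‖y‖) ^ 2 + (‖x‖ + ‖y‖) ^ 2 + (‖x‖ + ‖y‖) ^ 2 +
          (‖x‖ + ‖y‖) ^ 2) := by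
          gcongr
          refine (norm_add_le _ _).trans (add_le_add ((norm_sub_le _ _).trans (add_le_add
            ((norm_sub_le _ _).trans (add_le_add (h1 _ (by simp)) (h1 _ (by simp)))) ?_)) ?_)
          · rw [norm_smul, Complex.norm_I, one_mul]; exact h1 _ (by simp)
          · rw [norm_smul, Complex.norm_I, one_mul]; exact h1 _ hI
      _ = _ := by norm_num; ring
  -- B(tx, t⁻¹y) = B(x, y) for real t, so the polarization bound can be optimized over t.
  have key2 : ∀ (t : ℝ), 0 < t → ‖B x y‖ ≤ (t * ‖x‖ + t⁻¹ * ‖y‖) ^ 2 := by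
    intro t ht
    have h := key ((t : ℂ) • x) (((t⁻¹ : ℝ) : ℂ) • y)
    rw [hsmul, hsmul', Complex.conj_ofReal, smul_smul, ← Complex.ofReal_mul,
      inv_mul_cancel₀ ht.ne', Complex.ofReal_one, one_smul, norm_smul, norm_smul,
      Complex.norm_real, Complex.norm_real, Real.norm_of_nonneg ht.le,
      Real.norm_of_nonneg (by positivity)] at h
    exact h
  -- The norm is only a seminorm: when one vector is null, B(x, y) = 0 follows by letting t tend to
  -- ∞ or to 0.
  rcases (norm_nonneg x).eq_or_lt with hx | hx
  · have hlim : Tendsto (fun t : ℝ => (t * ‖x‖ + t⁻¹ * ‖y‖) ^ 2) atTop (𝓝 ((0 + 0 * ‖y‖) ^ 2)) := by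
      rw [← hx]
      simp only [mul_zero]
      exact ((tendsto_const_nhds).add (tendsto_inv_atTop_zero.mul_const _)).pow 2
    have := ge_of_tendsto hlim ((eventually_gt_atTop 0).mono key2)
    rw [← hx]
    simpa using this
  rcases (norm_nonneg y).eq_or_lt with hy | hy
  · have hlim : Tendsto (fun t : ℝ => (t⁻¹ * ‖x‖ + t * ‖y‖) ^ 2) atTop (𝓝 ((0 * ‖x‖ + 0) ^ 2)) := by
      rw [← hy]
      simp only [mul_zero]
      exact ((tendsto_inv_atTop_zero.mul_const _).add (tendsto_const_nhds)).pow 2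
    have := ge_of_tendsto hlim ((eventually_gt_atTop 0).mono fun t ht => by
      have := key2 t⁻¹ (inv_pos.2 ht)
      rwa [inv_inv] at this)
    rw [← hy]
    simpa using this
  -- The minimizing t; both terms then equal √(‖x‖‖y‖), which produces the constant 4.
  have h := key2 (√(‖y‖ / ‖x‖)) (by positivity)
  refine h.trans (le_of_eq ?_)
  have e : √(‖y‖ / ‖x‖) ^ 2 = ‖y‖ / ‖x‖ := Real.sq_sqrt (by positivity)
  have e0 : √(‖y‖ / ‖x‖) ≠ 0 := by positivity
  generalize √(‖y‖ / ‖x‖) = t at *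
  have : (t * ‖x‖ + t⁻¹ * ‖y‖) ^ 2 = t ^ 2 * ‖x‖ ^ 2 + 2 * ‖x‖ * ‖y‖ + (t ^ 2)⁻¹ * ‖y‖ ^ 2 := by
    field_simp
    ring
  rw [this, e]
  field_simp
  ring

/-! ### Upper semicontinuous fields -/

namespace IsUSCField

variable {X Y : Type*} [TopologicalSpace X] [TopologicalSpace Y] {E : X → Type*}
  [∀ x, NormedAddCommGroup (E x)] [∀ x, NormedSpace ℂ (E x)] [TopologicalSpace (Tot E)]
  (hE : IsUSCField E) {q : Y → X} {I J : ∀ y, E (q y)} {y₀ : Y}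

include hE

theorem continuousAt_add (hI : ContinuousAt (fun y => (⟨q y, I y⟩ : Tot E)) y₀)
    (hJ : ContinuousAt (fun y => (⟨q y, J y⟩ : Tot E)) y₀) :
    ContinuousAt (fun y => (⟨q y, I y + J y⟩ : Tot E)) y₀ := by
  have : ContinuousAt (fun y => (⟨q y, I y, J y⟩ : TotPair E)) y₀ := by
    rw [ContinuousAt, nhds_induced, tendsto_comap_iff]
    exact hI.prodMk hJ
  exact hE.continuous_add.continuousAt.comp this

theorem continuousAt_smul {φ : Y → ℂ} (hφ : ContinuousAt φ y₀)
    (hI : ContinuousAt (fun y => (⟨q y, I y⟩ : Tot E)) y₀) :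
    ContinuousAt (fun y => (⟨q y, φ y • I y⟩ : Tot E)) y₀ :=
  hE.continuous_smul.continuousAt.comp (f := fun y => (φ y, (⟨q y, I y⟩ : Tot E))) (hφ.prodMk hI)

theorem continuousAt_sub (hI : ContinuousAt (fun y => (⟨q y, I y⟩ : Tot E)) y₀)
    (hJ : ContinuousAt (fun y => (⟨q y, J y⟩ : Tot E)) y₀) :
    ContinuousAt (fun y => (⟨q y, I y - J y⟩ : Tot E)) y₀ := by
  have := hE.continuousAt_add hI (hE.continuousAt_smul (φ := fun _ => -1) continuousAt_const hJ)
  simpa only [neg_smul, one_smul, ← sub_eq_add_neg] using this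

theorem continuousAt_zero (hq : ContinuousAt q y₀) :
    ContinuousAt (fun y => (⟨q y, 0⟩ : Tot E)) y₀ := by
  refine Tendsto.mono_right ?_ (hE.tendsto_zero (q y₀))
  rw [tendsto_inf, tendsto_comap_iff, tendsto_comap_iff]
  refine ⟨?_, hq⟩
  simp only [Function.comp_def, norm_zero]
  exact tendsto_const_nhds

/-- This is the only way in which the topology controls norms: the norm being merely upper
semicontinuous, strict upper bounds spread to neighbourhoods and lower bounds do not. -/
theorem eventually_norm_lt (hI : ContinuousAt (fun y => (⟨q y, I y⟩ : Tot E)) y₀) {c : ℝ}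
    (hc : ‖I y₀‖ < c) : ∀ᶠ y in 𝓝 y₀, ‖I y‖ < c :=
  hI.eventually (hE.usc_norm ⟨q y₀, I y₀⟩ c hc)

/-- A section is continuous at a point when it is close, near this point, to a continuous section
with the same value. -/
theorem continuousAt_of_tendsto (hq : ContinuousAt q y₀)
    (hJ : ContinuousAt (fun y => (⟨q y, J y⟩ : Tot E)) y₀) (h0 : J y₀ = I y₀)
    (h : Tendsto (fun y => ‖I y - J y‖) (𝓝 y₀) (𝓝 0)) :
    ContinuousAt (fun y => (⟨q y, I y⟩ : Tot E)) y₀ := by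
  have h1 : ContinuousAt (fun y => (⟨q y, I y - J y⟩ : Tot E)) y₀ := by
    rw [ContinuousAt, h0, sub_self]
    refine Tendsto.mono_right ?_ (hE.tendsto_zero (q y₀))
    rw [tendsto_inf, tendsto_comap_iff, tendsto_comap_iff]
    exact ⟨h, hq⟩
  simpa only [sub_add_cancel] using hE.continuousAt_add h1 hJ

/-- A local uniform limit of continuous sections is continuous. -/
theorem continuousAt_of_approx (hq : ContinuousAt q y₀)
    (h : ∀ ε > 0, ∃ J : ∀ y, E (q y), ContinuousAt (fun y => (⟨q y, J y⟩ : Tot E)) y₀ ∧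
      ∀ᶠ y in 𝓝 y₀, ‖I y - J y‖ ≤ ε) : ContinuousAt (fun y => (⟨q y, I y⟩ : Tot E)) y₀ := by
  -- A continuous section through the value of I at y₀. Each approximant J is near σ at y₀, hence
  -- near y₀ by upper semicontinuity, so I - σ tends to 0 in norm.
  obtain ⟨σ, hσ, hσ0⟩ := hE.exists_section (q y₀) (I y₀)
  have hσ' : ContinuousAt (fun y => (⟨q y, σ (q y)⟩ : Tot E)) y₀ :=
    hσ.continuousAt.comp hq
  refine hE.continuousAt_of_tendsto hq hσ' hσ0 ?_
  rw [Metric.tendsto_nhds]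
  intro ε hε
  obtain ⟨J, hJ, hIJ⟩ := h (ε / 3) (by positivity)
  have h0 : ‖J y₀ - σ (q y₀)‖ < ε / 2 := by
    rw [hσ0, ← norm_neg, neg_sub]
    exact hIJ.self_of_nhds.trans_lt (by linarith)
  filter_upwards [hIJ, hE.eventually_norm_lt (hE.continuousAt_sub hJ hσ') h0] with y h1 h2
  rw [dist_zero_right, norm_norm]
  calc ‖I y - σ (q y)‖ = ‖(I y - J y) + (J y - σ (q y))‖ := by rw [sub_add_sub_cancel]
    _ ≤ ‖I y - J y‖ + ‖J y - σ (q y)‖ := norm_add_le _ _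
    _ < ε := by linarith

theorem continuous_add_comp (hI : Continuous (fun y => (⟨q y, I y⟩ : Tot E)))
    (hJ : Continuous (fun y => (⟨q y, J y⟩ : Tot E))) :
    Continuous (fun y => (⟨q y, I y + J y⟩ : Tot E)) :=
  continuous_iff_continuousAt.2 fun _ => hE.continuousAt_add hI.continuousAt hJ.continuousAt

theorem continuous_sub_comp (hI : Continuous (fun y => (⟨q y, I y⟩ : Tot E)))
    (hJ : Continuous (fun y => (⟨q y, J y⟩ : Tot E))) :
    Continuous (fun y => (⟨q y, I y - J y⟩ : Tot E)) :=
  continuous_iff_continuousAt.2 fun _ => hE.continuousAt_sub hI.continuousAt hJ.continuousAt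

theorem continuous_smul_comp {φ : Y → ℂ} (hφ : Continuous φ)
    (hI : Continuous (fun y => (⟨q y, I y⟩ : Tot E))) :
    Continuous (fun y => (⟨q y, φ y • I y⟩ : Tot E)) :=
  continuous_iff_continuousAt.2 fun _ => hE.continuousAt_smul hφ.continuousAt hI.continuousAt

theorem continuous_zero_comp (hq : Continuous q) : Continuous (fun y => (⟨q y, 0⟩ : Tot E)) :=
  continuous_iff_continuousAt.2 fun _ => hE.continuousAt_zero hq.continuousAt

theorem bddAbove_norm (hI : Continuous (fun y => (⟨q y, I y⟩ : Tot E))) {K : Set Y}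
    (hK : IsCompact K) (h0 : ∀ y ∉ K, I y = 0) : ∃ C, 0 ≤ C ∧ ∀ y, ‖I y‖ ≤ C := by
  obtain ⟨C, hC⟩ := (((hE.usc_norm.comp hI).upperSemicontinuousOn K).bddAbove_of_isCompact hK)
  refine ⟨max C 0, le_max_right _ _, fun y => ?_⟩
  by_cases hy : y ∈ K
  · exact (hC ⟨y, hy, rfl⟩).trans (le_max_left _ _)
  · rw [h0 y hy, norm_zero]
    exact le_max_right _ _

/-- Approximation of a compactly supported continuous section by a module of sections that is
dense in each fibre. -/
theorem exists_approx_of_dense {B : Type*} [TopologicalSpace B] [T2Space B] [LocallyCompactSpace B]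
    {r : Y → B} (hr : IsClosedEmbedding r) (S : Submodule ℂ (∀ y, E (q y)))
    (hS : ∀ φ : C(B, ℝ), HasCompactSupport φ → ∀ s ∈ S, (fun y => ((φ (r y) : ℝ) : ℂ) • s y) ∈ S)
    (hSc : ∀ s ∈ S, Continuous fun y => (⟨q y, s y⟩ : Tot E))
    (hd : ∀ y, ∀ e : E (q y), ∀ ε > 0, ∃ s ∈ S, ‖s y - e‖ < ε)
    (hI : Continuous fun y => (⟨q y, I y⟩ : Tot E)) {L : Set B} (hL : IsCompact L)
    (hf : ∀ y, r y ∉ L → I y = 0) {ε : ℝ} (hε : 0 < ε) : ∃ s ∈ S, ∀ y, ‖s y - I y‖ ≤ ε := by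
  refine exists_approx r S hS I hL hf hε.le fun b _ => ?_
  -- At a point of the range, an approximation at one point persists nearby by upper semicontinuity.
  -- Off the range, which is closed, a neighbourhood meets no fibre and there is nothing to
  -- approximate.
  by_cases hb : b ∈ Set.range r
  · obtain ⟨y, rfl⟩ := hb
    obtain ⟨s, hs, h⟩ := hd y (I y) ε hε
    have := hE.eventually_norm_lt (hE.continuousAt_sub (hSc s hs).continuousAt hI.continuousAt) h
    rw [hr.isInducing.nhds_eq_comap, eventually_comap] at this
    exact ⟨s, hs, _, this, fun z hz => (hz z rfl).le⟩
  · exact ⟨0, S.zero_mem, _, hr.isClosed_range.isOpen_compl.mem_nhds hb,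
      fun z hz => (hz ⟨z, rfl⟩).elim⟩

end IsUSCField

end

end FellGroupoid

namespace FellGroupoid

noncomputable section

/-! ### Groupoid algebra -/

namespace TopGroupoid

variable {G M : Type*} [TopologicalSpace G] [TopologicalSpace M] {Γ : TopGroupoid G M}

/-- Treating multiplication as a relation allows the product of a ∈ E_g and b ∈ E_h to be placed in
E_k for every name k of the arrow gh. The lemmas below derive such relations from one another. -/
theorem IsMul.unique {g h k k' : G} (p : Γ.IsMul g h k) (p' : Γ.IsMul g h k') : k = k' := by
  obtain ⟨_, rfl⟩ := p
  obtain ⟨_, rfl⟩ := p'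
  rfl

theorem IsMul.src_eq {g h k : G} (p : Γ.IsMul g h k) : Γ.src k = Γ.src h := by
  obtain ⟨_, rfl⟩ := p
  exact Γ.src_mul _ _ _

theorem IsMul.tgt_eq {g h k : G} (p : Γ.IsMul g h k) : Γ.tgt k = Γ.tgt g := by
  obtain ⟨_, rfl⟩ := p
  exact Γ.tgt_mul _ _ _

/-- If `gh = a`, `hk = b` and `ak = c`, then `gb = c`. -/
theorem IsMul.assoc {g h k a b c : G} (p : Γ.IsMul g h a) (q : Γ.IsMul h k b)
    (r : Γ.IsMul a k c) : Γ.IsMul g b c := by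
  obtain ⟨e, rfl⟩ := p
  obtain ⟨e', rfl⟩ := q
  obtain ⟨_, rfl⟩ := r
  exact ⟨_, (Γ.mul_assoc g h k e e').symm⟩

/-- If `gh = a`, `hk = b` and `gb = c`, then `ak = c`. -/
theorem IsMul.assoc' {g h k a b c : G} (p : Γ.IsMul g h a) (q : Γ.IsMul h k b)
    (r : Γ.IsMul g b c) : Γ.IsMul a k c := by
  obtain ⟨e, rfl⟩ := p
  obtain ⟨e', rfl⟩ := q
  obtain ⟨_, rfl⟩ := r
  exact ⟨_, Γ.mul_assoc g h k e e'⟩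

variable (Γ)

theorem isMul_mul (g h : G) (c : Γ.src g = Γ.tgt h) : Γ.IsMul g h (Γ.mul g h c) := ⟨c, rfl⟩

theorem isMul_unit_right (g : G) {x : M} (hx : Γ.src g = x) : Γ.IsMul g (Γ.unit x) g := by
  subst hx
  exact ⟨_, Γ.mul_unit g⟩

theorem isMul_unit_left (g : G) {x : M} (hx : Γ.tgt g = x) : Γ.IsMul (Γ.unit x) g g := by
  subst hx
  exact ⟨_, Γ.unit_mul g⟩

theorem isMul_inv_left (g : G) {x : M} (hx : Γ.src g = x) : Γ.IsMul (Γ.inv g) g (Γ.unit x) := by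
  subst hx
  exact ⟨_, Γ.inv_mul g⟩

theorem isMul_inv_right (g : G) {x : M} (hx : Γ.tgt g = x) : Γ.IsMul g (Γ.inv g) (Γ.unit x) := by
  subst hx
  exact ⟨_, Γ.mul_inv g⟩

variable {Γ}

/-- If `gh = k`, then `g⁻¹k = h`. -/
theorem IsMul.inv_left {g h k : G} (p : Γ.IsMul g h k) : Γ.IsMul (Γ.inv g) k h :=
  (Γ.isMul_inv_left g p.1).assoc p (Γ.isMul_unit_left h rfl)

/-- If `gh = k`, then `kh⁻¹ = g`. -/
theorem IsMul.inv_right {g h k : G} (p : Γ.IsMul g h k) : Γ.IsMul k (Γ.inv h) g :=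
  p.assoc' (Γ.isMul_inv_right h p.1.symm) (Γ.isMul_unit_right g rfl)

theorem IsMul.inv {g h k : G} (p : Γ.IsMul g h k) : Γ.IsMul (Γ.inv h) (Γ.inv g) (Γ.inv k) := by
  have h1 : Γ.IsMul (Γ.inv k) g (Γ.inv h) :=
    (Γ.isMul_inv_left k p.src_eq).assoc p.inv_right (Γ.isMul_unit_left _ (Γ.tgt_inv h))
  exact h1.inv_right

theorem IsMul.eq_of_left {g h h' k : G} (p : Γ.IsMul g h k) (p' : Γ.IsMul g h' k) : h = h' :=
  p.inv_left.unique p'.inv_left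

theorem IsMul.eq_of_right {g g' h k : G} (p : Γ.IsMul g h k) (p' : Γ.IsMul g' h k) : g = g' :=
  p.inv_right.unique p'.inv_right

variable (Γ)

/-- `g k⁻¹`. -/
def div (g k : G) (e : Γ.src g = Γ.src k) : G := Γ.mul g (Γ.inv k) (e.trans (Γ.tgt_inv k).symm)

theorem isMul_div (g k : G) (e : Γ.src g = Γ.src k) : Γ.IsMul (Γ.div g k e) k g :=
  Γ.isMul_mul_inv g k e

theorem isMul_div' (g k : G) (e : Γ.src g = Γ.src k) : Γ.IsMul g (Γ.inv k) (Γ.div g k e) :=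
  ⟨_, rfl⟩

theorem continuous_mul_comp {Y : Type*} [TopologicalSpace Y] {g h k : Y → G} (hg : Continuous g)
    (hh : Continuous h) (p : ∀ y, Γ.IsMul (g y) (h y) (k y)) : Continuous k := by
  refine (Γ.continuous_mul.comp ((hg.prodMk hh).subtype_mk fun y => (p y).1)).congr fun y => ?_
  exact (p y).2

theorem isClosedEmbedding_sfib [T2Space M] (x : M) :
    IsClosedEmbedding (Subtype.val : Γ.SFib x → G) :=
  (isClosed_singleton.preimage Γ.continuous_src).isClosedEmbedding_subtypeVal

theorem isClosedEmbedding_tfib [T2Space M] (x : M) :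
    IsClosedEmbedding (Subtype.val : Γ.TFib x → G) :=
  (isClosed_singleton.preimage Γ.continuous_tgt).isClosedEmbedding_subtypeVal

/-- Left translation by `γ`, as a homeomorphism from `Γ^{s(γ)}` to `Γ^{t(γ)}`. -/
def leftMulHomeo (γ : G) : Γ.TFib (Γ.src γ) ≃ₜ Γ.TFib (Γ.tgt γ) where
  toFun := Γ.leftMul γ
  invFun h := ⟨Γ.mul (Γ.inv γ) h.1 ((Γ.src_inv γ).trans h.2.symm),
    (Γ.tgt_mul _ _ _).trans (Γ.tgt_inv γ)⟩
  left_inv h := Subtype.ext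
    ((Γ.isMul_mul _ _ _).unique (Γ.isMul_mul γ h.1 h.2.symm).inv_left)
  right_inv h := Subtype.ext <| (Γ.isMul_mul _ _ _).unique <| by
    have := (Γ.isMul_mul (Γ.inv γ) h.1 ((Γ.src_inv γ).trans h.2.symm)).inv_left
    rwa [Γ.inv_inv] at this
  continuous_toFun := (Γ.continuous_mul_comp continuous_const continuous_subtype_val
    fun h => Γ.isMul_mul γ h.1 h.2.symm).subtype_mk _
  continuous_invFun := (Γ.continuous_mul_comp continuous_const continuous_subtype_val
    fun h => Γ.isMul_mul (Γ.inv γ) h.1 ((Γ.src_inv γ).trans h.2.symm)).subtype_mk _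

/-- The map `g ↦ g k`, from `Γ_{t(k)}` to `Γ_{s(k)}`. -/
def rightMul {x y : M} (k : G) (ht : Γ.tgt k = x) (hs : Γ.src k = y) (g : Γ.SFib x) : Γ.SFib y :=
  ⟨Γ.mul g.1 k (g.2.trans ht.symm), (Γ.src_mul _ _ _).trans hs⟩

theorem isMul_rightMul {x y : M} (k : G) (ht : Γ.tgt k = x) (hs : Γ.src k = y) (g : Γ.SFib x) :
    Γ.IsMul g.1 k (Γ.rightMul k ht hs g).1 := ⟨_, rfl⟩

theorem rightDiv_rightMul {x y : M} (k : G) (ht : Γ.tgt k = x) (hs : Γ.src k = y) (g : Γ.SFib x) :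
    Γ.rightDiv k ht hs (Γ.rightMul k ht hs g) = g :=
  Subtype.ext ((Γ.isMul_rightDiv k ht hs _).eq_of_right (Γ.isMul_rightMul k ht hs g))

/-- The set of the arrows with source and target in given compact sets is compact. -/
theorem IsProper.isCompact (hΓ : Γ.IsProper) {K K' : Set M} (hK : IsCompact K)
    (hK' : IsCompact K') : IsCompact {g | Γ.src g ∈ K ∧ Γ.tgt g ∈ K'} :=
  hΓ.isCompact_preimage (hK.prod hK')

/-- The fibre product of `Y` and `Γ` over `M`, along `p : Y → M` and the source map. -/
abbrev FibProd {Y : Type*} (p : Y → M) : Type _ := {z : Y × G // Γ.src z.2 = p z.1}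

/-- The tube lemma in fibre products. -/
theorem eventually_fibProd [T2Space M] {Y : Type*} [TopologicalSpace Y] {p : Y → M} (hp : Continuous p)
    {P : Γ.FibProd p → Prop} {y₀ : Y} {L : Set G} (hL : IsCompact L)
    (h : ∀ g (e : Γ.src g = p y₀), g ∈ L → ∀ᶠ z in 𝓝 (⟨(y₀, g), e⟩ : Γ.FibProd p), P z) :
    ∀ᶠ y in 𝓝 y₀, ∀ g ∈ L, ∀ e : Γ.src g = p y, P ⟨(y, g), e⟩ := by
  refine hL.eventually_forall_of_forall_eventually (P := fun y g => ∀ e : Γ.src g = p y, P ⟨(y, g), e⟩)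
    fun g hg => ?_
  by_cases e : Γ.src g = p y₀
  · have := h g e hg
    rw [nhds_subtype_eq_comap, eventually_comap] at this
    filter_upwards [this] with z hz e'
    exact hz ⟨z, e'⟩ rfl
  -- Here (y₀, g) lies outside the closed fibre product, so nearby pairs carry no condition.
  · have : IsClosed {z : Y × G | Γ.src z.2 = p z.1} :=
      isClosed_eq (Γ.continuous_src.comp continuous_snd) (hp.comp continuous_fst)
    filter_upwards [this.isOpen_compl.mem_nhds (x := (y₀, g)) e] with z hz e'
    exact (hz e').elim

end TopGroupoid

/-! ### Integration along the fibres -/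

namespace HaarSystem

variable {G M : Type*} [TopologicalSpace G] [TopologicalSpace M] [MeasurableSpace G]
  [BorelSpace G] {Γ : TopGroupoid G M} (lam : HaarSystem Γ)

instance (x : M) : IsFiniteMeasureOnCompacts (lam.meas x) := lam.finite_on_compacts x

instance (x : M) : IsFiniteMeasureOnCompacts (lam.smeas x) :=
  MeasureTheory.Measure.IsFiniteMeasureOnCompacts.map (lam.meas x) (Γ.invFib x)

theorem integral_smeas {B : Type*} [NormedAddCommGroup B] [NormedSpace ℝ B] (x : M)
    (u : Γ.SFib x → B) :
    ∫ g, u g ∂(lam.smeas x) = ∫ g : Γ.TFib x, u (Γ.invFib x g) ∂(lam.meas x) :=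
  (Γ.invFib x).measurableEmbedding.integral_map _

theorem lintegral_smeas (x : M) (u : Γ.SFib x → ℝ≥0∞) :
    ∫⁻ g, u g ∂(lam.smeas x) = ∫⁻ g : Γ.TFib x, u (Γ.invFib x g) ∂(lam.meas x) :=
  (Γ.invFib x).measurableEmbedding.lintegral_map _

theorem integral_leftMul {B : Type*} [NormedAddCommGroup B] [NormedSpace ℝ B] (γ : G)
    (u : Γ.TFib (Γ.tgt γ) → B) :
    ∫ g, u g ∂(lam.meas (Γ.tgt γ)) = ∫ g, u (Γ.leftMul γ g) ∂(lam.meas (Γ.src γ)) := by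
  rw [← lam.left_invariant]
  exact (Γ.leftMulHomeo γ).measurableEmbedding.integral_map _

theorem lintegral_leftMul (γ : G) (u : Γ.TFib (Γ.tgt γ) → ℝ≥0∞) :
    ∫⁻ g, u g ∂(lam.meas (Γ.tgt γ)) = ∫⁻ g, u (Γ.leftMul γ g) ∂(lam.meas (Γ.src γ)) := by
  rw [← lam.left_invariant]
  exact (Γ.leftMulHomeo γ).measurableEmbedding.lintegral_map _

/-- Substitution `h = g k⁻¹`. -/
theorem integral_div {B : Type*} [NormedAddCommGroup B] [NormedSpace ℝ B] (g : G)
    (u : Γ.TFib (Γ.tgt g) → B) :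
    ∫ h, u h ∂(lam.meas (Γ.tgt g)) = ∫ k : Γ.SFib (Γ.src g),
      u ⟨Γ.div g k.1 k.2.symm, Γ.tgt_mul _ _ _⟩ ∂(lam.smeas (Γ.src g)) := by
  -- Left translation by g identifies Γ^{s(g)} with Γ^{t(g)}; inversion then replaces h ∈ Γ^{s(g)}
  -- by k = h⁻¹ ∈ Γ_{s(g)}.
  rw [integral_leftMul, integral_smeas]
  congr 1 with h
  congr 1
  refine Subtype.ext ((Γ.isMul_mul _ _ h.2.symm).unique ?_)
  have := Γ.isMul_div' g (Γ.inv h.1) ((Γ.src_inv _).trans h.2).symm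
  rwa [Γ.inv_inv] at this

theorem lintegral_div (g : G) (u : Γ.TFib (Γ.tgt g) → ℝ≥0∞) :
    ∫⁻ h, u h ∂(lam.meas (Γ.tgt g)) = ∫⁻ k : Γ.SFib (Γ.src g),
      u ⟨Γ.div g k.1 k.2.symm, Γ.tgt_mul _ _ _⟩ ∂(lam.smeas (Γ.src g)) := by
  rw [lintegral_leftMul, lintegral_smeas]
  congr 1 with h
  congr 1
  refine Subtype.ext ((Γ.isMul_mul _ _ h.2.symm).unique ?_)
  have := Γ.isMul_div' g (Γ.inv h.1) ((Γ.src_inv _).trans h.2).symm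
  rwa [Γ.inv_inv] at this

/-- Invariance of `(λ_x)` under right translations. -/
theorem integral_rightMul {B : Type*} [NormedAddCommGroup B] [NormedSpace ℝ B] {x y : M} (k : G)
    (ht : Γ.tgt k = x) (hs : Γ.src k = y) (u : Γ.SFib y → B) :
    ∫ g, u g ∂(lam.smeas y) = ∫ g, u (Γ.rightMul k ht hs g) ∂(lam.smeas x) := by
  -- Inversion conjugates right translation by k⁻¹ into left translation by k, for which invariance
  -- is an axiom.
  obtain ⟨k, rfl⟩ : ∃ k', Γ.inv k' = k := ⟨_, Γ.inv_inv k⟩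
  obtain rfl : Γ.tgt k = y := (Γ.src_inv k).symm.trans hs
  obtain rfl : Γ.src k = x := (Γ.tgt_inv k).symm.trans ht
  rw [integral_smeas, integral_leftMul, integral_smeas]
  congr 1 with h
  congr 1
  refine Subtype.ext ((Γ.isMul_mul k h.1 h.2.symm).inv.unique ?_)
  exact Γ.isMul_mul _ _ _

variable [T2Space G] [LocallyCompactSpace G]

theorem continuous_integral_smeas (φ : C(G, ℝ)) (hφ : HasCompactSupport φ) :
    Continuous fun x => ∫ g : Γ.SFib x, φ g.1 ∂(lam.smeas x) := by
  have h := lam.continuous_integral (fun g => φ (Γ.inv g)) (φ.continuous.comp Γ.continuous_inv)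
    (hφ.comp_homeomorph (⟨⟨Γ.inv, Γ.inv, Γ.inv_inv, Γ.inv_inv⟩, Γ.continuous_inv,
      Γ.continuous_inv⟩ : G ≃ₜ G))
  simp only [integral_smeas]
  exact h

/-- The integral is continuous in x, and it vanishes unless x belongs to the compact set of sources
of the support of φ. -/
theorem exists_integral_le (φ : C(G, ℝ)) (hφ : HasCompactSupport φ) :
    ∃ C, 0 ≤ C ∧ ∀ x, ∫ g : Γ.SFib x, φ g.1 ∂(lam.smeas x) ≤ C := by
  obtain ⟨D, hD⟩ := (hφ.isCompact.image Γ.continuous_src).bddAbove_image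
    (lam.continuous_integral_smeas φ hφ).continuousOn
  refine ⟨max D 0, le_max_right _ _, fun x => ?_⟩
  by_cases hx : x ∈ Γ.src '' tsupport φ
  · exact (hD ⟨x, hx, rfl⟩).trans (le_max_left _ _)
  · refine le_trans (le_of_eq ?_) (le_max_right _ _)
    refine integral_eq_zero_of_ae (ae_of_all _ fun g => ?_)
    exact image_eq_zero_of_notMem_tsupport fun hg => hx ⟨g.1, hg, g.2⟩

variable [T2Space M]

/-- The indicator of L is dominated by a compactly supported continuous function. The uniformity in
x of the bound is what makes later estimates hold on all fibres at once. -/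
theorem exists_smeas_le {L : Set G} (hL : IsCompact L) :
    ∃ C, 0 ≤ C ∧ ∀ x, lam.smeas x (Subtype.val ⁻¹' L) ≤ ENNReal.ofReal C := by
  obtain ⟨f, hf1, -, hfc, hf01⟩ := exists_continuous_one_zero_of_isCompact
    hL isClosed_empty (Set.disjoint_empty _)
  obtain ⟨C, hC, h⟩ := lam.exists_integral_le f hfc
  refine ⟨C, hC, fun x => ?_⟩
  have hm : MeasurableSet ((Subtype.val : Γ.SFib x → G) ⁻¹' L) :=
    (hL.isClosed.preimage continuous_subtype_val).measurableSet
  have hint : Integrable (fun g : Γ.SFib x => f g.1) (lam.smeas x) :=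
    (f.continuous.comp continuous_subtype_val).integrable_of_hasCompactSupport
      (hfc.comp_isClosedEmbedding (Γ.isClosedEmbedding_sfib x))
  calc lam.smeas x (Subtype.val ⁻¹' L)
      = ∫⁻ g, (Subtype.val ⁻¹' L : Set (Γ.SFib x)).indicator 1 g ∂(lam.smeas x) :=
        (lintegral_indicator_one hm).symm
    _ ≤ ∫⁻ g : Γ.SFib x, ENNReal.ofReal (f g.1) ∂(lam.smeas x) := by
        refine lintegral_mono fun g => ?_
        by_cases hg : g.1 ∈ L
        · rw [hf1 hg, Set.indicator_of_mem (by exact hg)]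
          simp
        · rw [Set.indicator_of_notMem (by exact hg)]
          exact zero_le
    _ = ENNReal.ofReal (∫ g : Γ.SFib x, f g.1 ∂(lam.smeas x)) :=
        (ofReal_integral_eq_lintegral_ofReal hint (ae_of_all _ fun g => (hf01 _).1)).symm
    _ ≤ _ := ENNReal.ofReal_le_ofReal (h x)

/-- Stated for the lower integral, which is monotone on arbitrary functions; no measurability of
norms of sections is needed. -/
theorem lintegral_le_of_support {x : M} {L : Set G} (hL : IsCompact L) {C c : ℝ}
    (hC : lam.smeas x (Subtype.val ⁻¹' L) ≤ ENNReal.ofReal C) (hc : 0 ≤ c)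
    {u : Γ.SFib x → ℝ≥0∞} (hu : ∀ g, u g ≤ ENNReal.ofReal c) (h0 : ∀ g : Γ.SFib x, g.1 ∉ L → u g = 0) :
    ∫⁻ g, u g ∂(lam.smeas x) ≤ ENNReal.ofReal (c * C) := by
  have hm : MeasurableSet ((Subtype.val : Γ.SFib x → G) ⁻¹' L) :=
    (hL.isClosed.preimage continuous_subtype_val).measurableSet
  calc ∫⁻ g, u g ∂(lam.smeas x)
      ≤ ∫⁻ g, (Subtype.val ⁻¹' L : Set (Γ.SFib x)).indicator (fun _ => ENNReal.ofReal c) g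
          ∂(lam.smeas x) := by
        refine lintegral_mono fun g => ?_
        by_cases hg : g ∈ (Subtype.val ⁻¹' L : Set (Γ.SFib x))
        · rw [Set.indicator_of_mem hg]
          exact hu g
        · rw [h0 g hg]
          exact zero_le
    _ = ENNReal.ofReal c * lam.smeas x (Subtype.val ⁻¹' L) := lintegral_indicator_const hm _
    _ ≤ ENNReal.ofReal c * ENNReal.ofReal C := by gcongr
    _ = _ := (ENNReal.ofReal_mul hc).symm

theorem norm_integral_le_of_support {B : Type*} [NormedAddCommGroup B] [NormedSpace ℝ B] {x : M}
    {L : Set G} (hL : IsCompact L) {C c : ℝ}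
    (hC : lam.smeas x (Subtype.val ⁻¹' L) ≤ ENNReal.ofReal C) (hC0 : 0 ≤ C) (hc : 0 ≤ c)
    {u : Γ.SFib x → B} (hu : ∀ g, ‖u g‖ ≤ c) (h0 : ∀ g : Γ.SFib x, g.1 ∉ L → u g = 0) :
    ‖∫ g, u g ∂(lam.smeas x)‖ ≤ c * C := by
  have h := (enorm_integral_le_lintegral_enorm u).trans
    (lam.lintegral_le_of_support hL hC hc (u := fun g => ‖u g‖ₑ)
      (fun g => by rw [← ofReal_norm]; exact ENNReal.ofReal_le_ofReal (hu g))
      (fun g hg => by rw [h0 g hg, enorm_zero]))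
  rw [← ofReal_norm] at h
  exact (ENNReal.ofReal_le_ofReal_iff (by positivity)).1 h

end HaarSystem

end

end FellGroupoid

namespace FellGroupoid

noncomputable section

/-! ### Modules of sections stable under multiplication by functions -/

/-- Pointwise multiplication of sections by a function. -/
def mulBy {Z : Type*} (V : Z → Type*) [∀ z, AddCommGroup (V z)] [∀ z, Module ℂ (V z)] (w : Z → ℂ) :
    (∀ z, V z) →ₗ[ℂ] ∀ z, V z where
  toFun s z := w z • s z
  map_add' s t := by ext z; exact smul_add _ _ _
  map_smul' c s := by ext z; exact smul_comm _ _ _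

theorem mulBy_mem_span {Z : Type*} {V : Z → Type*} [∀ z, AddCommGroup (V z)] [∀ z, Module ℂ (V z)]
    {w : Z → ℂ} {A : Set (∀ z, V z)} (hA : ∀ s ∈ A, mulBy V w s ∈ Submodule.span ℂ A) :
    ∀ s ∈ Submodule.span ℂ A, mulBy V w s ∈ Submodule.span ℂ A :=
  fun _ hs => (Submodule.span_le (p := (Submodule.span ℂ A).comap (mulBy V w))).2 hA hs

/-! ### Continuity of integrals along the fibres -/

namespace HaarSystem

variable {G M : Type*} [TopologicalSpace G] [TopologicalSpace M] [MeasurableSpace G]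
  [BorelSpace G] {Γ : TopGroupoid G M} (lam : HaarSystem Γ)
  [T2Space G] [LocallyCompactSpace G] [T2Space M]

theorem integrable_of_support {B : Type*} [NormedAddCommGroup B] {x : M} {u : Γ.SFib x → B}
    (hu : Continuous u) {L : Set G} (hL : IsCompact L) (h0 : ∀ g : Γ.SFib x, g.1 ∉ L → u g = 0) :
    Integrable u (lam.smeas x) :=
  hu.integrable_of_hasCompactSupport (HasCompactSupport.intro
    ((Γ.isClosedEmbedding_sfib x).isCompact_preimage hL) fun g hg => h0 g hg)

variable {X : Type*} [TopologicalSpace X] {E : X → Type*}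
  [∀ x, NormedAddCommGroup (E x)] [∀ x, NormedSpace ℂ (E x)] [TopologicalSpace (Tot E)]

theorem _root_.FellGroupoid.IsUSCField.continuous_fibre (hE : IsUSCField E) {Y : Type*}
    [TopologicalSpace Y] {p : Y → M} {q : Y → X} {s : ∀ z : Γ.FibProd p, E (q z.1.1)}
    (hs : Continuous (fun z => (⟨q z.1.1, s z⟩ : Tot E))) (y : Y) :
    Continuous (X := Γ.SFib (p y)) (Y := E (q y)) fun g => s ⟨(y, g.1), g.2⟩ := by
  rw [(hE.inducing_mk (q y)).continuous_iff]
  exact hs.comp ((continuous_const.prodMk continuous_subtype_val).subtype_mk _)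

/-- The integral along the fibres of a continuous section, with supports locally uniformly compact,
is a continuous section. -/
theorem continuousAt_integral (hE : IsUSCField E) (hc : ∀ x, CompleteSpace (E x)) {Y : Type*}
    [TopologicalSpace Y] {p : Y → M} (hp : Continuous p) {q : Y → X} (hq : Continuous q)
    (u : ∀ y, Γ.SFib (p y) → E (q y))
    (hu : Continuous fun z : Γ.FibProd p => (⟨q z.1.1, u z.1.1 ⟨z.1.2, z.2⟩⟩ : Tot E)) {y₀ : Y}
    {L : Set G} (hL : IsCompact L) (h0 : ∀ᶠ y in 𝓝 y₀, ∀ g : Γ.SFib (p y), g.1 ∉ L → u y g = 0) :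
    ContinuousAt (fun y => (⟨q y, ∫ g, u y g ∂(lam.smeas (p y))⟩ : Tot E)) y₀ := by
  obtain ⟨ψ, hψ1, -, hψc, hψ01⟩ := exists_continuous_one_zero_of_isCompact
    hL isClosed_empty (Set.disjoint_empty _)
  obtain ⟨C, hC0, hC⟩ := lam.exists_smeas_le hψc.isCompact
  have hLψ : ∀ g ∉ tsupport ψ, g ∉ L := fun g hg hgL => hg (subset_tsupport _ (by
    rw [Function.mem_support, hψ1 hgL]; exact one_ne_zero))
  -- Elementary sections φ(g)σ(q(y)): their fibre integral is the scalar ∫φ times σ(q(y)), so its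
  -- continuity is the axiom on Haar systems. The general case is reached by approximation.
  set A : Set (∀ z : Γ.FibProd p, E (q z.1.1)) := {s | ∃ φ : C(G, ℝ), HasCompactSupport φ ∧
    ∃ σ : ∀ x, E x, Continuous (fun x => (⟨x, σ x⟩ : Tot E)) ∧
      s = fun z : Γ.FibProd p => ((φ z.1.2 : ℝ) : ℂ) • σ (q z.1.1)} with hA
  have hSfib : ∀ y, Continuous fun g : Γ.SFib (p y) => (⟨(y, g.1), g.2⟩ : Γ.FibProd p) := fun y =>
    (continuous_const.prodMk continuous_subtype_val).subtype_mk _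
  have hcomp : ∀ (s : ∀ z : Γ.FibProd p, E (q z.1.1)),
      Continuous (fun z => (⟨q z.1.1, s z⟩ : Tot E)) → ∀ y,
      Continuous (X := Γ.SFib (p y)) (Y := E (q y)) fun g => s ⟨(y, g.1), g.2⟩ :=
    fun s hs y => hE.continuous_fibre hs y
  have hmul : ∀ φ : C(G, ℝ), HasCompactSupport φ → ∀ s ∈ Submodule.span ℂ A,
      mulBy _ (fun z : Γ.FibProd p => ((φ z.1.2 : ℝ) : ℂ)) s ∈ Submodule.span ℂ A := by
    intro φ hφ
    refine mulBy_mem_span ?_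
    rintro _ ⟨φ', hφ', σ, hσ, rfl⟩
    refine Submodule.subset_span ⟨φ * φ', hφ.mul_right, σ, hσ, ?_⟩
    ext z
    simp [mulBy, mul_smul]
  have hprop : ∀ s ∈ Submodule.span ℂ A, Continuous (fun z => (⟨q z.1.1, s z⟩ : Tot E)) ∧
      (∃ K : Set G, IsCompact K ∧ ∀ z : Γ.FibProd p, z.1.2 ∉ K → s z = 0) ∧
      Continuous fun y => (⟨q y, ∫ g : Γ.SFib (p y), s (⟨(y, g.1), g.2⟩ : Γ.FibProd p) ∂(lam.smeas (p y))⟩ :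
        Tot E) := by
    intro s hs
    induction hs using Submodule.span_induction with
    | mem s hs =>
      obtain ⟨φ, hφ, σ, hσ, rfl⟩ := hs
      refine ⟨?_, ⟨_, hφ.isCompact, fun z hz => ?_⟩, ?_⟩
      · exact hE.continuous_smul_comp (q := fun z : Γ.FibProd p => q z.1.1)
          (I := fun z => σ (q z.1.1)) (Complex.continuous_ofReal.comp
          (φ.continuous.comp (continuous_snd.comp continuous_subtype_val)))
          (hσ.comp (hq.comp (continuous_fst.comp continuous_subtype_val)))
      · beta_reduce
        rw [image_eq_zero_of_notMem_tsupport hz, Complex.ofReal_zero, zero_smul]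
      · have := hE.continuous_smul_comp (q := q) (I := fun y => σ (q y))
          (φ := fun y => ((∫ g : Γ.SFib (p y), φ g.1 ∂(lam.smeas (p y)) : ℝ) : ℂ))
          (Complex.continuous_ofReal.comp ((lam.continuous_integral_smeas φ hφ).comp hp))
          (hσ.comp hq)
        refine this.congr fun y => ?_
        congr 1
        have := hc (q y)
        change _ = ∫ g : Γ.SFib (p y), ((φ g.1 : ℝ) : ℂ) • σ (q y) ∂(lam.smeas (p y))
        rw [integral_smul_const, integral_complex_ofReal]
    | zero =>
      refine ⟨hE.continuous_zero_comp (hq.comp (continuous_fst.comp continuous_subtype_val)),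
        ⟨∅, isCompact_empty, fun _ _ => rfl⟩, ?_⟩
      simp only [Pi.zero_apply, integral_zero]
      exact hE.continuous_zero_comp hq
    | add s t _ _ hs ht =>
      obtain ⟨hs1, ⟨K, hK, hs2⟩, hs3⟩ := hs
      obtain ⟨ht1, ⟨K', hK', ht2⟩, ht3⟩ := ht
      refine ⟨hE.continuous_add_comp hs1 ht1, ⟨K ∪ K', hK.union hK', fun z hz => ?_⟩, ?_⟩
      · rw [Set.mem_union, not_or] at hz
        simp [hs2 z hz.1, ht2 z hz.2]
      · refine (hE.continuous_add_comp hs3 ht3).congr fun y => ?_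
        congr 1
        exact (integral_add
          (lam.integrable_of_support (hcomp s hs1 y) hK fun g hg => hs2 _ hg)
          (lam.integrable_of_support (hcomp t ht1 y) hK' fun g hg => ht2 _ hg)).symm
    | smul c s _ hs =>
      obtain ⟨hs1, ⟨K, hK, hs2⟩, hs3⟩ := hs
      refine ⟨hE.continuous_smul_comp continuous_const hs1, ⟨K, hK, fun z hz => ?_⟩, ?_⟩
      · simp [hs2 z hz]
      · refine (hE.continuous_smul_comp (φ := fun _ => c) continuous_const hs3).congr fun y => ?_
        congr 1
        exact (integral_smul c _).symm
  refine hE.continuousAt_of_approx hq.continuousAt fun ε hε => ?_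
  -- C bounds the measure of the support of ψ on every fibre, so a uniform error δ costs at most δC
  -- ≤ ε after integration.
  set δ := ε / (C + 1) with hδ
  have hδ0 : 0 < δ := by positivity
  let ev : (∀ z : Γ.FibProd p, E (q z.1.1)) →ₗ[ℂ] (∀ _ : Γ.SFib (p y₀), E (q y₀)) :=
    { toFun := fun s g => s (⟨(y₀, g.1), g.2⟩ : Γ.FibProd p), map_add' := fun _ _ => rfl, map_smul' := fun _ _ => rfl }
  -- The approximation takes place on the single fibre over y₀, where the bundle is constant with
  -- value E(q y₀).
  obtain ⟨_, ⟨s, hs, rfl⟩, hsu⟩ := hE.exists_approx_of_dense (q := fun _ : Γ.SFib (p y₀) => q y₀)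
    (Γ.isClosedEmbedding_sfib (p y₀)) ((Submodule.span ℂ A).map ev)
    (by
      rintro φ hφ _ ⟨s, hs, rfl⟩
      exact ⟨_, hmul φ hφ s hs, rfl⟩)
    (by
      rintro _ ⟨s, hs, rfl⟩
      exact (hprop s hs).1.comp (hSfib y₀))
    (by
      intro g e η hη
      obtain ⟨σ, hσ, hσ0⟩ := hE.exists_section (q y₀) e
      obtain ⟨φ, hφ1, -, hφc, -⟩ := exists_continuous_one_zero_of_isCompact
        (isCompact_singleton (x := g.1)) isClosed_empty (Set.disjoint_empty _)
      refine ⟨_, ⟨_, Submodule.subset_span ⟨φ, hφc, σ, hσ, rfl⟩, rfl⟩, ?_⟩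
      have : φ g.1 = 1 := hφ1 rfl
      simpa [ev, this, hσ0] using hη)
    (I := u y₀) (hu.comp (hSfib y₀)) hL (fun g hg => h0.self_of_nhds g hg) (half_pos hδ0)
  have hs' := hmul ψ hψc s hs
  refine ⟨_, (hprop _ hs').2.2.continuousAt, ?_⟩
  -- The error is at most δ/2 over y₀; being strictly less than δ is an open condition and so
  -- persists, for y near y₀, at all arrows of the compact support of ψ. Outside it, both u and ψs
  -- vanish.
  have htube := Γ.eventually_fibProd hp (y₀ := y₀) hψc.isCompact
    (P := fun z => ‖s z - u z.1.1 ⟨z.1.2, z.2⟩‖ < δ) (fun g e _ =>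
      hE.eventually_norm_lt (I := fun z : Γ.FibProd p => s z - u z.1.1 ⟨z.1.2, z.2⟩)
        (hE.continuousAt_sub (hprop s hs).1.continuousAt hu.continuousAt)
        ((hsu ⟨g, e⟩).trans_lt (half_lt_self hδ0)))
  filter_upwards [htube, h0] with y hy hy0
  obtain ⟨h1, ⟨K, hK, h2⟩, -⟩ := hprop _ hs'
  rw [← integral_sub (lam.integrable_of_support (hcomp _ hu y) hL hy0)
    (lam.integrable_of_support (hcomp _ h1 y) hK fun g hg => h2 _ hg)]
  refine (lam.norm_integral_le_of_support hψc.isCompact (hC _) hC0 hδ0.le (fun g => ?_)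
    fun g hg => ?_).trans ?_
  · by_cases hg : g.1 ∈ tsupport ψ
    · have e1 : u y g = ((ψ g.1 : ℝ) : ℂ) • u y g := by
        by_cases hgL : g.1 ∈ L
        · rw [hψ1 hgL]; simp
        · rw [hy0 g hgL, smul_zero]
      change ‖u y g - ((ψ g.1 : ℝ) : ℂ) • s (⟨(y, g.1), g.2⟩ : Γ.FibProd p)‖ ≤ δ
      rw [e1, ← smul_sub, norm_smul, Complex.norm_real, Real.norm_of_nonneg (hψ01 _).1,
        norm_sub_rev]
      calc _ ≤ 1 * δ := mul_le_mul (hψ01 _).2 (hy g.1 hg g.2).le (norm_nonneg _) zero_le_one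
        _ = δ := one_mul _
    · change ‖u y g - ((ψ g.1 : ℝ) : ℂ) • s (⟨(y, g.1), g.2⟩ : Γ.FibProd p)‖ ≤ δ
      rw [hy0 g (hLψ _ hg), image_eq_zero_of_notMem_tsupport hg]
      simpa using hδ0.le
  · change u y g - ((ψ g.1 : ℝ) : ℂ) • s (⟨(y, g.1), g.2⟩ : Γ.FibProd p) = 0
    rw [hy0 g (hLψ _ hg), image_eq_zero_of_notMem_tsupport hg]
    simp
  · rw [hδ, div_mul_eq_mul_div, div_le_iff₀ (by positivity)]
    nlinarith

end HaarSystem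

/-! ### Fell bundles -/

namespace FellBundle

variable {G M : Type*} [TopologicalSpace G] [TopologicalSpace M] {Γ : TopGroupoid G M} {E : G → Type*}
  [∀ g, NormedAddCommGroup (E g)] [∀ g, NormedSpace ℂ (E g)] [TopologicalSpace (Tot E)]
  (F : FellBundle Γ E)

/-- The C*-identity applied to a* gives ‖a*‖² = ‖aa*‖ ≤ ‖a‖‖a*‖; the reverse inequality is the same
one for a*. -/
theorem norm_star {g k : G} (p : Γ.inv g = k) (a : E g) : ‖F.star p a‖ = ‖a‖ := by
  have key : ∀ {g k : G} (p : Γ.inv g = k) (a : E g), ‖F.star p a‖ ≤ ‖a‖ := by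
    intro g k p a
    have q : Γ.inv k = g := by rw [← p, Γ.inv_inv]
    have hp : Γ.IsMul (Γ.inv k) k (Γ.unit (Γ.src k)) := Γ.isMul_inv_left k rfl
    rw [q] at hp
    have h1 := F.norm_star_mul_self q hp (F.star p a)
    have h2 := F.norm_mul_le hp (F.star q (F.star p a)) (F.star p a)
    rw [h1, F.star_star p q, sq] at h2
    by_contra hlt
    push Not at hlt
    have := mul_lt_mul_of_pos_right hlt ((norm_nonneg a).trans_lt hlt)
    linarith
  have q : Γ.inv k = g := by rw [← p, Γ.inv_inv]
  refine le_antisymm (key p a) ?_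
  have := key q (F.star p a)
  rwa [F.star_star p q] at this

/-- The product, as a bounded bilinear map. -/
def mulL {g h k : G} (p : Γ.IsMul g h k) : E g →L[ℂ] E h →L[ℂ] E k :=
  LinearMap.mkContinuous₂ (LinearMap.mk₂ ℂ (F.mul p) (F.add_mul p) (F.smul_mul p) (F.mul_add p)
    (fun z a b => F.mul_smul p z a b)) 1 fun a b => by
      rw [one_mul]; exact F.norm_mul_le p a b

@[simp]
theorem mulL_apply {g h k : G} (p : Γ.IsMul g h k) (a : E g) (b : E h) :
    F.mulL p a b = F.mul p a b := rfl

/-- The adjoint, as a bounded real linear map. -/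
def starL {g k : G} (p : Γ.inv g = k) : E g →L[ℝ] E k :=
  LinearMap.mkContinuous
    { toFun := F.star p
      map_add' := F.star_add p
      map_smul' := fun r a => by
        have := F.star_smul p (r : ℂ) a
        rw [Complex.conj_ofReal] at this
        exact this } 1 fun a => by
      rw [one_mul]; exact (F.norm_star p a).le

theorem mul_zero {g h k : G} (p : Γ.IsMul g h k) (a : E g) : F.mul p a 0 = 0 :=
  map_zero (F.mulL p a)

theorem zero_mul {g h k : G} (p : Γ.IsMul g h k) (b : E h) : F.mul p 0 b = 0 := by
  rw [← mulL_apply, map_zero]; rfl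

theorem sub_mul {g h k : G} (p : Γ.IsMul g h k) (a a' : E g) (b : E h) :
    F.mul p (a - a') b = F.mul p a b - F.mul p a' b := by
  rw [← mulL_apply, map_sub]; rfl

theorem star_zero {g k : G} (p : Γ.inv g = k) : F.star p 0 = 0 := map_zero (F.starL p)

theorem star_sub {g k : G} (p : Γ.inv g = k) (a b : E g) :
    F.star p (a - b) = F.star p a - F.star p b := map_sub (F.starL p) a b

theorem mul_integral {α : Type*} [MeasurableSpace α] {μ : Measure α} {g h k : G}
    (p : Γ.IsMul g h k) (a : E g) {u : α → E h} (hu : Integrable u μ) :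
    F.mul p a (∫ x, u x ∂μ) = ∫ x, F.mul p a (u x) ∂μ := by
  have := F.complete h
  have := F.complete k
  exact ((F.mulL p a).integral_comp_comm hu).symm

theorem integral_mul {α : Type*} [MeasurableSpace α] {μ : Measure α} {g h k : G}
    (p : Γ.IsMul g h k) (b : E h) {u : α → E g} (hu : Integrable u μ) :
    F.mul p (∫ x, u x ∂μ) b = ∫ x, F.mul p (u x) b ∂μ := by
  have := F.complete g
  have := F.complete k
  exact (((F.mulL p).flip b).integral_comp_comm hu).symm

theorem star_integral {α : Type*} [MeasurableSpace α] {μ : Measure α} {g k : G}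
    (p : Γ.inv g = k) {u : α → E g} (hu : Integrable u μ) :
    F.star p (∫ x, u x ∂μ) = ∫ x, F.star p (u x) ∂μ := by
  have := F.complete g
  have := F.complete k
  exact ((F.starL p).integral_comp_comm hu).symm

/-- The product only depends on the arrows. -/
theorem mul_congr {g g' h h' k : G} (ξ η : ∀ g, E g) (p : Γ.IsMul g h k) (p' : Γ.IsMul g' h' k)
    (hg : g = g') (hh : h = h') : F.mul p (ξ g) (η h) = F.mul p' (ξ g') (η h') := by
  subst hg hh
  rfl

theorem continuous_star_comp {Y : Type*} [TopologicalSpace Y] {g k : Y → G}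
    (p : ∀ y, Γ.inv (g y) = k y) {a : ∀ y, E (g y)}
    (ha : Continuous fun y => (⟨g y, a y⟩ : Tot E)) :
    Continuous fun y => (⟨k y, F.star (p y) (a y)⟩ : Tot E) := by
  have key : ∀ {g k : G} (p : Γ.inv g = k) (a : E g),
      (⟨k, F.star p a⟩ : Tot E) = ⟨Γ.inv g, F.star rfl a⟩ := by
    rintro g k rfl a
    rfl
  exact (F.continuous_star.comp ha).congr fun y => (key (p y) (a y)).symm

end FellBundle

end

end FellGroupoid

namespace FellGroupoid

noncomputable section

/-- A bounded biadditive map is continuous. -/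
theorem continuous_of_biadditive_bound {V A : Type*} [SeminormedAddCommGroup V]
    [NormedAddCommGroup A] (B : V →+ V →+ A) (hb : ∀ u v, ‖B u v‖ ≤ 4 * ‖u‖ * ‖v‖) :
    Continuous fun p : V × V => B p.1 p.2 := by
  rw [continuous_iff_continuousAt]
  rintro ⟨ξ, η⟩
  rw [ContinuousAt, tendsto_iff_norm_sub_tendsto_zero]
  have e : ∀ p : V × V, ‖B p.1 p.2 - B ξ η‖ ≤
      4 * ‖p.1 - ξ‖ * ‖p.2‖ + 4 * ‖ξ‖ * ‖p.2 - η‖ := by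
    intro p
    have : B p.1 p.2 - B ξ η = B (p.1 - ξ) p.2 + B ξ (p.2 - η) := by
      rw [map_sub, map_sub]
      simp
    rw [this]
    exact (norm_add_le _ _).trans (add_le_add (hb _ _) (hb _ _))
  have hcont : Continuous fun p : V × V => 4 * ‖p.1 - ξ‖ * ‖p.2‖ + 4 * ‖ξ‖ * ‖p.2 - η‖ := by
    fun_prop
  refine squeeze_zero (fun _ => norm_nonneg _) e ?_
  have := hcont.tendsto (ξ, η)
  simpa using this

namespace FellBundle

variable {G M : Type*} [TopologicalSpace G] [TopologicalSpace M] {Γ : TopGroupoid G M} {E : G → Type*}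
  [∀ g, NormedAddCommGroup (E g)] [∀ g, NormedSpace ℂ (E g)] [TopologicalSpace (Tot E)]
  (F : FellBundle Γ E)

/-! ### Compactly supported sections -/

/-- Sections on `Γ`. -/
def mkCc (u : ∀ g, E g) (hu : Continuous fun g => (⟨g, u g⟩ : Tot E))
    (h0 : ∃ L : Set G, IsCompact L ∧ ∀ g ∉ L, u g = 0) : F.Cc := ⟨u, hu, h0⟩

/-- Evaluation of a section at an arrow. -/
def ev (ξ : F.Cc) (g : G) : E g := ξ.1 g

@[simp]
theorem mkCc_ev (u : ∀ g, E g) (hu) (h0) (g : G) : F.ev (F.mkCc u hu h0) g = u g := rfl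

variable {F} in
theorem Cc.ext {ξ η : F.Cc} (h : ∀ g, F.ev ξ g = F.ev η g) : ξ = η :=
  Subtype.ext (funext h)

theorem continuous_ev (ξ : F.Cc) : Continuous fun g => (⟨g, F.ev ξ g⟩ : Tot E) := ξ.2.1

theorem exists_support (ξ : F.Cc) : ∃ L : Set G, IsCompact L ∧ ∀ g ∉ L, F.ev ξ g = 0 := ξ.2.2

theorem exists_bound (ξ : F.Cc) : ∃ C, 0 ≤ C ∧ ∀ g, ‖F.ev ξ g‖ ≤ C := by
  obtain ⟨K, hK, h0⟩ := F.exists_support ξ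
  exact F.isField.bddAbove_norm (F.continuous_ev ξ) hK h0

/-- Multiplication of a section by a continuous function. -/
def ccMul (w : C(G, ℂ)) : F.Cc →ₗ[ℂ] F.Cc where
  toFun ξ := F.mkCc (fun g => w g • F.ev ξ g)
    (F.isField.continuous_smul_comp w.continuous (F.continuous_ev ξ)) (by
    obtain ⟨K, hK, h0⟩ := F.exists_support ξ
    exact ⟨K, hK, fun g hg => by rw [h0 g hg, smul_zero]⟩)
  map_add' ξ η := Cc.ext fun g => smul_add _ _ _
  map_smul' c ξ := Cc.ext fun g => smul_comm _ _ _

@[simp]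
theorem ccMul_ev (w : C(G, ℂ)) (ξ : F.Cc) (g : G) : F.ev (F.ccMul w ξ) g = w g • F.ev ξ g := rfl

/-- Multiplication of a section on a fibre by a continuous function. -/
def fibMul {x : M} (w : C(Γ.SFib x, ℂ)) (ξ : F.CcFib x) : F.CcFib x :=
  ⟨fun g => w g • ξ.eval g, F.isField.continuous_smul_comp w.continuous ξ.2.1, by
    obtain ⟨K, hK, h0⟩ := ξ.2.2
    exact ⟨K, hK, fun g hg => by
      change w g • ξ.1 g = 0
      rw [h0 g hg, smul_zero]⟩⟩

theorem exists_cc [T2Space G] [LocallyCompactSpace G] (g : G) (a : E g) :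
    ∃ ξ : F.Cc, F.ev ξ g = a := by
  obtain ⟨σ, hσ, hσ0⟩ := F.isField.exists_section g a
  obtain ⟨φ, hφ1, -, hφc, -⟩ := exists_continuous_one_zero_of_isCompact
    (isCompact_singleton (x := g)) isClosed_empty (Set.disjoint_empty _)
  refine ⟨F.mkCc (fun g => ((φ g : ℝ) : ℂ) • σ g) (F.isField.continuous_smul_comp
    (Complex.continuous_ofReal.comp φ.continuous) hσ) ⟨_, hφc.isCompact, fun g hg => ?_⟩, ?_⟩
  · rw [image_eq_zero_of_notMem_tsupport hg]; simp
  · have : φ g = 1 := hφ1 rfl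
    simp [this, hσ0]

/-- The form in which fullness of the bundle is used: only subspaces containing the products need to
be recognized. -/
theorem exists_norm_sub_lt {g h k : G} (p : Γ.IsMul g h k) (N : Submodule ℂ (E k))
    (hN : ∀ a b, F.mul p a b ∈ N) (e : E k) {ε : ℝ} (hε : 0 < ε) : ∃ n ∈ N, ‖n - e‖ < ε := by
  obtain ⟨n, hn, h⟩ := Metric.dense_iff.1 (F.dense_mul p) e ε hε
  refine ⟨n, Submodule.span_le.2 ?_ h, by rwa [Metric.mem_ball, dist_eq_norm] at hn⟩
  rintro _ ⟨a, b, rfl⟩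
  exact hN a b

variable {F}

theorem CcFib.ext {x : M} {ξ η : F.CcFib x} (h : ∀ g, ξ.eval g = η.eval g) : ξ = η :=
  Subtype.ext (funext h)

theorem CcFib.eval_add {x : M} (ξ η : F.CcFib x) (g : Γ.SFib x) :
    (ξ + η).eval g = ξ.eval g + η.eval g := rfl

theorem CcFib.eval_sub {x : M} (ξ η : F.CcFib x) (g : Γ.SFib x) :
    (ξ - η).eval g = ξ.eval g - η.eval g := rfl

theorem CcFib.eval_smul {x : M} (c : ℂ) (ξ : F.CcFib x) (g : Γ.SFib x) :
    (c • ξ).eval g = c • ξ.eval g := rfl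

theorem CcFib.continuous {x : M} (ξ : F.CcFib x) :
    Continuous fun g : Γ.SFib x => (⟨g.1, ξ.eval g⟩ : Tot E) := ξ.2.1

theorem CcFib.exists_support {x : M} (ξ : F.CcFib x) :
    ∃ L : Set G, IsCompact L ∧ ∀ g : Γ.SFib x, g.1 ∉ L → ξ.eval g = 0 := by
  obtain ⟨-, K, hK, h0⟩ := ξ.2
  exact ⟨_, hK.image continuous_subtype_val, fun g hg => h0 g fun h => hg ⟨g, h, rfl⟩⟩

theorem CcFib.exists_bound {x : M} (ξ : F.CcFib x) : ∃ C, 0 ≤ C ∧ ∀ g, ‖ξ.eval g‖ ≤ C := by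
  obtain ⟨hξ, K, hK, h0⟩ := ξ.2
  exact F.isField.bddAbove_norm hξ hK h0

variable (F)

/-- Sections on a fibre. -/
def mkFib [T2Space M] {x : M} (u : ∀ g : Γ.SFib x, E g.1)
    (hu : Continuous fun g : Γ.SFib x => (⟨g.1, u g⟩ : Tot E))
    (h0 : ∃ L : Set G, IsCompact L ∧ ∀ g : Γ.SFib x, g.1 ∉ L → u g = 0) : F.CcFib x :=
  ⟨u, hu, by
    obtain ⟨L, hL, h⟩ := h0
    exact ⟨_, (Γ.isClosedEmbedding_sfib x).isCompact_preimage hL, h⟩⟩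

@[simp]
theorem mkFib_eval [T2Space M] {x : M} (u : ∀ g : Γ.SFib x, E g.1) (hu) (h0) (g : Γ.SFib x) :
    (F.mkFib u hu h0).eval g = u g := rfl

@[simp]
theorem restrict_eval [T2Space M] {x : M} (ξ : F.Cc) (g : Γ.SFib x) :
    (F.restrict x ξ).eval g = F.ev ξ g.1 := rfl

theorem rmulPre_eval {x y : M} (k : G) (ht : Γ.tgt k = x) (hs : Γ.src k = y) (e : E k)
    (ξ : F.CcFib x) (g : Γ.SFib y) : (F.rmulPre k ht hs e ξ).eval g =
      F.mul (Γ.isMul_rightDiv k ht hs g) (ξ.eval (Γ.rightDiv k ht hs g)) e := rfl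

/-- The two values of ξ lie in formally different fibres, but after multiplication by e both lie in
E_l and can be compared. -/
theorem eval_congr {x : M} (ξ : F.CcFib x) {g g' : Γ.SFib x} (h : g = g') {k l : G}
    (p : Γ.IsMul g.1 k l) (p' : Γ.IsMul g'.1 k l) (e : E k) :
    F.mul p (ξ.eval g) e = F.mul p' (ξ.eval g') e := by
  subst h
  rfl

theorem rmulPre_eval_rightMul {x y : M} (k : G) (ht : Γ.tgt k = x) (hs : Γ.src k = y) (e : E k)
    (ξ : F.CcFib x) (g : Γ.SFib x) : (F.rmulPre k ht hs e ξ).eval (Γ.rightMul k ht hs g) =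
      F.mul (Γ.isMul_rightMul k ht hs g) (ξ.eval g) e :=
  F.eval_congr ξ (Γ.rightDiv_rightMul k ht hs g) _ _ e

theorem rmulPre_unit_eval {x : M} (e : E (Γ.unit x)) (ξ : F.CcFib x) (g : Γ.SFib x) :
    (F.rmulPre (Γ.unit x) (Γ.tgt_unit x) (Γ.src_unit x) e ξ).eval g =
      F.mul (Γ.isMul_unit_right g.1 g.2) (ξ.eval g) e :=
  F.eval_congr ξ (Subtype.ext ((Γ.isMul_rightDiv _ (Γ.tgt_unit x) (Γ.src_unit x) g).eq_of_right
    (Γ.isMul_unit_right g.1 g.2))) _ _ e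

variable [MeasurableSpace G] [BorelSpace G] [T2Space G] (lam : HaarSystem Γ)

/-! ### The inner product -/

theorem ipPre_star (x : M) (ξ η : F.CcFib x) :
    F.star (Γ.inv_unit x) (F.ipPre lam x ξ η) = F.ipPre lam x η ξ := by
  unfold ipPre
  rw [F.star_integral _ (F.integrable_ip_integrand lam x ξ η)]
  congr 1 with g
  rw [F.star_mul _ (Γ.inv_inv _) rfl _ (Γ.isMul_inv_self g), F.star_star]

/-- The canonical map from `C_c(Γ_x; E)` to `L²(Γ_x; E)`, as a linear map. -/
def toL2FibL (x : M) : F.CcFib x →ₗ[ℂ] F.L2Fib lam x where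
  toFun := F.toL2Fib lam x
  map_add' ξ η := UniformSpace.Completion.coe_add (α := F.PreL2 lam x) ξ η
  map_smul' c ξ := UniformSpace.Completion.coe_smul (X := F.PreL2 lam x) c ξ

theorem toL2FibL_apply (x : M) (ξ : F.CcFib x) : F.toL2FibL lam x ξ = F.toL2Fib lam x ξ := rfl

theorem toL2Fib_add (x : M) (ξ η : F.CcFib x) :
    F.toL2Fib lam x (ξ + η) = F.toL2Fib lam x ξ + F.toL2Fib lam x η := map_add (F.toL2FibL lam x) ξ η

theorem toL2Fib_sub (x : M) (ξ η : F.CcFib x) :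
    F.toL2Fib lam x (ξ - η) = F.toL2Fib lam x ξ - F.toL2Fib lam x η := map_sub (F.toL2FibL lam x) ξ η

theorem toL2Fib_smul (x : M) (c : ℂ) (ξ : F.CcFib x) :
    F.toL2Fib lam x (c • ξ) = c • F.toL2Fib lam x ξ := map_smul (F.toL2FibL lam x) c ξ

theorem norm_preL2 (x : M) (ξ : F.PreL2 lam x) : ‖ξ‖ = ‖F.toL2Fib lam x ξ‖ :=
  (UniformSpace.Completion.norm_coe (E := F.PreL2 lam x) ξ).symm

theorem norm_toL2Fib (x : M) (ξ : F.CcFib x) :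
    ‖F.toL2Fib lam x ξ‖ = √‖F.ipPre lam x ξ ξ‖ :=
  UniformSpace.Completion.norm_coe (E := F.PreL2 lam x) _

theorem norm_toL2Fib_sq (x : M) (ξ : F.CcFib x) :
    ‖F.ipPre lam x ξ ξ‖ = ‖F.toL2Fib lam x ξ‖ ^ 2 := by
  rw [norm_toL2Fib, Real.sq_sqrt (norm_nonneg _)]

theorem denseRange_toL2Fib (x : M) : DenseRange (F.toL2Fib lam x) :=
  UniformSpace.Completion.denseRange_coe (α := F.PreL2 lam x)

theorem norm_ipPre_le (x : M) (ξ η : F.CcFib x) :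
    ‖F.ipPre lam x ξ η‖ ≤ 4 * ‖F.toL2Fib lam x ξ‖ * ‖F.toL2Fib lam x η‖ := by
  have h := norm_sesq_le (V := F.PreL2 lam x) (F.ipPre lam x) (F.ipPre_add lam x)
    (F.ipPre_add' lam x) (F.ipPre_smul lam x) (F.ipPre_smul' lam x)
    (fun ξ => (F.norm_toL2Fib_sq lam x ξ).trans (by rw [norm_preL2])) ξ η
  exact h.trans_eq (by rw [← F.norm_preL2 lam x ξ, ← F.norm_preL2 lam x η])

/-- The inner product on `C_c(Γ_x; E)`, as a biadditive map. -/
def ipPreHom (x : M) : F.PreL2 lam x →+ F.PreL2 lam x →+ E (Γ.unit x) :=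
  AddMonoidHom.mk' (fun ξ => AddMonoidHom.mk' (F.ipPre lam x ξ) (F.ipPre_add lam x ξ))
    fun ξ η => AddMonoidHom.ext fun ζ => F.ipPre_add' lam x ξ η ζ

theorem continuous_ipPreHom (x : M) :
    Continuous fun p : F.PreL2 lam x × F.PreL2 lam x => F.ipPreHom lam x p.1 p.2 :=
  continuous_of_biadditive_bound _ fun ξ η => by
    rw [norm_preL2, norm_preL2]
    exact F.norm_ipPre_le lam x ξ η

theorem continuous_ip (x : M) :
    Continuous fun p : F.L2Fib lam x × F.L2Fib lam x => F.ip lam x p.1 p.2 := by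
  have := F.complete (Γ.unit x)
  exact (UniformSpace.Completion.isDenseInducing_toCompl (F.PreL2 lam x)).extend_Z_bilin
    (UniformSpace.Completion.isDenseInducing_toCompl (F.PreL2 lam x)) (F.continuous_ipPreHom lam x)

theorem ip_coe (x : M) (ξ η : F.CcFib x) :
    F.ip lam x (F.toL2Fib lam x ξ) (F.toL2Fib lam x η) = F.ipPre lam x ξ η := by
  have := (UniformSpace.Completion.isDenseInducing_coe.prodMap
    UniformSpace.Completion.isDenseInducing_coe).extend_eq (F.continuous_ipPreHom lam x)
    ((show F.PreL2 lam x from ξ), (show F.PreL2 lam x from η))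
  exact this

variable {F lam}

theorem continuous_ip_comp {Y : Type*} [TopologicalSpace Y] {x : M} {u v : Y → F.L2Fib lam x}
    (hu : Continuous u) (hv : Continuous v) : Continuous fun y => F.ip lam x (u y) (v y) :=
  (F.continuous_ip lam x).comp (hu.prodMk hv)

/-- Induction principle for `L²(Γ_x; E)`. -/
theorem l2Fib_induction {x : M} {P : F.L2Fib lam x → Prop} (hP : IsClosed {u | P u})
    (h : ∀ ξ, P (F.toL2Fib lam x ξ)) (u : F.L2Fib lam x) : P u :=
  (F.denseRange_toL2Fib lam x).induction_on u hP h

variable (F lam)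

theorem ip_add_right (x : M) (u v w : F.L2Fib lam x) :
    F.ip lam x u (v + w) = F.ip lam x u v + F.ip lam x u w := by
  induction u using l2Fib_induction with
  | hP =>
    exact isClosed_eq (continuous_ip_comp continuous_id continuous_const)
      ((continuous_ip_comp continuous_id continuous_const).add
        (continuous_ip_comp continuous_id continuous_const))
  | h ξ =>
  induction v using l2Fib_induction with
  | hP =>
    exact isClosed_eq (continuous_ip_comp continuous_const (continuous_id.add continuous_const))
      ((continuous_ip_comp continuous_const continuous_id).add continuous_const)
  | h η =>
  induction w using l2Fib_induction with
  | hP =>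
    exact isClosed_eq (continuous_ip_comp continuous_const (continuous_const.add continuous_id))
      (continuous_const.add (continuous_ip_comp continuous_const continuous_id))
  | h ζ => rw [← toL2Fib_add, ip_coe, ip_coe, ip_coe, ipPre_add]

theorem ip_smul_right (x : M) (c : ℂ) (u v : F.L2Fib lam x) :
    F.ip lam x u (c • v) = c • F.ip lam x u v := by
  induction u using l2Fib_induction with
  | hP =>
    exact isClosed_eq (continuous_ip_comp continuous_id continuous_const)
      ((continuous_ip_comp continuous_id continuous_const).const_smul c)
  | h ξ =>
  induction v using l2Fib_induction with
  | hP =>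
    exact isClosed_eq (continuous_ip_comp continuous_const (continuous_id.const_smul c))
      ((continuous_ip_comp continuous_const continuous_id).const_smul c)
  | h η => rw [← toL2Fib_smul, ip_coe, ip_coe, ipPre_smul]

theorem ip_star (x : M) (u v : F.L2Fib lam x) :
    F.star (Γ.inv_unit x) (F.ip lam x u v) = F.ip lam x v u := by
  induction u using l2Fib_induction with
  | hP =>
    exact isClosed_eq ((F.starL (Γ.inv_unit x)).continuous.comp
      (continuous_ip_comp continuous_id continuous_const))
      (continuous_ip_comp continuous_const continuous_id)
  | h ξ =>
  induction v using l2Fib_induction with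
  | hP =>
    exact isClosed_eq ((F.starL (Γ.inv_unit x)).continuous.comp
      (continuous_ip_comp continuous_const continuous_id))
      (continuous_ip_comp continuous_id continuous_const)
  | h η => rw [ip_coe, ip_coe, ipPre_star]

theorem ip_add_left (x : M) (u v w : F.L2Fib lam x) :
    F.ip lam x (u + v) w = F.ip lam x u w + F.ip lam x v w := by
  rw [← ip_star, ip_add_right, star_add, ip_star, ip_star]

theorem ip_smul_left (x : M) (c : ℂ) (u v : F.L2Fib lam x) :
    F.ip lam x (c • u) v = (starRingEnd ℂ c) • F.ip lam x u v := by
  rw [← ip_star, ip_smul_right, star_smul, ip_star]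

theorem norm_ip_self (x : M) (u : F.L2Fib lam x) : ‖F.ip lam x u u‖ = ‖u‖ ^ 2 := by
  induction u using l2Fib_induction with
  | hP =>
    exact isClosed_eq (continuous_ip_comp continuous_id continuous_id).norm
      (continuous_norm.pow 2)
  | h ξ => rw [ip_coe, norm_toL2Fib_sq]

theorem norm_ip_le (x : M) (u v : F.L2Fib lam x) : ‖F.ip lam x u v‖ ≤ 4 * ‖u‖ * ‖v‖ :=
  norm_sesq_le _ (F.ip_add_right lam x) (F.ip_add_left lam x) (F.ip_smul_right lam x)
    (F.ip_smul_left lam x) (F.norm_ip_self lam x) u v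

/-- The map `v ↦ ⟨u, v⟩`. -/
def ipL (x : M) (u : F.L2Fib lam x) : F.L2Fib lam x →L[ℂ] E (Γ.unit x) :=
  LinearMap.mkContinuous
    { toFun := F.ip lam x u
      map_add' := F.ip_add_right lam x u
      map_smul' := fun c v => F.ip_smul_right lam x c u v } (4 * ‖u‖) (F.norm_ip_le lam x u)

@[simp]
theorem ipL_apply (x : M) (u v : F.L2Fib lam x) : F.ipL lam x u v = F.ip lam x u v := rfl

theorem ip_sub_right (x : M) (u v w : F.L2Fib lam x) :
    F.ip lam x u (v - w) = F.ip lam x u v - F.ip lam x u w := map_sub (F.ipL lam x u) v w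

theorem ip_sub_left (x : M) (u v w : F.L2Fib lam x) :
    F.ip lam x (u - v) w = F.ip lam x u w - F.ip lam x v w := by
  rw [← ip_star, ip_sub_right, star_sub, ip_star, ip_star]

variable {F lam}

theorem eq_of_ip {x : M} {ι : Type*} {j : ι → F.L2Fib lam x} (hj : DenseRange j)
    {u v : F.L2Fib lam x} (h : ∀ i, F.ip lam x (j i) u = F.ip lam x (j i) v) : u = v := by
  have : ∀ w, F.ip lam x w (u - v) = 0 := fun w =>
    hj.induction_on w (isClosed_eq (continuous_ip_comp continuous_id continuous_const)
      continuous_const) fun i => by rw [ip_sub_right, h, sub_self]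
  have h2 := F.norm_ip_self lam x (u - v)
  rw [this, norm_zero] at h2
  exact sub_eq_zero.1 (norm_eq_zero.1 (pow_eq_zero_iff two_ne_zero |>.1 h2.symm))

variable (F lam)

theorem norm_ip_integrand_le {x : M} (ξ η : F.CcFib x) (g : Γ.SFib x) :
    ‖F.mul (Γ.isMul_inv_self g) (F.star rfl (ξ.eval g)) (η.eval g)‖ ≤ ‖ξ.eval g‖ * ‖η.eval g‖ :=
  (F.norm_mul_le _ _ _).trans_eq (by rw [norm_star])

/-! ### Density in the fibre modules -/

section

variable [LocallyCompactSpace G] [T2Space M]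

/-- Converts uniform smallness on a fixed support into smallness in L², by integrating ‖ξ(g)‖² ≤ c².
-/
theorem norm_toL2Fib_le {x : M} {L : Set G} (hL : IsCompact L) {C c : ℝ}
    (hC : lam.smeas x (Subtype.val ⁻¹' L) ≤ ENNReal.ofReal C) (hC0 : 0 ≤ C) (hc : 0 ≤ c)
    (ξ : F.CcFib x) (hξ : ∀ g, ‖ξ.eval g‖ ≤ c) (h0 : ∀ g : Γ.SFib x, g.1 ∉ L → ξ.eval g = 0) :
    ‖F.toL2Fib lam x ξ‖ ≤ c * √C := by
  rw [norm_toL2Fib]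
  refine Real.sqrt_le_iff.2 ⟨by positivity, ?_⟩
  rw [mul_pow, Real.sq_sqrt hC0]
  refine lam.norm_integral_le_of_support hL hC hC0 (by positivity) (fun g => ?_) fun g hg => ?_
  · refine (F.norm_ip_integrand_le ξ ξ g).trans ?_
    rw [sq]
    exact mul_le_mul (hξ g) (hξ g) (norm_nonneg _) hc
  · rw [h0 g hg, mul_zero]

/-- Approximation of sections on a fibre, uniformly and with control of the support. -/
theorem exists_approx_fib {x : M} (S : Submodule ℂ (∀ g : Γ.SFib x, E g.1))
    (hS : ∀ φ : C(G, ℝ), HasCompactSupport φ → ∀ s ∈ S,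
      (fun g : Γ.SFib x => ((φ g.1 : ℝ) : ℂ) • s g) ∈ S)
    (hSc : ∀ s ∈ S, Continuous fun g : Γ.SFib x => (⟨g.1, s g⟩ : Tot E))
    (hd : ∀ (g : Γ.SFib x) (e : E g.1), ∀ ε > 0, ∃ s ∈ S, ‖s g - e‖ < ε) (ξ : F.CcFib x) :
    ∃ L : Set G, IsCompact L ∧ (∀ g : Γ.SFib x, g.1 ∉ L → ξ.eval g = 0) ∧ ∀ ε > 0,
      ∃ ζ : F.CcFib x, (fun g => ζ.eval g) ∈ S ∧
      (∀ g, ‖ζ.eval g - ξ.eval g‖ ≤ ε) ∧ ∀ g : Γ.SFib x, g.1 ∉ L → ζ.eval g = 0 := by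
  obtain ⟨K, hK, h0⟩ := ξ.exists_support
  obtain ⟨ψ, hψ1, -, hψc, hψ01⟩ := exists_continuous_one_zero_of_isCompact
    hK isClosed_empty (Set.disjoint_empty _)
  have hKψ : ∀ g ∉ tsupport ψ, g ∉ K := fun g hg hgL => hg (subset_tsupport _ (by
    rw [Function.mem_support, hψ1 hgL]; exact one_ne_zero))
  refine ⟨tsupport ψ, hψc.isCompact, fun g hg => h0 g (hKψ _ hg), fun ε hε => ?_⟩
  obtain ⟨s, hs, hsε⟩ := F.isField.exists_approx_of_dense (Γ.isClosedEmbedding_sfib x) S hS hSc hd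
    ξ.continuous hK h0 hε
  have hs' := hS ψ hψc s hs
  have hz : ∀ g : Γ.SFib x, g.1 ∉ tsupport ψ → ((ψ g.1 : ℝ) : ℂ) • s g = 0 := fun g hg => by
    rw [image_eq_zero_of_notMem_tsupport hg, Complex.ofReal_zero, zero_smul]
  refine ⟨F.mkFib _ (hSc _ hs') ⟨_, hψc.isCompact, hz⟩, hs', fun g => ?_, hz⟩
  -- Multiplication by ψ confines the support without increasing the error, since ξ = ψξ and 0 ≤ ψ ≤
  -- 1.
  rw [mkFib_eval]
  have e1 : ξ.eval g = ((ψ g.1 : ℝ) : ℂ) • ξ.eval g := by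
    by_cases hg : g.1 ∈ K
    · rw [hψ1 hg]; simp
    · rw [h0 g hg, smul_zero]
  rw [e1, ← smul_sub, norm_smul, Complex.norm_real, Real.norm_of_nonneg (hψ01 _).1]
  exact (mul_le_mul (hψ01 _).2 (hsε g) (norm_nonneg _) zero_le_one).trans_eq (one_mul ε)

/-- The uniform approximants of ξ have supports in one compact set L independent of ε, so they
converge in L² as well. This is the common source of density results for fibre modules. -/
theorem exists_approx_l2Fib {x : M} (S : Submodule ℂ (∀ g : Γ.SFib x, E g.1))
    (hS : ∀ φ : C(G, ℝ), HasCompactSupport φ → ∀ s ∈ S,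
      (fun g : Γ.SFib x => ((φ g.1 : ℝ) : ℂ) • s g) ∈ S)
    (hSc : ∀ s ∈ S, Continuous fun g : Γ.SFib x => (⟨g.1, s g⟩ : Tot E))
    (hd : ∀ (g : Γ.SFib x) (e : E g.1), ∀ ε > 0, ∃ s ∈ S, ‖s g - e‖ < ε) (u : F.L2Fib lam x)
    {ε : ℝ} (hε : 0 < ε) :
    ∃ ζ : F.CcFib x, (fun g => ζ.eval g) ∈ S ∧ ‖F.toL2Fib lam x ζ - u‖ < ε := by
  obtain ⟨_, h1, ξ, rfl⟩ := Metric.dense_iff.1 (F.denseRange_toL2Fib lam x) u (ε / 2) (half_pos hε)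
  rw [Metric.mem_ball, dist_eq_norm] at h1
  obtain ⟨L, hL, hξ0, h⟩ := F.exists_approx_fib S hS hSc hd ξ
  obtain ⟨C, hC0, hC⟩ := lam.exists_smeas_le hL
  -- In L² this uniform error costs at most ε/4, and ε/2 has already been spent on replacing u by ξ.
  obtain ⟨ζ, hζ, h2, h3⟩ := h (ε / (4 * (√C + 1))) (by positivity)
  refine ⟨ζ, hζ, ?_⟩
  have h4 : ‖F.toL2Fib lam x (ζ - ξ)‖ ≤ ε / (4 * (√C + 1)) * √C :=
    F.norm_toL2Fib_le lam hL (hC x) hC0 (by positivity) _ h2 fun g hg => by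
      rw [CcFib.eval_sub, h3 g hg, hξ0 g hg, sub_self]
  have h5 : ε / (4 * (√C + 1)) * √C ≤ ε / 4 := by
    have := Real.sqrt_nonneg C
    rw [div_mul_eq_mul_div, div_le_div_iff₀ (by positivity) (by norm_num)]
    nlinarith
  rw [toL2Fib_sub] at h4
  calc _ = ‖(F.toL2Fib lam x ζ - F.toL2Fib lam x ξ) + (F.toL2Fib lam x ξ - u)‖ := by
        rw [sub_add_sub_cancel]
    _ ≤ _ := norm_add_le _ _
    _ < ε := by linarith

/-- Global sections take arbitrary values at each arrow and form a module over the continuous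
functions. Density of their restrictions makes `fiberOp` determined by the global operator. -/
theorem denseRange_restrict (x : M) :
    DenseRange fun ξ : F.Cc => F.toL2Fib lam x (F.restrict x ξ) := by
  intro u
  rw [Metric.mem_closure_range_iff]
  intro ε hε
  let ev : (∀ g : G, E g) →ₗ[ℂ] (∀ g : Γ.SFib x, E g.1) :=
    { toFun := fun s g => s g.1, map_add' := fun _ _ => rfl, map_smul' := fun _ _ => rfl }
  obtain ⟨ζ, ⟨ξ, hξ, he⟩, h⟩ := F.exists_approx_l2Fib lam ((CcSection F.isField
    (ContinuousMap.id G)).map ev)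
    (by
      rintro φ hφ _ ⟨ξ, hξ, rfl⟩
      exact ⟨_, (F.ccMul ⟨fun g => ((φ g : ℝ) : ℂ), Complex.continuous_ofReal.comp φ.continuous⟩
        ⟨ξ, hξ⟩).2, rfl⟩)
    (by
      rintro _ ⟨ξ, hξ, rfl⟩
      exact hξ.1.comp continuous_subtype_val)
    (fun g e ε hε => by
      obtain ⟨ξ, hξ⟩ := F.exists_cc g.1 e
      refine ⟨_, ⟨ξ.1, ξ.2, rfl⟩, ?_⟩
      change ‖F.ev ξ g.1 - e‖ < ε
      rwa [hξ, sub_self, norm_zero]) u hε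
  refine ⟨⟨ξ, hξ⟩, ?_⟩
  have : F.restrict x ⟨ξ, hξ⟩ = ζ := CcFib.ext fun g => congrFun he g
  rwa [this, dist_comm, dist_eq_norm]

end

/-! ### Right multiplication -/

/-- This is (ve)*(we') = (e*(v*w))e', with an explicit witness for every product of arrows involved.
-/
theorem rmul_integrand {g k gk : G} {a b : M} (q : Γ.IsMul g k gk) (hg : Γ.src g = a)
    (p : Γ.IsMul (Γ.inv gk) gk (Γ.unit b))
    (p₀ : Γ.IsMul (Γ.inv g) g (Γ.unit a)) (p₁ : Γ.IsMul (Γ.inv k) (Γ.unit a) (Γ.inv k))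
    (p₂ : Γ.IsMul (Γ.inv k) k (Γ.unit b)) (v w : E g) (e e' : E k) :
    F.mul p (F.star rfl (F.mul q v e)) (F.mul q w e') =
      F.mul p₂ (F.mul p₁ (F.star rfl e) (F.mul p₀ (F.star rfl v) w)) e' := by
  have hu : Γ.IsMul (Γ.unit a) k k := Γ.isMul_unit_left k (by rw [← hg, q.1])
  rw [F.star_mul q rfl rfl rfl q.inv, F.mul_assoc q.inv p q.inv_left p₂,
    ← F.mul_assoc p₀ hu q q.inv_left, ← F.mul_assoc p₁ p₂ hu p₂]

/-- By right invariance of the measures, ⟨ξe, ηe'⟩ = e*⟨ξ, η⟩e': the map ξ ⊗ e ↦ ξe preserves the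
inner products of an interior tensor product. Boundedness of right multiplication and existence of
`transport` rest on it. -/
theorem ipPre_rmulPre {x y : M} (k : G) (ht : Γ.tgt k = x) (hs : Γ.src k = y) (e e' : E k)
    (ξ η : F.CcFib x) : F.ipPre lam y (F.rmulPre k ht hs e ξ) (F.rmulPre k ht hs e' η) =
      F.mul (Γ.isMul_inv_left k hs) (F.mul (Γ.isMul_unit_right (Γ.inv k) ((Γ.src_inv k).trans ht))
        (F.star rfl e) (F.ipPre lam x ξ η)) e' := by
  have hi := F.integrable_ip_integrand lam x ξ η
  unfold ipPre
  have hi' : Integrable (fun g : Γ.SFib x => F.mul (Γ.isMul_unit_right (Γ.inv k)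
      ((Γ.src_inv k).trans ht)) (F.star rfl e) (F.mul (Γ.isMul_inv_self g)
        (F.star rfl (ξ.eval g)) (η.eval g))) (lam.smeas x) := (F.mulL _ _).integrable_comp hi
  rw [lam.integral_rightMul k ht hs, F.mul_integral _ _ hi, F.integral_mul _ _ hi']
  congr 1 with g
  rw [rmulPre_eval_rightMul, rmulPre_eval_rightMul]
  exact F.rmul_integrand (Γ.isMul_rightMul k ht hs g) g.2 _ _ _ _ _ _ _ _

theorem rmulPre_add {x y : M} (k : G) (ht : Γ.tgt k = x) (hs : Γ.src k = y) (e : E k)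
    (ξ η : F.CcFib x) : F.rmulPre k ht hs e (ξ + η) =
      F.rmulPre k ht hs e ξ + F.rmulPre k ht hs e η :=
  CcFib.ext fun _ => F.add_mul _ _ _ _

theorem rmulPre_smul {x y : M} (k : G) (ht : Γ.tgt k = x) (hs : Γ.src k = y) (e : E k)
    (c : ℂ) (ξ : F.CcFib x) : F.rmulPre k ht hs e (c • ξ) = c • F.rmulPre k ht hs e ξ :=
  CcFib.ext fun _ => F.smul_mul _ _ _ _

theorem norm_rmulPre_le {x y : M} (k : G) (ht : Γ.tgt k = x) (hs : Γ.src k = y) (e : E k)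
    (ξ : F.CcFib x) : ‖F.toL2Fib lam y (F.rmulPre k ht hs e ξ)‖ ≤ ‖e‖ * ‖F.toL2Fib lam x ξ‖ := by
  rw [norm_toL2Fib]
  refine Real.sqrt_le_iff.2 ⟨by positivity, ?_⟩
  rw [ipPre_rmulPre, mul_pow, ← norm_toL2Fib_sq]
  refine (F.norm_mul_le _ _ _).trans ?_
  calc _ ≤ ‖F.star rfl e‖ * ‖F.ipPre lam x ξ ξ‖ * ‖e‖ := by
        gcongr
        exact F.norm_mul_le _ _ _
    _ = _ := by rw [norm_star]; ring

/-- Right multiplication by `e`, as a bounded operator. -/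
def rmulL {x y : M} (k : G) (ht : Γ.tgt k = x) (hs : Γ.src k = y) (e : E k) :
    F.L2Fib lam x →L[ℂ] F.L2Fib lam y :=
  LinearMap.extendOfNorm
    { toFun := fun ξ => F.toL2Fib lam y (F.rmulPre k ht hs e ξ)
      map_add' := fun ξ η => by rw [rmulPre_add, toL2Fib_add]
      map_smul' := fun c ξ => by rw [rmulPre_smul, toL2Fib_smul, RingHom.id_apply] }
    (F.toL2FibL lam x)

theorem rmulL_coe {x y : M} (k : G) (ht : Γ.tgt k = x) (hs : Γ.src k = y) (e : E k)
    (ξ : F.CcFib x) : F.rmulL lam k ht hs e (F.toL2Fib lam x ξ) =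
      F.toL2Fib lam y (F.rmulPre k ht hs e ξ) :=
  LinearMap.extendOfNorm_eq (F.denseRange_toL2Fib lam x) ⟨‖e‖, F.norm_rmulPre_le lam k ht hs e⟩ ξ

theorem rmul_eq {x y : M} (k : G) (ht : Γ.tgt k = x) (hs : Γ.src k = y) (e : E k)
    (u : F.L2Fib lam x) : F.rmul lam k ht hs e u = F.rmulL lam k ht hs e u := by
  have hunif : UniformContinuous fun ξ : F.PreL2 lam x =>
      (show F.PreL2 lam y from F.rmulPre k ht hs e ξ) := by
    let φ : F.PreL2 lam x →+ F.PreL2 lam y :=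
      AddMonoidHom.mk' (fun ξ => F.rmulPre k ht hs e ξ) (F.rmulPre_add k ht hs e)
    refine (AddMonoidHomClass.lipschitz_of_bound φ ‖e‖ fun ξ => ?_).uniformContinuous
    rw [norm_preL2, norm_preL2]
    exact F.norm_rmulPre_le lam k ht hs e ξ
  have hc : Continuous (F.rmul lam k ht hs e) := UniformSpace.Completion.continuous_map
  induction u using l2Fib_induction with
  | hP =>
    exact isClosed_eq hc (F.rmulL lam k ht hs e).continuous
  | h ξ =>
    rw [rmulL_coe]
    exact UniformSpace.Completion.map_coe hunif _

theorem norm_rmulL_le {x y : M} (k : G) (ht : Γ.tgt k = x) (hs : Γ.src k = y) (e : E k)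
    (u : F.L2Fib lam x) : ‖F.rmulL lam k ht hs e u‖ ≤ ‖e‖ * ‖u‖ :=
  LinearMap.norm_extendOfNorm_apply_le (F.denseRange_toL2Fib lam x) ‖e‖
    (F.norm_rmulPre_le lam k ht hs e) u

theorem ip_rmulL {x y : M} (k : G) (ht : Γ.tgt k = x) (hs : Γ.src k = y) (e e' : E k)
    (u v : F.L2Fib lam x) : F.ip lam y (F.rmulL lam k ht hs e u) (F.rmulL lam k ht hs e' v) =
      F.mul (Γ.isMul_inv_left k hs) (F.mul (Γ.isMul_unit_right (Γ.inv k) ((Γ.src_inv k).trans ht))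
        (F.star rfl e) (F.ip lam x u v)) e' := by
  have hc : Continuous fun a : E (Γ.unit x) => F.mul (Γ.isMul_inv_left k hs)
      (F.mul (Γ.isMul_unit_right (Γ.inv k) ((Γ.src_inv k).trans ht)) (F.star rfl e) a) e' :=
    ((F.mulL (Γ.isMul_inv_left k hs)).flip e').continuous.comp
      (F.mulL (Γ.isMul_unit_right (Γ.inv k) ((Γ.src_inv k).trans ht)) (F.star rfl e)).continuous
  induction u using l2Fib_induction with
  | hP =>
    exact isClosed_eq (continuous_ip_comp (F.rmulL lam k ht hs e).continuous continuous_const)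
      (hc.comp (continuous_ip_comp continuous_id continuous_const))
  | h ξ =>
  induction v using l2Fib_induction with
  | hP =>
    exact isClosed_eq (continuous_ip_comp continuous_const (F.rmulL lam k ht hs e').continuous)
      (hc.comp (continuous_ip_comp continuous_const continuous_id))
  | h η => rw [rmulL_coe, rmulL_coe, ip_coe, ip_coe, ipPre_rmulPre]

theorem rmulL_add {x y : M} (k : G) (ht : Γ.tgt k = x) (hs : Γ.src k = y) (e e' : E k)
    (u : F.L2Fib lam x) : F.rmulL lam k ht hs (e + e') u =
      F.rmulL lam k ht hs e u + F.rmulL lam k ht hs e' u := by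
  induction u using l2Fib_induction with
  | hP =>
    exact isClosed_eq (F.rmulL lam k ht hs _).continuous
      ((F.rmulL lam k ht hs _).continuous.add (F.rmulL lam k ht hs _).continuous)
  | h ξ =>
    rw [rmulL_coe, rmulL_coe, rmulL_coe, ← toL2Fib_add]
    congr 1
    exact CcFib.ext fun _ => F.mul_add _ _ _ _

theorem rmulL_smul {x y : M} (k : G) (ht : Γ.tgt k = x) (hs : Γ.src k = y) (c : ℂ) (e : E k)
    (u : F.L2Fib lam x) : F.rmulL lam k ht hs (c • e) u = c • F.rmulL lam k ht hs e u := by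
  induction u using l2Fib_induction with
  | hP =>
    exact isClosed_eq (F.rmulL lam k ht hs _).continuous
      ((F.rmulL lam k ht hs _).continuous.const_smul c)
  | h ξ =>
    rw [rmulL_coe, rmulL_coe, ← toL2Fib_smul]
    congr 1
    exact CcFib.ext fun _ => F.mul_smul _ _ _ _

/-- The sections of the form `∑ ξᵢ eᵢ`. -/
def rmulSpan {x y : M} (k : G) (ht : Γ.tgt k = x) (hs : Γ.src k = y) :
    Submodule ℂ (∀ g : Γ.SFib y, E g.1) :=
  Submodule.span ℂ {s | ∃ (e : E k) (ξ : F.CcFib x), s = fun g => (F.rmulPre k ht hs e ξ).eval g}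

/-- A scalar function passes to the first factor after translation: φ·(ξe) = (φ'ξ)e with φ'(g) =
φ(gk). -/
theorem rmulSpan_smul {x y : M} (k : G) (ht : Γ.tgt k = x) (hs : Γ.src k = y) (φ : C(G, ℝ)) :
    ∀ s ∈ F.rmulSpan k ht hs, (fun g : Γ.SFib y => ((φ g.1 : ℝ) : ℂ) • s g) ∈
      F.rmulSpan k ht hs := by
  refine mulBy_mem_span (w := fun g : Γ.SFib y => ((φ g.1 : ℝ) : ℂ)) ?_
  rintro _ ⟨e, ξ, rfl⟩
  have hc : Continuous fun g : Γ.SFib x => ((φ (Γ.rightMul k ht hs g).1 : ℝ) : ℂ) :=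
    Complex.continuous_ofReal.comp (φ.continuous.comp (Γ.continuous_mul_comp continuous_subtype_val
      continuous_const fun g => Γ.isMul_rightMul k ht hs g))
  refine Submodule.subset_span ⟨e, F.fibMul ⟨_, hc⟩ ξ, ?_⟩
  ext g
  have e1 : g.1 = (Γ.rightMul k ht hs (Γ.rightDiv k ht hs g)).1 :=
    (Γ.isMul_rightDiv k ht hs g).unique (Γ.isMul_rightMul k ht hs _)
  change ((φ g.1 : ℝ) : ℂ) • F.mul (Γ.isMul_rightDiv k ht hs g) (ξ.eval (Γ.rightDiv k ht hs g)) e =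
    F.mul (Γ.isMul_rightDiv k ht hs g) (((φ (Γ.rightMul k ht hs (Γ.rightDiv k ht hs g)).1 : ℝ) : ℂ) •
      ξ.eval (Γ.rightDiv k ht hs g)) e
  rw [F.smul_mul, ← e1]

theorem rmulSpan_continuous {x y : M} (k : G) (ht : Γ.tgt k = x) (hs : Γ.src k = y) :
    ∀ s ∈ F.rmulSpan k ht hs, Continuous fun g : Γ.SFib y => (⟨g.1, s g⟩ : Tot E) := by
  intro s hs
  induction hs using Submodule.span_induction with
  | mem s hs =>
    obtain ⟨e, ξ, rfl⟩ := hs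
    exact CcFib.continuous _
  | zero => exact F.isField.continuous_zero_comp continuous_subtype_val
  | add s t _ _ hs ht => exact F.isField.continuous_add_comp hs ht
  | smul c s _ hs => exact F.isField.continuous_smul_comp continuous_const hs

/-- Fullness for the factorization g = (gk⁻¹)k: products of E_{gk⁻¹} and E_k span a dense subspace
of E_g, and every element of E_{gk⁻¹} is the value of a section. -/
theorem rmulSpan_dense [LocallyCompactSpace G] [T2Space M] {x y : M} (k : G) (ht : Γ.tgt k = x)
    (hs : Γ.src k = y) (g : Γ.SFib y) (e : E g.1) : ∀ ε > 0, ∃ s ∈ F.rmulSpan k ht hs, ‖s g - e‖ < ε := by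
  intro ε hε
  obtain ⟨_, ⟨s, hs', rfl⟩, h⟩ := F.exists_norm_sub_lt (Γ.isMul_rightDiv k ht hs g)
    ((F.rmulSpan k ht hs).map (LinearMap.proj g)) (fun a b => by
      obtain ⟨ξ, hξ⟩ := F.exists_cc (Γ.rightDiv k ht hs g).1 a
      refine ⟨_, Submodule.subset_span ⟨b, F.restrict x ξ, rfl⟩, ?_⟩
      change F.mul (Γ.isMul_rightDiv k ht hs g) (F.ev ξ (Γ.rightDiv k ht hs g).1) b = _
      rw [hξ]) e hε
  exact ⟨s, hs', h⟩

end FellBundle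

end

end FellGroupoid

namespace FellGroupoid

noncomputable section

namespace FellBundle

variable {G M : Type*} [TopologicalSpace G] [TopologicalSpace M] {Γ : TopGroupoid G M} {E : G → Type*}
  [∀ g, NormedAddCommGroup (E g)] [∀ g, NormedSpace ℂ (E g)] [TopologicalSpace (Tot E)]
  (F : FellBundle Γ E)

/-! ### Kernel operators -/

theorem _root_.FellGroupoid.TopGroupoid.continuous_div {Y : Type*} [TopologicalSpace Y] {g k : Y → G}
    (hg : Continuous g) (hk : Continuous k) (e : ∀ y, Γ.src (g y) = Γ.src (k y)) :
    Continuous fun y => Γ.div (g y) (k y) (e y) :=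
  Γ.continuous_mul_comp hg (Γ.continuous_inv.comp hk) fun y => Γ.isMul_div' _ _ (e y)

theorem _root_.FellGroupoid.TopGroupoid.inv_div (g k : G) (e : Γ.src g = Γ.src k) :
    Γ.inv (Γ.div g k e) = Γ.div k g e.symm := by
  have h1 := (Γ.isMul_div' g k e).inv
  rw [Γ.inv_inv] at h1
  exact h1.unique (Γ.isMul_div' k g e.symm)

/-- The arrow `gk⁻¹` for `g, k ∈ Γ_x`. -/
def fdiv {x : M} (g k : Γ.SFib x) : G := Γ.div g.1 k.1 (g.2.trans k.2.symm)

theorem isMul_fdiv {x : M} (g k : Γ.SFib x) : Γ.IsMul (fdiv g k) k.1 g.1 := Γ.isMul_div _ _ _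

theorem isMul_fdiv' {x : M} (g k : Γ.SFib x) : Γ.IsMul g.1 (Γ.inv k.1) (fdiv g k) :=
  Γ.isMul_div' _ _ _

theorem inv_fdiv {x : M} (g k : Γ.SFib x) : Γ.inv (fdiv g k) = fdiv k g := Γ.inv_div _ _ _

/-- The map `(g, k) ↦ gk⁻¹` on `Γ_x × Γ_x`. -/
def divMap (_ : FellBundle Γ E) (x : M) : C(Γ.SFib x × Γ.SFib x, G) :=
  ⟨fun p => fdiv p.1 p.2, Γ.continuous_div (continuous_subtype_val.comp continuous_fst)
    (continuous_subtype_val.comp continuous_snd) _⟩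

/-- The compactly supported continuous kernels on `Γ_x × Γ_x`. -/
abbrev FibKer (x : M) : Submodule ℂ (∀ p : Γ.SFib x × Γ.SFib x, E (F.divMap x p)) :=
  CcSection F.isField (F.divMap x)

variable {F}

/-- Evaluation of a kernel. -/
def kev {x : M} (K : F.FibKer x) (g k : Γ.SFib x) : E (fdiv g k) := K.1 (g, k)

theorem kev_sub {x : M} (K K' : F.FibKer x) (g k : Γ.SFib x) :
    kev (K - K') g k = kev K g k - kev K' g k := rfl

theorem kev_add {x : M} (K K' : F.FibKer x) (g k : Γ.SFib x) :
    kev (K + K') g k = kev K g k + kev K' g k := rfl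

theorem kev_smul {x : M} (c : ℂ) (K : F.FibKer x) (g k : Γ.SFib x) :
    kev (c • K) g k = c • kev K g k := rfl

theorem continuous_kev {x : M} (K : F.FibKer x) :
    Continuous fun p : Γ.SFib x × Γ.SFib x => (⟨fdiv p.1 p.2, kev K p.1 p.2⟩ : Tot E) := K.2.1

theorem exists_support_kev {x : M} (K : F.FibKer x) : ∃ L : Set G, IsCompact L ∧
    ∀ g k : Γ.SFib x, (g.1 ∉ L ∨ k.1 ∉ L) → kev K g k = 0 := by
  obtain ⟨-, C, hC, h0⟩ := K.2
  refine ⟨(fun p : Γ.SFib x × Γ.SFib x => p.1.1) '' C ∪ (fun p : Γ.SFib x × Γ.SFib x => p.2.1) '' C,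
    (hC.image (continuous_subtype_val.comp continuous_fst)).union
      (hC.image (continuous_subtype_val.comp continuous_snd)), fun g k h => h0 (g, k) fun hgk => ?_⟩
  rcases h with h | h
  · exact h (Or.inl ⟨_, hgk, rfl⟩)
  · exact h (Or.inr ⟨_, hgk, rfl⟩)

variable (F)

/-- Kernels on a fibre. -/
def mkKer [T2Space M] {x : M} (u : ∀ g k : Γ.SFib x, E (fdiv g k))
    (hu : Continuous fun p : Γ.SFib x × Γ.SFib x => (⟨fdiv p.1 p.2, u p.1 p.2⟩ : Tot E))
    (h0 : ∃ L : Set G, IsCompact L ∧ ∀ g k : Γ.SFib x, (g.1 ∉ L ∨ k.1 ∉ L) → u g k = 0) : F.FibKer x :=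
  ⟨fun p => u p.1 p.2, hu, by
    obtain ⟨L, hL, h⟩ := h0
    have hc := (Γ.isClosedEmbedding_sfib x).isCompact_preimage hL
    refine ⟨_, hc.prod hc, fun p hp => h p.1 p.2 ?_⟩
    rw [Set.mem_prod, not_and_or] at hp
    exact hp⟩

@[simp]
theorem mkKer_kev [T2Space M] {x : M} (u : ∀ g k : Γ.SFib x, E (fdiv g k)) (hu) (h0) (g k : Γ.SFib x) :
    kev (F.mkKer u hu h0) g k = u g k := rfl

variable [T2Space M]

/-- The adjoint kernel. -/
def kerAdj {x : M} (K : F.FibKer x) : F.FibKer x :=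
  F.mkKer (fun g k => F.star (inv_fdiv k g) (kev K k g))
    (F.continuous_star_comp (g := fun p : Γ.SFib x × Γ.SFib x => fdiv p.2 p.1)
      (fun p => inv_fdiv p.2 p.1) ((continuous_kev K).comp continuous_swap)) (by
      obtain ⟨L, hL, h⟩ := exists_support_kev K
      exact ⟨L, hL, fun g k hgk => by rw [h k g hgk.symm, star_zero]⟩)

theorem kerAdj_kev {x : M} (K : F.FibKer x) (g k : Γ.SFib x) :
    kev (F.kerAdj K) g k = F.star (inv_fdiv k g) (kev K k g) := rfl

theorem kerAdj_kerAdj {x : M} (K : F.FibKer x) : F.kerAdj (F.kerAdj K) = K := by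
  refine Subtype.ext (funext fun p => ?_)
  exact F.star_star _ _ (kev K p.1 p.2)

/-- The kernel `ξ(g) η(k)*`. -/
def rankOneKer {x : M} (ξ η : F.CcFib x) : F.FibKer x :=
  F.mkKer (fun g k => F.mul (isMul_fdiv' g k) (ξ.eval g) (F.star rfl (η.eval k)))
    (F.continuous_mul_comp (fun p : Γ.SFib x × Γ.SFib x => isMul_fdiv' p.1 p.2)
      (ξ.continuous.comp continuous_fst)
      (F.continuous_star_comp (fun _ => rfl) (η.continuous.comp continuous_snd))) (by
      obtain ⟨L, hL, h⟩ := ξ.exists_support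
      obtain ⟨L', hL', h'⟩ := η.exists_support
      refine ⟨L ∪ L', hL.union hL', fun g k hgk => ?_⟩
      rcases hgk with hgk | hgk
      · rw [h g fun hg => hgk (Or.inl hg), zero_mul]
      · rw [h' k fun hk => hgk (Or.inr hk), star_zero, mul_zero])

variable [MeasurableSpace G] [BorelSpace G] [T2Space G] [LocallyCompactSpace G] (lam : HaarSystem Γ)

variable {F} in
theorem continuous_kerOp_integrand {x : M} (K : F.FibKer x) (η : F.CcFib x) (g : Γ.SFib x) :
    Continuous fun k : Γ.SFib x => F.mul (isMul_fdiv g k) (kev K g k) (η.eval k) := by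
  rw [(F.isField.inducing_mk g.1).continuous_iff]
  exact F.continuous_mul_comp (fun k => isMul_fdiv g k)
    ((continuous_kev K).comp (continuous_const.prodMk continuous_id)) η.continuous

variable {F} in
theorem integrable_kerOp {x : M} (K : F.FibKer x) (η : F.CcFib x) (g : Γ.SFib x) :
    Integrable (fun k : Γ.SFib x => F.mul (isMul_fdiv g k) (kev K g k) (η.eval k))
      (lam.smeas x) := by
  obtain ⟨L, hL, h⟩ := η.exists_support
  exact lam.integrable_of_support (continuous_kerOp_integrand K η g) hL fun k hk => by
    rw [h k hk, mul_zero]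

/-- The operator `(Kη)(g) = ∫ K(g, k) η(k) dλ_x(k)`. -/
def kerOp {x : M} (K : F.FibKer x) (η : F.CcFib x) : F.CcFib x :=
  F.mkFib (fun g => ∫ k, F.mul (isMul_fdiv g k) (kev K g k) (η.eval k) ∂(lam.smeas x))
    (by
      obtain ⟨L, hL, h⟩ := η.exists_support
      refine continuous_iff_continuousAt.2 fun g => lam.continuousAt_integral F.isField F.complete
        (p := fun _ : Γ.SFib x => x) continuous_const continuous_subtype_val
        (fun g k => F.mul (isMul_fdiv g k) (kev K g k) (η.eval k)) ?_ hL
        (Eventually.of_forall fun g k hk => by rw [h k hk, mul_zero])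
      have hk : Continuous fun z : Γ.FibProd (fun _ : Γ.SFib x => x) => (⟨z.1.2, z.2⟩ : Γ.SFib x) :=
        (continuous_snd.comp continuous_subtype_val).subtype_mk _
      exact F.continuous_mul_comp (fun z : Γ.FibProd (fun _ : Γ.SFib x => x) =>
        isMul_fdiv z.1.1 ⟨z.1.2, z.2⟩)
        ((continuous_kev K).comp ((continuous_fst.comp continuous_subtype_val).prodMk hk))
        (η.continuous.comp hk))
    (by
      obtain ⟨L, hL, h⟩ := exists_support_kev K
      refine ⟨L, hL, fun g hg => ?_⟩
      simp only [h g _ (Or.inl hg), zero_mul, integral_zero])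

theorem kerOp_eval {x : M} (K : F.FibKer x) (η : F.CcFib x) (g : Γ.SFib x) :
    (F.kerOp lam K η).eval g =
      ∫ k, F.mul (isMul_fdiv g k) (kev K g k) (η.eval k) ∂(lam.smeas x) := rfl

theorem kerOp_add_right {x : M} (K : F.FibKer x) (η ζ : F.CcFib x) :
    F.kerOp lam K (η + ζ) = F.kerOp lam K η + F.kerOp lam K ζ := by
  refine CcFib.ext fun g => ?_
  rw [CcFib.eval_add, kerOp_eval, kerOp_eval, kerOp_eval,
    ← integral_add (integrable_kerOp lam K η g) (integrable_kerOp lam K ζ g)]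
  simp only [CcFib.eval_add, F.mul_add]

theorem kerOp_add_left {x : M} (K K' : F.FibKer x) (η : F.CcFib x) :
    F.kerOp lam (K + K') η = F.kerOp lam K η + F.kerOp lam K' η := by
  refine CcFib.ext fun g => ?_
  rw [CcFib.eval_add, kerOp_eval, kerOp_eval, kerOp_eval,
    ← integral_add (integrable_kerOp lam K η g) (integrable_kerOp lam K' η g)]
  simp only [kev_add, F.add_mul]

theorem kerOp_sub_left {x : M} (K K' : F.FibKer x) (η : F.CcFib x) :
    F.kerOp lam (K - K') η = F.kerOp lam K η - F.kerOp lam K' η := by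
  refine CcFib.ext fun g => ?_
  rw [CcFib.eval_sub, kerOp_eval, kerOp_eval, kerOp_eval,
    ← integral_sub (integrable_kerOp lam K η g) (integrable_kerOp lam K' η g)]
  simp only [kev_sub, F.sub_mul]

theorem kerOp_smul_left {x : M} (c : ℂ) (K : F.FibKer x) (η : F.CcFib x) :
    F.kerOp lam (c • K) η = c • F.kerOp lam K η := by
  refine CcFib.ext fun g => ?_
  rw [CcFib.eval_smul, kerOp_eval, kerOp_eval, ← integral_smul]
  simp only [kev_smul, F.smul_mul]

/-- The factor ξ(g) comes out of the integral, leaving ∫ η(k)*ζ(k) = ⟨η, ζ⟩. -/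
theorem kerOp_rankOneKer {x : M} (ξ η ζ : F.CcFib x) : F.kerOp lam (F.rankOneKer ξ η) ζ =
    F.rmulPre (Γ.unit x) (Γ.tgt_unit x) (Γ.src_unit x) (F.ipPre lam x η ζ) ξ := by
  refine CcFib.ext fun g => ?_
  rw [rmulPre_unit_eval, kerOp_eval, ipPre,
    F.mul_integral _ _ (F.integrable_ip_integrand lam x η ζ)]
  congr 1 with k
  exact F.mul_assoc _ _ _ _ _ _ _

/-- Fubini for the continuous compactly supported double integrand (K(g,k)η(k))*ζ(g) =
η(k)*(K(g,k)*ζ(g)). -/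
theorem ipPre_kerOp {x : M} (K : F.FibKer x) (η ζ : F.CcFib x) :
    F.ipPre lam x (F.kerOp lam K η) ζ = F.ipPre lam x η (F.kerOp lam (F.kerAdj K) ζ) := by
  have hpt : ∀ g k : Γ.SFib x, F.mul (Γ.isMul_inv_self g)
      (F.star rfl (F.mul (isMul_fdiv g k) (kev K g k) (η.eval k))) (ζ.eval g) =
      F.mul (Γ.isMul_inv_self k) (F.star rfl (η.eval k))
        (F.mul (isMul_fdiv k g) (kev (F.kerAdj K) k g) (ζ.eval g)) := by
    intro g k
    have h1 : Γ.IsMul (Γ.inv k.1) (fdiv k g) (Γ.inv g.1) := by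
      have := (isMul_fdiv g k).inv
      rwa [inv_fdiv] at this
    rw [F.star_mul (isMul_fdiv g k) (inv_fdiv g k) rfl rfl h1,
      F.mul_assoc h1 (Γ.isMul_inv_self g) (isMul_fdiv k g) (Γ.isMul_inv_self k)]
    rfl
  obtain ⟨L, hL, h⟩ := ζ.exists_support
  obtain ⟨L', hL', h'⟩ := η.exists_support
  have hi : ∀ g, Integrable (fun k : Γ.SFib x => F.star rfl
      (F.mul (isMul_fdiv g k) (kev K g k) (η.eval k))) (lam.smeas x) := fun g =>
    (F.starL rfl).integrable_comp (integrable_kerOp lam K η g)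
  calc F.ipPre lam x (F.kerOp lam K η) ζ
      = ∫ g, ∫ k, F.mul (Γ.isMul_inv_self g) (F.star rfl (F.mul (isMul_fdiv g k) (kev K g k)
          (η.eval k))) (ζ.eval g) ∂(lam.smeas x) ∂(lam.smeas x) := by
        unfold ipPre
        congr 1 with g
        rw [kerOp_eval, F.star_integral _ (integrable_kerOp lam K η g), F.integral_mul _ _ (hi g)]
    _ = ∫ k, ∫ g, F.mul (Γ.isMul_inv_self g) (F.star rfl (F.mul (isMul_fdiv g k) (kev K g k)
          (η.eval k))) (ζ.eval g) ∂(lam.smeas x) ∂(lam.smeas x) := by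
        refine integral_integral_swap_of_hasCompactSupport ?_ ?_
        · rw [(F.isField.inducing_mk (Γ.unit x)).continuous_iff]
          exact F.continuous_mul_comp (fun p : Γ.SFib x × Γ.SFib x => Γ.isMul_inv_self p.1)
            (F.continuous_star_comp (fun _ => rfl)
              (F.continuous_mul_comp (fun p : Γ.SFib x × Γ.SFib x => isMul_fdiv p.1 p.2)
                (continuous_kev K) (η.continuous.comp continuous_snd)))
            (ζ.continuous.comp continuous_fst)
        · refine HasCompactSupport.intro
            (((Γ.isClosedEmbedding_sfib x).isCompact_preimage hL).prod
              ((Γ.isClosedEmbedding_sfib x).isCompact_preimage hL')) fun p hp => ?_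
          rw [Set.mem_prod, not_and_or] at hp
          change F.mul (Γ.isMul_inv_self p.1) (F.star rfl (F.mul (isMul_fdiv p.1 p.2)
            (kev K p.1 p.2) (η.eval p.2))) (ζ.eval p.1) = 0
          rcases hp with hp | hp
          · rw [h _ hp, mul_zero]
          · rw [h' _ hp, mul_zero, star_zero, zero_mul]
    _ = F.ipPre lam x η (F.kerOp lam (F.kerAdj K) ζ) := by
        unfold ipPre
        congr 1 with k
        rw [kerOp_eval, F.mul_integral _ _ (integrable_kerOp lam (F.kerAdj K) ζ k)]
        simp only [hpt]

/-- A supremum estimate needs only the row integrals; the column integrals of K are the row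
integrals of its adjoint. -/
theorem norm_kerOp_eval_le {x : M} (K : F.FibKer x) {C s : ℝ} (hC0 : 0 ≤ C) (hs : 0 ≤ s)
    (hC : ∀ g, ∫⁻ k, ‖kev K g k‖ₑ ∂(lam.smeas x) ≤ ENNReal.ofReal C) (η : F.CcFib x)
    (hη : ∀ k, ‖η.eval k‖ ≤ s) (g : Γ.SFib x) : ‖(F.kerOp lam K η).eval g‖ ≤ C * s := by
  have h : ‖(F.kerOp lam K η).eval g‖ₑ ≤ ENNReal.ofReal (C * s) := by
    calc _ ≤ ∫⁻ k, ‖F.mul (isMul_fdiv g k) (kev K g k) (η.eval k)‖ₑ ∂(lam.smeas x) :=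
          enorm_integral_le_lintegral_enorm _
      _ ≤ ∫⁻ k, ‖kev K g k‖ₑ * ENNReal.ofReal s ∂(lam.smeas x) := by
          refine lintegral_mono fun k => ?_
          rw [← ofReal_norm, ← ofReal_norm, ← ENNReal.ofReal_mul (norm_nonneg _)]
          exact ENNReal.ofReal_le_ofReal ((F.norm_mul_le _ _ _).trans
            (mul_le_mul_of_nonneg_left (hη k) (norm_nonneg _)))
      _ = (∫⁻ k, ‖kev K g k‖ₑ ∂(lam.smeas x)) * ENNReal.ofReal s :=
          lintegral_mul_const' _ _ ENNReal.ofReal_ne_top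
      _ ≤ ENNReal.ofReal C * ENNReal.ofReal s := by gcongr; exact hC g
      _ = _ := (ENNReal.ofReal_mul hC0).symm
  rw [← ofReal_norm] at h
  exact (ENNReal.ofReal_le_ofReal_iff (by positivity)).1 h

/-- The Schur test. -/
theorem norm_kerOp_le {x : M} (K : F.FibKer x) {C : ℝ} (hC0 : 0 ≤ C)
    (hrow : ∀ g, ∫⁻ k, ‖kev K g k‖ₑ ∂(lam.smeas x) ≤ ENNReal.ofReal C)
    (hcol : ∀ k, ∫⁻ g, ‖kev K g k‖ₑ ∂(lam.smeas x) ≤ ENNReal.ofReal C) (η : F.CcFib x) :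
    ‖F.toL2Fib lam x (F.kerOp lam K η)‖ ≤ 4 * C * ‖F.toL2Fib lam x η‖ := by
  have hrow' : ∀ g, ∫⁻ k, ‖kev (F.kerAdj K) g k‖ₑ ∂(lam.smeas x) ≤ ENNReal.ofReal C := by
    intro g
    refine le_of_eq_of_le ?_ (hcol g)
    congr 1 with k
    rw [kerAdj_kev, ← ofReal_norm, norm_star, ofReal_norm]
  obtain ⟨L, hL, h⟩ := exists_support_kev (F.kerAdj K)
  obtain ⟨L', hL', h'⟩ := η.exists_support
  obtain ⟨s, hs, hη⟩ := η.exists_bound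
  obtain ⟨D, hD0, hD⟩ := lam.exists_smeas_le (hL.union hL')
  -- The iterates of K*K grow at most like (C²)ⁿ in supremum norm and keep their support in L ∪ L'.
  -- Hence they have the same growth in L², and `norm_le_of_adjoint` turns this into an operator
  -- bound in which the bound and the support of η no longer appear.
  have hiter : ∀ n : ℕ, (∀ g, ‖((fun v => F.kerOp lam (F.kerAdj K) (F.kerOp lam K v))^[n] η).eval g‖ ≤
      (C ^ 2) ^ n * s) ∧ ∀ g : Γ.SFib x, g.1 ∉ L ∪ L' →
      ((fun v => F.kerOp lam (F.kerAdj K) (F.kerOp lam K v))^[n] η).eval g = 0 := by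
    intro n
    induction n with
    | zero =>
      refine ⟨fun g => by simpa using hη g, fun g hg => h' g fun h => hg (Or.inr h)⟩
    | succ n ih =>
      rw [Function.iterate_succ_apply']
      refine ⟨fun g => ?_, fun g hg => ?_⟩
      · refine (F.norm_kerOp_eval_le lam _ hC0 (s := C * ((C ^ 2) ^ n * s)) (by positivity) hrow' _
          (F.norm_kerOp_eval_le lam _ hC0 (by positivity) hrow _ ih.1) g).trans_eq (by ring)
      · rw [kerOp_eval]
        simp only [h g _ (Or.inl fun h => hg (Or.inl h)), zero_mul, integral_zero]
  refine norm_le_of_adjoint (fun u => ‖F.toL2Fib lam x u‖) (F.ipPre lam x) (fun _ => norm_nonneg _)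
    (F.norm_toL2Fib_sq lam x) (F.norm_ipPre_le lam x) (F.kerOp lam K) (F.kerOp lam (F.kerAdj K))
    (F.ipPre_kerOp lam K) (fun u v => ?_) (C := s * √D) hC0 fun n => ?_
  · rw [F.ipPre_kerOp, kerAdj_kerAdj]
  · refine (F.norm_toL2Fib_le lam (hL.union hL') (hD x) hD0 (by positivity) _ (hiter n).1
      (hiter n).2).trans_eq (by ring)

end FellBundle

end

end FellGroupoid

namespace FellGroupoid

noncomputable section

/-- When y depends on x in a Lipschitz way, witnesses for a convergent sequence form a Cauchy
sequence, and their limit is a witness. It serves for y an adjoint of the operator x. -/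
theorem isClosed_exists_of_norm_sub_le {X Y : Type*} [NormedAddCommGroup X] [NormedAddCommGroup Y]
    [CompleteSpace Y] {R : X → Y → Prop} {C : ℝ}
    (h : ∀ x x' y y', R x y → R x' y' → ‖y - y'‖ ≤ C * ‖x - x'‖)
    (hR : IsClosed {p : X × Y | R p.1 p.2}) : IsClosed {x | ∃ y, R x y} := by
  refine isClosed_of_closure_subset fun x hx => ?_
  obtain ⟨t, ht, hlim⟩ := mem_closure_iff_seq_limit.1 hx
  choose y hy using ht
  have hcauchy : CauchySeq y := by
    have h1 := hlim.cauchySeq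
    rw [Metric.cauchySeq_iff] at h1 ⊢
    intro ε hε
    obtain ⟨N, hN⟩ := h1 (ε / (|C| + 1)) (by positivity)
    refine ⟨N, fun m hm n hn => ?_⟩
    have h2 := hN m hm n hn
    rw [dist_eq_norm] at h2 ⊢
    rw [lt_div_iff₀ (by positivity)] at h2
    have h3 := h _ _ _ _ (hy m) (hy n)
    have h4 := le_abs_self C
    nlinarith [norm_nonneg (t m - t n)]
  obtain ⟨z, hz⟩ := cauchySeq_tendsto_of_complete hcauchy
  exact ⟨z, hR.mem_of_tendsto (hlim.prodMk_nhds hz) (Eventually.of_forall hy)⟩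

namespace FellBundle

variable {G M : Type*} [TopologicalSpace G] [TopologicalSpace M] {Γ : TopGroupoid G M} {E : G → Type*}
  [∀ g, NormedAddCommGroup (E g)] [∀ g, NormedSpace ℂ (E g)] [TopologicalSpace (Tot E)]
  [MeasurableSpace G] [BorelSpace G] [T2Space G] [LocallyCompactSpace G] [T2Space M]
  (F : FellBundle Γ E) (lam : HaarSystem Γ)

/-! ### The Hilbert module `L²(Γ; E)` and its operators -/

instance : CompleteSpace (F.L2 lam) :=
  (Submodule.isClosed_topologicalClosure _).completeSpace_coe

/-- The canonical map from `C_c(Γ; E)` to `L²(Γ; E)`, as a linear map. -/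
def toL2L : F.Cc →ₗ[ℂ] F.L2 lam where
  toFun := F.toL2 lam
  map_add' ξ η := Subtype.ext (map_add (F.toFamily lam) ξ η)
  map_smul' c ξ := Subtype.ext (map_smul (F.toFamily lam) c ξ)

theorem denseRange_toL2 : DenseRange (F.toL2 lam) := by
  intro ξ
  rw [Metric.mem_closure_range_iff]
  intro ε hε
  obtain ⟨_, ⟨η, rfl⟩, h⟩ := Metric.mem_closure_iff.1 ξ.2 ε hε
  exact ⟨η, h⟩

/-- The map `ξ ↦ ξ_x`. -/
def fiberL (x : M) : F.L2 lam →L[ℂ] F.L2Fib lam x :=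
  LinearMap.mkContinuous
    { toFun := fun ξ => F.fiberAt lam ξ x
      map_add' := fun _ _ => rfl
      map_smul' := fun _ _ => rfl } 1 fun ξ => by
      rw [one_mul]
      exact lp.norm_apply_le_norm ENNReal.top_ne_zero ξ.1 x

theorem fiberAt_add (x : M) (ξ η : F.L2 lam) :
    F.fiberAt lam (ξ + η) x = F.fiberAt lam ξ x + F.fiberAt lam η x := rfl

theorem fiberAt_sub (x : M) (ξ η : F.L2 lam) :
    F.fiberAt lam (ξ - η) x = F.fiberAt lam ξ x - F.fiberAt lam η x := rfl

theorem fiberAt_smul (x : M) (c : ℂ) (ξ : F.L2 lam) :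
    F.fiberAt lam (c • ξ) x = c • F.fiberAt lam ξ x := rfl

theorem fiberAt_toL2 (x : M) (ξ : F.Cc) :
    F.fiberAt lam (F.toL2 lam ξ) x = F.toL2Fib lam x (F.restrict x ξ) := rfl

theorem norm_fiberAt_le (x : M) (ξ : F.L2 lam) : ‖F.fiberAt lam ξ x‖ ≤ ‖ξ‖ :=
  lp.norm_apply_le_norm ENNReal.top_ne_zero ξ.1 x

variable {F lam}

theorem norm_le_of_fiberAt {ξ : F.L2 lam} {C : ℝ} (hC : 0 ≤ C) (h : ∀ x, ‖F.fiberAt lam ξ x‖ ≤ C) :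
    ‖ξ‖ ≤ C :=
  lp.norm_le_of_forall_le hC h

theorem l2_ext {ξ η : F.L2 lam} (h : ∀ x, F.fiberAt lam ξ x = F.fiberAt lam η x) : ξ = η :=
  Subtype.ext (lp.ext (funext h))

variable (F lam)

theorem denseRange_fiberAt (x : M) : DenseRange fun ξ : F.L2 lam => F.fiberAt lam ξ x :=
  (F.denseRange_restrict lam x).mono (by rintro _ ⟨ξ, rfl⟩; exact ⟨F.toL2 lam ξ, rfl⟩)

/-- The operator `T` acts fibrewise, with norm at most `C`. -/
def FibBound (T : F.L2 lam →L[ℂ] F.L2 lam) (C : ℝ) : Prop :=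
  ∀ ξ x, ‖F.fiberAt lam (T ξ) x‖ ≤ C * ‖F.fiberAt lam ξ x‖

/-- Extension to `L²(Γ; E)` of an operator on `C_c(Γ; E)` with uniformly bounded fibres. -/
theorem exists_extension (A : F.Cc →ₗ[ℂ] F.Cc) {C : ℝ} (hC : 0 ≤ C)
    (h : ∀ η x, ‖F.toL2Fib lam x (F.restrict x (A η))‖ ≤ C * ‖F.toL2Fib lam x (F.restrict x η)‖) :
    ∃ T : F.L2 lam →L[ℂ] F.L2 lam, (∀ η, T (F.toL2 lam η) = F.toL2 lam (A η)) ∧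
      F.FibBound lam T C := by
  have hb : ∀ η, ‖(F.toL2L lam ∘ₗ A) η‖ ≤ C * ‖F.toL2L lam η‖ := fun η =>
    norm_le_of_fiberAt (by positivity) fun x => (h η x).trans
      (mul_le_mul_of_nonneg_left (F.norm_fiberAt_le lam x (F.toL2 lam η)) hC)
  have hT : ∀ η, (F.toL2L lam ∘ₗ A).extendOfNorm (F.toL2L lam) (F.toL2 lam η) =
      F.toL2 lam (A η) :=
    LinearMap.extendOfNorm_eq (F.denseRange_toL2 lam) ⟨C, hb⟩
  refine ⟨(F.toL2L lam ∘ₗ A).extendOfNorm (F.toL2L lam), hT, fun ξ x => ?_⟩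
  refine (F.denseRange_toL2 lam).induction_on (p := fun ξ =>
    ‖F.fiberAt lam ((F.toL2L lam ∘ₗ A).extendOfNorm (F.toL2L lam) ξ) x‖ ≤
      C * ‖F.fiberAt lam ξ x‖) ξ ?_ fun η => ?_
  · exact isClosed_le ((F.fiberL lam x).continuous.comp (ContinuousLinearMap.continuous _)).norm
      ((F.fiberL lam x).continuous.norm.const_mul C)
  · rw [hT]
    exact h η x

variable {F lam}

theorem FibBound.opNorm_le {T : F.L2 lam →L[ℂ] F.L2 lam} {C : ℝ} (hC : 0 ≤ C)
    (h : F.FibBound lam T C) : ‖T‖ ≤ C :=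
  T.opNorm_le_bound hC fun ξ => norm_le_of_fiberAt (by positivity) fun x =>
    (h ξ x).trans (mul_le_mul_of_nonneg_left (F.norm_fiberAt_le lam x ξ) hC)

theorem FibBound.exists_fiberOp {T : F.L2 lam →L[ℂ] F.L2 lam} {C : ℝ} (h : F.FibBound lam T C)
    (x : M) : ∃ S : F.L2Fib lam x →L[ℂ] F.L2Fib lam x,
      ∀ ξ : F.L2 lam, S (F.fiberAt lam ξ x) = F.fiberAt lam (T ξ) x :=
  ⟨((F.fiberL lam x ∘L T).toLinearMap).extendOfNorm (F.fiberL lam x).toLinearMap,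
    LinearMap.extendOfNorm_eq (e := (F.fiberL lam x).toLinearMap) (F.denseRange_fiberAt lam x)
      ⟨C, fun ξ => h ξ x⟩⟩

theorem FibBound.fiberOp_apply {T : F.L2 lam →L[ℂ] F.L2 lam} {C : ℝ} (h : F.FibBound lam T C)
    (x : M) (ξ : F.L2 lam) :
    F.fiberOp lam T x (F.fiberAt lam ξ x) = F.fiberAt lam (T ξ) x := by
  have := h.exists_fiberOp x
  unfold fiberOp
  rw [dif_pos this]
  exact this.choose_spec ξ

theorem clm_eq_of_fiberAt {x : M} {S S' : F.L2Fib lam x →L[ℂ] F.L2Fib lam x}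
    (h : ∀ ξ : F.L2 lam, S (F.fiberAt lam ξ x) = S' (F.fiberAt lam ξ x)) : S = S' :=
  ContinuousLinearMap.ext fun u => congrFun (DenseRange.equalizer (F.denseRange_fiberAt lam x)
    S.continuous S'.continuous (funext h)) u

theorem clm_eq_of_toL2Fib {x : M} {S S' : F.L2Fib lam x →L[ℂ] F.L2Fib lam x}
    (h : ∀ ξ, S (F.toL2Fib lam x ξ) = S' (F.toL2Fib lam x ξ)) : S = S' :=
  ContinuousLinearMap.ext fun u => congrFun (DenseRange.equalizer (F.denseRange_toL2Fib lam x)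
    S.continuous S'.continuous (funext h)) u

/-- The vectors ξ_x are dense, so any bounded operator with the defining property is the chosen one,
and the default value 0 does not intervene. -/
theorem fiberOp_eq {T : F.L2 lam →L[ℂ] F.L2 lam} {x : M} {S : F.L2Fib lam x →L[ℂ] F.L2Fib lam x}
    (h : ∀ ξ : F.L2 lam, S (F.fiberAt lam ξ x) = F.fiberAt lam (T ξ) x) : F.fiberOp lam T x = S := by
  have h' : ∃ S : F.L2Fib lam x →L[ℂ] F.L2Fib lam x,
      ∀ ξ : F.L2 lam, S (F.fiberAt lam ξ x) = F.fiberAt lam (T ξ) x := ⟨S, h⟩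
  unfold fiberOp
  rw [dif_pos h']
  exact clm_eq_of_fiberAt fun ξ => (h'.choose_spec ξ).trans (h ξ).symm

theorem FibBound.norm_fiberOp_le {T : F.L2 lam →L[ℂ] F.L2 lam} {C : ℝ} (hC : 0 ≤ C)
    (h : F.FibBound lam T C) (x : M) : ‖F.fiberOp lam T x‖ ≤ C := by
  refine ContinuousLinearMap.opNorm_le_bound _ hC fun u => ?_
  refine (F.denseRange_fiberAt lam x).induction_on (p := fun u => ‖F.fiberOp lam T x u‖ ≤ C * ‖u‖)
    u ?_ fun ξ => ?_
  · exact isClosed_le (F.fiberOp lam T x).continuous.norm (continuous_norm.const_mul C)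
  · rw [h.fiberOp_apply]
    exact h ξ x

theorem FibBound.fiberOp_sub {T T' : F.L2 lam →L[ℂ] F.L2 lam} {C C' : ℝ} (h : F.FibBound lam T C)
    (h' : F.FibBound lam T' C') (x : M) :
    F.fiberOp lam (T - T') x = F.fiberOp lam T x - F.fiberOp lam T' x :=
  fiberOp_eq fun ξ => by
    rw [_root_.sub_apply, h.fiberOp_apply, h'.fiberOp_apply]
    rfl

variable (F lam)

/-- Multiplication by a bounded continuous function on `M`. -/
theorem exists_mulOp (φ : C(M, ℂ)) {C : ℝ} (hC : 0 ≤ C) (hφ : ∀ x, ‖φ x‖ ≤ C) :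
    ∃ T : F.L2 lam →L[ℂ] F.L2 lam, ‖T‖ ≤ C ∧
      ∀ ξ x, F.fiberAt lam (T ξ) x = φ x • F.fiberAt lam ξ x := by
  -- The function φ ∘ s is constant on Γ_x, with value φ(x).
  have hr : ∀ η x, F.toL2Fib lam x (F.restrict x (F.ccMul (φ.comp ⟨Γ.src, Γ.continuous_src⟩) η)) =
      φ x • F.toL2Fib lam x (F.restrict x η) := by
    intro η x
    rw [← toL2Fib_smul]
    congr 1
    refine CcFib.ext fun g => ?_
    rw [CcFib.eval_smul, restrict_eval, ccMul_ev, restrict_eval]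
    change φ (Γ.src g.1) • _ = _
    rw [g.2]
  obtain ⟨T, hT, hTC⟩ := F.exists_extension lam (F.ccMul (φ.comp ⟨Γ.src, Γ.continuous_src⟩)) hC
    fun η x => by
      rw [hr, norm_smul]
      exact mul_le_mul_of_nonneg_right (hφ x) (norm_nonneg _)
  refine ⟨T, hTC.opNorm_le hC, fun ξ x => ?_⟩
  refine (F.denseRange_toL2 lam).induction_on (p := fun ξ =>
    F.fiberAt lam (T ξ) x = φ x • F.fiberAt lam ξ x) ξ ?_ fun η => ?_
  · exact isClosed_eq ((F.fiberL lam x).continuous.comp T.continuous)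
      ((φ x • F.fiberL lam x).continuous)
  · rw [hT, fiberAt_toL2, hr, fiberAt_toL2]

/-! ### Continuity of the inner products -/

/-- The inner product of two elements of C_c(Γ;E) is a continuous section of the field of the A_x,
as a fibre integral. -/
theorem continuous_ipPre_restrict (ξ η : F.Cc) : Continuous fun x =>
    (⟨Γ.unit x, F.ipPre lam x (F.restrict x ξ) (F.restrict x η)⟩ : Tot E) := by
  obtain ⟨L, hL, h⟩ := F.exists_support η
  refine continuous_iff_continuousAt.2 fun x => lam.continuousAt_integral F.isField F.complete
    (p := fun x : M => x) continuous_id Γ.continuous_unit (fun x g => F.mul (Γ.isMul_inv_self g)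
      (F.star rfl ((F.restrict x ξ).eval g)) ((F.restrict x η).eval g)) ?_ hL
    (Eventually.of_forall fun x g hg => by rw [restrict_eval, restrict_eval, h _ hg, mul_zero])
  have hg : Continuous fun z : Γ.FibProd (fun x : M => x) => z.1.2 :=
    continuous_snd.comp continuous_subtype_val
  exact F.continuous_mul_comp (fun z : Γ.FibProd (fun x : M => x) =>
    Γ.isMul_inv_self (⟨z.1.2, z.2⟩ : Γ.SFib z.1.1))
    (F.continuous_star_comp (fun _ => rfl) ((F.continuous_ev ξ).comp hg))
    ((F.continuous_ev η).comp hg)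

/-- Upper semicontinuity of x ↦ ‖ξ_x‖: it holds on C_c(Γ;E), where ‖ξ_x‖² is the norm of a
continuous section, and it survives uniform limits. -/
theorem eventually_norm_fiberAt_lt (ξ : F.L2 lam) {x : M} {c : ℝ} (h : ‖F.fiberAt lam ξ x‖ < c) :
    ∀ᶠ y in 𝓝 x, ‖F.fiberAt lam ξ y‖ < c := by
  obtain ⟨d, hd1, hd2⟩ := exists_between h
  set δ := min (c - d) (d - ‖F.fiberAt lam ξ x‖) with hδ
  have hδ0 : 0 < δ := lt_min (by linarith) (by linarith)
  obtain ⟨_, h1, η, rfl⟩ := Metric.dense_iff.1 (F.denseRange_toL2 lam) ξ δ hδ0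
  rw [Metric.mem_ball, dist_eq_norm] at h1
  have h2 : ∀ y, ‖F.fiberAt lam (F.toL2 lam η) y - F.fiberAt lam ξ y‖ < δ := fun y =>
    (F.norm_fiberAt_le lam y (F.toL2 lam η - ξ)).trans_lt h1
  have hd0 : 0 ≤ d := (norm_nonneg _).trans hd1.le
  have h3 : ‖F.ipPre lam x (F.restrict x η) (F.restrict x η)‖ < d ^ 2 := by
    rw [norm_toL2Fib_sq, ← fiberAt_toL2]
    have h4 := (norm_sub_norm_le _ _).trans_lt (h2 x)
    have h5 : δ ≤ d - ‖F.fiberAt lam ξ x‖ := min_le_right _ _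
    exact pow_lt_pow_left₀ (by linarith) (norm_nonneg _) two_ne_zero
  filter_upwards [F.isField.eventually_norm_lt
    (F.continuous_ipPre_restrict lam η η).continuousAt h3] with y hy
  rw [norm_toL2Fib_sq, ← fiberAt_toL2] at hy
  have h4 := lt_of_pow_lt_pow_left₀ 2 hd0 hy
  have h5 := (norm_sub_norm_le (F.fiberAt lam ξ y) (F.fiberAt lam (F.toL2 lam η) y))
  rw [norm_sub_rev] at h5
  have h6 : δ ≤ c - d := min_le_left _ _
  linarith [h2 y]

/-! ### Adjointable operators -/

variable {F lam}

theorem eq_of_ip_fiberAt {x : M} {u v : F.L2Fib lam x}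
    (h : ∀ ξ : F.L2 lam, F.ip lam x (F.fiberAt lam ξ x) u = F.ip lam x (F.fiberAt lam ξ x) v) :
    u = v := eq_of_ip (F.denseRange_fiberAt lam x) h

theorem eq_of_ip_fiberAt' {x : M} {u v : F.L2Fib lam x}
    (h : ∀ ξ : F.L2 lam, F.ip lam x u (F.fiberAt lam ξ x) = F.ip lam x v (F.fiberAt lam ξ x)) :
    u = v := eq_of_ip_fiberAt fun ξ => by
  rw [← F.ip_star, h, F.ip_star]

/-- An adjointable operator commutes with multiplication by functions on M. Multiplying ξ by a bump
function at x leaves (Tξ)_x unchanged and brings the norm of ξ arbitrarily close to ‖ξ_x‖, by upper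
semicontinuity. -/
theorem IsAdjointable.fibBound [LocallyCompactSpace M] {T : F.L2 lam →L[ℂ] F.L2 lam}
    (hT : F.IsAdjointable lam T) : F.FibBound lam T ‖T‖ := by
  obtain ⟨S, hS⟩ := hT
  intro ξ x
  refine le_of_forall_gt_imp_ge_of_dense fun a ha => ?_
  obtain ⟨c, hc, hca⟩ : ∃ c, ‖F.fiberAt lam ξ x‖ < c ∧ ‖T‖ * c ≤ a := by
    have hlim : Tendsto (fun c => ‖T‖ * c) (𝓝[>] ‖F.fiberAt lam ξ x‖)
        (𝓝 (‖T‖ * ‖F.fiberAt lam ξ x‖)) :=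
      ((continuous_const.mul continuous_id).tendsto _).mono_left nhdsWithin_le_nhds
    obtain ⟨c, h1, h2⟩ := ((hlim.eventually_lt_const ha).and self_mem_nhdsWithin).exists
    exact ⟨c, h2, h1.le⟩
  have hc0 : 0 ≤ c := (norm_nonneg _).trans hc.le
  have hU := F.eventually_norm_fiberAt_lt lam ξ hc
  obtain ⟨U, hUs, hUo, hxU⟩ := mem_nhds_iff.1 hU
  obtain ⟨φ, hφ1, hφ0, -, hφ01⟩ := exists_continuous_one_zero_of_isCompact
    (isCompact_singleton (x := x)) hUo.isClosed_compl
    (Set.disjoint_singleton_left.2 fun h => h hxU)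
  have hφx : φ x = 1 := hφ1 rfl
  have hφn : ∀ y, ‖((φ y : ℝ) : ℂ)‖ ≤ 1 := fun y => by
    rw [Complex.norm_real, Real.norm_of_nonneg (hφ01 y).1]; exact (hφ01 y).2
  obtain ⟨m, -, hm⟩ := F.exists_mulOp lam ⟨fun y => ((φ y : ℝ) : ℂ),
    Complex.continuous_ofReal.comp φ.continuous⟩ zero_le_one hφn
  have hmx : ∀ ζ y, F.fiberAt lam (m ζ) y = ((φ y : ℝ) : ℂ) • F.fiberAt lam ζ y := hm
  -- Against any η, both sides pass to the adjoint, and ξ and mξ agree at x because φ(x) = 1.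
  have e1 : F.fiberAt lam (T ξ) x = F.fiberAt lam (T (m ξ)) x := by
    refine eq_of_ip_fiberAt' fun η => ?_
    rw [hS, hS, hmx, ip_smul_left, hφx]
    simp
  have e2 : ‖m ξ‖ ≤ c := norm_le_of_fiberAt hc0 fun y => by
    rw [hmx, norm_smul]
    by_cases hy : y ∈ U
    · have h1 : ‖F.fiberAt lam ξ y‖ < c := hUs hy
      calc _ ≤ 1 * c := mul_le_mul (hφn y) h1.le (norm_nonneg _) zero_le_one
        _ = c := one_mul c
    · have : φ y = 0 := hφ0 hy
      rw [this]
      simpa using hc0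
  calc _ = ‖F.fiberAt lam (T (m ξ)) x‖ := by rw [e1]
    _ ≤ ‖T (m ξ)‖ := F.norm_fiberAt_le lam _ _
    _ ≤ ‖T‖ * ‖m ξ‖ := T.le_opNorm _
    _ ≤ ‖T‖ * c := by gcongr
    _ ≤ a := hca

/-- The adjoint of an adjointable operator. -/
theorem IsAdjointable.exists_adjoint [LocallyCompactSpace M] {T : F.L2 lam →L[ℂ] F.L2 lam}
    (hT : F.IsAdjointable lam T) : ∃ S : F.L2 lam →L[ℂ] F.L2 lam, ‖S‖ ≤ 4 * ‖T‖ ∧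
      F.FibBound lam S (4 * ‖T‖) ∧
      ∀ (ξ η : F.L2 lam) (x : M), F.ip lam x (F.fiberAt lam (T ξ) x) (F.fiberAt lam η x) =
        F.ip lam x (F.fiberAt lam ξ x) (F.fiberAt lam (S η) x) := by
  have hB := hT.fibBound
  obtain ⟨S, hS⟩ := hT
  have hb : ∀ η x, ‖F.fiberAt lam (S η) x‖ ≤ 4 * ‖T‖ * ‖F.fiberAt lam η x‖ := by
    intro η x
    -- Since ‖(Sη)_x‖² = ‖⟨(TSη)_x, η_x⟩‖, the fibrewise bound of T passes to S with the factor 4 of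
    -- `norm_ip_le`.
    have h1 : ‖F.fiberAt lam (S η) x‖ ^ 2 ≤
        ‖F.fiberAt lam (S η) x‖ * (4 * ‖T‖ * ‖F.fiberAt lam η x‖) := by
      rw [← norm_ip_self, ← hS]
      calc _ ≤ 4 * ‖F.fiberAt lam (T (S η)) x‖ * ‖F.fiberAt lam η x‖ := F.norm_ip_le lam x _ _
        _ ≤ 4 * (‖T‖ * ‖F.fiberAt lam (S η) x‖) * ‖F.fiberAt lam η x‖ := by
          gcongr; exact hB _ _
        _ = _ := by ring
    rcases (norm_nonneg (F.fiberAt lam (S η) x)).eq_or_lt with h0 | h0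
    · rw [← h0]; positivity
    · rw [sq] at h1
      exact le_of_mul_le_mul_left h1 h0
  -- The adjoint is given as a mere function; its linearity follows from nondegeneracy of the inner
  -- product.
  let S₀ : F.L2 lam →ₗ[ℂ] F.L2 lam :=
    { toFun := S
      map_add' := fun η ζ => l2_ext fun x => eq_of_ip_fiberAt fun ξ => by
        rw [← hS, fiberAt_add, fiberAt_add, ip_add_right, ip_add_right, hS, hS]
      map_smul' := fun c η => l2_ext fun x => eq_of_ip_fiberAt fun ξ => by
        rw [← hS, RingHom.id_apply, fiberAt_smul, fiberAt_smul, ip_smul_right, ip_smul_right, hS] }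
  refine ⟨S₀.mkContinuous (4 * ‖T‖) fun η => norm_le_of_fiberAt (by positivity) fun x =>
    (hb η x).trans (mul_le_mul_of_nonneg_left (F.norm_fiberAt_le lam x η) (by positivity)),
    LinearMap.mkContinuous_norm_le _ (by positivity) _, hb, hS⟩

theorem IsAdjointable.exists_fiber_adjoint [LocallyCompactSpace M] {T : F.L2 lam →L[ℂ] F.L2 lam}
    (hT : F.IsAdjointable lam T) (x : M) : ∃ S : F.L2Fib lam x →L[ℂ] F.L2Fib lam x,
      ∀ u v, F.ip lam x (F.fiberOp lam T x u) v = F.ip lam x u (S v) := by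
  have hB := hT.fibBound
  obtain ⟨S, -, hSb, hS⟩ := hT.exists_adjoint
  refine ⟨F.fiberOp lam S x, fun u v => ?_⟩
  refine (F.denseRange_fiberAt lam x).induction_on₂ (p := fun u v =>
    F.ip lam x (F.fiberOp lam T x u) v = F.ip lam x u (F.fiberOp lam S x v)) ?_ (fun ξ η => ?_) u v
  · exact isClosed_eq
      (continuous_ip_comp ((F.fiberOp lam T x).continuous.comp continuous_fst) continuous_snd)
      (continuous_ip_comp continuous_fst ((F.fiberOp lam S x).continuous.comp continuous_snd))
  · rw [hB.fiberOp_apply, hSb.fiberOp_apply, hS]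

theorem isAdjointable_sub {T T' : F.L2 lam →L[ℂ] F.L2 lam} (h : F.IsAdjointable lam T)
    (h' : F.IsAdjointable lam T') : F.IsAdjointable lam (T - T') := by
  obtain ⟨S, hS⟩ := h
  obtain ⟨S', hS'⟩ := h'
  refine ⟨fun η => S η - S' η, fun ξ η x => ?_⟩
  rw [_root_.sub_apply, fiberAt_sub, fiberAt_sub, ip_sub_left, ip_sub_right, hS, hS']

theorem isAdjointable_comp {T T' : F.L2 lam →L[ℂ] F.L2 lam} (h : F.IsAdjointable lam T)
    (h' : F.IsAdjointable lam T') : F.IsAdjointable lam (T ∘L T') := by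
  obtain ⟨S, hS⟩ := h
  obtain ⟨S', hS'⟩ := h'
  exact ⟨fun η => S' (S η), fun ξ η x => by rw [ContinuousLinearMap.comp_apply, hS, hS']⟩

theorem isAdjointable_of_mul {φ : C(M, ℂ)} {C : ℝ} (hC : 0 ≤ C) (hφ : ∀ x, ‖φ x‖ ≤ C)
    {T : F.L2 lam →L[ℂ] F.L2 lam}
    (hT : ∀ ξ x, F.fiberAt lam (T ξ) x = φ x • F.fiberAt lam ξ x) : F.IsAdjointable lam T := by
  obtain ⟨S, -, hS⟩ := F.exists_mulOp lam ((starRingEnd C(M, ℂ)) φ) hC fun x => by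
    change ‖(starRingEnd ℂ) (φ x)‖ ≤ C
    rw [RCLike.norm_conj]
    exact hφ x
  refine ⟨S, fun ξ η x => ?_⟩
  rw [hT, hS, ip_smul_left, ip_smul_right]
  rfl

/-- The adjointable operators form a closed set. -/
theorem isClosed_isAdjointable [LocallyCompactSpace M] :
    IsClosed {T : F.L2 lam →L[ℂ] F.L2 lam | F.IsAdjointable lam T} := by
  have h := isClosed_exists_of_norm_sub_le (C := 4)
    (R := fun T S : F.L2 lam →L[ℂ] F.L2 lam => ∀ (ξ η : F.L2 lam) (x : M),
      F.ip lam x (F.fiberAt lam (T ξ) x) (F.fiberAt lam η x) =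
        F.ip lam x (F.fiberAt lam ξ x) (F.fiberAt lam (S η) x)) ?_ ?_
  · refine (congrArg IsClosed ?_).mp h
    ext T
    constructor
    · rintro ⟨S, hS⟩
      exact ⟨S, hS⟩
    · intro hT
      obtain ⟨S, -, -, hS⟩ := IsAdjointable.exists_adjoint hT
      exact ⟨S, hS⟩
  -- Adjoints are unique, so S - S' is the adjoint of T - T' and has norm at most 4‖T - T'‖.
  · intro T T' S S' hS hS'
    have hT : F.IsAdjointable lam (T - T') := isAdjointable_sub ⟨S, hS⟩ ⟨S', hS'⟩
    obtain ⟨R, hRn, -, hR⟩ := hT.exists_adjoint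
    have : R = S - S' := ContinuousLinearMap.ext fun η => l2_ext fun x =>
      eq_of_ip_fiberAt fun ξ => by
        rw [← hR, _root_.sub_apply, _root_.sub_apply, fiberAt_sub,
          fiberAt_sub, ip_sub_left, ip_sub_right, hS, hS']
    rw [← this]
    exact hRn
  · simp only [Set.ofPred_forall]
    refine isClosed_iInter fun ξ => isClosed_iInter fun η => isClosed_iInter fun x => ?_
    exact isClosed_eq
      (continuous_ip_comp ((F.fiberL lam x).continuous.comp
        ((ContinuousLinearMap.apply ℂ _ ξ).continuous.comp continuous_fst)) continuous_const)
      (continuous_ip_comp continuous_const ((F.fiberL lam x).continuous.comp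
        ((ContinuousLinearMap.apply ℂ _ η).continuous.comp continuous_snd)))

/-! ### Transport along arrows -/

variable (F lam)

/-- The map `ξ ⊗ e ↦ ξe`. -/
def rmulTensor {x y : M} (k : G) (ht : Γ.tgt k = x) (hs : Γ.src k = y) :
    TensorProduct ℂ (F.L2Fib lam x) (E k) →ₗ[ℂ] F.L2Fib lam y :=
  TensorProduct.lift (LinearMap.mk₂ ℂ (fun u e => F.rmulL lam k ht hs e u)
    (fun u v _ => map_add _ u v) (fun c u _ => map_smul _ c u)
    (fun u e e' => F.rmulL_add lam k ht hs e e' u) (fun c u e => F.rmulL_smul lam k ht hs c e u))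

theorem rmulTensor_tmul {x y : M} (k : G) (ht : Γ.tgt k = x) (hs : Γ.src k = y)
    (u : F.L2Fib lam x) (e : E k) :
    F.rmulTensor lam k ht hs (u ⊗ₜ e) = F.rmulL lam k ht hs e u := rfl

/-- `rmulSpan` satisfies the criterion of `exists_approx_l2Fib`; by linearity, its elements lie in
the range. -/
theorem denseRange_rmulTensor {x y : M} (k : G) (ht : Γ.tgt k = x) (hs : Γ.src k = y) :
    DenseRange (F.rmulTensor lam k ht hs) := by
  intro u
  rw [Metric.mem_closure_range_iff]
  intro ε hε
  obtain ⟨ζ, hζ, h⟩ := F.exists_approx_l2Fib lam (F.rmulSpan k ht hs)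
    (fun φ _ => F.rmulSpan_smul k ht hs φ) (F.rmulSpan_continuous k ht hs)
    (F.rmulSpan_dense k ht hs) u hε
  have key : ∀ s ∈ F.rmulSpan k ht hs, ∃ ζ : F.CcFib y, (fun g => ζ.eval g) = s ∧
      F.toL2Fib lam y ζ ∈ LinearMap.range (F.rmulTensor lam k ht hs) := by
    intro s hs'
    induction hs' using Submodule.span_induction with
    | mem s hs' =>
      obtain ⟨e, ξ, rfl⟩ := hs'
      exact ⟨_, rfl, F.toL2Fib lam x ξ ⊗ₜ e, by rw [rmulTensor_tmul, rmulL_coe]⟩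
    | zero => exact ⟨0, rfl, by
        rw [← toL2FibL_apply, map_zero]
        exact Submodule.zero_mem _⟩
    | add s t _ _ hs' ht' =>
      obtain ⟨ζ, rfl, h⟩ := hs'
      obtain ⟨ζ', rfl, h'⟩ := ht'
      exact ⟨ζ + ζ', rfl, by rw [toL2Fib_add]; exact Submodule.add_mem _ h h'⟩
    | smul c s _ hs' =>
      obtain ⟨ζ, rfl, h⟩ := hs'
      exact ⟨c • ζ, rfl, by rw [toL2Fib_smul]; exact Submodule.smul_mem _ c h⟩
  obtain ⟨ζ', hζ', v, hv⟩ := key _ hζ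
  obtain rfl : ζ' = ζ := CcFib.ext fun g => congrFun hζ' g
  refine ⟨v, ?_⟩
  rwa [hv, dist_comm, dist_eq_norm]

variable {F lam}

theorem norm_adjoint_le {x : M} {T T' : F.L2Fib lam x →L[ℂ] F.L2Fib lam x}
    (h : ∀ u v, F.ip lam x (T u) v = F.ip lam x u (T' v)) : ‖T'‖ ≤ 4 * ‖T‖ := by
  refine T'.opNorm_le_bound (by positivity) fun v => ?_
  have h1 : ‖T' v‖ ^ 2 ≤ ‖T' v‖ * (4 * ‖T‖ * ‖v‖) := by
    rw [← F.norm_ip_self lam x, ← h]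
    calc _ ≤ 4 * ‖T (T' v)‖ * ‖v‖ := F.norm_ip_le lam x _ _
      _ ≤ 4 * (‖T‖ * ‖T' v‖) * ‖v‖ := by gcongr; exact T.le_opNorm _
      _ = _ := by ring
  rcases (norm_nonneg (T' v)).eq_or_lt with h0 | h0
  · rw [← h0]; positivity
  · rw [sq] at h1
    exact le_of_mul_le_mul_left h1 h0

/-- T ⊗ 1 must descend along Θ : u ⊗ e ↦ ue and be bounded for the norm ‖Θ(·)‖. For the semi-inner
product ⟨Θ·, Θ·⟩ it has the adjoint T' ⊗ 1, so the growth of the iterates of (T' ⊗ 1)(T ⊗ 1) on each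
single tensor is enough. -/
theorem exists_transport {x y : M} (k : G) (ht : Γ.tgt k = x) (hs : Γ.src k = y)
    {T T' : F.L2Fib lam x →L[ℂ] F.L2Fib lam x}
    (h : ∀ u v, F.ip lam x (T u) v = F.ip lam x u (T' v)) :
    ∃ S : F.L2Fib lam y →L[ℂ] F.L2Fib lam y, ‖S‖ ≤ 8 * ‖T‖ ∧
      ∀ u e, S (F.rmulL lam k ht hs e u) = F.rmulL lam k ht hs e (T u) := by
  have h' : ∀ u v, F.ip lam x (T' u) v = F.ip lam x u (T v) := fun u v => by
    rw [← F.ip_star, ← h, F.ip_star]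
  have hT' := norm_adjoint_le h
  set Θ := F.rmulTensor lam k ht hs with hΘ
  set T₁ := LinearMap.rTensor (E k) T.toLinearMap with hT₁
  set T₂ := LinearMap.rTensor (E k) T'.toLinearMap with hT₂
  have hadj : ∀ {T T' : F.L2Fib lam x →L[ℂ] F.L2Fib lam x}
      (_ : ∀ u v, F.ip lam x (T u) v = F.ip lam x u (T' v)) (u v),
      F.ip lam y (Θ (LinearMap.rTensor (E k) T.toLinearMap u)) (Θ v) =
        F.ip lam y (Θ u) (Θ (LinearMap.rTensor (E k) T'.toLinearMap v)) := by
    intro T T' h u v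
    induction u using TensorProduct.induction_on with
    | zero =>
      have h0 : ∀ w : F.L2Fib lam y, F.ip lam y 0 w = 0 := fun w => by
        have := F.ip_smul_left lam y 0 0 w
        rwa [smul_zero, map_zero, zero_smul] at this
      rw [map_zero, map_zero, h0, h0]
    | add u u' hu hu' => rw [map_add, map_add, map_add, ip_add_left, ip_add_left, hu, hu']
    | tmul u e =>
      induction v using TensorProduct.induction_on with
      | zero =>
        have h0 : ∀ w : F.L2Fib lam y, F.ip lam y w 0 = 0 := fun w => map_zero (F.ipL lam y w)
        rw [map_zero, map_zero, map_zero, h0, h0]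
      | add v v' hv hv' => rw [map_add, map_add, map_add, ip_add_right, ip_add_right, hv, hv']
      | tmul v e' =>
        rw [LinearMap.rTensor_tmul, LinearMap.rTensor_tmul, hΘ, rmulTensor_tmul, rmulTensor_tmul,
          rmulTensor_tmul, rmulTensor_tmul, ip_rmulL, ip_rmulL]
        congr 2
        exact h u v
  -- On an elementary tensor the n-th iterate is (T'T)ⁿu ⊗ e, and ‖T'T‖ ≤ 4‖T‖² = (2‖T‖)². The
  -- constant C depends on the chosen representation of the tensor, but it disappears from the final
  -- bound 4·2‖T‖.
  have hgrow : ∀ u, ∃ C, ∀ n : ℕ, ‖Θ ((fun v => T₂ (T₁ v))^[n] u)‖ ≤ C * ((2 * ‖T‖) ^ 2) ^ n := by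
    have hit : ∀ n : ℕ, (fun v => T₂ (T₁ v))^[n] = ⇑((T₂ ∘ₗ T₁) ^ n) := fun n => by
      rw [Module.End.coe_pow]; rfl
    intro u
    simp only [hit]
    induction u using TensorProduct.induction_on with
    | zero => exact ⟨0, fun n => by simp⟩
    | add u u' hu hu' =>
      obtain ⟨C, hC⟩ := hu
      obtain ⟨C', hC'⟩ := hu'
      refine ⟨C + C', fun n => ?_⟩
      rw [map_add, map_add, _root_.add_mul]
      exact (norm_add_le _ _).trans (add_le_add (hC n) (hC' n))
    | tmul u e =>
      refine ⟨‖e‖ * ‖u‖, fun n => ?_⟩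
      have : ((T₂ ∘ₗ T₁) ^ n) (u ⊗ₜ[ℂ] e) = (((T' ∘L T) ^ n) u) ⊗ₜ[ℂ] e := by
        induction n with
        | zero => rfl
        | succ n ih =>
          rw [pow_succ', pow_succ', Module.End.mul_apply, ih]
          rfl
      rw [this, hΘ, rmulTensor_tmul]
      refine (F.norm_rmulL_le lam k ht hs e _).trans ?_
      rw [_root_.mul_assoc]
      refine mul_le_mul_of_nonneg_left ?_ (norm_nonneg _)
      calc ‖((T' ∘L T) ^ n) u‖ ≤ ‖(T' ∘L T) ^ n‖ * ‖u‖ := ContinuousLinearMap.le_opNorm _ _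
        _ ≤ ((2 * ‖T‖) ^ 2) ^ n * ‖u‖ := by
          gcongr
          have h1 : ‖(T' ∘L T) ^ n‖ ≤ ‖T' ∘L T‖ ^ n := by
            clear this
            induction n with
            | zero =>
              rw [pow_zero, pow_zero]
              exact ContinuousLinearMap.norm_id_le
            | succ n ih =>
              rw [pow_succ, pow_succ]
              exact (_root_.norm_mul_le _ _).trans (by gcongr)
          refine h1.trans ?_
          gcongr
          calc ‖T' ∘L T‖ ≤ ‖T'‖ * ‖T‖ := ContinuousLinearMap.opNorm_comp_le _ _
            _ ≤ 4 * ‖T‖ * ‖T‖ := by gcongr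
            _ = _ := by ring
        _ = _ := mul_comm _ _
  have hbound : ∀ u, ‖(Θ ∘ₗ T₁) u‖ ≤ 8 * ‖T‖ * ‖Θ u‖ := by
    intro u
    obtain ⟨C, hC⟩ := hgrow u
    have := norm_le_of_adjoint (fun u => ‖Θ u‖) (fun u v => F.ip lam y (Θ u) (Θ v))
      (fun _ => norm_nonneg _) (fun u => F.norm_ip_self lam y _) (fun u v => F.norm_ip_le lam y _ _)
      T₁ T₂ (hadj h) (hadj h') (by positivity) hC
    exact this.trans_eq (by ring)
  have hd := F.denseRange_rmulTensor lam k ht hs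
  refine ⟨(Θ ∘ₗ T₁).extendOfNorm Θ, LinearMap.opNorm_extendOfNorm_le hd (by positivity) hbound,
    fun u e => ?_⟩
  exact LinearMap.extendOfNorm_eq hd ⟨_, hbound⟩ (u ⊗ₜ e)

theorem clm_eq_of_rmulL {x y : M} {k : G} {ht : Γ.tgt k = x} {hs : Γ.src k = y}
    {S S' : F.L2Fib lam y →L[ℂ] F.L2Fib lam y}
    (h : ∀ u e, S (F.rmulL lam k ht hs e u) = S' (F.rmulL lam k ht hs e u)) : S = S' := by
  refine ContinuousLinearMap.ext fun u => congrFun (DenseRange.equalizer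
    (F.denseRange_rmulTensor lam k ht hs) S.continuous S'.continuous (funext fun v => ?_)) u
  induction v using TensorProduct.induction_on with
  | zero => simp
  | add u v hu hv => simpa using congrArg₂ (· + ·) hu hv
  | tmul u e => exact h u e

/-- The vectors ue span a dense subspace, so the defining property determines `transport` and
excludes its default value. -/
theorem transport_eq {x y : M} {γ : G} {hs : Γ.src γ = x} {ht : Γ.tgt γ = y}
    {T : F.L2Fib lam x →L[ℂ] F.L2Fib lam x} {S : F.L2Fib lam y →L[ℂ] F.L2Fib lam y}
    (h : ∀ u e, S (F.rmulL lam (Γ.inv γ) ((Γ.tgt_inv γ).trans hs) ((Γ.src_inv γ).trans ht) e u) =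
      F.rmulL lam (Γ.inv γ) ((Γ.tgt_inv γ).trans hs) ((Γ.src_inv γ).trans ht) e (T u)) :
    F.transport lam γ hs ht T = S := by
  have h' : ∃ S : F.L2Fib lam y →L[ℂ] F.L2Fib lam y,
      ∀ (ξ : F.L2Fib lam x) (e : E (Γ.inv γ)),
        S (F.rmul lam (Γ.inv γ) ((Γ.tgt_inv γ).trans hs) ((Γ.src_inv γ).trans ht) e ξ) =
          F.rmul lam (Γ.inv γ) ((Γ.tgt_inv γ).trans hs) ((Γ.src_inv γ).trans ht) e (T ξ) :=
    ⟨S, fun u e => by rw [rmul_eq, rmul_eq, h]⟩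
  unfold transport
  rw [dif_pos h']
  refine clm_eq_of_rmulL (k := Γ.inv γ) (ht := (Γ.tgt_inv γ).trans hs)
    (hs := (Γ.src_inv γ).trans ht) fun u e => ?_
  have := h'.choose_spec u e
  rw [rmul_eq, rmul_eq] at this
  rw [this, h]

/-- The operators on `L²(Γ_x; E)` having an adjoint. -/
def HasAdj {x : M} (T : F.L2Fib lam x →L[ℂ] F.L2Fib lam x) : Prop :=
  ∃ T' : F.L2Fib lam x →L[ℂ] F.L2Fib lam x, ∀ u v, F.ip lam x (T u) v = F.ip lam x u (T' v)

theorem HasAdj.sub {x : M} {T S : F.L2Fib lam x →L[ℂ] F.L2Fib lam x} (hT : HasAdj T)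
    (hS : HasAdj S) : HasAdj (T - S) := by
  obtain ⟨T', hT'⟩ := hT
  obtain ⟨S', hS'⟩ := hS
  exact ⟨T' - S', fun u v => by
    rw [_root_.sub_apply, _root_.sub_apply, ip_sub_left, ip_sub_right,
      hT', hS']⟩

theorem HasAdj.transport_apply {x y : M} {T : F.L2Fib lam x →L[ℂ] F.L2Fib lam x} (hT : HasAdj T)
    (γ : G) (hs : Γ.src γ = x) (ht : Γ.tgt γ = y) (u : F.L2Fib lam x) (e : E (Γ.inv γ)) :
    F.transport lam γ hs ht T
      (F.rmulL lam (Γ.inv γ) ((Γ.tgt_inv γ).trans hs) ((Γ.src_inv γ).trans ht) e u) =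
      F.rmulL lam (Γ.inv γ) ((Γ.tgt_inv γ).trans hs) ((Γ.src_inv γ).trans ht) e (T u) := by
  obtain ⟨T', hT'⟩ := hT
  obtain ⟨S, -, hS⟩ := exists_transport (Γ.inv γ) ((Γ.tgt_inv γ).trans hs)
    ((Γ.src_inv γ).trans ht) hT'
  rw [transport_eq hS, hS]

theorem HasAdj.norm_transport_le {x y : M} {T : F.L2Fib lam x →L[ℂ] F.L2Fib lam x} (hT : HasAdj T)
    (γ : G) (hs : Γ.src γ = x) (ht : Γ.tgt γ = y) : ‖F.transport lam γ hs ht T‖ ≤ 8 * ‖T‖ := by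
  obtain ⟨T', hT'⟩ := hT
  obtain ⟨S, hSn, hS⟩ := exists_transport (Γ.inv γ) ((Γ.tgt_inv γ).trans hs)
    ((Γ.src_inv γ).trans ht) hT'
  rw [transport_eq hS]
  exact hSn

theorem HasAdj.transport_sub {x y : M} {T S : F.L2Fib lam x →L[ℂ] F.L2Fib lam x} (hT : HasAdj T)
    (hS : HasAdj S) (γ : G) (hs : Γ.src γ = x) (ht : Γ.tgt γ = y) :
    F.transport lam γ hs ht (T - S) = F.transport lam γ hs ht T - F.transport lam γ hs ht S :=
  transport_eq fun u e => by
    rw [_root_.sub_apply, hT.transport_apply, hS.transport_apply,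
      _root_.sub_apply, map_sub]

end FellBundle

end

end FellGroupoid

namespace FellGroupoid

noncomputable section

namespace FellBundle

variable {G M : Type*} [TopologicalSpace G] [TopologicalSpace M] {Γ : TopGroupoid G M} {E : G → Type*}
  [∀ g, NormedAddCommGroup (E g)] [∀ g, NormedSpace ℂ (E g)] [TopologicalSpace (Tot E)]
  (F : FellBundle Γ E)

/-! ### Kernels over the fibred product `Γ ×_s Γ` -/

/-- The continuous kernels `K(g, k) ∈ E_{gk⁻¹}` on `Γ ×_s Γ` with compact support over the compact
subsets of `M`. -/
def Kern : Submodule ℂ (∀ z : Γ.FibProd Γ.src, E (Γ.div z.1.1 z.1.2 z.2.symm)) where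
  carrier := {K | Continuous (fun z : Γ.FibProd Γ.src =>
      (⟨Γ.div z.1.1 z.1.2 z.2.symm, K z⟩ : Tot E)) ∧
    ∀ Q : Set M, IsCompact Q → ∃ L : Set G, IsCompact L ∧
      ∀ z : Γ.FibProd Γ.src, Γ.src z.1.1 ∈ Q → (z.1.1 ∉ L ∨ z.1.2 ∉ L) → K z = 0}
  add_mem' := by
    rintro K K' ⟨hK, h⟩ ⟨hK', h'⟩
    refine ⟨F.isField.continuous_add_comp hK hK', fun Q hQ => ?_⟩
    obtain ⟨L, hL, h0⟩ := h Q hQ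
    obtain ⟨L', hL', h0'⟩ := h' Q hQ
    refine ⟨L ∪ L', hL.union hL', fun z hz hzL => ?_⟩
    rw [Pi.add_apply, h0 z hz (hzL.imp (fun h hg => h (Or.inl hg)) fun h hg => h (Or.inl hg)),
      h0' z hz (hzL.imp (fun h hg => h (Or.inr hg)) fun h hg => h (Or.inr hg)), add_zero]
  zero_mem' := ⟨F.isField.continuous_zero_comp (Γ.continuous_div
    (continuous_fst.comp continuous_subtype_val) (continuous_snd.comp continuous_subtype_val) _),
    fun _ _ => ⟨∅, isCompact_empty, fun _ _ _ => rfl⟩⟩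
  smul_mem' := by
    rintro c K ⟨hK, h⟩
    refine ⟨F.isField.continuous_smul_comp continuous_const hK, fun Q hQ => ?_⟩
    obtain ⟨L, hL, h0⟩ := h Q hQ
    exact ⟨L, hL, fun z hz hzL => by rw [Pi.smul_apply, h0 z hz hzL, smul_zero]⟩

variable {F} in
/-- The value `K(g, k) ∈ E_{gk⁻¹}`. -/
def gev (K : F.Kern) (g k : G) (e : Γ.src g = Γ.src k) : E (Γ.div g k e) := K.1 ⟨(g, k), e.symm⟩

variable {F} in
theorem continuous_gev (K : F.Kern) : Continuous fun z : Γ.FibProd Γ.src =>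
    (⟨Γ.div z.1.1 z.1.2 z.2.symm, gev K z.1.1 z.1.2 z.2.symm⟩ : Tot E) := K.2.1

variable {F} in
theorem continuous_gev_comp (K : F.Kern) {Y : Type*} [TopologicalSpace Y] {g k : Y → G}
    (hg : Continuous g) (hk : Continuous k) (e : ∀ y, Γ.src (g y) = Γ.src (k y)) :
    Continuous fun y => (⟨Γ.div (g y) (k y) (e y), gev K (g y) (k y) (e y)⟩ : Tot E) :=
  (continuous_gev K).comp ((hg.prodMk hk).subtype_mk fun y => (e y).symm)

variable {F} in
theorem exists_support_gev (K : F.Kern) {Q : Set M} (hQ : IsCompact Q) : ∃ L : Set G, IsCompact L ∧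
    ∀ g k (e : Γ.src g = Γ.src k), Γ.src g ∈ Q → (g ∉ L ∨ k ∉ L) → gev K g k e = 0 := by
  obtain ⟨L, hL, h⟩ := K.2.2 Q hQ
  exact ⟨L, hL, fun g k e hg hgk => h ⟨(g, k), e.symm⟩ hg hgk⟩

/-- Construction of a kernel. -/
def mkKern (u : ∀ g k (e : Γ.src g = Γ.src k), E (Γ.div g k e))
    (hu : Continuous fun z : Γ.FibProd Γ.src =>
      (⟨Γ.div z.1.1 z.1.2 z.2.symm, u z.1.1 z.1.2 z.2.symm⟩ : Tot E))
    (h0 : ∀ Q : Set M, IsCompact Q → ∃ L : Set G, IsCompact L ∧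
      ∀ g k (e : Γ.src g = Γ.src k), Γ.src g ∈ Q → (g ∉ L ∨ k ∉ L) → u g k e = 0) : F.Kern :=
  ⟨fun z => u z.1.1 z.1.2 z.2.symm, hu, fun Q hQ => by
    obtain ⟨L, hL, h⟩ := h0 Q hQ
    exact ⟨L, hL, fun z hz hzL => h _ _ _ hz hzL⟩⟩

/-- Multiplication of a kernel by a continuous function on `Γ × Γ`. -/
def kernMul (w : C(G × G, ℂ)) (K : F.Kern) : F.Kern :=
  F.mkKern (fun g k e => w (g, k) • gev K g k e)
    (F.isField.continuous_smul_comp (w.continuous.comp continuous_subtype_val) (continuous_gev K))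
    fun Q hQ => by
      obtain ⟨L, hL, h⟩ := exists_support_gev K hQ
      exact ⟨L, hL, fun g k e hg hgk => by rw [h g k e hg hgk, smul_zero]⟩

theorem kernMul_gev (w : C(G × G, ℂ)) (K : F.Kern) (g k : G) (e : Γ.src g = Γ.src k) :
    gev (F.kernMul w K) g k e = w (g, k) • gev K g k e := rfl

/-- The kernel `(g, k) ↦ K(k, g)*`. -/
def kernAdj (K : F.Kern) : F.Kern :=
  F.mkKern (fun g k e => F.star (Γ.inv_div k g e.symm) (gev K k g e.symm))
    (F.continuous_star_comp (g := fun z : Γ.FibProd Γ.src => Γ.div z.1.2 z.1.1 z.2)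
      (fun z => Γ.inv_div z.1.2 z.1.1 z.2) (continuous_gev_comp K
        (continuous_snd.comp continuous_subtype_val) (continuous_fst.comp continuous_subtype_val)
        fun z => z.2))
    fun Q hQ => by
      obtain ⟨L, hL, h⟩ := exists_support_gev K hQ
      exact ⟨L, hL, fun g k e hg hgk => by rw [h k g e.symm (e ▸ hg) hgk.symm, star_zero]⟩

/-- The kernel `ξ(g) η(k)*`. -/
def rankKern (ξ η : F.Cc) : F.Kern :=
  F.mkKern (fun g k e => F.mul (Γ.isMul_div' g k e) (F.ev ξ g) (F.star rfl (F.ev η k)))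
    (F.continuous_mul_comp (fun z : Γ.FibProd Γ.src => Γ.isMul_div' z.1.1 z.1.2 z.2.symm)
      ((F.continuous_ev ξ).comp (continuous_fst.comp continuous_subtype_val))
      (F.continuous_star_comp (fun _ => rfl)
        ((F.continuous_ev η).comp (continuous_snd.comp continuous_subtype_val))))
    fun _ _ => by
      obtain ⟨L, hL, h⟩ := F.exists_support ξ
      obtain ⟨L', hL', h'⟩ := F.exists_support η
      refine ⟨L ∪ L', hL.union hL', fun g k e _ hgk => ?_⟩
      rcases hgk with hgk | hgk
      · rw [h g fun hg => hgk (Or.inl hg), zero_mul]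
      · rw [h' k fun hk => hgk (Or.inr hk), star_zero, mul_zero]

theorem rankKern_gev (ξ η : F.Cc) (g k : G) (e : Γ.src g = Γ.src k) :
    gev (F.rankKern ξ η) g k e =
      F.mul (Γ.isMul_div' g k e) (F.ev ξ g) (F.star rfl (F.ev η k)) := rfl

/-- The kernel `f(gk⁻¹)` of the convolution by `f`. -/
def convKern (hΓ : Γ.IsProper) (f : F.Cc) : F.Kern :=
  F.mkKern (fun g k e => F.ev f (Γ.div g k e))
    ((F.continuous_ev f).comp (Γ.continuous_div (continuous_fst.comp continuous_subtype_val)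
      (continuous_snd.comp continuous_subtype_val) fun z : Γ.FibProd Γ.src => z.2.symm))
    fun Q hQ => by
      obtain ⟨L, hL, h⟩ := F.exists_support f
      -- If gk⁻¹ ∈ L, then t(g) ∈ t(L) and t(k) ∈ s(L). With sources in Q, properness leaves a
      -- compact set of arrows.
      refine ⟨_, TopGroupoid.IsProper.isCompact Γ hΓ hQ ((hL.image Γ.continuous_tgt).union (hL.image Γ.continuous_src)),
        fun g k e hg hgk => h _ fun hd => ?_⟩
      have hp := Γ.isMul_div g k e
      rcases hgk with hgk | hgk
      · exact hgk ⟨hg, Or.inl ⟨_, hd, hp.tgt_eq.symm⟩⟩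
      · exact hgk ⟨by rw [← e]; exact hg, Or.inr ⟨_, hd, hp.1⟩⟩

variable {F} in
theorem gev_add (K K' : F.Kern) (g k : G) (e : Γ.src g = Γ.src k) :
    gev (K + K') g k e = gev K g k e + gev K' g k e := rfl

variable {F} in
theorem gev_sub (K K' : F.Kern) (g k : G) (e : Γ.src g = Γ.src k) :
    gev (K - K') g k e = gev K g k e - gev K' g k e := rfl

variable {F} in
theorem gev_smul (c : ℂ) (K : F.Kern) (g k : G) (e : Γ.src g = Γ.src k) :
    gev (c • K) g k e = c • gev K g k e := rfl

variable {F} in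
theorem Kern.ext {K K' : F.Kern} (h : ∀ g k e, gev K g k e = gev K' g k e) : K = K' :=
  Subtype.ext (funext fun z => h z.1.1 z.1.2 z.2.symm)

variable [T2Space M]

/-- The restriction of a kernel to `Γ_x × Γ_x`. -/
def kernFib (K : F.Kern) (x : M) : F.FibKer x :=
  F.mkKer (fun g k => gev K g.1 k.1 (g.2.trans k.2.symm))
    (continuous_gev_comp K (continuous_subtype_val.comp continuous_fst)
      (continuous_subtype_val.comp continuous_snd) fun p => p.1.2.trans p.2.2.symm) (by
      obtain ⟨L, hL, h⟩ := exists_support_gev K (isCompact_singleton (x := x))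
      exact ⟨L, hL, fun g k hgk => h _ _ _ g.2 hgk⟩)

theorem kernFib_kernAdj (K : F.Kern) (x : M) : F.kernFib (F.kernAdj K) x = F.kerAdj (F.kernFib K x) :=
  rfl

theorem kernFib_rankKern (ξ η : F.Cc) (x : M) :
    F.kernFib (F.rankKern ξ η) x = F.rankOneKer (F.restrict x ξ) (F.restrict x η) := rfl

variable [MeasurableSpace G] [BorelSpace G] [T2Space G] [LocallyCompactSpace G] (lam : HaarSystem Γ)

theorem kerOp_smul_right {x : M} (c : ℂ) (K : F.FibKer x) (η : F.CcFib x) :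
    F.kerOp lam K (c • η) = c • F.kerOp lam K η := by
  refine CcFib.ext fun g => ?_
  rw [CcFib.eval_smul, kerOp_eval, kerOp_eval, ← integral_smul]
  simp only [CcFib.eval_smul, F.mul_smul]

theorem kerOp_sub_right {x : M} (K : F.FibKer x) (η ζ : F.CcFib x) :
    F.kerOp lam K (η - ζ) = F.kerOp lam K η - F.kerOp lam K ζ := by
  rw [eq_sub_iff_add_eq, ← kerOp_add_right, sub_add_cancel]

/-- The action of a kernel on `C_c(Γ; E)`. -/
def kernAct (K : F.Kern) : F.Cc →ₗ[ℂ] F.Cc where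
  toFun η := F.mkCc (fun g => (F.kerOp lam (F.kernFib K (Γ.src g))
      (F.restrict (Γ.src g) η)).eval ⟨g, rfl⟩)
    (by
      obtain ⟨L, hL, h⟩ := F.exists_support η
      refine continuous_iff_continuousAt.2 fun g => lam.continuousAt_integral F.isField F.complete
        (p := Γ.src) Γ.continuous_src continuous_id
        (fun g k => F.mul (Γ.isMul_div g k.1 k.2.symm) (gev K g k.1 k.2.symm) (F.ev η k.1)) ?_ hL
        (Eventually.of_forall fun g k hk => by rw [h k.1 hk, mul_zero])
      exact F.continuous_mul_comp (fun z : Γ.FibProd Γ.src => Γ.isMul_div z.1.1 z.1.2 z.2.symm)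
        (continuous_gev K) ((F.continuous_ev η).comp (continuous_snd.comp continuous_subtype_val)))
    (by
      obtain ⟨L, hL, h⟩ := F.exists_support η
      -- Only objects in the compact set s(L) contribute, so compactness of the support of K over
      -- compact sets of objects suffices.
      obtain ⟨L', hL', h'⟩ := exists_support_gev K (hL.image Γ.continuous_src)
      refine ⟨L', hL', fun g hg => integral_eq_zero_of_ae (ae_of_all _ fun k => ?_)⟩
      change F.mul (Γ.isMul_div g k.1 k.2.symm) (gev K g k.1 k.2.symm) (F.ev η k.1) = 0
      by_cases hk : k.1 ∈ L
      · rw [h' _ _ _ ⟨_, hk, k.2⟩ (Or.inl hg), zero_mul]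
      · rw [h _ hk, mul_zero])
  map_add' η ζ := Cc.ext fun g =>
    congrArg (CcFib.eval · _) (F.kerOp_add_right lam (F.kernFib K (Γ.src g))
      (F.restrict (Γ.src g) η) (F.restrict (Γ.src g) ζ))
  map_smul' c η := Cc.ext fun g =>
    congrArg (CcFib.eval · _) (F.kerOp_smul_right lam c (F.kernFib K (Γ.src g))
      (F.restrict (Γ.src g) η))

theorem restrict_kernAct (K : F.Kern) (η : F.Cc) (x : M) :
    F.restrict x (F.kernAct lam K η) = F.kerOp lam (F.kernFib K x) (F.restrict x η) := by
  refine CcFib.ext ?_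
  rintro ⟨g, rfl⟩
  rfl

theorem ev_kernAct (K : F.Kern) (η : F.Cc) (g : G) : F.ev (F.kernAct lam K η) g =
    ∫ k : Γ.SFib (Γ.src g), F.mul (Γ.isMul_div g k.1 k.2.symm) (gev K g k.1 k.2.symm) (F.ev η k.1)
      ∂(lam.smeas (Γ.src g)) := rfl

/-- The substitution h = gk⁻¹, under which h⁻¹g = k. -/
theorem ev_kernAct_convKern (hΓ : Γ.IsProper) (f η : F.Cc) (g : G) :
    F.ev (F.kernAct lam (F.convKern hΓ f) η) g = F.conv lam f η g := by
  rw [ev_kernAct, conv, lam.integral_div g]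
  congr 1 with k
  refine F.mul_congr (F.ev f) (F.ev η) _ _ rfl ?_
  exact (Γ.isMul_div g k.1 k.2.symm).eq_of_left (Γ.isMul_mul_inv_mul _ g (Γ.tgt_mul _ _ _))

/-- The uniform bounds of Schur's test for a kernel. -/
def KernBound (K : F.Kern) (C : ℝ) : Prop :=
  ∀ x, (∀ g, ∫⁻ k, ‖kev (F.kernFib K x) g k‖ₑ ∂(lam.smeas x) ≤ ENNReal.ofReal C) ∧
    ∀ k, ∫⁻ g, ‖kev (F.kernFib K x) g k‖ₑ ∂(lam.smeas x) ≤ ENNReal.ofReal C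

/-- D depends on L only: among kernels supported in a fixed compact set, uniform convergence implies
norm convergence of the operators. -/
theorem exists_kernBound {L : Set G} (hL : IsCompact L) : ∃ D, 0 ≤ D ∧ ∀ (K : F.Kern) (c : ℝ),
    0 ≤ c → (∀ g k e, ‖gev K g k e‖ ≤ c) → (∀ g k e, (g ∉ L ∨ k ∉ L) → gev K g k e = 0) →
    F.KernBound lam K (c * D) := by
  obtain ⟨D, hD0, hD⟩ := lam.exists_smeas_le hL
  refine ⟨D, hD0, fun K c hc hK h0 x => ⟨fun g => ?_, fun k => ?_⟩⟩
  · refine lam.lintegral_le_of_support hL (hD x) hc (fun k => ?_) fun k hk => ?_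
    · rw [← ofReal_norm]
      exact ENNReal.ofReal_le_ofReal (hK _ _ _)
    · exact (congrArg (‖·‖ₑ) (h0 _ _ _ (Or.inr hk))).trans enorm_zero
  · refine lam.lintegral_le_of_support hL (hD x) hc (fun g => ?_) fun g hg => ?_
    · rw [← ofReal_norm]
      exact ENNReal.ofReal_le_ofReal (hK _ _ _)
    · exact (congrArg (‖·‖ₑ) (h0 _ _ _ (Or.inl hg))).trans enorm_zero

variable {F} in
/-- The kernel vanishes outside a compact subset of `Γ ×_s Γ`. -/
def IsCompactKern (K : F.Kern) : Prop := ∃ L : Set G, IsCompact L ∧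
  ∀ g k e, (g ∉ L ∨ k ∉ L) → gev K g k e = 0

variable {F} in
theorem IsCompactKern.exists_norm_le {K : F.Kern} (hK : IsCompactKern K) :
    ∃ c, 0 ≤ c ∧ ∀ g k e, ‖gev K g k e‖ ≤ c := by
  obtain ⟨L, hL, h⟩ := hK
  have hcl : IsClosedEmbedding (Subtype.val : Γ.FibProd Γ.src → G × G) :=
    (isClosed_eq (Γ.continuous_src.comp continuous_snd)
      (Γ.continuous_src.comp continuous_fst)).isClosedEmbedding_subtypeVal
  obtain ⟨c, hc0, hc⟩ := F.isField.bddAbove_norm (continuous_gev K)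
    (hcl.isCompact_preimage (hL.prod hL)) fun z hz => h _ _ _ (by
      by_contra hcon
      push Not at hcon
      exact hz hcon)
  exact ⟨c, hc0, fun g k e => hc ⟨(g, k), e.symm⟩⟩

variable {F} in
theorem IsCompactKern.exists_kernBound {K : F.Kern} (hK : IsCompactKern K) :
    ∃ C, 0 ≤ C ∧ F.KernBound lam K C := by
  obtain ⟨c, hc0, hc⟩ := hK.exists_norm_le
  obtain ⟨L, hL, h⟩ := hK
  obtain ⟨D, hD0, hD⟩ := F.exists_kernBound lam hL
  exact ⟨c * D, by positivity, hD K c hc0 hc h⟩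

/-- The kernel f(gk⁻¹) need not have compact support, but by invariance its row and column integrals
are the integrals of ‖f(h⁻¹)‖ and ‖f(h)‖ over Γ_{t(g)} and Γ_{t(k)}, whose integrands are supported
in L⁻¹ and L. -/
theorem exists_kernBound_convKern (hΓ : Γ.IsProper) (f : F.Cc) :
    ∃ C, 0 ≤ C ∧ F.KernBound lam (F.convKern hΓ f) C := by
  obtain ⟨L, hL, h⟩ := F.exists_support f
  obtain ⟨c, hc0, hc⟩ := F.exists_bound f
  obtain ⟨D, hD0, hD⟩ := lam.exists_smeas_le (hL.union (hL.image Γ.continuous_inv))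
  have hce : ∀ g, ‖F.ev f g‖ₑ ≤ ENNReal.ofReal c := fun g => by
    rw [← ofReal_norm]
    exact ENNReal.ofReal_le_ofReal (hc _)
  refine ⟨c * D, by positivity, fun x => ⟨fun g => ?_, fun k => ?_⟩⟩
  · obtain ⟨g, rfl⟩ := g
    refine le_of_eq_of_le (lam.lintegral_div g fun h => ‖F.ev f h.1‖ₑ).symm ?_
    have h1 := lam.lintegral_smeas (Γ.tgt g) fun h => ‖F.ev f (Γ.inv h.1)‖ₑ
    have h2 : ∀ h : Γ.TFib (Γ.tgt g), ‖F.ev f (Γ.inv (Γ.invFib (Γ.tgt g) h).1)‖ₑ =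
        ‖F.ev f h.1‖ₑ := fun h => congrArg (fun g => ‖F.ev f g‖ₑ) (Γ.inv_inv h.1)
    simp only [h2] at h1
    rw [← h1]
    refine lam.lintegral_le_of_support (hL.union (hL.image Γ.continuous_inv)) (hD _) hc0
      (fun h => hce _) fun k hk => ?_
    rw [h _ fun hk' => hk (Or.inr ⟨_, hk', Γ.inv_inv _⟩), enorm_zero]
  · obtain ⟨k, rfl⟩ := k
    have h2 : ∀ g : Γ.SFib (Γ.src k), ‖kev (F.kernFib (F.convKern hΓ f) (Γ.src k)) g ⟨k, rfl⟩‖ₑ =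
        ‖F.ev f (Γ.inv (Γ.div k g.1 g.2.symm))‖ₑ := fun g => by
      rw [Γ.inv_div]
      rfl
    simp only [h2]
    refine le_of_eq_of_le (lam.lintegral_div k fun h => ‖F.ev f (Γ.inv h.1)‖ₑ).symm ?_
    refine le_of_eq_of_le (lam.lintegral_smeas (Γ.tgt k) fun h => ‖F.ev f h.1‖ₑ).symm ?_
    refine lam.lintegral_le_of_support (hL.union (hL.image Γ.continuous_inv)) (hD _) hc0
      (fun h => hce _) fun k hk => ?_
    rw [h _ fun hk' => hk (Or.inl hk'), enorm_zero]

/-! ### Operators given by kernels -/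

/-- `T` is the operator with kernel `K`. -/
def IsKernOp (K : F.Kern) (T : F.L2 lam →L[ℂ] F.L2 lam) : Prop :=
  ∀ η, T (F.toL2 lam η) = F.toL2 lam (F.kernAct lam K η)

variable {F lam}

theorem KernBound.norm_le {K : F.Kern} {C : ℝ} (hC : 0 ≤ C) (hK : F.KernBound lam K C) (x : M)
    (ω : F.CcFib x) : ‖F.toL2Fib lam x (F.kerOp lam (F.kernFib K x) ω)‖ ≤
      4 * C * ‖F.toL2Fib lam x ω‖ :=
  F.norm_kerOp_le lam _ hC (hK x).1 (hK x).2 ω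

theorem KernBound.adj {K : F.Kern} {C : ℝ} (hK : F.KernBound lam K C) :
    F.KernBound lam (F.kernAdj K) C := by
  have h : ∀ x (g k : Γ.SFib x), ‖kev (F.kernFib (F.kernAdj K) x) g k‖ₑ =
      ‖kev (F.kernFib K x) k g‖ₑ := fun x g k => by
    rw [← ofReal_norm, ← ofReal_norm, kernFib_kernAdj, kerAdj_kev, norm_star]
  intro x
  simp only [h]
  exact (hK x).symm

theorem KernBound.exists_op {K : F.Kern} {C : ℝ} (hC : 0 ≤ C) (hK : F.KernBound lam K C) :
    ∃ T, F.IsKernOp lam K T ∧ F.FibBound lam T (4 * C) :=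
  F.exists_extension lam (F.kernAct lam K) (by positivity) fun η x => by
    rw [restrict_kernAct]
    exact hK.norm_le hC x _

theorem clm_eq_of_toL2 {S S' : F.L2 lam →L[ℂ] F.L2 lam}
    (h : ∀ ξ, S (F.toL2 lam ξ) = S' (F.toL2 lam ξ)) : S = S' :=
  ContinuousLinearMap.ext fun u => congrFun (DenseRange.equalizer (F.denseRange_toL2 lam)
    S.continuous S'.continuous (funext h)) u

theorem IsKernOp.unique {K : F.Kern} {T T'} (h : F.IsKernOp lam K T) (h' : F.IsKernOp lam K T') :
    T = T' := clm_eq_of_toL2 fun ξ => (h ξ).trans (h' ξ).symm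

theorem IsKernOp.fibBound {K : F.Kern} {C : ℝ} {T} (h : F.IsKernOp lam K T) (hC : 0 ≤ C)
    (hK : F.KernBound lam K C) : F.FibBound lam T (4 * C) := by
  obtain ⟨T', h', hb⟩ := hK.exists_op hC
  rwa [h.unique h']

/-- Immediate for restrictions of global sections; they are dense, and both sides are bounded in ω
by the Schur test. -/
theorem IsKernOp.fiberOp_apply {K : F.Kern} {C : ℝ} {T} (h : F.IsKernOp lam K T) (hC : 0 ≤ C)
    (hK : F.KernBound lam K C) (x : M) (ω : F.CcFib x) :
    F.fiberOp lam T x (F.toL2Fib lam x ω) =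
      F.toL2Fib lam x (F.kerOp lam (F.kernFib K x) ω) := by
  have hb := h.fibBound hC hK
  rw [← sub_eq_zero, ← norm_le_zero_iff]
  refine le_of_forall_pos_le_add fun ε hε => ?_
  -- Each of the two operators contributes an error of at most 4C times the distance.
  obtain ⟨_, h1, η, rfl⟩ := Metric.dense_iff.1 (F.denseRange_restrict lam x) (F.toL2Fib lam x ω)
    (ε / (8 * C + 1)) (by positivity)
  rw [Metric.mem_ball, dist_eq_norm, lt_div_iff₀ (by positivity)] at h1
  have h2 : F.fiberOp lam T x (F.toL2Fib lam x (F.restrict x η)) =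
      F.toL2Fib lam x (F.kerOp lam (F.kernFib K x) (F.restrict x η)) := by
    rw [← fiberAt_toL2, hb.fiberOp_apply, h, fiberAt_toL2, restrict_kernAct]
  have h3 : F.fiberOp lam T x (F.toL2Fib lam x ω) -
      F.toL2Fib lam x (F.kerOp lam (F.kernFib K x) ω) =
      F.toL2Fib lam x (F.kerOp lam (F.kernFib K x) (F.restrict x η - ω)) -
        F.fiberOp lam T x (F.toL2Fib lam x (F.restrict x η - ω)) := by
    rw [kerOp_sub_right, toL2Fib_sub, toL2Fib_sub, map_sub, h2]
    abel
  rw [h3]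
  have h4 := hK.norm_le hC x (F.restrict x η - ω)
  have h5 := (F.fiberOp lam T x).le_of_opNorm_le (hb.norm_fiberOp_le (by positivity) x)
    (F.toL2Fib lam x (F.restrict x η - ω))
  have h6 := norm_sub_le (F.toL2Fib lam x (F.kerOp lam (F.kernFib K x) (F.restrict x η - ω)))
    (F.fiberOp lam T x (F.toL2Fib lam x (F.restrict x η - ω)))
  rw [toL2Fib_sub] at h4 h5
  have h7 : ‖F.toL2Fib lam x (F.restrict x η) - F.toL2Fib lam x ω‖ * (8 * C + 1) < ε := h1
  have h8 := norm_nonneg (F.toL2Fib lam x (F.restrict x η) - F.toL2Fib lam x ω)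
  rw [toL2Fib_sub] at h6 ⊢
  linarith

theorem IsKernOp.isAdjointable {K : F.Kern} {C : ℝ} {T} (h : F.IsKernOp lam K T) (hC : 0 ≤ C)
    (hK : F.KernBound lam K C) : F.IsAdjointable lam T := by
  obtain ⟨T', h', -⟩ := hK.adj.exists_op hC
  refine ⟨T', fun ξ η x => ?_⟩
  refine (F.denseRange_toL2 lam).induction_on₂ (p := fun ξ η =>
    F.ip lam x (F.fiberAt lam (T ξ) x) (F.fiberAt lam η x) =
      F.ip lam x (F.fiberAt lam ξ x) (F.fiberAt lam (T' η) x)) ?_ (fun ξ η => ?_) ξ η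
  · exact isClosed_eq
      (continuous_ip_comp ((F.fiberL lam x).continuous.comp (T.continuous.comp continuous_fst))
        ((F.fiberL lam x).continuous.comp continuous_snd))
      (continuous_ip_comp ((F.fiberL lam x).continuous.comp continuous_fst)
        ((F.fiberL lam x).continuous.comp (T'.continuous.comp continuous_snd)))
  · rw [h, h', fiberAt_toL2, fiberAt_toL2, fiberAt_toL2, fiberAt_toL2, ip_coe, ip_coe,
      restrict_kernAct, restrict_kernAct, ipPre_kerOp, kernFib_kernAdj]

theorem kernAct_add_left (K K' : F.Kern) (η : F.Cc) :
    F.kernAct lam (K + K') η = F.kernAct lam K η + F.kernAct lam K' η :=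
  Cc.ext fun g => congrArg (CcFib.eval · _) (F.kerOp_add_left lam (F.kernFib K (Γ.src g))
    (F.kernFib K' (Γ.src g)) (F.restrict (Γ.src g) η))

theorem kernAct_sub_left (K K' : F.Kern) (η : F.Cc) :
    F.kernAct lam (K - K') η = F.kernAct lam K η - F.kernAct lam K' η :=
  Cc.ext fun g => congrArg (CcFib.eval · _) (F.kerOp_sub_left lam (F.kernFib K (Γ.src g))
    (F.kernFib K' (Γ.src g)) (F.restrict (Γ.src g) η))

theorem kernAct_smul_left (c : ℂ) (K : F.Kern) (η : F.Cc) :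
    F.kernAct lam (c • K) η = c • F.kernAct lam K η :=
  Cc.ext fun g => congrArg (CcFib.eval · _) (F.kerOp_smul_left lam c (F.kernFib K (Γ.src g))
    (F.restrict (Γ.src g) η))

theorem IsKernOp.add {K K' : F.Kern} {T T'} (h : F.IsKernOp lam K T) (h' : F.IsKernOp lam K' T') :
    F.IsKernOp lam (K + K') (T + T') := fun η => by
  rw [_root_.add_apply, h, h', kernAct_add_left]
  exact (map_add (F.toL2L lam) _ _).symm

theorem IsKernOp.sub {K K' : F.Kern} {T T'} (h : F.IsKernOp lam K T) (h' : F.IsKernOp lam K' T') :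
    F.IsKernOp lam (K - K') (T - T') := fun η => by
  rw [_root_.sub_apply, h, h', kernAct_sub_left]
  exact (map_sub (F.toL2L lam) _ _).symm

theorem IsKernOp.smul {K : F.Kern} {T} (c : ℂ) (h : F.IsKernOp lam K T) :
    F.IsKernOp lam (c • K) (c • T) := fun η => by
  rw [_root_.smul_apply, h, kernAct_smul_left]
  exact (map_smul (F.toL2L lam) c _).symm

theorem isKernOp_zero : F.IsKernOp lam 0 0 := fun η => by
  have h := kernAct_smul_left (lam := lam) 0 (0 : F.Kern) η
  rw [zero_smul, zero_smul] at h
  rw [h]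
  exact (map_zero (F.toL2L lam)).symm

theorem isLeftConv_iff (hΓ : Γ.IsProper) (f : F.Cc) (S : F.L2 lam →L[ℂ] F.L2 lam) :
    F.IsLeftConv lam f S ↔ F.IsKernOp lam (F.convKern hΓ f) S := by
  refine forall_congr' fun η => ⟨?_, fun h => ⟨_, F.ev_kernAct_convKern lam hΓ f η, h⟩⟩
  rintro ⟨ζ, hζ, h⟩
  rw [h]
  congr 1
  exact Cc.ext fun g => (hζ g).trans (F.ev_kernAct_convKern lam hΓ f η g).symm

/-- The kernel description tests T on C_c(Γ;E) only. The reverse implication therefore needs a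
density argument, and with it continuity of e ↦ ξ_x e. -/
theorem isRankOne_iff_isKernOp (ξ η : F.Cc) (T : F.L2 lam →L[ℂ] F.L2 lam) :
    F.IsRankOne lam (F.toL2 lam ξ) (F.toL2 lam η) T ↔ F.IsKernOp lam (F.rankKern ξ η) T := by
  have key : ∀ ζ x, F.fiberAt lam (F.toL2 lam (F.kernAct lam (F.rankKern ξ η) ζ)) x =
      F.rmul lam (Γ.unit x) (Γ.tgt_unit x) (Γ.src_unit x)
        (F.ip lam x (F.fiberAt lam (F.toL2 lam η) x) (F.fiberAt lam (F.toL2 lam ζ) x))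
        (F.fiberAt lam (F.toL2 lam ξ) x) := fun ζ x => by
    rw [fiberAt_toL2, fiberAt_toL2, fiberAt_toL2, fiberAt_toL2, ip_coe, rmul_eq, rmulL_coe,
      restrict_kernAct, kernFib_rankKern, kerOp_rankOneKer]
  constructor
  · intro h ζ
    exact l2_ext fun x => (h _ x).trans (key ζ x).symm
  · intro h ζ x
    refine (F.denseRange_toL2 lam).induction_on (p := fun ζ => F.fiberAt lam (T ζ) x =
      F.rmul lam (Γ.unit x) (Γ.tgt_unit x) (Γ.src_unit x)
        (F.ip lam x (F.fiberAt lam (F.toL2 lam η) x) (F.fiberAt lam ζ x))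
        (F.fiberAt lam (F.toL2 lam ξ) x)) ζ ?_ fun ζ => by rw [h, key]
    have hlin : Continuous fun e => F.rmulL lam (Γ.unit x) (Γ.tgt_unit x) (Γ.src_unit x) e
        (F.fiberAt lam (F.toL2 lam ξ) x) := by
      refine ((LinearMap.mk₂ ℂ (fun u e => F.rmulL lam (Γ.unit x) (Γ.tgt_unit x) (Γ.src_unit x) e u)
        (fun u v _ => map_add _ u v) (fun c u _ => map_smul _ c u)
        (fun u e e' => F.rmulL_add lam _ _ _ e e' u) (fun c u e => F.rmulL_smul lam _ _ _ c e u)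
        (F.fiberAt lam (F.toL2 lam ξ) x)).mkContinuous
          ‖F.fiberAt lam (F.toL2 lam ξ) x‖ fun e => ?_).continuous
      rw [mul_comm]
      exact F.norm_rmulL_le lam _ _ _ e _
    simp only [rmul_eq]
    exact isClosed_eq ((F.fiberL lam x).continuous.comp T.continuous)
      (hlin.comp (continuous_ip_comp continuous_const (F.fiberL lam x).continuous))

end FellBundle

end

end FellGroupoid

namespace FellGroupoid

noncomputable section

/-! ### Norm closures of sets of operators -/

section ClosureOfOperators

variable {H : Type*} [NormedAddCommGroup H] [NormedSpace ℂ H] {T : H →L[ℂ] H}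

theorem clm_mem_closure_iff {s : Set (H →L[ℂ] H)} :
    T ∈ closure s ↔ ∀ ε > 0, ∃ S ∈ s, ‖S - T‖ ≤ ε := by
  rw [Metric.mem_closure_iff]
  refine ⟨fun h ε hε => ?_, fun h ε hε => ?_⟩
  · obtain ⟨S, hS, h⟩ := h ε hε
    rw [dist_comm, dist_eq_norm] at h
    exact ⟨S, hS, h.le⟩
  · obtain ⟨S, hS, h⟩ := h (ε / 2) (half_pos hε)
    refine ⟨S, hS, ?_⟩
    rw [dist_comm, dist_eq_norm]
    exact h.trans_lt (half_lt_self hε)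

theorem clm_mem_of_isClosed {s : Set (H →L[ℂ] H)} (hs : IsClosed s)
    (h : ∀ ε > 0, ∃ S ∈ s, ‖S - T‖ ≤ ε) : T ∈ s :=
  hs.closure_eq ▸ clm_mem_closure_iff.2 h

theorem clm_mem_topologicalClosure_iff {P : Submodule ℂ (H →L[ℂ] H)} :
    T ∈ P.topologicalClosure ↔ ∀ ε > 0, ∃ S ∈ P, ‖S - T‖ ≤ ε := clm_mem_closure_iff

theorem clm_mem_topologicalClosure {P : Submodule ℂ (H →L[ℂ] H)}
    (h : ∀ ε > 0, ∃ S ∈ P.topologicalClosure, ‖S - T‖ ≤ ε) : T ∈ P.topologicalClosure :=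
  clm_mem_of_isClosed P.isClosed_topologicalClosure h

theorem clm_topologicalClosure_span_le {A : Set (H →L[ℂ] H)} {P : Submodule ℂ (H →L[ℂ] H)}
    (h : ∀ T ∈ A, ∀ ε > 0, ∃ S ∈ P, ‖S - T‖ ≤ ε) :
    (Submodule.span ℂ A).topologicalClosure ≤ P.topologicalClosure :=
  Submodule.topologicalClosure_minimal _
    (Submodule.span_le.2 fun T hT => clm_mem_topologicalClosure_iff.2 (h T hT))
    P.isClosed_topologicalClosure

end ClosureOfOperators

namespace FellBundle

variable {G M : Type*} [TopologicalSpace G] [TopologicalSpace M] {Γ : TopGroupoid G M} {E : G → Type*}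
  [∀ g, NormedAddCommGroup (E g)] [∀ g, NormedSpace ℂ (E g)] [TopologicalSpace (Tot E)]
  (F : FellBundle Γ E)

/-! ### Kernels of finite rank -/

/-- The linear span of the kernels `ξ(g) η(k)*`. -/
def rankSpan : Submodule ℂ F.Kern := Submodule.span ℂ {K | ∃ ξ η, K = F.rankKern ξ η}

variable {F}

/-- A weight a(g)b(k) is absorbed by the factors of ξ(g)η(k)*: it replaces ξ by aξ and η by the
product of η with the conjugate of b. -/
theorem kernMul_mem_rankSpan (a b : C(G, ℂ)) {w : C(G × G, ℂ)} (hw : ∀ g k, w (g, k) = a g * b k)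
    {K : F.Kern} (hK : K ∈ F.rankSpan) : F.kernMul w K ∈ F.rankSpan := by
  induction hK using Submodule.span_induction with
  | mem K hK =>
    obtain ⟨ξ, η, rfl⟩ := hK
    refine Submodule.subset_span ⟨F.ccMul a ξ, F.ccMul (starRingEnd C(G, ℂ) b) η, ?_⟩
    refine Kern.ext fun g k e => ?_
    rw [kernMul_gev, rankKern_gev, rankKern_gev, ccMul_ev, ccMul_ev, F.smul_mul, F.star_smul,
      F.mul_smul, smul_smul, hw]
    congr 2
    exact (Complex.conj_conj _).symm
  | zero =>
    have : F.kernMul w 0 = 0 := Kern.ext fun g k e => smul_zero _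
    rw [this]
    exact Submodule.zero_mem _
  | add K K' _ _ h h' =>
    have : F.kernMul w (K + K') = F.kernMul w K + F.kernMul w K' :=
      Kern.ext fun g k e => smul_add _ _ _
    rw [this]
    exact Submodule.add_mem _ h h'
  | smul c K _ h =>
    have : F.kernMul w (c • K) = c • F.kernMul w K := Kern.ext fun g k e => smul_comm _ _ _
    rw [this]
    exact Submodule.smul_mem _ c h

theorem isCompactKern_of_mem_rankSpan {K : F.Kern} (hK : K ∈ F.rankSpan) : IsCompactKern K := by
  induction hK using Submodule.span_induction with
  | mem K hK =>
    obtain ⟨ξ, η, rfl⟩ := hK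
    obtain ⟨L, hL, h⟩ := F.exists_support ξ
    obtain ⟨L', hL', h'⟩ := F.exists_support η
    refine ⟨L ∪ L', hL.union hL', fun g k e hgk => ?_⟩
    rw [rankKern_gev]
    rcases hgk with hgk | hgk
    · rw [h g fun hg => hgk (Or.inl hg), zero_mul]
    · rw [h' k fun hk => hgk (Or.inr hk), star_zero, mul_zero]
  | zero => exact ⟨∅, isCompact_empty, fun _ _ _ _ => rfl⟩
  | add K K' _ _ h h' =>
    obtain ⟨L, hL, h⟩ := h
    obtain ⟨L', hL', h'⟩ := h'
    refine ⟨L ∪ L', hL.union hL', fun g k e hgk => ?_⟩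
    rw [gev_add, h g k e (hgk.imp (fun h hg => h (Or.inl hg)) fun h hg => h (Or.inl hg)),
      h' g k e (hgk.imp (fun h hg => h (Or.inr hg)) fun h hg => h (Or.inr hg)), add_zero]
  | smul c K _ h =>
    obtain ⟨L, hL, h⟩ := h
    exact ⟨L, hL, fun g k e hgk => by rw [gev_smul, h g k e hgk, smul_zero]⟩

variable [T2Space M] [T2Space G] [LocallyCompactSpace G]

variable (F) in
/-- The map `K ↦ K(g, ·)`. -/
def gevL (g : G) : F.Kern →ₗ[ℂ] ∀ k : Γ.SFib (Γ.src g), E (Γ.div g k.1 k.2.symm) where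
  toFun K k := gev K g k.1 k.2.symm
  map_add' _ _ := rfl
  map_smul' _ _ := rfl

/-- Uniform approximation of a compactly supported kernel along a fibre `{g} × Γ_{s(g)}`. -/
theorem exists_rankSpan_approx_fib {K : F.Kern} {L : Set G} (hL : IsCompact L)
    (h0 : ∀ g k e, (g ∉ L ∨ k ∉ L) → gev K g k e = 0) (g : G) {ε : ℝ} (hε : 0 < ε) :
    ∃ K' ∈ F.rankSpan, ∀ k e, ‖gev K' g k e - gev K g k e‖ ≤ ε := by
  have h := F.isField.exists_approx_of_dense (Y := Γ.SFib (Γ.src g)) (B := G)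
    (q := fun k => Γ.div g k.1 k.2.symm) (I := fun k => gev K g k.1 k.2.symm)
    (Γ.isClosedEmbedding_sfib (Γ.src g)) (F.rankSpan.map (F.gevL g)) ?_ ?_ ?_
    (continuous_gev_comp K continuous_const continuous_subtype_val _) hL
    (fun k hk => h0 _ _ _ (Or.inr hk)) hε
  · obtain ⟨_, ⟨K', hK', rfl⟩, h⟩ := h
    exact ⟨K', hK', fun k e => h ⟨k, e.symm⟩⟩
  · rintro φ - _ ⟨K', hK', rfl⟩
    let b : C(G, ℂ) := ⟨fun k => ((φ k : ℝ) : ℂ), Complex.continuous_ofReal.comp φ.continuous⟩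
    refine ⟨_, kernMul_mem_rankSpan 1 b
      (w := b.comp ⟨Prod.snd, continuous_snd⟩) (fun g k => (one_mul _).symm) hK', rfl⟩
  · rintro _ ⟨K', hK', rfl⟩
    exact continuous_gev_comp K' continuous_const continuous_subtype_val _
  -- Fullness for the product g·k⁻¹: the values ξ(g)η(k)* are all the products of E_g and E_{k⁻¹}.
  · intro k e ε hε
    obtain ⟨_, ⟨_, ⟨K', hK', rfl⟩, rfl⟩, h⟩ := F.exists_norm_sub_lt (Γ.isMul_div' g k.1 k.2.symm)
      ((F.rankSpan.map (F.gevL g)).map (LinearMap.proj k)) (fun a b => by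
        obtain ⟨ξ, rfl⟩ := F.exists_cc g a
        obtain ⟨η, hη⟩ := F.exists_cc k.1 (F.star (Γ.inv_inv _) b)
        refine ⟨_, ⟨_, Submodule.subset_span ⟨ξ, η, rfl⟩, rfl⟩, ?_⟩
        change F.mul (Γ.isMul_div' g k.1 k.2.symm) (F.ev ξ g) (F.star rfl (F.ev η k.1)) = _
        rw [hη, F.star_star]) e hε
    exact ⟨_, ⟨K', hK', rfl⟩, h⟩

/-- Uniform approximation of a compactly supported kernel by kernels of finite rank, with control of
the supports. -/
theorem IsCompactKern.exists_rankSpan_approx {K : F.Kern} (hK : IsCompactKern K) :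
    ∃ L : Set G, IsCompact L ∧ (∀ g k e, (g ∉ L ∨ k ∉ L) → gev K g k e = 0) ∧ ∀ ε > 0,
      ∃ K' ∈ F.rankSpan, (∀ g k e, ‖gev K' g k e - gev K g k e‖ ≤ ε) ∧
        ∀ g k e, (g ∉ L ∨ k ∉ L) → gev K' g k e = 0 := by
  obtain ⟨L, hL, h0⟩ := hK
  obtain ⟨ψ, hψ1, -, hψc, hψ01⟩ := exists_continuous_one_zero_of_isCompact hL isClosed_empty
    (Set.disjoint_empty _)
  set b : C(G, ℂ) := ⟨fun k => ((ψ k : ℝ) : ℂ), Complex.continuous_ofReal.comp ψ.continuous⟩ with hb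
  have hbk : ∀ k, b k = ((ψ k : ℝ) : ℂ) := fun _ => rfl
  have hbn : ∀ k, ‖b k‖ ≤ 1 := fun k => by
    rw [hbk, Complex.norm_real, Real.norm_of_nonneg (hψ01 k).1]
    exact (hψ01 k).2
  have hb1 : ∀ k ∈ L, b k = 1 := fun k hk => by
    have : ψ k = 1 := hψ1 hk
    rw [hbk, this, Complex.ofReal_one]
  have hb0 : ∀ k ∉ tsupport ψ, b k = 0 := fun k hk => by
    rw [hbk, image_eq_zero_of_notMem_tsupport hk, Complex.ofReal_zero]
  have hLψ : L ⊆ tsupport ψ := fun k hk => by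
    by_contra hcon
    exact one_ne_zero ((hb1 k hk).symm.trans (hb0 k hcon))
  -- Cutoffs in k alone (`w₂`) and in both variables (`w`). The first serves for the local
  -- approximation near an arrow g₀, the second controls the final support.
  let w₂ : C(G × G, ℂ) := b.comp ⟨Prod.snd, continuous_snd⟩
  let w : C(G × G, ℂ) := b.comp ⟨Prod.fst, continuous_fst⟩ * w₂
  have hww : ∀ g k, w (g, k) = b g * b k := fun _ _ => rfl
  -- Cutting off does not increase the error: the factor is 1 where K may be nonzero, and elsewhere
  -- it shrinks a vector approximating 0.
  have hw : ∀ (c : ℂ) (g k : G) (e : Γ.src g = Γ.src k) (u : E (Γ.div g k e)), ‖c‖ ≤ 1 →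
      (g ∈ L → k ∈ L → c = 1) → ‖c • u - gev K g k e‖ ≤ ‖u - gev K g k e‖ := by
    intro c g k e u hc1 hc
    by_cases hgk : g ∈ L ∧ k ∈ L
    · rw [hc hgk.1 hgk.2, one_smul]
    · rw [h0 g k e (by tauto), sub_zero, sub_zero, norm_smul]
      exact mul_le_of_le_one_left (norm_nonneg _) hc1
  refine ⟨tsupport ψ, hψc, fun g k e hgk => h0 g k e
    (hgk.imp (fun h hg => h (hLψ hg)) fun h hg => h (hLψ hg)), fun ε hε => ?_⟩
  have happ := exists_approx (Z := Γ.FibProd Γ.src) (fun z => z.1.1)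
    (F.rankSpan.map F.Kern.subtype) ?_ K.1 hL (fun z hz => h0 _ _ _ (Or.inl hz)) hε.le ?_
  · obtain ⟨_, ⟨K', hK', rfl⟩, h⟩ := happ
    refine ⟨F.kernMul w K', kernMul_mem_rankSpan b b hww hK',
      fun g k e => ?_, fun g k e hgk => ?_⟩
    · rw [kernMul_gev]
      refine (hw _ g k e _ ?_ fun hg hk => ?_).trans (h ⟨(g, k), e.symm⟩)
      · rw [hww, norm_mul]
        exact mul_le_one₀ (hbn _) (norm_nonneg _) (hbn _)
      · rw [hww, hb1 g hg, hb1 k hk, one_mul]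
    · rw [kernMul_gev, hww]
      rcases hgk with hgk | hgk
      · rw [hb0 g hgk, MulZeroClass.zero_mul, zero_smul]
      · rw [hb0 k hgk, MulZeroClass.mul_zero, zero_smul]
  · rintro φ - _ ⟨K', hK', rfl⟩
    let a : C(G, ℂ) := ⟨fun k => ((φ k : ℝ) : ℂ), Complex.continuous_ofReal.comp φ.continuous⟩
    exact ⟨_, kernMul_mem_rankSpan a 1 (w := a.comp ⟨Prod.fst, continuous_fst⟩)
      (fun g k => (mul_one _).symm) hK', rfl⟩
  -- An approximation along {g₀} × Γ_{s(g₀)} extends to g near g₀ by the tube lemma, for k in the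
  -- support of ψ. For the other k, the cutoff makes the approximant vanish, as K does.
  · intro g₀ _
    obtain ⟨K', hK', h1⟩ := exists_rankSpan_approx_fib hL h0 g₀ (half_pos hε)
    set K'' := F.kernMul w₂ K' with hK''
    have h2 : ∀ k e, ‖gev K'' g₀ k e - gev K g₀ k e‖ < ε := fun k e =>
      ((hw _ g₀ k e _ (hbn k) fun _ hk => hb1 k hk).trans (h1 k e)).trans_lt (half_lt_self hε)
    have h3 := Γ.eventually_fibProd (p := Γ.src) Γ.continuous_src
      (P := fun z => ‖gev K'' z.1.1 z.1.2 z.2.symm - gev K z.1.1 z.1.2 z.2.symm‖ < ε)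
      (y₀ := g₀) (L := tsupport ψ) hψc fun k e _ => F.isField.eventually_norm_lt
        (F.isField.continuous_sub_comp (continuous_gev K'') (continuous_gev K)).continuousAt
        (h2 k e.symm)
    refine ⟨K''.1, ⟨K'', kernMul_mem_rankSpan 1 b (fun g k => (one_mul _).symm) hK', rfl⟩, _, h3,
      fun z hz => ?_⟩
    by_cases hk : z.1.2 ∈ tsupport ψ
    · exact (hz _ hk z.2).le
    · change ‖w₂ (z.1.1, z.1.2) • gev K' z.1.1 z.1.2 z.2.symm - gev K z.1.1 z.1.2 z.2.symm‖ ≤ ε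
      have : w₂ (z.1.1, z.1.2) = 0 := hb0 _ hk
      rw [this, zero_smul, h0 _ _ _ (Or.inr fun h => hk (hLψ h)), sub_zero, norm_zero]
      exact hε.le

/-! ### Compact operators -/

variable [MeasurableSpace G] [BorelSpace G] {lam : HaarSystem Γ}

theorem exists_isKernOp_mem_compactOps {K : F.Kern} (hK : K ∈ F.rankSpan) :
    ∃ T ∈ F.compactOps lam, F.IsKernOp lam K T := by
  induction hK using Submodule.span_induction with
  | mem K hK =>
    obtain ⟨ξ, η, rfl⟩ := hK
    obtain ⟨C, hC0, hC⟩ := (isCompactKern_of_mem_rankSpan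
      (Submodule.subset_span ⟨ξ, η, rfl⟩ : F.rankKern ξ η ∈ F.rankSpan)).exists_kernBound lam
    obtain ⟨T, hT, -⟩ := hC.exists_op hC0
    exact ⟨T, Submodule.le_topologicalClosure _ (Submodule.subset_span
      ⟨_, _, (isRankOne_iff_isKernOp ξ η T).2 hT⟩), hT⟩
  | zero => exact ⟨0, Submodule.zero_mem _, isKernOp_zero⟩
  | add K K' _ _ h h' =>
    obtain ⟨T, hT, h⟩ := h
    obtain ⟨T', hT', h'⟩ := h'
    exact ⟨T + T', Submodule.add_mem _ hT hT', h.add h'⟩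
  | smul c K _ h =>
    obtain ⟨T, hT, h⟩ := h
    exact ⟨c • T, Submodule.smul_mem _ c hT, h.smul c⟩

theorem mem_compactOps_of_approx {T : F.L2 lam →L[ℂ] F.L2 lam}
    (h : ∀ ε > 0, ∃ T' ∈ F.compactOps lam, ‖T' - T‖ ≤ ε) : T ∈ F.compactOps lam := by
  exact clm_mem_topologicalClosure (H := F.L2 lam) h

/-- The finite rank approximants share a compact support with K, so by the Schur test uniform
convergence of the kernels is norm convergence of the operators. -/
theorem IsKernOp.mem_compactOps {K : F.Kern} {T} (h : F.IsKernOp lam K T) (hK : IsCompactKern K) :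
    T ∈ F.compactOps lam := by
  obtain ⟨L, hL, h0, happ⟩ := hK.exists_rankSpan_approx
  obtain ⟨D, hD0, hD⟩ := F.exists_kernBound lam hL
  refine mem_compactOps_of_approx fun ε hε => ?_
  obtain ⟨K', hK', h1, h2⟩ := happ (ε / (4 * D + 1)) (by positivity)
  obtain ⟨T', hT', h'⟩ := exists_isKernOp_mem_compactOps (lam := lam) hK'
  refine ⟨T', hT', ?_⟩
  have hb := (h'.sub h).fibBound (by positivity) (hD (K' - K) (ε / (4 * D + 1)) (by positivity) h1
    fun g k e hgk => by rw [gev_sub, h0 g k e hgk, h2 g k e hgk, sub_zero])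
  refine (hb.opNorm_le (by positivity)).trans ?_
  have : 4 * (ε / (4 * D + 1) * D) = ε * (4 * D / (4 * D + 1)) := by ring
  rw [this]
  exact mul_le_of_le_one_right hε.le (div_le_one_of_le₀ (by linarith) (by positivity))

variable (F lam) in
/-- The operators with kernels of finite rank. -/
def finRankOps : Submodule ℂ (F.L2 lam →L[ℂ] F.L2 lam) where
  carrier := {T | ∃ K ∈ F.rankSpan, F.IsKernOp lam K T}
  add_mem' := by
    rintro _ _ ⟨K, hK, h⟩ ⟨K', hK', h'⟩
    exact ⟨K + K', Submodule.add_mem _ hK hK', h.add h'⟩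
  zero_mem' := ⟨0, Submodule.zero_mem _, isKernOp_zero⟩
  smul_mem' := by
    rintro c _ ⟨K, hK, h⟩
    exact ⟨c • K, Submodule.smul_mem _ c hK, h.smul c⟩

/-- The operator u⟨v, ·⟩ depends continuously on u and v, which are approximated by elements of
C_c(Γ;E). -/
theorem IsRankOne.exists_finRankOps {u v : F.L2 lam} {S : F.L2 lam →L[ℂ] F.L2 lam}
    (hS : F.IsRankOne lam u v S) {ε : ℝ} (hε : 0 < ε) :
    ∃ T' ∈ F.finRankOps lam, ‖T' - S‖ ≤ ε := by
  -- The two terms come from changing u and then v; δ ≤ 1 bounds the approximant of u by ‖u‖ + 1,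
  -- and 4 is the constant of `norm_ip_le`.
  obtain ⟨δ, hδ0, hδ1, hδ⟩ : ∃ δ : ℝ, 0 < δ ∧ δ ≤ 1 ∧ 4 * (δ * ‖v‖ + (‖u‖ + 1) * δ) ≤ ε := by
    refine ⟨min 1 (ε / (4 * (‖v‖ + (‖u‖ + 1)))), lt_min one_pos (by positivity), min_le_left _ _, ?_⟩
    have h1 := min_le_right 1 (ε / (4 * (‖v‖ + (‖u‖ + 1))))
    rw [le_div_iff₀ (by positivity)] at h1
    linarith
  obtain ⟨_, hξ, ξ, rfl⟩ := Metric.dense_iff.1 (F.denseRange_toL2 lam) u δ hδ0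
  obtain ⟨_, hη, η, rfl⟩ := Metric.dense_iff.1 (F.denseRange_toL2 lam) v δ hδ0
  rw [Metric.mem_ball, dist_eq_norm] at hξ hη
  have hK : F.rankKern ξ η ∈ F.rankSpan := Submodule.subset_span ⟨ξ, η, rfl⟩
  obtain ⟨T', -, hT'⟩ := exists_isKernOp_mem_compactOps (lam := lam) hK
  refine ⟨T', ⟨_, hK, hT'⟩, ContinuousLinearMap.opNorm_le_bound _ hε.le fun ζ =>
    norm_le_of_fiberAt (by positivity) fun x => ?_⟩
  have h1 := (isRankOne_iff_isKernOp ξ η T').2 hT' ζ x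
  have h2 := hS ζ x
  rw [rmul_eq] at h1 h2
  set R := fun e => F.rmulL lam (Γ.unit x) (Γ.tgt_unit x) (Γ.src_unit x) e with hR
  have hRsub : ∀ e e' w, R (e - e') w = R e w - R e' w := fun e e' w => by
    rw [eq_sub_iff_add_eq, hR]
    simp only
    rw [← rmulL_add, sub_add_cancel]
  set ξx := F.fiberAt lam (F.toL2 lam ξ) x
  set ηx := F.fiberAt lam (F.toL2 lam η) x
  set ζx := F.fiberAt lam ζ x
  have e1 : ‖F.fiberAt lam u x - ξx‖ ≤ δ := by
    rw [norm_sub_rev]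
    exact (F.norm_fiberAt_le lam x (F.toL2 lam ξ - u)).trans hξ.le
  have e2 : ‖F.fiberAt lam v x - ηx‖ ≤ δ := by
    rw [norm_sub_rev]
    exact (F.norm_fiberAt_le lam x (F.toL2 lam η - v)).trans hη.le
  have e3 : ‖ξx‖ ≤ ‖u‖ + 1 := by
    have h3 := norm_sub_norm_le ξx (F.fiberAt lam u x)
    rw [norm_sub_rev] at h3
    linarith [F.norm_fiberAt_le lam x u]
  have e4 : ‖F.fiberAt lam v x‖ ≤ ‖v‖ := F.norm_fiberAt_le lam x v
  have e5 : ‖ζx‖ ≤ ‖ζ‖ := F.norm_fiberAt_le lam x ζ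
  rw [_root_.sub_apply, fiberAt_sub, h1, h2]
  have e6 : R (F.ip lam x ηx ζx) ξx - R (F.ip lam x (F.fiberAt lam v x) ζx) (F.fiberAt lam u x) =
      -(R (F.ip lam x (F.fiberAt lam v x) ζx) (F.fiberAt lam u x - ξx) +
        R (F.ip lam x (F.fiberAt lam v x - ηx) ζx) ξx) := by
    rw [ip_sub_left, hRsub, map_sub]
    abel
  change ‖R (F.ip lam x ηx ζx) ξx - R (F.ip lam x (F.fiberAt lam v x) ζx) (F.fiberAt lam u x)‖ ≤ _
  rw [e6, norm_neg]
  calc _ ≤ _ := norm_add_le _ _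
    _ ≤ 4 * ‖F.fiberAt lam v x‖ * ‖ζx‖ * ‖F.fiberAt lam u x - ξx‖ +
        4 * ‖F.fiberAt lam v x - ηx‖ * ‖ζx‖ * ‖ξx‖ :=
      add_le_add ((F.norm_rmulL_le lam _ _ _ _ _).trans
          (mul_le_mul_of_nonneg_right (F.norm_ip_le lam x _ _) (norm_nonneg _)))
        ((F.norm_rmulL_le lam _ _ _ _ _).trans
          (mul_le_mul_of_nonneg_right (F.norm_ip_le lam x _ _) (norm_nonneg _)))
    _ ≤ 4 * ‖v‖ * ‖ζ‖ * δ + 4 * δ * ‖ζ‖ * (‖u‖ + 1) := by gcongr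
    _ = 4 * (δ * ‖v‖ + (‖u‖ + 1) * δ) * ‖ζ‖ := by ring
    _ ≤ ε * ‖ζ‖ := by gcongr

/-- A compact operator is a norm limit of operators with kernels of finite rank. -/
theorem exists_isKernOp_of_mem_compactOps {T : F.L2 lam →L[ℂ] F.L2 lam}
    (hT : T ∈ F.compactOps lam) {ε : ℝ} (hε : 0 < ε) :
    ∃ K ∈ F.rankSpan, ∃ T', F.IsKernOp lam K T' ∧ ‖T' - T‖ ≤ ε := by
  have h := clm_topologicalClosure_span_le (H := F.L2 lam) (P := F.finRankOps lam)
    (A := {T | ∃ ξ η, F.IsRankOne lam ξ η T}) (by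
      rintro T ⟨u, v, h⟩ ε hε
      exact h.exists_finRankOps hε) hT
  obtain ⟨T', ⟨K, hK, h1⟩, h2⟩ := (clm_mem_topologicalClosure_iff (H := F.L2 lam)).1 h ε hε
  exact ⟨K, hK, T', h1, h2⟩

theorem isAdjointable_of_mem_compactOps [LocallyCompactSpace M] {T : F.L2 lam →L[ℂ] F.L2 lam}
    (hT : T ∈ F.compactOps lam) : F.IsAdjointable lam T := by
  refine clm_mem_of_isClosed (H := F.L2 lam) (isClosed_isAdjointable (F := F) (lam := lam))
    fun ε hε => ?_
  obtain ⟨K, hK, T', hT', h⟩ := exists_isKernOp_of_mem_compactOps hT hε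
  obtain ⟨C, hC0, hC⟩ := (isCompactKern_of_mem_rankSpan hK).exists_kernBound lam
  exact ⟨T', hT'.isAdjointable hC0 hC, h⟩

end FellBundle

end

end FellGroupoid

namespace FellGroupoid

noncomputable section

namespace FellBundle

variable {G M : Type*} [TopologicalSpace G] [TopologicalSpace M] {Γ : TopGroupoid G M} {E : G → Type*}
  [∀ g, NormedAddCommGroup (E g)] [∀ g, NormedSpace ℂ (E g)] [TopologicalSpace (Tot E)]
  [MeasurableSpace G] [BorelSpace G] [T2Space G] [LocallyCompactSpace G] [T2Space M]
  {F : FellBundle Γ E} {lam : HaarSystem Γ}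

/-! ### Fibres of adjointable operators -/

section

variable [LocallyCompactSpace M] {T T' : F.L2 lam →L[ℂ] F.L2 lam}

theorem IsAdjointable.norm_fiberOp_le (hT : F.IsAdjointable lam T) (x : M) :
    ‖F.fiberOp lam T x‖ ≤ ‖T‖ := hT.fibBound.norm_fiberOp_le (norm_nonneg T) x

theorem IsAdjointable.fiberOp_apply (hT : F.IsAdjointable lam T) (x : M) (ξ : F.L2 lam) :
    F.fiberOp lam T x (F.fiberAt lam ξ x) = F.fiberAt lam (T ξ) x := hT.fibBound.fiberOp_apply x ξ

theorem IsAdjointable.fiberOp_sub (hT : F.IsAdjointable lam T) (hT' : F.IsAdjointable lam T')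
    (x : M) : F.fiberOp lam (T - T') x = F.fiberOp lam T x - F.fiberOp lam T' x :=
  hT.fibBound.fiberOp_sub hT'.fibBound x

theorem IsAdjointable.norm_fiberOp_sub_le (hT : F.IsAdjointable lam T)
    (hT' : F.IsAdjointable lam T') (x : M) :
    ‖F.fiberOp lam T x - F.fiberOp lam T' x‖ ≤ ‖T - T'‖ := by
  rw [← hT.fiberOp_sub hT']
  exact (isAdjointable_sub hT hT').norm_fiberOp_le x

theorem IsAdjointable.hasAdj (hT : F.IsAdjointable lam T) (x : M) : HasAdj (F.fiberOp lam T x) :=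
  hT.exists_fiber_adjoint x

theorem IsAdjointable.opNorm_le_of_fiberOp (hT : F.IsAdjointable lam T) {C : ℝ} (hC : 0 ≤ C)
    (h : ∀ x, ‖F.fiberOp lam T x‖ ≤ C) : ‖T‖ ≤ C :=
  FibBound.opNorm_le hC fun ξ x => by
    rw [← hT.fiberOp_apply]
    exact (F.fiberOp lam T x).le_of_opNorm_le (h x) _

end

/-! ### The set `𝓚_Γ` is closed -/

variable (F lam) in
theorem exists_mulOp_zeroAtInfty (φ : C₀(M, ℂ)) : ∃ m : F.L2 lam →L[ℂ] F.L2 lam,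
    ∀ ξ x, F.fiberAt lam (m ξ) x = φ x • F.fiberAt lam ξ x := by
  obtain ⟨m, -, hm⟩ := F.exists_mulOp lam (φ : C(M, ℂ)) (norm_nonneg φ.toBCF)
    fun x => φ.toBCF.norm_coe_le_norm x
  exact ⟨m, hm⟩

/-- With the multiplication operator m fixed, the condition becomes continuous in T, as needed for
passing to limits. -/
theorem isLocallyCompact_iff {T : F.L2 lam →L[ℂ] F.L2 lam} : F.IsLocallyCompact lam T ↔
    ∀ (φ : C₀(M, ℂ)) (m : F.L2 lam →L[ℂ] F.L2 lam),
      (∀ ξ x, F.fiberAt lam (m ξ) x = φ x • F.fiberAt lam ξ x) → m ∘L T ∈ F.compactOps lam := by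
  constructor
  · intro h φ m hm
    obtain ⟨S, hS, h⟩ := h φ
    have : m ∘L T = S := ContinuousLinearMap.ext fun ξ => l2_ext fun x => by
      rw [ContinuousLinearMap.comp_apply, hm, h]
    rwa [this]
  · intro h φ
    obtain ⟨m, hm⟩ := F.exists_mulOp_zeroAtInfty lam φ
    exact ⟨_, h φ m hm, fun ξ x => by rw [ContinuousLinearMap.comp_apply, hm]⟩

theorem isLocallyCompact_of_approx {T : F.L2 lam →L[ℂ] F.L2 lam}
    (h : ∀ ε > 0, ∃ T', F.IsLocallyCompact lam T' ∧ ‖T' - T‖ ≤ ε) : F.IsLocallyCompact lam T := by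
  rw [isLocallyCompact_iff]
  intro φ m hm
  refine mem_compactOps_of_approx fun ε hε => ?_
  obtain ⟨T', hT', h⟩ := h (ε / (‖m‖ + 1)) (by positivity)
  refine ⟨m ∘L T', isLocallyCompact_iff.1 hT' φ m hm, ?_⟩
  rw [← ContinuousLinearMap.comp_sub]
  refine (ContinuousLinearMap.opNorm_comp_le _ _).trans ?_
  rw [le_div_iff₀ (by positivity)] at h
  have := norm_nonneg (T' - T)
  linarith

theorem isInvariant_of_approx [LocallyCompactSpace M] {T : F.L2 lam →L[ℂ] F.L2 lam}
    (hT : F.IsAdjointable lam T)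
    (h : ∀ ε > 0, ∃ T', F.IsAdjointable lam T' ∧ F.IsInvariant lam T' ∧ ‖T' - T‖ ≤ ε) :
    F.IsInvariant lam T := by
  intro γ
  rw [← sub_eq_zero, ← norm_le_zero_iff]
  refine le_of_forall_pos_le_add fun ε hε => ?_
  -- The transported difference costs 8 times the error and the fibre difference at the target once
  -- more.
  obtain ⟨T', hT', hinv, h⟩ := h (ε / 9) (by positivity)
  have h1 := (((hT'.hasAdj (Γ.src γ)).sub (hT.hasAdj (Γ.src γ))).norm_transport_le γ rfl rfl)
  rw [(hT'.hasAdj _).transport_sub (hT.hasAdj _), hinv γ] at h1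
  have h2 := hT'.norm_fiberOp_sub_le hT (Γ.src γ)
  have h3 := hT'.norm_fiberOp_sub_le hT (Γ.tgt γ)
  have h4 := norm_sub_le_norm_sub_add_norm_sub
    (F.transport lam γ rfl rfl (F.fiberOp lam T (Γ.src γ))) (F.fiberOp lam T' (Γ.tgt γ))
    (F.fiberOp lam T (Γ.tgt γ))
  rw [norm_sub_rev (F.transport lam γ rfl rfl (F.fiberOp lam T (Γ.src γ)))
    (F.fiberOp lam T' (Γ.tgt γ))] at h4
  linarith

theorem mem_invariantCompactOps_of_approx [LocallyCompactSpace M] {T : F.L2 lam →L[ℂ] F.L2 lam}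
    (h : ∀ ε > 0, ∃ T' ∈ F.invariantCompactOps lam, ‖T' - T‖ ≤ ε) :
    T ∈ F.invariantCompactOps lam := by
  have hT : F.IsAdjointable lam T :=
    clm_mem_of_isClosed (H := F.L2 lam) (isClosed_isAdjointable (F := F) (lam := lam))
      fun ε hε => by
        obtain ⟨T', hT', h⟩ := h ε hε
        exact ⟨T', hT'.1, h⟩
  refine ⟨hT, isLocallyCompact_of_approx fun ε hε => ?_, isInvariant_of_approx hT fun ε hε => ?_, ?_⟩
  · obtain ⟨T', hT', h⟩ := h ε hε
    exact ⟨T', hT'.2.1, h⟩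
  · obtain ⟨T', hT', h⟩ := h ε hε
    exact ⟨T', hT'.1, hT'.2.2.1, h⟩
  · refine Metric.tendsto_nhds.2 fun ε hε => ?_
    obtain ⟨T', hT', h⟩ := h (ε / 2) (half_pos hε)
    filter_upwards [Metric.tendsto_nhds.1 hT'.2.2.2 (ε / 2) (half_pos hε)] with x hx
    rw [Real.dist_0_eq_abs, abs_norm] at hx ⊢
    have h1 := hT'.1.norm_fiberOp_sub_le hT x
    have h2 := norm_sub_norm_le (F.fiberOp lam T x) (F.fiberOp lam T' x)
    rw [norm_sub_rev] at h2
    linarith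

/-! ### Convolution operators belong to `𝓚_Γ` -/

theorem kernFib_kernMul_src {w : C(G × G, ℂ)} {φ : M → ℂ} (hw : ∀ g k, w (g, k) = φ (Γ.src g))
    (K : F.Kern) (x : M) : F.kernFib (F.kernMul w K) x = φ x • F.kernFib K x := by
  refine Subtype.ext (funext fun p => ?_)
  change w (p.1.1, p.2.1) • gev K p.1.1 p.2.1 _ = φ x • gev K p.1.1 p.2.1 _
  rw [hw, p.1.2]

theorem IsKernOp.mulOp_comp {K : F.Kern} {T m : F.L2 lam →L[ℂ] F.L2 lam} {φ : M → ℂ}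
    (h : F.IsKernOp lam K T) {w : C(G × G, ℂ)} (hw : ∀ g k, w (g, k) = φ (Γ.src g))
    (hm : ∀ ξ x, F.fiberAt lam (m ξ) x = φ x • F.fiberAt lam ξ x) :
    F.IsKernOp lam (F.kernMul w K) (m ∘L T) := fun η => l2_ext fun x => by
  rw [ContinuousLinearMap.comp_apply, hm, h, fiberAt_toL2, fiberAt_toL2, restrict_kernAct,
    restrict_kernAct, kernFib_kernMul_src hw, kerOp_smul_left, toL2Fib_smul]

/-- Up to a small error in norm, φ may be multiplied by a compactly supported ψ; the kernel
ψ(s(g))φ(s(g))K(g,k) then has compact support. -/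
theorem IsKernOp.isLocallyCompact [LocallyCompactSpace M] {K : F.Kern}
    {T : F.L2 lam →L[ℂ] F.L2 lam} (h : F.IsKernOp lam K T) : F.IsLocallyCompact lam T := by
  rw [isLocallyCompact_iff]
  intro φ m hm
  refine mem_compactOps_of_approx fun ε hε => ?_
  have hδ : 0 < ε / (‖T‖ + 1) := by positivity
  obtain ⟨Q, hQ, hφ⟩ : ∃ Q : Set M, IsCompact Q ∧ ∀ x ∉ Q, ‖φ x‖ < ε / (‖T‖ + 1) := by
    have := (Metric.tendsto_nhds.1 (zero_at_infty φ) _ hδ)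
    obtain ⟨Q, hQ, h⟩ := mem_cocompact.1 this
    exact ⟨Q, hQ, fun x hx => by simpa using h hx⟩
  obtain ⟨ψ, hψ1, -, hψc, hψ01⟩ := exists_continuous_one_zero_of_isCompact hQ isClosed_empty
    (Set.disjoint_empty _)
  set φ' : C(M, ℂ) := ⟨fun x => ((ψ x : ℝ) : ℂ) * φ x,
    (Complex.continuous_ofReal.comp ψ.continuous).mul φ.continuous⟩ with hφ'
  have hsub : ∀ x, ‖φ' x - φ x‖ ≤ ε / (‖T‖ + 1) := fun x => by
    have e : φ' x - φ x = (((ψ x - 1 : ℝ)) : ℂ) * φ x := by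
      rw [Complex.ofReal_sub, Complex.ofReal_one, _root_.sub_mul, one_mul]
      rfl
    rw [e, norm_mul, Complex.norm_real, Real.norm_eq_abs]
    by_cases hx : x ∈ Q
    · have : ψ x = 1 := hψ1 hx
      rw [this, sub_self, abs_zero, MulZeroClass.zero_mul]
      exact hδ.le
    · have h1 : |ψ x - 1| ≤ 1 := by
        rw [abs_le]
        constructor <;> linarith [(hψ01 x).1, (hψ01 x).2]
      calc |ψ x - 1| * ‖φ x‖ ≤ 1 * (ε / (‖T‖ + 1)) :=
            mul_le_mul h1 (hφ x hx).le (norm_nonneg _) zero_le_one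
        _ = _ := one_mul _
  have hbound : ∀ x, ‖φ' x‖ ≤ ‖φ.toBCF‖ := fun x => by
    change ‖((ψ x : ℝ) : ℂ) * φ x‖ ≤ _
    rw [norm_mul, Complex.norm_real, Real.norm_of_nonneg (hψ01 x).1]
    exact (mul_le_of_le_one_left (norm_nonneg _) (hψ01 x).2).trans (φ.toBCF.norm_coe_le_norm x)
  obtain ⟨m', -, hm'⟩ := F.exists_mulOp lam φ' (norm_nonneg φ.toBCF) hbound
  refine ⟨m' ∘L T, ?_, ?_⟩
  · let w : C(G × G, ℂ) := φ'.comp ⟨fun p => Γ.src p.1, Γ.continuous_src.comp continuous_fst⟩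
    refine (h.mulOp_comp (w := w) (φ := φ') (fun _ _ => rfl) hm').mem_compactOps ?_
    obtain ⟨L, hL, h0⟩ := exists_support_gev K hψc.isCompact
    refine ⟨L, hL, fun g k e hgk => ?_⟩
    rw [kernMul_gev]
    by_cases hg : Γ.src g ∈ tsupport ψ
    · rw [h0 g k e hg hgk, smul_zero]
    · have : w (g, k) = ((ψ (Γ.src g) : ℝ) : ℂ) * φ (Γ.src g) := rfl
      rw [this, image_eq_zero_of_notMem_tsupport hg, Complex.ofReal_zero, MulZeroClass.zero_mul,
        zero_smul]
  · rw [← ContinuousLinearMap.sub_comp]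
    have h1 : ‖m' - m‖ ≤ ε / (‖T‖ + 1) := FibBound.opNorm_le hδ.le fun ξ x => by
      rw [_root_.sub_apply, fiberAt_sub, hm, hm', ← sub_smul, norm_smul]
      exact mul_le_mul_of_nonneg_right (hsub x) (norm_nonneg _)
    refine (ContinuousLinearMap.opNorm_comp_le _ _).trans ?_
    rw [le_div_iff₀ (by positivity)] at h1
    have := norm_nonneg (m' - m)
    linarith

/-- Invariance of convolution: the kernel depends on gl⁻¹ only, which is unchanged when both arrows
are translated on the right by k. -/
theorem kerOp_convKern_rmulPre (hΓ : Γ.IsProper) (f : F.Cc) {x y : M} (k : G) (ht : Γ.tgt k = x)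
    (hs : Γ.src k = y) (e : E k) (ω : F.CcFib x) :
    F.kerOp lam (F.kernFib (F.convKern hΓ f) y) (F.rmulPre k ht hs e ω) =
      F.rmulPre k ht hs e (F.kerOp lam (F.kernFib (F.convKern hΓ f) x) ω) := by
  refine CcFib.ext fun g => ?_
  rw [rmulPre_eval, kerOp_eval, kerOp_eval, F.integral_mul _ _ (integrable_kerOp lam _ _ _),
    lam.integral_rightMul k ht hs]
  congr 1 with l
  rw [rmulPre_eval_rightMul]
  have hd : fdiv g (Γ.rightMul k ht hs l) = fdiv (Γ.rightDiv k ht hs g) l := by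
    have h1 := (Γ.isMul_rightMul k ht hs l)
    have h2 := isMul_fdiv (Γ.rightDiv k ht hs g) l
    have h3 := Γ.isMul_rightDiv k ht hs g
    exact (isMul_fdiv g (Γ.rightMul k ht hs l)).eq_of_right (h2.assoc h1 h3)
  have key : ∀ (d : G) (_ : d = fdiv (Γ.rightDiv k ht hs g) l)
      (p : Γ.IsMul d (Γ.rightMul k ht hs l).1 g.1),
      F.mul p (F.ev f d) (F.mul (Γ.isMul_rightMul k ht hs l) (ω.eval l) e) =
        F.mul (Γ.isMul_rightDiv k ht hs g) (F.mul (isMul_fdiv (Γ.rightDiv k ht hs g) l)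
          (F.ev f (fdiv (Γ.rightDiv k ht hs g) l)) (ω.eval l)) e := by
    rintro d rfl p
    exact (F.mul_assoc _ _ _ _ _ _ _).symm
  exact key _ hd (isMul_fdiv g _)

theorem isInvariant_of_isKernOp_convKern (hΓ : Γ.IsProper) (f : F.Cc)
    {T : F.L2 lam →L[ℂ] F.L2 lam} (h : F.IsKernOp lam (F.convKern hΓ f) T) :
    F.IsInvariant lam T := by
  obtain ⟨C, hC0, hC⟩ := F.exists_kernBound_convKern lam hΓ f
  intro γ
  refine transport_eq fun u e => ?_
  refine l2Fib_induction (P := fun u => F.fiberOp lam T (Γ.tgt γ) (F.rmulL lam (Γ.inv γ)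
    ((Γ.tgt_inv γ).trans rfl) ((Γ.src_inv γ).trans rfl) e u) = F.rmulL lam (Γ.inv γ)
    ((Γ.tgt_inv γ).trans rfl) ((Γ.src_inv γ).trans rfl) e (F.fiberOp lam T (Γ.src γ) u)) ?_ ?_ u
  · exact isClosed_eq ((ContinuousLinearMap.continuous _).comp (ContinuousLinearMap.continuous _))
      ((ContinuousLinearMap.continuous _).comp (ContinuousLinearMap.continuous _))
  · intro ω
    rw [rmulL_coe, h.fiberOp_apply hC0 hC, h.fiberOp_apply hC0 hC, rmulL_coe,
      kerOp_convKern_rmulPre]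

/-- If f(gk⁻¹) ≠ 0 with g, k ∈ Γ_x, then t(k), which is in the orbit of x, is the source of an arrow
of the support of f. So T_x = 0 outside a compact set of orbits. -/
theorem tendsto_norm_fiberOp_convKern (hΓ : Γ.IsProper) (f : F.Cc)
    {T : F.L2 lam →L[ℂ] F.L2 lam} (h : F.IsKernOp lam (F.convKern hΓ f) T) :
    Tendsto (fun x => ‖F.fiberOp lam T x‖) Γ.atInftyOrbit (𝓝 0) := by
  obtain ⟨C, hC0, hC⟩ := F.exists_kernBound_convKern lam hΓ f
  obtain ⟨L, hL, h0⟩ := F.exists_support f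
  have hcont : Continuous fun g => Quotient.mk Γ.orbitSetoid (Γ.src g) :=
    continuous_quotient_mk'.comp Γ.continuous_src
  refine tendsto_nhds_of_eventually_eq ?_
  refine mem_comap.2 ⟨_, (hL.image hcont).compl_mem_cocompact, fun x hx => ?_⟩
  have h1 : F.kernFib (F.convKern hΓ f) x = 0 := by
    refine Subtype.ext (funext fun p => h0 _ fun hd => hx ⟨_, hd, ?_⟩)
    refine Quotient.sound ⟨Γ.inv p.2.1, ?_, ?_⟩
    · rw [Γ.src_inv]
      exact (isMul_fdiv p.1 p.2).1.symm
    · rw [Γ.tgt_inv, p.2.2]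
  have h2 : F.fiberOp lam T x = 0 := clm_eq_of_toL2Fib fun ω => by
    rw [h.fiberOp_apply hC0 hC, h1]
    have h3 := F.kerOp_smul_left lam 0 (0 : F.FibKer x) ω
    rw [zero_smul, zero_smul] at h3
    rw [h3]
    exact map_zero (F.toL2FibL lam x)
  change ‖F.fiberOp lam T x‖ = 0
  rw [h2, norm_zero]

theorem reducedCStar_subset_invariantCompactOps [LocallyCompactSpace M] (hΓ : Γ.IsProper) :
    F.reducedCStar lam ⊆ F.invariantCompactOps lam := by
  intro T hT
  refine mem_invariantCompactOps_of_approx fun ε hε => ?_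
  obtain ⟨T', ⟨f, hf⟩, h⟩ := (clm_mem_closure_iff (H := F.L2 lam)).1 hT ε hε
  rw [isLeftConv_iff hΓ] at hf
  obtain ⟨C, hC0, hC⟩ := F.exists_kernBound_convKern lam hΓ f
  exact ⟨T', ⟨hf.isAdjointable hC0 hC, hf.isLocallyCompact,
    isInvariant_of_isKernOp_convKern hΓ f hf, tendsto_norm_fiberOp_convKern hΓ f hf⟩, h⟩

end FellBundle

end

end FellGroupoid

namespace FellGroupoid

noncomputable section

/-! ### Changing the base point of a vector, and translated quotients of arrows -/

/-- Transport of vectors along an equality of base points. -/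
def tr {G : Type*} {E : G → Type*} {a b : G} (h : a = b) (v : E a) : E b := h ▸ v

namespace TopGroupoid

variable {G M : Type*} [TopologicalSpace G] [TopologicalSpace M] (Γ : TopGroupoid G M)

theorem src_div (g k : G) (e : Γ.src g = Γ.src k) : Γ.src (Γ.div g k e) = Γ.tgt k :=
  (Γ.isMul_div g k e).1

theorem div_div (g k n : G) (e : Γ.src g = Γ.src n) (e' : Γ.src k = Γ.src n)
    (e'' : Γ.src (Γ.div g n e) = Γ.src (Γ.div k n e')) :
    Γ.div (Γ.div g n e) (Γ.div k n e') e'' = Γ.div g k (e.trans e'.symm) :=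
  ((Γ.isMul_div (Γ.div g n e) (Γ.div k n e') e'').assoc (Γ.isMul_div k n e')
    (Γ.isMul_div g n e)).eq_of_right (Γ.isMul_div g k _)

end TopGroupoid

namespace FellBundle

variable {G M : Type*} [TopologicalSpace G] [TopologicalSpace M] {Γ : TopGroupoid G M} {E : G → Type*}
  [∀ g, NormedAddCommGroup (E g)] [∀ g, NormedSpace ℂ (E g)] [TopologicalSpace (Tot E)]
  {F : FellBundle Γ E}

theorem tot_tr {a b : G} (h : a = b) (v : E a) : (⟨b, tr h v⟩ : Tot E) = ⟨a, v⟩ := by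
  subst h; rfl

theorem continuous_tr {Y : Type*} [TopologicalSpace Y] {a b : Y → G} (h : ∀ y, a y = b y)
    {v : ∀ y, E (a y)} (hv : Continuous fun y => (⟨a y, v y⟩ : Tot E)) :
    Continuous fun y => (⟨b y, tr (h y) (v y)⟩ : Tot E) := by
  simp only [tot_tr]
  exact hv

theorem tr_zero {a b : G} (h : a = b) : tr h (0 : E a) = 0 := by
  subst h; rfl

theorem mul_tr {a b k l : G} (h : a = b) (p : Γ.IsMul b k l) (v : E a) (w : E k) :
    F.mul p (tr h v) w = F.mul (h ▸ p) v w := by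
  subst h; rfl

theorem tr_gev_congr (K : F.Kern) {g g' k k' b : G} (hg : g = g') (hk : k = k')
    (e : Γ.src g = Γ.src k) (e' : Γ.src g' = Γ.src k') (h : Γ.div g k e = b)
    (h' : Γ.div g' k' e' = b) : tr h (gev K g k e) = tr h' (gev K g' k' e') := by
  subst hg hk; rfl

/-! ### Translates of kernels -/

/-- The value `K(gn⁻¹, kn⁻¹)`, as an element of `E_{gk⁻¹}`. -/
def shev (K : F.Kern) {y : M} (n g k : Γ.SFib y) : E (fdiv g k) :=
  tr (Γ.div_div g.1 k.1 n.1 (g.2.trans n.2.symm) (k.2.trans n.2.symm)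
      ((Γ.src_div _ _ _).trans (Γ.src_div _ _ _).symm))
    (gev K (Γ.div g.1 n.1 (g.2.trans n.2.symm)) (Γ.div k.1 n.1 (k.2.trans n.2.symm))
      ((Γ.src_div _ _ _).trans (Γ.src_div _ _ _).symm))

theorem continuous_shev (K : F.Kern) {y : M} {Y : Type*} [TopologicalSpace Y]
    {n g k : Y → Γ.SFib y} (hn : Continuous n) (hg : Continuous g) (hk : Continuous k) :
    Continuous fun z => (⟨fdiv (g z) (k z), shev K (n z) (g z) (k z)⟩ : Tot E) :=
  continuous_tr _ (continuous_gev_comp K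
    (Γ.continuous_div (continuous_subtype_val.comp hg) (continuous_subtype_val.comp hn) _)
    (Γ.continuous_div (continuous_subtype_val.comp hk) (continuous_subtype_val.comp hn) _) _)

/-- The conditions on g and k bound the support of each translate independently of n; the condition
on n, from s(gn⁻¹) = t(n), makes the average over n an integral over a compact set. -/
theorem shev_eq_zero {K : F.Kern} {L : Set G} (h0 : ∀ g k e, (g ∉ L ∨ k ∉ L) → gev K g k e = 0)
    {y : M} {n g k : Γ.SFib y}
    (h : Γ.tgt g.1 ∉ Γ.tgt '' L ∨ Γ.tgt k.1 ∉ Γ.tgt '' L ∨ Γ.tgt n.1 ∉ Γ.src '' L) :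
    shev K n g k = 0 := by
  refine (congrArg (tr _) (h0 _ _ _ ?_)).trans (tr_zero _)
  rcases h with h | h | h
  · exact Or.inl fun hg => h ⟨_, hg, (Γ.isMul_div _ _ _).tgt_eq.symm⟩
  · exact Or.inr fun hg => h ⟨_, hg, (Γ.isMul_div _ _ _).tgt_eq.symm⟩
  · exact Or.inl fun hg => h ⟨_, hg, Γ.src_div _ _ _⟩

variable [T2Space M]

/-- The translate `(g, k) ↦ K(gn⁻¹, kn⁻¹)` of a compactly supported kernel. -/
def shKer (hΓ : Γ.IsProper) {K : F.Kern} (hK : IsCompactKern K) {y : M} (n : Γ.SFib y) :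
    F.FibKer y :=
  F.mkKer (shev K n) (continuous_shev K continuous_const continuous_fst continuous_snd) (by
    obtain ⟨L, hL, h0⟩ := hK
    refine ⟨_, TopGroupoid.IsProper.isCompact Γ hΓ (isCompact_singleton (x := y))
      (hL.image Γ.continuous_tgt), fun g k hgk => shev_eq_zero h0 ?_⟩
    exact hgk.imp (fun h hg => h ⟨g.2, hg⟩) fun h => Or.inl fun hk => h ⟨k.2, hk⟩)

theorem shKer_kev (hΓ : Γ.IsProper) {K : F.Kern} (hK : IsCompactKern K) {y : M}
    (n g k : Γ.SFib y) : kev (shKer hΓ hK n) g k = shev K n g k := rfl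

variable [MeasurableSpace G] [BorelSpace G] [T2Space G] [LocallyCompactSpace G] {lam : HaarSystem Γ}

/-- Substituting k = ln in the integral turns K(gn⁻¹, kn⁻¹) into K(gn⁻¹, l). Thus the translated
kernel satisfies the identity that defines transport. -/
theorem kerOp_shKer_rmulPre (hΓ : Γ.IsProper) {K : F.Kern} (hK : IsCompactKern K) {x y : M} (n : G)
    (ht : Γ.tgt n = x) (hs : Γ.src n = y) (e : E n) (ω : F.CcFib x) :
    F.kerOp lam (shKer hΓ hK ⟨n, hs⟩) (F.rmulPre n ht hs e ω) =
      F.rmulPre n ht hs e (F.kerOp lam (F.kernFib K x) ω) := by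
  refine CcFib.ext fun g => ?_
  rw [rmulPre_eval, kerOp_eval, kerOp_eval, F.integral_mul _ _ (integrable_kerOp lam _ _ _),
    lam.integral_rightMul n ht hs]
  congr 1 with l
  rw [rmulPre_eval_rightMul, shKer_kev]
  have h1 := Γ.isMul_rightMul n ht hs l
  have hl : Γ.div (Γ.rightMul n ht hs l).1 n ((Γ.rightMul n ht hs l).2.trans hs.symm) = l.1 :=
    (Γ.isMul_div _ _ _).eq_of_right h1
  have hd : fdiv (Γ.rightDiv n ht hs g) l = fdiv g (Γ.rightMul n ht hs l) :=
    ((isMul_fdiv (Γ.rightDiv n ht hs g) l).assoc h1 (Γ.isMul_rightDiv n ht hs g)).eq_of_right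
      (isMul_fdiv g (Γ.rightMul n ht hs l))
  have e1 : shev K ⟨n, hs⟩ g (Γ.rightMul n ht hs l) =
      tr hd (kev (F.kernFib K x) (Γ.rightDiv n ht hs g) l) :=
    tr_gev_congr K rfl hl _ _ _ _
  rw [e1, mul_tr]
  exact (F.mul_assoc _ _ _ _ _ _ _).symm

theorem exists_schur_bound {x : M} (K : F.FibKer x) : ∃ C, 0 ≤ C ∧
    (∀ g, ∫⁻ k, ‖kev K g k‖ₑ ∂(lam.smeas x) ≤ ENNReal.ofReal C) ∧
    ∀ k, ∫⁻ g, ‖kev K g k‖ₑ ∂(lam.smeas x) ≤ ENNReal.ofReal C := by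
  obtain ⟨L, hL, h0⟩ := exists_support_kev K
  have hcl := Γ.isClosedEmbedding_sfib x
  obtain ⟨c, hc0, hc⟩ := F.isField.bddAbove_norm (continuous_kev K)
    ((hcl.isCompact_preimage hL).prod (hcl.isCompact_preimage hL)) fun z hz => h0 _ _ (by
      by_contra hcon
      push Not at hcon
      exact hz hcon)
  have hce : ∀ g k, ‖kev K g k‖ₑ ≤ ENNReal.ofReal c := fun g k => by
    rw [← ofReal_norm]
    exact ENNReal.ofReal_le_ofReal (hc (g, k))
  obtain ⟨D, hD0, hD⟩ := lam.exists_smeas_le hL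
  exact ⟨c * D, by positivity,
    fun g => lam.lintegral_le_of_support hL (hD x) hc0 (fun k => hce g k)
      fun k hk => by rw [h0 g k (Or.inr hk), enorm_zero],
    fun k => lam.lintegral_le_of_support hL (hD x) hc0 (fun g => hce g k)
      fun g hg => by rw [h0 g k (Or.inl hg), enorm_zero]⟩

theorem exists_clm_kerOp {x : M} (K : F.FibKer x) : ∃ S : F.L2Fib lam x →L[ℂ] F.L2Fib lam x,
    ∀ ω, S (F.toL2Fib lam x ω) = F.toL2Fib lam x (F.kerOp lam K ω) := by
  obtain ⟨C, hC0, h1, h2⟩ := exists_schur_bound (lam := lam) K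
  let A : F.CcFib x →ₗ[ℂ] F.L2Fib lam x :=
    { toFun := fun ω => F.toL2Fib lam x (F.kerOp lam K ω)
      map_add' := fun ω ω' => by rw [kerOp_add_right, toL2Fib_add]
      map_smul' := fun c ω => by rw [kerOp_smul_right, toL2Fib_smul, RingHom.id_apply] }
  exact ⟨A.extendOfNorm (F.toL2FibL lam x), LinearMap.extendOfNorm_eq (f := A)
    (e := F.toL2FibL lam x) (F.denseRange_toL2Fib lam x)
    ⟨4 * C, fun ω => F.norm_kerOp_le lam K hC0 h1 h2 ω⟩⟩

/-- By uniqueness of transport, α_γ(T_{s(γ)}) is the operator whose kernel is the translate of K by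
n = γ⁻¹. -/
theorem IsKernOp.transport_apply (hΓ : Γ.IsProper) {K : F.Kern} (hK : IsCompactKern K)
    {T : F.L2 lam →L[ℂ] F.L2 lam} (h : F.IsKernOp lam K T) {y : M} (γ : G) (ht : Γ.tgt γ = y)
    (ω : F.CcFib y) : F.transport lam γ rfl ht (F.fiberOp lam T (Γ.src γ)) (F.toL2Fib lam y ω) =
      F.toL2Fib lam y (F.kerOp lam (shKer hΓ hK ⟨Γ.inv γ, (Γ.src_inv γ).trans ht⟩) ω) := by
  obtain ⟨C, hC0, hC⟩ := hK.exists_kernBound lam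
  obtain ⟨S, hS⟩ := exists_clm_kerOp (lam := lam) (shKer hΓ hK ⟨Γ.inv γ, (Γ.src_inv γ).trans ht⟩)
  have key : F.transport lam γ rfl ht (F.fiberOp lam T (Γ.src γ)) = S := by
    refine transport_eq fun u e => ?_
    refine l2Fib_induction (P := fun u => S (F.rmulL lam (Γ.inv γ)
      ((Γ.tgt_inv γ).trans rfl) ((Γ.src_inv γ).trans ht) e u) = F.rmulL lam (Γ.inv γ)
      ((Γ.tgt_inv γ).trans rfl) ((Γ.src_inv γ).trans ht) e (F.fiberOp lam T (Γ.src γ) u)) ?_ ?_ u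
    · exact isClosed_eq ((ContinuousLinearMap.continuous _).comp (ContinuousLinearMap.continuous _))
        ((ContinuousLinearMap.continuous _).comp (ContinuousLinearMap.continuous _))
    · intro ω
      rw [rmulL_coe, h.fiberOp_apply hC0 hC, rmulL_coe, hS, kerOp_shKer_rmulPre]
  rw [key, hS]

/-! ### Averages of kernels -/

theorem continuous_kerOp_shKer (hΓ : Γ.IsProper) {K : F.Kern} (hK : IsCompactKern K) {y : M}
    (ω : F.CcFib y) : Continuous fun p : Γ.SFib y × Γ.SFib y =>
      (⟨p.2.1, (F.kerOp lam (shKer hΓ hK p.1) ω).eval p.2⟩ : Tot E) := by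
  obtain ⟨L, hL, h⟩ := ω.exists_support
  refine continuous_iff_continuousAt.2 fun p => lam.continuousAt_integral F.isField F.complete
    (p := fun _ : Γ.SFib y × Γ.SFib y => y) continuous_const
    (continuous_subtype_val.comp continuous_snd)
    (fun p k => F.mul (isMul_fdiv p.2 k) (shev K p.1 p.2 k) (ω.eval k)) ?_ hL
    (Eventually.of_forall fun g k hk => by rw [h k hk, mul_zero])
  have hk : Continuous fun z : Γ.FibProd (fun _ : Γ.SFib y × Γ.SFib y => y) =>
      (⟨z.1.2, z.2⟩ : Γ.SFib y) := (continuous_snd.comp continuous_subtype_val).subtype_mk _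
  have hp : Continuous fun z : Γ.FibProd (fun _ : Γ.SFib y × Γ.SFib y => y) => z.1.1 :=
    continuous_fst.comp continuous_subtype_val
  exact F.continuous_mul_comp (fun z : Γ.FibProd (fun _ : Γ.SFib y × Γ.SFib y => y) =>
    isMul_fdiv z.1.1.2 ⟨z.1.2, z.2⟩)
    (continuous_shev K (continuous_fst.comp hp) (continuous_snd.comp hp) hk)
    (ω.continuous.comp hk)

theorem kerOp_shKer_eq_zero (hΓ : Γ.IsProper) {K : F.Kern} (hK : IsCompactKern K) {L : Set G}
    (h0 : ∀ g k e, (g ∉ L ∨ k ∉ L) → gev K g k e = 0) {y : M} (ω : F.CcFib y) {n g : Γ.SFib y}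
    (h : Γ.tgt g.1 ∉ Γ.tgt '' L ∨ Γ.tgt n.1 ∉ Γ.src '' L) :
    (F.kerOp lam (shKer hΓ hK n) ω).eval g = 0 := by
  rw [kerOp_eval]
  refine integral_eq_zero_of_ae (ae_of_all _ fun k => ?_)
  change F.mul (isMul_fdiv g k) (shev K n g k) (ω.eval k) = 0
  rw [shev_eq_zero h0 (h.imp_right Or.inr), zero_mul]

/-- All these sections are supported in one compact set, independent of n; on it the tube lemma
makes joint continuity uniform, and uniform smallness there is smallness in L². -/
theorem continuous_toL2Fib_kerOp_shKer (hΓ : Γ.IsProper) {K : F.Kern} (hK : IsCompactKern K)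
    {y : M} (ω : F.CcFib y) :
    Continuous fun n : Γ.SFib y => F.toL2Fib lam y (F.kerOp lam (shKer hΓ hK n) ω) := by
  obtain ⟨L, hL, h0⟩ := id hK
  have hQ := TopGroupoid.IsProper.isCompact Γ hΓ (isCompact_singleton (x := y))
    (hL.image Γ.continuous_tgt)
  obtain ⟨C, hC0, hC⟩ := lam.exists_smeas_le hQ
  refine continuous_iff_continuousAt.2 fun n₀ => Metric.tendsto_nhds.2 fun ε hε => ?_
  have hδ : 0 < ε / (√C + 1) := by positivity
  have hc := continuous_kerOp_shKer (lam := lam) hΓ hK ω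
  have hc1 : Continuous fun z : Γ.FibProd (fun _ : Γ.SFib y => y) =>
      (z.1.1, (⟨z.1.2, z.2⟩ : Γ.SFib y)) :=
    (continuous_fst.comp continuous_subtype_val).prodMk
      ((continuous_snd.comp continuous_subtype_val).subtype_mk _)
  have hc2 : Continuous fun z : Γ.FibProd (fun _ : Γ.SFib y => y) =>
      (n₀, (⟨z.1.2, z.2⟩ : Γ.SFib y)) :=
    continuous_const.prodMk ((continuous_snd.comp continuous_subtype_val).subtype_mk _)
  have hA : Continuous fun z : Γ.FibProd (fun _ : Γ.SFib y => y) =>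
      (⟨z.1.2, (F.kerOp lam (shKer hΓ hK z.1.1) ω).eval ⟨z.1.2, z.2⟩⟩ : Tot E) := hc.comp hc1
  have hB : Continuous fun z : Γ.FibProd (fun _ : Γ.SFib y => y) =>
      (⟨z.1.2, (F.kerOp lam (shKer hΓ hK n₀) ω).eval ⟨z.1.2, z.2⟩⟩ : Tot E) := hc.comp hc2
  have h3 := Γ.eventually_fibProd (p := fun _ : Γ.SFib y => y) continuous_const
    (P := fun z => ‖(F.kerOp lam (shKer hΓ hK z.1.1) ω).eval ⟨z.1.2, z.2⟩ -
      (F.kerOp lam (shKer hΓ hK n₀) ω).eval ⟨z.1.2, z.2⟩‖ < ε / (√C + 1))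
    (y₀ := n₀) hQ fun g e _ => F.isField.eventually_norm_lt
      (F.isField.continuous_sub_comp hA hB).continuousAt (by
        rw [sub_self, norm_zero]; exact hδ)
  filter_upwards [h3] with n hn
  rw [dist_eq_norm, ← toL2Fib_sub]
  have h4 : ∀ g : Γ.SFib y, g.1 ∉ {g | Γ.src g ∈ ({y} : Set M) ∧ Γ.tgt g ∈ Γ.tgt '' L} →
      Γ.tgt g.1 ∉ Γ.tgt '' L := fun g hg hg' => hg ⟨g.2, hg'⟩
  refine (F.norm_toL2Fib_le lam hQ (hC y) hC0 hδ.le _ (fun g => ?_) fun g hg => ?_).trans_lt ?_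
  · rw [CcFib.eval_sub]
    by_cases hg : g.1 ∈ {g | Γ.src g ∈ ({y} : Set M) ∧ Γ.tgt g ∈ Γ.tgt '' L}
    · exact (hn g.1 hg g.2).le
    · rw [kerOp_shKer_eq_zero hΓ hK h0 ω (Or.inl (h4 g hg)),
        kerOp_shKer_eq_zero hΓ hK h0 ω (Or.inl (h4 g hg)), sub_zero, norm_zero]
      exact hδ.le
  · rw [CcFib.eval_sub, kerOp_shKer_eq_zero hΓ hK h0 ω (Or.inl (h4 g hg)),
      kerOp_shKer_eq_zero hΓ hK h0 ω (Or.inl (h4 g hg)), sub_zero]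
  · rw [div_mul_eq_mul_div, div_lt_iff₀ (by positivity)]
    nlinarith [Real.sqrt_nonneg C]

end FellBundle

end

end FellGroupoid

namespace FellGroupoid

noncomputable section

namespace FellBundle

variable {G M : Type*} [TopologicalSpace G] [TopologicalSpace M] {Γ : TopGroupoid G M} {E : G → Type*}
  [∀ g, NormedAddCommGroup (E g)] [∀ g, NormedSpace ℂ (E g)] [TopologicalSpace (Tot E)]
  {F : FellBundle Γ E} [T2Space M] [MeasurableSpace G] [BorelSpace G] [T2Space G]
  [LocallyCompactSpace G]

theorem div_div_inv (h m : G) (e : Γ.src h = Γ.src m)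
    (e' : Γ.src (Γ.div h m e) = Γ.src (Γ.inv m)) : Γ.div (Γ.div h m e) (Γ.inv m) e' = h := by
  have h1 := Γ.isMul_div' (Γ.div h m e) (Γ.inv m) e'
  rw [Γ.inv_inv] at h1
  exact h1.unique (Γ.isMul_div h m e)

/-- The section `h ↦ ∫ c(s(l)) K(hl, l) dλ^{s(h)}(l)`. -/
def avgCc (lam : HaarSystem Γ) (hΓ : Γ.IsProper) (c : C(M, ℝ)) {K : F.Kern} (hK : IsCompactKern K) :
    F.Cc :=
  -- The integration variable is m = l⁻¹, so that K(hl, l) appears as K(hm⁻¹, m⁻¹) and c(s(l)) as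
  -- c(t(m)).
  F.mkCc (fun h => ∫ m : Γ.SFib (Γ.src h), ((c (Γ.tgt m.1) : ℝ) : ℂ) •
      tr (div_div_inv h m.1 m.2.symm ((Γ.src_div _ _ _).trans (Γ.src_inv _).symm))
        (gev K (Γ.div h m.1 m.2.symm) (Γ.inv m.1) ((Γ.src_div _ _ _).trans (Γ.src_inv _).symm))
      ∂(lam.smeas (Γ.src h)))
    (by
      obtain ⟨L, hL, h0⟩ := hK
      refine continuous_iff_continuousAt.2 fun h => lam.continuousAt_integral F.isField F.complete
        (p := Γ.src) Γ.continuous_src continuous_id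
        (fun h m => ((c (Γ.tgt m.1) : ℝ) : ℂ) •
          tr (div_div_inv h m.1 m.2.symm ((Γ.src_div _ _ _).trans (Γ.src_inv _).symm))
          (gev K (Γ.div h m.1 m.2.symm) (Γ.inv m.1) ((Γ.src_div _ _ _).trans (Γ.src_inv _).symm)))
        ?_ (hL.image Γ.continuous_inv) (Eventually.of_forall fun h m hm => by
          rw [h0 _ _ _ (Or.inr fun hm' => hm ⟨_, hm', Γ.inv_inv _⟩), tr_zero, smul_zero])
      have h1 : Continuous fun z : Γ.FibProd Γ.src => z.1.1 :=
        continuous_fst.comp continuous_subtype_val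
      have h2 : Continuous fun z : Γ.FibProd Γ.src => z.1.2 :=
        continuous_snd.comp continuous_subtype_val
      exact F.isField.continuous_smul_comp
        (Complex.continuous_ofReal.comp (c.continuous.comp (Γ.continuous_tgt.comp h2)))
        (continuous_tr (b := fun z : Γ.FibProd Γ.src => z.1.1) _ (continuous_gev_comp K
          (Γ.continuous_div h1 h2 fun z => z.2.symm) (Γ.continuous_inv.comp h2) _)))
    (by
      obtain ⟨L, hL, h0⟩ := hK
      -- A nonzero integrand requires hm⁻¹ ∈ L and m⁻¹ ∈ L, whose targets are t(h) and s(h);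
      -- properness then gives compact support.
      refine ⟨_, TopGroupoid.IsProper.isCompact Γ hΓ (hL.image Γ.continuous_tgt)
        (hL.image Γ.continuous_tgt), fun h hh => integral_eq_zero_of_ae (ae_of_all _ fun m => ?_)⟩
      have : gev K (Γ.div h m.1 m.2.symm) (Γ.inv m.1)
          ((Γ.src_div _ _ _).trans (Γ.src_inv _).symm) = 0 := by
        refine h0 _ _ _ ?_
        by_contra hcon
        push Not at hcon
        exact hh ⟨⟨_, hcon.2, (Γ.tgt_inv _).trans m.2⟩, ⟨_, hcon.1, (Γ.isMul_div _ _ _).tgt_eq.symm⟩⟩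
      change _ • tr _ _ = (0 : E h)
      rw [this, tr_zero, smul_zero])

variable {lam : HaarSystem Γ}

/-- The substitution n = mk shows that the average of the translated kernels at (g, k) depends on
gk⁻¹ alone: averaging turns a kernel into a convolution kernel. -/
theorem ev_avgCc (hΓ : Γ.IsProper) (c : C(M, ℝ)) {K : F.Kern} (hK : IsCompactKern K) {y : M}
    (g k : Γ.SFib y) : F.ev (avgCc lam hΓ c hK) (fdiv g k) =
      ∫ n : Γ.SFib y, ((c (Γ.tgt n.1) : ℝ) : ℂ) • shev K n g k ∂(lam.smeas y) := by
  have ht : Γ.tgt k.1 = Γ.src (fdiv g k) := (isMul_fdiv g k).1.symm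
  rw [lam.integral_rightMul k.1 ht k.2]
  refine integral_congr_ae (ae_of_all _ fun m => ?_)
  have h1 := Γ.isMul_rightMul k.1 ht k.2 m
  have e1 : Γ.div (fdiv g k) m.1 m.2.symm =
      Γ.div g.1 (Γ.rightMul k.1 ht k.2 m).1 (g.2.trans (Γ.rightMul k.1 ht k.2 m).2.symm) := by
    have h2 := (Γ.isMul_div (fdiv g k) m.1 m.2.symm)
    exact (h2.assoc h1 (isMul_fdiv g k)).eq_of_right (Γ.isMul_div _ _ _)
  have e2 : Γ.inv m.1 =
      Γ.div k.1 (Γ.rightMul k.1 ht k.2 m).1 (k.2.trans (Γ.rightMul k.1 ht k.2 m).2.symm) :=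
    h1.inv_left.eq_of_right (Γ.isMul_div _ _ _)
  change ((c (Γ.tgt m.1) : ℝ) : ℂ) • tr _ _ =
    ((c (Γ.tgt (Γ.rightMul k.1 ht k.2 m).1) : ℝ) : ℂ) • tr _ _
  rw [h1.tgt_eq]
  congr 1
  exact tr_gev_congr K e1 e2 _ _ _ _

/-- Pointwise in g, this is Fubini in (n, k): n is confined by the support of K and k by that of ω.
-/
theorem integral_kerOp_shKer (hΓ : Γ.IsProper) (c : C(M, ℝ)) {K : F.Kern} (hK : IsCompactKern K)
    {y : M} (ω : F.CcFib y) (g : Γ.SFib y) :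
    ∫ n : Γ.SFib y, ((c (Γ.tgt n.1) : ℝ) : ℂ) • (F.kerOp lam (shKer hΓ hK n) ω).eval g
      ∂(lam.smeas y) =
      (F.kerOp lam (F.kernFib (F.convKern hΓ (avgCc lam hΓ c hK)) y) ω).eval g := by
  obtain ⟨L, hL, h0⟩ := id hK
  obtain ⟨L', hL', h0'⟩ := ω.exists_support
  have hcl := Γ.isClosedEmbedding_sfib y
  have hQ := TopGroupoid.IsProper.isCompact Γ hΓ (isCompact_singleton (x := y))
    (hL.image Γ.continuous_src)
  have hn : ∀ n : Γ.SFib y, n.1 ∉ {g | Γ.src g ∈ ({y} : Set M) ∧ Γ.tgt g ∈ Γ.src '' L} →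
      Γ.tgt n.1 ∉ Γ.src '' L := fun n hn hn' => hn ⟨n.2, hn'⟩
  have hcont : Continuous fun p : Γ.SFib y × Γ.SFib y =>
      ((c (Γ.tgt p.1.1) : ℝ) : ℂ) • F.mul (isMul_fdiv g p.2) (shev K p.1 g p.2) (ω.eval p.2) := by
    have h1 : Continuous fun p : Γ.SFib y × Γ.SFib y =>
        F.mul (isMul_fdiv g p.2) (shev K p.1 g p.2) (ω.eval p.2) := by
      rw [(F.isField.inducing_mk g.1).continuous_iff]
      exact F.continuous_mul_comp (fun p : Γ.SFib y × Γ.SFib y => isMul_fdiv g p.2)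
        (continuous_shev K continuous_fst continuous_const continuous_snd)
        (ω.continuous.comp continuous_snd)
    exact (Complex.continuous_ofReal.comp (c.continuous.comp (Γ.continuous_tgt.comp
      (continuous_subtype_val.comp continuous_fst)))).smul h1
  have hsupp : HasCompactSupport fun p : Γ.SFib y × Γ.SFib y =>
      ((c (Γ.tgt p.1.1) : ℝ) : ℂ) • F.mul (isMul_fdiv g p.2) (shev K p.1 g p.2) (ω.eval p.2) := by
    refine HasCompactSupport.intro ((hcl.isCompact_preimage hQ).prod (hcl.isCompact_preimage hL'))
      fun p hp => ?_
    by_cases hp1 : p.1.1 ∈ {g | Γ.src g ∈ ({y} : Set M) ∧ Γ.tgt g ∈ Γ.src '' L}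
    · rw [h0' p.2 fun h => hp ⟨hp1, h⟩, mul_zero, smul_zero]
    · rw [shev_eq_zero h0 (Or.inr (Or.inr (hn _ hp1))), zero_mul, smul_zero]
  have hswap := integral_integral_swap_of_hasCompactSupport (μ := lam.smeas y) (ν := lam.smeas y)
    (f := fun n k => ((c (Γ.tgt n.1) : ℝ) : ℂ) • F.mul (isMul_fdiv g k) (shev K n g k) (ω.eval k))
    hcont hsupp
  calc _ = ∫ n : Γ.SFib y, ∫ k : Γ.SFib y, ((c (Γ.tgt n.1) : ℝ) : ℂ) •
        F.mul (isMul_fdiv g k) (shev K n g k) (ω.eval k) ∂(lam.smeas y) ∂(lam.smeas y) := by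
        congr 1 with n
        rw [integral_smul]
        rfl
    _ = _ := hswap
    _ = _ := by
      rw [kerOp_eval]
      congr 1 with k
      have e1 : kev (F.kernFib (F.convKern hΓ (avgCc lam hΓ c hK)) y) g k =
          ∫ n : Γ.SFib y, ((c (Γ.tgt n.1) : ℝ) : ℂ) • shev K n g k ∂(lam.smeas y) :=
        ev_avgCc hΓ c hK g k
      rw [e1, F.integral_mul]
      · simp only [F.smul_mul]
      · refine lam.integrable_of_support ?_ hQ fun n h => by
          rw [shev_eq_zero h0 (Or.inr (Or.inr (hn _ h))), smul_zero]
        have h1 : Continuous fun n : Γ.SFib y => shev K n g k := by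
          rw [(F.isField.inducing_mk (fdiv g k)).continuous_iff]
          exact continuous_shev K continuous_id continuous_const continuous_const
        exact (Complex.continuous_ofReal.comp (c.continuous.comp (Γ.continuous_tgt.comp
          continuous_subtype_val))).smul h1

theorem integrable_toL2Fib_kerOp_shKer (hΓ : Γ.IsProper) (c : C(M, ℝ)) {K : F.Kern}
    (hK : IsCompactKern K) {y : M} (ω : F.CcFib y) :
    Integrable (fun n : Γ.SFib y => ((c (Γ.tgt n.1) : ℝ) : ℂ) •
      F.toL2Fib lam y (F.kerOp lam (shKer hΓ hK n) ω)) (lam.smeas y) := by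
  obtain ⟨L, hL, h0⟩ := id hK
  refine lam.integrable_of_support ?_ (TopGroupoid.IsProper.isCompact Γ hΓ
    (isCompact_singleton (x := y)) (hL.image Γ.continuous_src)) fun n hn => ?_
  · exact (Complex.continuous_ofReal.comp (c.continuous.comp (Γ.continuous_tgt.comp
      continuous_subtype_val))).smul (continuous_toL2Fib_kerOp_shKer hΓ hK ω)
  · have : F.kerOp lam (shKer hΓ hK n) ω = 0 := CcFib.ext fun g =>
      kerOp_shKer_eq_zero hΓ hK h0 ω (Or.inr fun h => hn ⟨n.2, h⟩)
    rw [this]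
    have h1 : F.toL2Fib lam y 0 = 0 := map_zero (F.toL2FibL lam y)
    rw [h1, smul_zero]

/-- Evaluation at an arrow is not continuous on L², so the vector-valued integral is identified by
pairing with the dense vectors ζ, exchanging the integrals and using the pointwise formula. -/
theorem integral_toL2Fib_kerOp_shKer (hΓ : Γ.IsProper) (c : C(M, ℝ)) {K : F.Kern}
    (hK : IsCompactKern K) {y : M} (ω : F.CcFib y) :
    ∫ n : Γ.SFib y, ((c (Γ.tgt n.1) : ℝ) : ℂ) •
      F.toL2Fib lam y (F.kerOp lam (shKer hΓ hK n) ω) ∂(lam.smeas y) =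
      F.toL2Fib lam y (F.kerOp lam (F.kernFib (F.convKern hΓ (avgCc lam hΓ c hK)) y) ω) := by
  obtain ⟨L, hL, h0⟩ := id hK
  have := F.complete (Γ.unit y)
  have hcl := Γ.isClosedEmbedding_sfib y
  have hQ := TopGroupoid.IsProper.isCompact Γ hΓ (isCompact_singleton (x := y))
    (hL.image Γ.continuous_src)
  have hn : ∀ n : Γ.SFib y, n.1 ∉ {g | Γ.src g ∈ ({y} : Set M) ∧ Γ.tgt g ∈ Γ.src '' L} →
      Γ.tgt n.1 ∉ Γ.src '' L := fun n hn hn' => hn ⟨n.2, hn'⟩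
  refine eq_of_ip (F.denseRange_toL2Fib lam y) fun ζ => ?_
  obtain ⟨L', hL', h0'⟩ := ζ.exists_support
  have hcc : Continuous fun n : Γ.SFib y => ((c (Γ.tgt n.1) : ℝ) : ℂ) :=
    Complex.continuous_ofReal.comp (c.continuous.comp (Γ.continuous_tgt.comp continuous_subtype_val))
  have hcont : Continuous fun p : Γ.SFib y × Γ.SFib y => ((c (Γ.tgt p.1.1) : ℝ) : ℂ) •
      F.mul (Γ.isMul_inv_self p.2) (F.star rfl (ζ.eval p.2))
        ((F.kerOp lam (shKer hΓ hK p.1) ω).eval p.2) := by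
    have h1 : Continuous fun p : Γ.SFib y × Γ.SFib y =>
        F.mul (Γ.isMul_inv_self p.2) (F.star rfl (ζ.eval p.2))
          ((F.kerOp lam (shKer hΓ hK p.1) ω).eval p.2) := by
      rw [(F.isField.inducing_mk (Γ.unit y)).continuous_iff]
      exact F.continuous_mul_comp (fun p : Γ.SFib y × Γ.SFib y => Γ.isMul_inv_self p.2)
        (F.continuous_star_comp (fun _ => rfl) (ζ.continuous.comp continuous_snd))
        (continuous_kerOp_shKer hΓ hK ω)
    exact (hcc.comp continuous_fst).smul h1
  have hsupp : HasCompactSupport fun p : Γ.SFib y × Γ.SFib y => ((c (Γ.tgt p.1.1) : ℝ) : ℂ) •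
      F.mul (Γ.isMul_inv_self p.2) (F.star rfl (ζ.eval p.2))
        ((F.kerOp lam (shKer hΓ hK p.1) ω).eval p.2) := by
    refine HasCompactSupport.intro ((hcl.isCompact_preimage hQ).prod (hcl.isCompact_preimage hL'))
      fun p hp => ?_
    by_cases hp1 : p.1.1 ∈ {g | Γ.src g ∈ ({y} : Set M) ∧ Γ.tgt g ∈ Γ.src '' L}
    · rw [h0' p.2 fun h => hp ⟨hp1, h⟩, star_zero, zero_mul, smul_zero]
    · rw [kerOp_shKer_eq_zero hΓ hK h0 ω (Or.inr (hn _ hp1)), mul_zero, smul_zero]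
  have hswap := integral_integral_swap_of_hasCompactSupport (μ := lam.smeas y) (ν := lam.smeas y)
    (f := fun n g => ((c (Γ.tgt n.1) : ℝ) : ℂ) •
      F.mul (Γ.isMul_inv_self g) (F.star rfl (ζ.eval g))
        ((F.kerOp lam (shKer hΓ hK n) ω).eval g)) hcont hsupp
  calc _ = ∫ n : Γ.SFib y, F.ipL lam y (F.toL2Fib lam y ζ) (((c (Γ.tgt n.1) : ℝ) : ℂ) •
        F.toL2Fib lam y (F.kerOp lam (shKer hΓ hK n) ω)) ∂(lam.smeas y) :=
        ((F.ipL lam y (F.toL2Fib lam y ζ)).integral_comp_comm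
          (integrable_toL2Fib_kerOp_shKer hΓ c hK ω)).symm
    _ = ∫ n : Γ.SFib y, ∫ g : Γ.SFib y, ((c (Γ.tgt n.1) : ℝ) : ℂ) •
      F.mul (Γ.isMul_inv_self g) (F.star rfl (ζ.eval g))
        ((F.kerOp lam (shKer hΓ hK n) ω).eval g) ∂(lam.smeas y) ∂(lam.smeas y) := by
        congr 1 with n
        rw [map_smul, ipL_apply, ip_coe, integral_smul]
        rfl
    _ = _ := hswap
    _ = _ := by
      rw [ip_coe]
      unfold ipPre
      congr 1 with g
      rw [← integral_kerOp_shKer, F.mul_integral]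
      · simp only [F.mul_smul]
      · refine lam.integrable_of_support ?_ hQ fun n h => by
          rw [kerOp_shKer_eq_zero hΓ hK h0 ω (Or.inr (hn _ h)), smul_zero]
        have h1 : Continuous fun n : Γ.SFib y => (F.kerOp lam (shKer hΓ hK n) ω).eval g := by
          rw [(F.isField.inducing_mk g.1).continuous_iff]
          exact (continuous_kerOp_shKer hΓ hK ω).comp (continuous_id.prodMk continuous_const)
        exact hcc.smul h1

/-! ### Averaging -/

/-- The average of an operator with a compactly supported kernel is a convolution operator. -/
theorem IsKernOp.average (hΓ : Γ.IsProper) (c : C(M, ℝ)) {K : F.Kern} (hK : IsCompactKern K)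
    {T : F.L2 lam →L[ℂ] F.L2 lam} (h : F.IsKernOp lam K T) {y : M} (ω : F.CcFib y) :
    Integrable (fun γ : Γ.TFib y => c (Γ.src γ.1) •
      F.transport lam γ.1 rfl γ.2 (F.fiberOp lam T (Γ.src γ.1)) (F.toL2Fib lam y ω)) (lam.meas y) ∧
    ∫ γ : Γ.TFib y, c (Γ.src γ.1) •
      F.transport lam γ.1 rfl γ.2 (F.fiberOp lam T (Γ.src γ.1)) (F.toL2Fib lam y ω) ∂(lam.meas y) =
      F.toL2Fib lam y (F.kerOp lam (F.kernFib (F.convKern hΓ (avgCc lam hΓ c hK)) y) ω) := by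
  have e : (fun γ : Γ.TFib y => c (Γ.src γ.1) •
      F.transport lam γ.1 rfl γ.2 (F.fiberOp lam T (Γ.src γ.1)) (F.toL2Fib lam y ω)) =
      fun γ => (fun n : Γ.SFib y => ((c (Γ.tgt n.1) : ℝ) : ℂ) •
        F.toL2Fib lam y (F.kerOp lam (shKer hΓ hK n) ω)) (Γ.invFib y γ) := by
    funext γ
    have e1 : Γ.tgt (Γ.invFib y γ).1 = Γ.src γ.1 := Γ.tgt_inv _
    rw [h.transport_apply hΓ hK]
    simp only [e1]
    exact (Complex.coe_smul _ _).symm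
  rw [e]
  refine ⟨?_, ?_⟩
  · have h1 := integrable_toL2Fib_kerOp_shKer (lam := lam) hΓ c hK ω
    unfold HaarSystem.smeas at h1
    exact ((Γ.invFib y).measurableEmbedding.integrable_map_iff).1 h1
  · exact (lam.integral_smeas y _).symm.trans (integral_toL2Fib_kerOp_shKer hΓ c hK ω)

/-- An average of an operator that is close, where `c ≠ 0`, to an operator with a compactly
supported kernel, is close to a convolution operator. -/
theorem exists_isLeftConv_of_average [LocallyCompactSpace M] (hΓ : Γ.IsProper) (c : C(M, ℝ))
    (hc0 : ∀ x, 0 ≤ c x) (hci : ∀ x, Integrable (fun γ : Γ.TFib x => c (Γ.src γ.1)) (lam.meas x))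
    (hc1 : ∀ x, ∫ γ : Γ.TFib x, c (Γ.src γ.1) ∂(lam.meas x) ≤ 1)
    {K : F.Kern} (hK : IsCompactKern K) {T T' S : F.L2 lam →L[ℂ] F.L2 lam}
    (h : F.IsKernOp lam K T') (hT : F.IsAdjointable lam T) {ε : ℝ} (hε : 0 ≤ ε)
    (hTT' : ∀ x, c x ≠ 0 → ‖F.fiberOp lam T' x - F.fiberOp lam T x‖ ≤ ε)
    (hS : F.IsAdjointable lam S) (hSi : ∀ (y : M) (u : F.L2Fib lam y),
      Integrable (fun γ : Γ.TFib y => c (Γ.src γ.1) •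
        F.transport lam γ.1 rfl γ.2 (F.fiberOp lam T (Γ.src γ.1)) u) (lam.meas y) ∧
      F.fiberOp lam S y u = ∫ γ : Γ.TFib y, c (Γ.src γ.1) •
        F.transport lam γ.1 rfl γ.2 (F.fiberOp lam T (Γ.src γ.1)) u ∂(lam.meas y)) :
    ∃ f S', F.IsLeftConv lam f S' ∧ ‖S' - S‖ ≤ 8 * ε := by
  obtain ⟨C, hC0, hC⟩ := F.exists_kernBound_convKern lam hΓ (avgCc lam hΓ c hK)
  obtain ⟨D, hD0, hD⟩ := hK.exists_kernBound lam
  have hT' := h.isAdjointable hD0 hD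
  obtain ⟨S', hS', -⟩ := hC.exists_op hC0
  have hS'a := hS'.isAdjointable hC0 hC
  refine ⟨_, S', (isLeftConv_iff hΓ _ S').2 hS', ?_⟩
  refine (isAdjointable_sub hS'a hS).opNorm_le_of_fiberOp (by positivity) fun y => ?_
  refine ContinuousLinearMap.opNorm_le_bound _ (by positivity) fun u => ?_
  refine l2Fib_induction (P := fun u => ‖F.fiberOp lam (S' - S) y u‖ ≤ 8 * ε * ‖u‖) ?_ (fun ω => ?_) u
  · exact isClosed_le (ContinuousLinearMap.continuous _).norm (continuous_const.mul continuous_norm)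
  · obtain ⟨hi, he⟩ := h.average hΓ c hK ω
    obtain ⟨hi', he'⟩ := hSi y (F.toL2Fib lam y ω)
    rw [hS'a.fiberOp_sub hS, _root_.sub_apply, hS'.fiberOp_apply hC0 hC, ← he, he',
      ← integral_sub hi hi']
    refine (norm_integral_le_of_norm_le ((hci y).mul_const (8 * ε * ‖F.toL2Fib lam y ω‖))
      (ae_of_all _ fun γ => ?_)).trans ?_
    · rw [← smul_sub, norm_smul, Real.norm_of_nonneg (hc0 _)]
      by_cases hγ : c (Γ.src γ.1) = 0
      · rw [hγ, MulZeroClass.zero_mul, MulZeroClass.zero_mul]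
      refine mul_le_mul_of_nonneg_left ?_ (hc0 _)
      -- Transport multiplies norms by at most 8, whence the factor 8; the weight c then has total
      -- mass at most 1.
      rw [← _root_.sub_apply, ← (hT'.hasAdj _).transport_sub (hT.hasAdj _)]
      refine ContinuousLinearMap.le_of_opNorm_le _ ?_ _
      refine (((hT'.hasAdj _).sub (hT.hasAdj _)).norm_transport_le _ _ _).trans ?_
      exact mul_le_mul_of_nonneg_left (hTT' _ hγ) (by norm_num)
    · rw [integral_mul_const]
      exact mul_le_of_le_one_left (by positivity) (hc1 y)

end FellBundle

end

end FellGroupoid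

namespace FellGroupoid

noncomputable section

/-- Sums of absolutely convergent series stay in a closed subspace. This will produce the compact
operator whose average is a given one. -/
theorem exists_mem_topologicalClosure_tendsto {H : Type*} [NormedAddCommGroup H] [NormedSpace ℂ H]
    [CompleteSpace H] {P : Submodule ℂ (H →L[ℂ] H)} {t : ℕ → H →L[ℂ] H} {u : ℕ → ℝ}
    (hu : Summable u) (ht : ∀ n, t n ∈ P.topologicalClosure) (htu : ∀ n, ‖t n‖ ≤ u n) :
    ∃ T ∈ P.topologicalClosure,
      Tendsto (fun N => ‖T - ∑ n ∈ Finset.range N, t n‖) atTop (𝓝 0) := by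
  have hs := (Summable.of_norm_bounded hu htu).hasSum.tendsto_sum_nat
  refine ⟨_, P.isClosed_topologicalClosure.mem_of_tendsto hs
    (Eventually.of_forall fun N => Submodule.sum_mem _ fun n _ => ht n), ?_⟩
  simp only [norm_sub_rev _ (∑ n ∈ Finset.range _, t n)]
  exact tendsto_iff_norm_sub_tendsto_zero.1 hs

namespace HaarSystem

variable {G M : Type*} [TopologicalSpace G] [TopologicalSpace M] [MeasurableSpace G]
  [BorelSpace G] {Γ : TopGroupoid G M} (lam : HaarSystem Γ) [T2Space G] [LocallyCompactSpace G]
  [T2Space M]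

/-! ### Averages of functions on the objects -/

/-- The function `x ↦ ∫ c(s(γ)) dλ^x(γ)`. -/
def avg (c : M → ℝ) (x : M) : ℝ := ∫ γ : Γ.TFib x, c (Γ.src γ.1) ∂(lam.meas x)

/-- Left invariance: translation by γ does not change sources. Hence averages are functions on the
orbit space. -/
theorem avg_src (c : M → ℝ) (γ : G) : lam.avg c (Γ.src γ) = lam.avg c (Γ.tgt γ) := by
  unfold avg
  rw [lam.integral_leftMul γ]
  congr 1 with g
  change c (Γ.src g.1) = c (Γ.src (Γ.mul γ g.1 g.2.symm))
  rw [Γ.src_mul]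

theorem avg_nonneg {c : M → ℝ} (hc : ∀ x, 0 ≤ c x) (x : M) : 0 ≤ lam.avg c x :=
  integral_nonneg fun _ => hc _

theorem exists_of_avg_ne_zero {c : M → ℝ} {x : M} (h : lam.avg c x ≠ 0) :
    ∃ γ, Γ.tgt γ = x ∧ c (Γ.src γ) ≠ 0 := by
  by_contra hcon
  push Not at hcon
  exact h (integral_eq_zero_of_ae (ae_of_all _ fun γ => hcon γ.1 γ.2))

variable {c : C(M, ℝ)}

theorem hasCompactSupport_src (hΓ : Γ.IsProper) (hcs : HasCompactSupport c) (x : M) :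
    HasCompactSupport fun γ : Γ.TFib x => c (Γ.src γ.1) := by
  refine HasCompactSupport.intro ((Γ.isClosedEmbedding_tfib x).isCompact_preimage
    (TopGroupoid.IsProper.isCompact Γ hΓ hcs.isCompact (isCompact_singleton (x := x)))) fun γ hγ => ?_
  exact image_eq_zero_of_notMem_tsupport fun h => hγ ⟨h, γ.2⟩

theorem continuous_src_tfib (c : C(M, ℝ)) (x : M) : Continuous fun γ : Γ.TFib x => c (Γ.src γ.1) :=
  c.continuous.comp (Γ.continuous_src.comp continuous_subtype_val)

theorem integrable_src (hΓ : Γ.IsProper) (hcs : HasCompactSupport c) (x : M) :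
    Integrable (fun γ : Γ.TFib x => c (Γ.src γ.1)) (lam.meas x) :=
  (continuous_src_tfib c x).integrable_of_hasCompactSupport (hasCompactSupport_src hΓ hcs x)

/-- The integrand is nonzero at the unit of x, and the Haar measures have full support. -/
theorem avg_pos (hΓ : Γ.IsProper) (hcs : HasCompactSupport c) (hc : ∀ x, 0 ≤ c x) {x : M}
    (hx : c x ≠ 0) : 0 < lam.avg c x := by
  have := lam.full_support x
  refine (continuous_src_tfib c x).integral_pos_of_hasCompactSupport_nonneg_nonzero
    (hasCompactSupport_src hΓ hcs x) (fun _ => hc _) (x := ⟨Γ.unit x, Γ.tgt_unit x⟩) ?_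
  change c (Γ.src (Γ.unit x)) ≠ 0
  rwa [Γ.src_unit]

theorem avg_add (hΓ : Γ.IsProper) {c' : C(M, ℝ)} (hcs : HasCompactSupport c)
    (hcs' : HasCompactSupport c') (x : M) :
    lam.avg (c + c' : C(M, ℝ)) x = lam.avg c x + lam.avg c' x :=
  integral_add (lam.integrable_src hΓ hcs x) (lam.integrable_src hΓ hcs' x)

variable [LocallyCompactSpace M]

/-- The function c ∘ s need not have compact support on Γ, but its product with θ ∘ t does by
properness, and θ = 1 near the given object. -/
theorem continuous_avg (hΓ : Γ.IsProper) (hcs : HasCompactSupport c) : Continuous (lam.avg c) := by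
  refine continuous_iff_continuousAt.2 fun x₀ => ?_
  obtain ⟨V, hV, hVx⟩ := exists_compact_mem_nhds x₀
  obtain ⟨θ, hθ1, -, hθc, -⟩ := exists_continuous_one_zero_of_isCompact hV isClosed_empty
    (Set.disjoint_empty _)
  have h1 := lam.continuous_integral (fun γ => c (Γ.src γ) * θ (Γ.tgt γ))
    ((c.continuous.comp Γ.continuous_src).mul (θ.continuous.comp Γ.continuous_tgt))
    (HasCompactSupport.intro (TopGroupoid.IsProper.isCompact Γ hΓ hcs.isCompact hθc.isCompact)
      fun γ hγ => by
        by_cases h : Γ.src γ ∈ tsupport c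
        · rw [image_eq_zero_of_notMem_tsupport fun h' => hγ ⟨h, h'⟩, mul_zero]
        · rw [image_eq_zero_of_notMem_tsupport h, zero_mul])
  refine h1.continuousAt.congr ?_
  filter_upwards [hVx] with x hx
  refine integral_congr_ae (ae_of_all _ fun γ => ?_)
  have : θ (Γ.tgt γ.1) = 1 := hθ1 (by rw [γ.2]; exact hx)
  change c (Γ.src γ.1) * θ (Γ.tgt γ.1) = c (Γ.src γ.1)
  rw [this, mul_one]

/-- A compact set of orbits is in the positivity set of an average. -/
theorem exists_avg_pos (hΓ : Γ.IsProper) {Q : Set Γ.OrbitSpace} (hQ : IsCompact Q) :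
    ∃ c : C(M, ℝ), HasCompactSupport c ∧ (∀ x, 0 ≤ c x) ∧
      ∃ δ > 0, ∀ x, Quotient.mk Γ.orbitSetoid x ∈ Q → δ ≤ lam.avg c x := by
  have hlift : ∀ c : C(M, ℝ), ∀ x y : M, Γ.orbitSetoid x y → lam.avg c x = lam.avg c y := by
    rintro c x y ⟨γ, rfl, rfl⟩
    exact lam.avg_src c γ
  have hcont : ∀ c : C(M, ℝ), HasCompactSupport c →
      Continuous (Quotient.lift (lam.avg c) (hlift c)) := fun c hcs =>
    (lam.continuous_avg hΓ hcs).quotient_lift _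
  suffices h : ∃ c : C(M, ℝ), HasCompactSupport c ∧ (∀ x, 0 ≤ c x) ∧
      ∀ q ∈ Q, 0 < Quotient.lift (lam.avg c) (hlift c) q by
    obtain ⟨c, hcs, hc0, h⟩ := h
    obtain ⟨δ, hδ, h⟩ := hQ.exists_forall_le' (hcont c hcs).continuousOn h
    exact ⟨c, hcs, hc0, δ, hδ, fun x hx => h _ hx⟩
  -- A bump function at x has positive average on a neighbourhood of the orbit of x; weights of
  -- finitely many such neighbourhoods are added.
  refine hQ.induction_on (p := fun Q => ∃ c : C(M, ℝ), HasCompactSupport c ∧ (∀ x, 0 ≤ c x) ∧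
    ∀ q ∈ Q, 0 < Quotient.lift (lam.avg c) (hlift c) q) ?_ ?_ ?_ ?_
  · exact ⟨0, HasCompactSupport.zero, fun _ => le_rfl, fun _ h => h.elim⟩
  · intro s t hst h
    obtain ⟨c, hcs, hc0, h⟩ := h
    exact ⟨c, hcs, hc0, fun q hq => h q (hst hq)⟩
  · intro s t h h'
    obtain ⟨c, hcs, hc0, h⟩ := h
    obtain ⟨c', hcs', hc0', h'⟩ := h'
    refine ⟨c + c', hcs.add hcs', fun x => add_nonneg (hc0 x) (hc0' x), ?_⟩
    intro q
    induction q using Quotient.inductionOn with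
    | h x =>
      intro hq
      change 0 < lam.avg (c + c' : C(M, ℝ)) x
      rw [lam.avg_add hΓ hcs hcs']
      rcases hq with hq | hq
      · exact add_pos_of_pos_of_nonneg (h _ hq) (lam.avg_nonneg hc0' x)
      · exact add_pos_of_nonneg_of_pos (lam.avg_nonneg hc0 x) (h' _ hq)
  · intro q hq
    induction q using Quotient.inductionOn with
    | h x =>
      obtain ⟨c, hc1, -, hcs, hc01⟩ := exists_continuous_one_zero_of_isCompact
        (isCompact_singleton (x := x)) isClosed_empty (Set.disjoint_empty _)
      have hcx : c x = 1 := hc1 rfl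
      have hpos := lam.avg_pos hΓ hcs (fun x => (hc01 x).1) (x := x) (by rw [hcx]; exact one_ne_zero)
      refine ⟨{q | 0 < Quotient.lift (lam.avg c) (hlift c) q}, mem_nhdsWithin_of_mem_nhds
        ((hcont c hcs).continuousAt.eventually_const_lt hpos), c, hcs, fun x => (hc01 x).1,
        fun q hq => hq⟩

/-- A compactly supported weight whose average is `1` on a given compact set of orbits. -/
theorem exists_avg_eq_one (hΓ : Γ.IsProper) {Q : Set Γ.OrbitSpace} (hQ : IsCompact Q) :
    ∃ c : C(M, ℝ), HasCompactSupport c ∧ (∀ x, 0 ≤ c x) ∧ (∀ x, lam.avg c x ≤ 1) ∧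
      ∀ x, Quotient.mk Γ.orbitSetoid x ∈ Q → lam.avg c x = 1 := by
  obtain ⟨c, hcs, hc0, δ, hδ, h⟩ := lam.exists_avg_pos hΓ hQ
  have hm : ∀ x, 0 < max (lam.avg c x) δ := fun x => lt_max_of_lt_right hδ
  have hcont : Continuous fun x => (max (lam.avg c x) δ)⁻¹ :=
    ((lam.continuous_avg hΓ hcs).max continuous_const).inv₀ fun x => (hm x).ne'
  -- The normalizing factor is constant on orbits and so comes out of the average; the maximum with
  -- δ avoids division by zero and is inactive over Q.
  have havg : ∀ x, lam.avg (c * ⟨_, hcont⟩ : C(M, ℝ)) x = lam.avg c x * (max (lam.avg c x) δ)⁻¹ := by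
    intro x
    unfold avg
    rw [← integral_mul_const]
    refine integral_congr_ae (ae_of_all _ fun γ => ?_)
    change c (Γ.src γ.1) * (max (lam.avg c (Γ.src γ.1)) δ)⁻¹ = c (Γ.src γ.1) * (max (lam.avg c x) δ)⁻¹
    rw [lam.avg_src, γ.2]
  refine ⟨c * ⟨_, hcont⟩, hcs.mul_right, fun x => mul_nonneg (hc0 x) (inv_nonneg.2 (hm x).le),
    fun x => ?_, fun x hx => ?_⟩
  · rw [havg, ← div_eq_mul_inv]
    exact div_le_one_of_le₀ (le_max_left _ _) (hm x).le
  · rw [havg, max_eq_left (h x hx)]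
    exact mul_inv_cancel₀ (hδ.trans_le (h x hx)).ne'

end HaarSystem

/-! ### Inclusions between `reducedCStar`, `invariantCompactOps` and `averages` -/

namespace FellBundle

variable {G M : Type*} [TopologicalSpace G] [TopologicalSpace M] {Γ : TopGroupoid G M} {E : G → Type*}
  [∀ g, NormedAddCommGroup (E g)] [∀ g, NormedSpace ℂ (E g)] [TopologicalSpace (Tot E)]
  [MeasurableSpace G] [BorelSpace G] [T2Space G] [LocallyCompactSpace G] [T2Space M]
  [LocallyCompactSpace M] {F : FellBundle Γ E} {lam : HaarSystem Γ}

theorem transport_eq_of_invariant {T : F.L2 lam →L[ℂ] F.L2 lam} (hT : F.IsInvariant lam T) {y : M}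
    (γ : Γ.TFib y) :
    F.transport lam γ.1 rfl γ.2 (F.fiberOp lam T (Γ.src γ.1)) = F.fiberOp lam T y := by
  obtain ⟨γ, rfl⟩ := γ
  exact hT γ

/-- A weight localizing an operator of `𝓚_Γ` up to `ε`. -/
theorem exists_weight (hΓ : Γ.IsProper) {T : F.L2 lam →L[ℂ] F.L2 lam}
    (hT : Tendsto (fun x => ‖F.fiberOp lam T x‖) Γ.atInftyOrbit (𝓝 0)) {ε : ℝ} (hε : 0 < ε) :
    ∃ c : C(M, ℝ), HasCompactSupport c ∧ (∀ x, 0 ≤ c x) ∧ (∀ x, lam.avg c x ≤ 1) ∧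
      ∀ x, ‖F.fiberOp lam T x‖ ≤ ε ∨ lam.avg c x = 1 := by
  obtain ⟨V, hV, hVs⟩ := mem_comap.1 (Metric.tendsto_nhds.1 hT ε hε)
  obtain ⟨Q, hQ, hQV⟩ := mem_cocompact.1 hV
  obtain ⟨c, hcs, hc0, hc1, h⟩ := lam.exists_avg_eq_one hΓ hQ
  refine ⟨c, hcs, hc0, hc1, fun x => ?_⟩
  by_cases hx : Quotient.mk Γ.orbitSetoid x ∈ Q
  · exact Or.inr (h x hx)
  · left
    have h1 : dist ‖F.fiberOp lam T x‖ 0 < ε := hVs (hQV hx)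
    rw [Real.dist_0_eq_abs, abs_norm] at h1
    exact h1.le

/-- `φT` is compact for a locally compact operator `T` and `φ ∈ C_c(M)`. -/
theorem IsLocallyCompact.exists_compactOps {T : F.L2 lam →L[ℂ] F.L2 lam}
    (hT : F.IsLocallyCompact lam T) (φ : C(M, ℝ)) (hφ : HasCompactSupport φ) :
    ∃ S ∈ F.compactOps lam, ∀ ξ x, F.fiberAt lam (S ξ) x =
      ((φ x : ℝ) : ℂ) • F.fiberAt lam (T ξ) x := by
  have hc : HasCompactSupport fun x => ((φ x : ℝ) : ℂ) :=
    hφ.comp_left (g := fun r : ℝ => (r : ℂ)) Complex.ofReal_zero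
  exact hT ⟨⟨fun x => ((φ x : ℝ) : ℂ), Complex.continuous_ofReal.comp φ.continuous⟩,
    hc.is_zero_at_infty⟩

/-- By invariance, the average of T with a compactly supported weight c is T multiplied by `avg c`.
It is close to T, and it only sees T over the support of c, where T agrees with the compact operator
ψT. No cutoff function is involved. -/
theorem invariantCompactOps_subset_reducedCStar (hΓ : Γ.IsProper) :
    F.invariantCompactOps lam ⊆ F.reducedCStar lam := by
  rintro T ⟨hTa, hTc, hTi, hT0⟩
  refine (clm_mem_closure_iff (H := F.L2 lam)).2 fun ε hε => ?_
  -- Averaging the kernel approximation costs 8·ε/9, and replacing T by its weighted average costs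
  -- the remaining ε/9.
  have hη : 0 < ε / 9 := by positivity
  obtain ⟨c, hcs, hc0, hc1, hc⟩ := exists_weight hΓ hT0 hη
  have hχ0 := lam.avg_nonneg hc0
  have hχn : ∀ x, ‖((lam.avg c x : ℝ) : ℂ)‖ ≤ 1 := fun x => by
    rw [Complex.norm_real, Real.norm_of_nonneg (hχ0 x)]
    exact hc1 x
  obtain ⟨m, -, hm⟩ := F.exists_mulOp lam ⟨fun x => ((lam.avg c x : ℝ) : ℂ),
    Complex.continuous_ofReal.comp (lam.continuous_avg hΓ hcs)⟩ zero_le_one hχn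
  have hma : F.IsAdjointable lam m := isAdjointable_of_mul zero_le_one hχn hm
  have hSa : F.IsAdjointable lam (m ∘L T) := isAdjointable_comp hma hTa
  have hSx : ∀ x, F.fiberOp lam (m ∘L T) x = ((lam.avg c x : ℝ) : ℂ) • F.fiberOp lam T x :=
    fun x => fiberOp_eq fun ξ => by
      rw [_root_.smul_apply, hTa.fiberOp_apply, ContinuousLinearMap.comp_apply, hm]
      rfl
  obtain ⟨ψ, hψ1, -, hψc, -⟩ := exists_continuous_one_zero_of_isCompact hcs.isCompact
    isClosed_empty (Set.disjoint_empty _)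
  obtain ⟨S₁, hS₁, hS₁ξ⟩ := hTc.exists_compactOps ψ hψc
  have hS₁a := isAdjointable_of_mem_compactOps hS₁
  obtain ⟨K, hK, T', hT', hTT'⟩ := exists_isKernOp_of_mem_compactOps hS₁ hη
  have hKc := isCompactKern_of_mem_rankSpan hK
  obtain ⟨D, hD0, hD⟩ := hKc.exists_kernBound lam
  obtain ⟨f, S', hf, hS'⟩ := exists_isLeftConv_of_average hΓ c hc0 (lam.integrable_src hΓ hcs) hc1
    hKc hT' hTa hη.le (fun x hx => by
      -- Where the weight does not vanish, ψ = 1, so ψT and T have the same fibre operator.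
      have hψx : ψ x = 1 := hψ1 (subset_tsupport _ hx)
      have e : F.fiberOp lam T x = F.fiberOp lam S₁ x := (fiberOp_eq fun ξ => by
        rw [hTa.fiberOp_apply, hS₁ξ, hψx, Complex.ofReal_one, one_smul]).symm
      rw [e]
      exact ((hT'.isAdjointable hD0 hD).norm_fiberOp_sub_le hS₁a x).trans hTT') hSa
    (fun y u => by
      simp only [transport_eq_of_invariant hTi]
      refine ⟨(lam.integrable_src hΓ hcs y).smul_const _, ?_⟩
      rw [integral_smul_const, hSx, _root_.smul_apply]
      exact Complex.coe_smul _ _)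
  refine ⟨S', ⟨f, hf⟩, ?_⟩
  have h1 : ‖m ∘L T - T‖ ≤ ε / 9 := by
    refine (isAdjointable_sub hSa hTa).opNorm_le_of_fiberOp hη.le fun x => ?_
    rw [hSa.fiberOp_sub hTa, hSx]
    rcases hc x with h | h
    · have e : ((lam.avg c x : ℝ) : ℂ) • F.fiberOp lam T x - F.fiberOp lam T x =
          (((lam.avg c x - 1 : ℝ)) : ℂ) • F.fiberOp lam T x := by
        rw [Complex.ofReal_sub, Complex.ofReal_one, sub_smul, one_smul]
      rw [e, norm_smul, Complex.norm_real, Real.norm_eq_abs]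
      have h2 : |lam.avg c x - 1| ≤ 1 := by
        rw [abs_le]
        constructor <;> linarith [hχ0 x, hc1 x]
      calc _ ≤ 1 * (ε / 9) := mul_le_mul h2 h (norm_nonneg _) zero_le_one
        _ = _ := one_mul _
    · rw [h, Complex.ofReal_one, one_smul, sub_self, norm_zero]
      exact hη.le
  have h2 := norm_sub_le_norm_sub_add_norm_sub S' (m ∘L T) T
  linarith

/-- A non-integrable function has integral 0 by convention, which contradicts the normalization to
1. -/
theorem _root_.FellGroupoid.HaarSystem.IsCutoff.integrable {c : M → ℝ} (hc : lam.IsCutoff c) (x : M) :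
    Integrable (fun γ : Γ.TFib x => c (Γ.src γ.1)) (lam.meas x) := by
  by_contra h
  have h1 := hc.integral_eq_one x
  rw [integral_undef h] at h1
  exact zero_ne_one h1

/-- A compact T is approximated in norm by operators with compactly supported kernels, whose
averages are convolution operators; averaging enlarges the error at most 8 times. -/
theorem averages_subset_reducedCStar (hΓ : Γ.IsProper) {c : M → ℝ} (hc : lam.IsCutoff c) :
    F.averages lam c ⊆ F.reducedCStar lam := by
  rintro S ⟨T, hT, hSa, hS⟩
  have hTa := isAdjointable_of_mem_compactOps hT
  refine (clm_mem_closure_iff (H := F.L2 lam)).2 fun ε hε => ?_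
  have hη : 0 < ε / 8 := by positivity
  obtain ⟨K, hK, T', hT', hTT'⟩ := exists_isKernOp_of_mem_compactOps hT hη
  have hKc := isCompactKern_of_mem_rankSpan hK
  obtain ⟨D, hD0, hD⟩ := hKc.exists_kernBound lam
  obtain ⟨f, S', hf, hS'⟩ := exists_isLeftConv_of_average hΓ ⟨c, hc.continuous⟩ hc.nonneg
    hc.integrable (fun x => (hc.integral_eq_one x).le) hKc hT' hTa hη.le
    (fun x _ => ((hT'.isAdjointable hD0 hD).norm_fiberOp_sub_le hTa x).trans hTT') hSa hS
  exact ⟨S', ⟨f, hf⟩, hS'.trans_eq (by ring)⟩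

/-- Weights localizing an operator of `𝓚_Γ` over the set where a cutoff function does not vanish. -/
theorem exists_weights (hΓ : Γ.IsProper) {c : M → ℝ} (hc : lam.IsCutoff c)
    {S : F.L2 lam →L[ℂ] F.L2 lam} (hSa : F.IsAdjointable lam S)
    (hS0 : Tendsto (fun x => ‖F.fiberOp lam S x‖) Γ.atInftyOrbit (𝓝 0)) :
    ∃ (w : ℕ → C(M, ℝ)) (C : ℝ), 0 ≤ C ∧ (∀ n, HasCompactSupport (w n)) ∧
      (∀ n x, |w n x| * ‖F.fiberOp lam S x‖ ≤ C * (1 / 2 : ℝ) ^ n) ∧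
      ∀ N x, c x ≠ 0 →
        |∑ n ∈ Finset.range (N + 1), w n x - 1| * ‖F.fiberOp lam S x‖ ≤ (1 / 2 : ℝ) ^ N := by
  choose b hbs hb0 hb1 hb using fun n : ℕ => exists_weight hΓ hS0 (ε := (1 / 2 : ℝ) ^ n) (by positivity)
  have hχ0 := fun n => lam.avg_nonneg (hb0 n)
  have hχc := fun n => lam.continuous_avg hΓ (hbs n)
  have hcompact : ∀ n, ∃ ψ : C(M, ℝ), HasCompactSupport ψ ∧ (∀ x, ψ x ∈ Set.Icc (0 : ℝ) 1) ∧
      ∀ x, c x ≠ 0 → lam.avg (b n) x ≠ 0 → ψ x = 1 := by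
    intro n
    -- The average of b_n is invariant and need not have compact support on M. Its support meets {c
    -- ≠ 0} inside a compact set, by the support condition on cutoff functions over the support of
    -- b_n, and ψ_n is 1 there.
    obtain ⟨ψ, hψ1, -, hψc, hψ01⟩ := exists_continuous_one_zero_of_isCompact
      ((hc.compact_support _ (hbs n).isCompact).image Γ.continuous_src) isClosed_empty
      (Set.disjoint_empty _)
    refine ⟨ψ, hψc, hψ01, fun x hx hx' => hψ1 ?_⟩
    obtain ⟨γ, rfl, hγ⟩ := lam.exists_of_avg_ne_zero hx'
    refine ⟨Γ.inv γ, subset_closure ⟨?_, ?_⟩, Γ.src_inv γ⟩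
    · rw [Γ.tgt_inv]
      exact subset_tsupport _ hγ
    · rwa [Γ.src_inv]
  choose ψ hψc hψ01 hψ1 using hcompact
  let χ : ℕ → C(M, ℝ) := fun n => ⟨fun x => lam.avg (b n) x, hχc n⟩
  -- The first factor equals 1 as soon as ψ_n or ψ_{n+1} does. Hence on {c ≠ 0} the compactly
  -- supported v_n equals χ_{n+1} - χ_n, and the sums telescope.
  let v : ℕ → C(M, ℝ) := fun n => (ψ n + ψ (n + 1) * (1 - ψ n)) * (χ (n + 1) - χ n)
  have hv : ∀ n x, v n x =
      (ψ n x + ψ (n + 1) x * (1 - ψ n x)) * (lam.avg (b (n + 1)) x - lam.avg (b n) x) :=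
    fun _ _ => rfl
  have hvc : ∀ n, HasCompactSupport (v n) := fun n =>
    HasCompactSupport.mul_right ((hψc n).add (hψc (n + 1)).mul_right)
  have hvx : ∀ n x, c x ≠ 0 → v n x = lam.avg (b (n + 1)) x - lam.avg (b n) x := by
    intro n x hx
    rw [hv]
    by_cases h1 : lam.avg (b n) x = 0
    · by_cases h2 : lam.avg (b (n + 1)) x = 0
      · rw [h1, h2]
        ring
      · rw [hψ1 (n + 1) x hx h2]
        ring
    · rw [hψ1 n x hx h1]
      ring
  have hvn : ∀ n x, |v n x| * ‖F.fiberOp lam S x‖ ≤ (1 / 2 : ℝ) ^ n := by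
    intro n x
    have h1 : |v n x| ≤ 1 := by
      rw [hv, abs_mul]
      obtain ⟨h1, h2⟩ := hψ01 n x
      obtain ⟨h3, h4⟩ := hψ01 (n + 1) x
      refine mul_le_one₀ ?_ (abs_nonneg _) ?_
      · rw [abs_le]
        constructor <;> nlinarith
      · rw [abs_le]
        constructor <;> linarith [hχ0 n x, hχ0 (n + 1) x, hb1 n x, hb1 (n + 1) x]
    -- Either S_x is small, or χ_n and χ_{n+1} both equal 1 at x and v_n vanishes there.
    by_cases h2 : ‖F.fiberOp lam S x‖ ≤ (1 / 2 : ℝ) ^ n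
    · exact (mul_le_of_le_one_left (norm_nonneg _) h1).trans h2
    · have h3 : (1 / 2 : ℝ) ^ (n + 1) ≤ (1 / 2 : ℝ) ^ n :=
        pow_le_pow_of_le_one (by norm_num) (by norm_num) (Nat.le_succ n)
      have h4 := (hb n x).resolve_left h2
      have h5 := (hb (n + 1) x).resolve_left fun h => h2 (h.trans h3)
      rw [hv, h4, h5, sub_self, MulZeroClass.mul_zero, abs_zero, MulZeroClass.zero_mul]
      positivity
  have h0 : ∀ x, c x ≠ 0 → ψ 0 x * lam.avg (b 0) x = lam.avg (b 0) x := by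
    intro x hx
    by_cases h1 : lam.avg (b 0) x = 0
    · rw [h1, MulZeroClass.mul_zero]
    · rw [hψ1 0 x hx h1, one_mul]
  -- The initial term is bounded by ‖S‖; the shift w_{n+1} = v_n costs a factor 2 in the geometric
  -- bound.
  refine ⟨fun n => Nat.casesOn n (ψ 0 * χ 0) v, ‖S‖ + 2, by positivity, fun n => ?_, fun n x => ?_,
    fun N x hx => ?_⟩
  · cases n with
    | zero => exact (hψc 0).mul_right
    | succ n => exact hvc n
  · cases n with
    | zero =>
      have h1 : |ψ 0 x * lam.avg (b 0) x| ≤ 1 := by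
        rw [abs_of_nonneg (mul_nonneg (hψ01 0 x).1 (hχ0 0 x))]
        exact mul_le_one₀ (hψ01 0 x).2 (hχ0 0 x) (hb1 0 x)
      change |ψ 0 x * lam.avg (b 0) x| * _ ≤ _
      have h2 := mul_le_of_le_one_left (norm_nonneg (F.fiberOp lam S x)) h1
      rw [pow_zero, mul_one]
      linarith [hSa.norm_fiberOp_le x]
    | succ n =>
      refine (hvn n x).trans ?_
      have h1 : (0 : ℝ) ≤ (1 / 2) ^ n := by positivity
      have h2 := mul_nonneg (norm_nonneg S) h1
      rw [pow_succ]
      linarith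
  · have hsum : ∀ N, ∑ n ∈ Finset.range (N + 1), (Nat.casesOn n (ψ 0 * χ 0) v : C(M, ℝ)) x =
        lam.avg (b N) x := by
      intro N
      induction N with
      | zero =>
        rw [zero_add, Finset.sum_range_one]
        exact h0 x hx
      | succ N ih =>
        rw [Finset.sum_range_succ, ih]
        change lam.avg (b N) x + v N x = _
        rw [hvx N x hx]
        ring
    rw [hsum]
    rcases hb N x with h | h
    · have h1 : |lam.avg (b N) x - 1| ≤ 1 := by
        rw [abs_le]
        constructor <;> linarith [hχ0 N x, hb1 N x]
      exact (mul_le_of_le_one_left (norm_nonneg _) h1).trans h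
    · rw [h, sub_self, abs_zero, MulZeroClass.zero_mul]
      positivity

/-- An operator of `𝓚_Γ` coincides with a compact operator over the set where a given cutoff
function does not vanish. -/
theorem exists_compactOps_eq (hΓ : Γ.IsProper) {c : M → ℝ} (hc : lam.IsCutoff c)
    {S : F.L2 lam →L[ℂ] F.L2 lam} (hS : S ∈ F.invariantCompactOps lam) :
    ∃ T ∈ F.compactOps lam, ∀ x, c x ≠ 0 → F.fiberOp lam T x = F.fiberOp lam S x := by
  obtain ⟨hSa, hSc, -, hS0⟩ := hS
  obtain ⟨w, C, hC, hwc, hwn, hws⟩ := exists_weights hΓ hc hSa hS0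
  choose t ht htξ using fun n => hSc.exists_compactOps (w n) (hwc n)
  have hreal : ∀ (r D : ℝ) (x : M) (ξ : F.L2 lam), |r| * ‖F.fiberOp lam S x‖ ≤ D →
      ‖(r : ℂ) • F.fiberAt lam (S ξ) x‖ ≤ D * ‖F.fiberAt lam ξ x‖ := by
    intro r D x ξ h
    rw [norm_smul, Complex.norm_real, Real.norm_eq_abs, ← hSa.fiberOp_apply]
    calc _ ≤ |r| * (‖F.fiberOp lam S x‖ * ‖F.fiberAt lam ξ x‖) := by
          gcongr
          exact ContinuousLinearMap.le_opNorm _ _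
      _ = |r| * ‖F.fiberOp lam S x‖ * ‖F.fiberAt lam ξ x‖ := by ring
      _ ≤ _ := mul_le_mul_of_nonneg_right h (norm_nonneg _)
  have htn : ∀ n, ‖t n‖ ≤ C * (1 / 2 : ℝ) ^ n := fun n => FibBound.opNorm_le (by positivity)
    fun ξ x => by
      rw [htξ]
      exact hreal _ _ x ξ (hwn n x)
  obtain ⟨T, hT, hlim⟩ := exists_mem_topologicalClosure_tendsto (H := F.L2 lam)
    ((summable_geometric_of_lt_one (by norm_num) (by norm_num : (1 / 2 : ℝ) < 1)).mul_left C) ht htn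
  refine ⟨T, hT, fun x hx => fiberOp_eq fun ξ => ?_⟩
  have hsum : ∀ N, F.fiberAt lam ((∑ n ∈ Finset.range N, t n) ξ) x =
      ((∑ n ∈ Finset.range N, w n x : ℝ) : ℂ) • F.fiberAt lam (S ξ) x := by
    intro N
    induction N with
    | zero =>
      rw [Finset.sum_range_zero, Finset.sum_range_zero, Complex.ofReal_zero, zero_smul]
      rfl
    | succ N ih =>
      rw [Finset.sum_range_succ, Finset.sum_range_succ, _root_.add_apply, fiberAt_add, ih, htξ,
        Complex.ofReal_add, add_smul]
  rw [hSa.fiberOp_apply, ← sub_eq_zero, ← norm_le_zero_iff]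
  have hlim2 : Tendsto (fun N => ‖T - ∑ n ∈ Finset.range (N + 1), t n‖ * ‖ξ‖ +
      (1 / 2 : ℝ) ^ N * ‖F.fiberAt lam ξ x‖) atTop (𝓝 0) := by
    have h1 := ((hlim.comp (tendsto_add_atTop_nat 1)).mul_const ‖ξ‖).add
      ((tendsto_pow_atTop_nhds_zero_of_lt_one (by norm_num : (0 : ℝ) ≤ 1 / 2)
        (by norm_num)).mul_const ‖F.fiberAt lam ξ x‖)
    rwa [MulZeroClass.zero_mul, MulZeroClass.zero_mul, add_zero] at h1
  refine ge_of_tendsto' hlim2 fun N => ?_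
  -- The error splits into the tail of the series, small in norm, and the defect of the partial sum
  -- of weights from 1, small on S_x because c(x) ≠ 0.
  have e : F.fiberAt lam (S ξ) x - F.fiberAt lam (T ξ) x =
      -(F.fiberAt lam ((T - ∑ n ∈ Finset.range (N + 1), t n) ξ) x +
        ((∑ n ∈ Finset.range (N + 1), w n x - 1 : ℝ) : ℂ) • F.fiberAt lam (S ξ) x) := by
    have h1 : ((∑ n ∈ Finset.range (N + 1), w n x - 1 : ℝ) : ℂ) • F.fiberAt lam (S ξ) x =
        F.fiberAt lam ((∑ n ∈ Finset.range (N + 1), t n) ξ) x - F.fiberAt lam (S ξ) x := by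
      rw [hsum, Complex.ofReal_sub, Complex.ofReal_one, sub_smul, one_smul]
    rw [h1, _root_.sub_apply, fiberAt_sub]
    abel
  rw [e, norm_neg]
  refine (norm_add_le _ _).trans (add_le_add ?_ (hreal _ _ x ξ (hws N x hx)))
  exact (F.norm_fiberAt_le lam x _).trans (ContinuousLinearMap.le_opNorm _ _)

/-- The average of T involves T_x only where c(x) ≠ 0. There T_x = S_x, so by invariance of S every
transported operator is the same fibre of S, and the weights integrate to 1. -/
theorem reducedCStar_subset_averages (hΓ : Γ.IsProper) {c : M → ℝ} (hc : lam.IsCutoff c) :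
    F.reducedCStar lam ⊆ F.averages lam c := by
  intro S hS
  have hS' := reducedCStar_subset_invariantCompactOps hΓ hS
  obtain ⟨T, hT, hTS⟩ := exists_compactOps_eq hΓ hc hS'
  refine ⟨T, hT, hS'.1, fun x ξ => ?_⟩
  have e : (fun γ : Γ.TFib x => c (Γ.src γ.1) •
      F.transport lam γ.1 rfl γ.2 (F.fiberOp lam T (Γ.src γ.1)) ξ) =
      fun γ => c (Γ.src γ.1) • F.fiberOp lam S x ξ := by
    funext γ
    by_cases hγ : c (Γ.src γ.1) = 0
    · rw [hγ, zero_smul, zero_smul]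
    · rw [hTS _ hγ, transport_eq_of_invariant hS'.2.2.1]
  rw [e]
  refine ⟨(hc.integrable x).smul_const _, ?_⟩
  rw [integral_smul_const, hc.integral_eq_one, one_smul]

end FellBundle

end

end FellGroupoid

theorem mainTheorem3 {G M : Type*}
    [TopologicalSpace G] [T2Space G] [LocallyCompactSpace G] [SecondCountableTopology G]
    [TopologicalSpace M] [T2Space M] [LocallyCompactSpace M] [SecondCountableTopology M]
    [MeasurableSpace G] [BorelSpace G]
    (Γ : FellGroupoid.TopGroupoid G M) (hΓ : Γ.IsProper) (lam : FellGroupoid.HaarSystem Γ)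
    {E : G → Type*} [∀ g, NormedAddCommGroup (E g)] [∀ g, NormedSpace ℂ (E g)]
    [TopologicalSpace (FellGroupoid.Tot E)] (F : FellGroupoid.FellBundle Γ E) :
    F.reducedCStar lam = F.invariantCompactOps lam ∧
      ∀ c : M → ℝ, lam.IsCutoff c → F.reducedCStar lam = F.averages lam c := by
  refine ⟨Set.Subset.antisymm (FellGroupoid.FellBundle.reducedCStar_subset_invariantCompactOps hΓ)
    (FellGroupoid.FellBundle.invariantCompactOps_subset_reducedCStar hΓ), fun c hc => ?_⟩
  exact Set.Subset.antisymm (FellGroupoid.FellBundle.reducedCStar_subset_averages hΓ hc)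
    (FellGroupoid.FellBundle.averages_subset_reducedCStar hΓ hc)
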